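/- Let $d\ge 1$, let $l_1,\dots,l_d>0$, and let $V\in C^2(\mathbb R^d,\mathbb R)$ be a separable potential, $V(q)=\sum_{j=1}^d V_j(q_j)$ with functions $V_j:\mathbb R\to\mathbb R$, which is periodic with respect to the lattice $\mathcal L=\bigoplus_j l_j\mathbb Z$. Let $\mathbb T=\mathbb R^d/\mathcal L$ and let $\mathbb T^*=\mathbb R^d/\mathcal L^*$ be the Brillouin zone, $\mathcal L^*=\bigoplus_j (2\pi/l_j)\mathbb Z$. Classical side. Let $H(p,q)=\tfrac12|p|^2+V(q)$, let $(p(t,x),q(t,x))$ be the solution of $\dot p=-\nabla V(q)$, $\dot q=p$ with initial value $x$, and let $\bar v(x)$ be the common value of $\lim_{T\to+\infty}\frac1T\int_0^T p(t,x)\,dt$ and $\lim_{T\to-\infty}\frac1T\int_0^T p(t,x)\,dt$ if both limits exist and are equal, $\bar v(x)=0$ otherwise. Let $\nu$ be the image of the Liouville measure $dp\,dq$ on $\mathbb R^d\times\mathbb T$ under the map $(H,\bar v)$ into $\mathbb R^{d+1}$. Semiclassical side. For $\hbar>0$ and $k\in\mathbb R^d$ let $E_1^\hbar(k)\le E_2^\hbar(k)\le\dots$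 be the eigenvalues, counted with multiplicity, of the self-adjoint operator $H^\hbar(k)=\tfrac12(-i\hbar\nabla+\hbar k)^2+V$ on $L^2(\mathbb T)$. Let $\bar v_n^\hbar(k)=\hbar^{-1}\nabla_kE_n^\hbar(k)$ where $E_n^\hbar$ is differentiable at $k$, and $\bar v_n^\hbar(k)=0$ elsewhere. Let $\nu^\hbar$ be the image under $(n,k)\mapsto(E_n^\hbar(k),\bar v_n^\hbar(k))$ of the measure $(2\pi\hbar)^d\,\mu_1\times\mu_2$ on $\mathbb N\times\mathbb T^*$, where $\mu_1$ is counting measure and $\mu_2$ is Haar measure on $\mathbb T^*$ normalized to total mass $1$. Then these maps are measurable up to null sets, $\nu$ and all $\nu^\hbar$ ($\hbar>0$) are finite on compact sets, and $\nu^\hbar$ converges weak-* to $\nu$ as $\hbar\searrow0$: for every continuous $f:\mathbb R^{d+1}\to\mathbb R$ of compact support, $$\lim_{\hbar\searrow0}\int_{\mathbb R^{d+1}} f\,d\nu^\hbar=\int_{\mathbb R^{d+1}} f\,d\nu .$$ -/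

import Mathlib

open MeasureTheory Filter Topology
open scoped ContDiff ComplexConjugate

noncomputable section

namespace PeriodicMotion

variable {d : ℕ}

/-- Euclidean configuration (or momentum, velocity, quasimomentum) space `ℝ^d`. -/
abbrev Space (d : ℕ) : Type := EuclideanSpace ℝ (Fin d)

/-- Invariance under the rectangular lattice `⨁ j, (L j) ℤ`. -/
def IsLatticePeriodic {α : Type*} (L : Fin d → ℝ) (f : Space d → α) : Prop :=
  ∀ (j : Fin d) (q : Space d), f (q + EuclideanSpace.single j (L j)) = f q

/-- The half-open box with edges `L j`: a fundamental cell of the lattice `⨁ j, (L j) ℤ`. With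
Lebesgue measure it represents the torus `𝕋 = ℝ^d / ⨁ j, (L j) ℤ`. -/
def cell (L : Fin d → ℝ) : Set (Space d) :=
  {q | ∀ j, q j ∈ Set.Ico 0 (L j)}

/-! ### Classical motion -/

/-- The Hamiltonian function `H(p, q) = |p|² / 2 + V(q)`. -/
def hamiltonian (V : Space d → ℝ) (x : Space d × Space d) : ℝ :=
  ‖x.1‖ ^ 2 / 2 + V x.2

/-- `γ = (p, q)` is the solution of Hamilton's equations `p' = -∇V(q)`, `q' = p` on all of `ℝ`
with initial value `x`. -/
def IsTrajectory (V : Space d → ℝ) (x : Space d × Space d) (γ : ℝ → Space d × Space d) : Prop :=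
  γ 0 = x ∧ ∀ t : ℝ, HasDerivAt γ (-gradient V (γ t).2, (γ t).1) t

open Classical in
/-- The Hamiltonian flow `Φ^t(x)`. For a periodic `V` of class `C²` the trajectory through `x`
exists and is unique; the value in the other case is immaterial. -/
def flow (V : Space d → ℝ) (t : ℝ) (x : Space d × Space d) : Space d × Space d :=
  if h : ∃ γ, IsTrajectory V x γ then h.choose t else x

/-- The mean velocity `T⁻¹ ∫₀ᵀ p(t, x) dt`. -/
def meanVelocity (V : Space d → ℝ) (x : Space d × Space d) (T : ℝ) : Space d :=
  T⁻¹ • ∫ t in (0 : ℝ)..T, (flow V t x).1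

open Classical in
/-- The asymptotic velocity: the common limit of the mean velocities for `T → +∞` and
`T → -∞` if both limits exist and are equal, and `0` otherwise. -/
def asymptoticVelocity (V : Space d → ℝ) (x : Space d × Space d) : Space d :=
  if h : ∃ v, Tendsto (meanVelocity V x) atTop (𝓝 v) ∧ Tendsto (meanVelocity V x) atBot (𝓝 v)
  then h.choose else 0

/-- The classical energy-velocity map `A = (H, v̄)`. -/
def energyVelocity (V : Space d → ℝ) (x : Space d × Space d) : ℝ × Space d :=
  (hamiltonian V x, asymptoticVelocity V x)

/-- Liouville measure `dp dq` on the phase space `ℝ^d × 𝕋` over the torus. -/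
def liouville (L : Fin d → ℝ) : Measure (Space d × Space d) :=
  volume.restrict (Set.univ ×ˢ cell L)

/-- The classical energy-velocity distribution `ν`. -/
def classicalMeasure (L : Fin d → ℝ) (V : Space d → ℝ) : Measure (ℝ × Space d) :=
  (liouville L).map (energyVelocity V)

/-! ### Quantum motion -/

/-- The `j`-th component of `D + ℏk`, with `D = -iℏ∇`, acting on smooth functions. -/
def blochMomentum (hbar : ℝ) (k : Space d) (j : Fin d) (φ : Space d → ℂ) (q : Space d) : ℂ :=
  -Complex.I * (hbar : ℂ) * fderiv ℝ φ q (EuclideanSpace.single j 1)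
    + ((hbar * k j : ℝ) : ℂ) * φ q

/-- The differential expression `½ (D + ℏk)² φ + V φ` for smooth `φ`. -/
def blochExpr (V : Space d → ℝ) (hbar : ℝ) (k : Space d) (φ : Space d → ℂ) (q : Space d) : ℂ :=
  (1 / 2 : ℂ) * ∑ j, blochMomentum hbar k j (blochMomentum hbar k j φ) q + (V q : ℂ) * φ q

/-- The Hilbert space `L²(𝕋)`. -/
abbrev TorusL2 (L : Fin d → ℝ) : Type := Lp ℂ 2 (volume.restrict (cell L))

/-- `ψ` lies in the domain of the operator `H(k) = ½ (D + ℏk)² + V` on `L²(𝕋)`, and `H(k) ψ = f`.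
The operator is applied in the sense of distributions on the torus: its domain consists of those
`ψ ∈ L²(𝕋)` for which the distribution `H(k) ψ` is in `L²(𝕋)`. For bounded `V` this domain is the
Sobolev space `H²(𝕋)`, and the operator is the self-adjoint one given by the quadratic form
of `½ (D + ℏk)² + V` on `H¹(𝕋)`. -/
def IsBlochImage (L : Fin d → ℝ) (V : Space d → ℝ) (hbar : ℝ) (k : Space d)
    (ψ f : TorusL2 L) : Prop :=
  ∀ φ : Space d → ℂ, ContDiff ℝ ∞ φ → IsLatticePeriodic L φ →
    ∫ q in cell L, conj (blochExpr V hbar k φ q) * ψ q = ∫ q in cell L, conj (φ q) * f q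

/-- The span of all eigenfunctions of `H(k)` whose eigenvalue is at most `E`. Its dimension is the
number of eigenvalues `≤ E`, counted with multiplicity. -/
def spectralSubspace (L : Fin d → ℝ) (V : Space d → ℝ) (hbar : ℝ) (k : Space d) (E : ℝ) :
    Submodule ℂ (TorusL2 L) :=
  Submodule.span ℂ {ψ | ∃ E' : ℝ, E' ≤ E ∧ IsBlochImage L V hbar k ψ ((E' : ℂ) • ψ)}

/-- The band functions: the eigenvalues `E₀(k) ≤ E₁(k) ≤ …` of `H(k)` in ascending order, counted
with multiplicity (numbered from `0`). -/
def bandEnergy (L : Fin d → ℝ) (V : Space d → ℝ) (hbar : ℝ) (n : ℕ) (k : Space d) : ℝ :=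
  sInf {E : ℝ | ((n + 1 : ℕ) : Cardinal) ≤ Module.rank ℂ (spectralSubspace L V hbar k E)}

open Classical in
/-- The semiclassical asymptotic velocity: `ℏ⁻¹ ∇ₖ Eₙ(k)` where the gradient exists,
and `0` elsewhere. -/
def bandVelocity (L : Fin d → ℝ) (V : Space d → ℝ) (hbar : ℝ) (n : ℕ) (k : Space d) : Space d :=
  if DifferentiableAt ℝ (bandEnergy L V hbar n) k
  then hbar⁻¹ • gradient (bandEnergy L V hbar n) k else 0

/-- The semiclassical energy-velocity map. -/
def bandEnergyVelocity (L : Fin d → ℝ) (V : Space d → ℝ) (hbar : ℝ) (x : ℕ × Space d) :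
    ℝ × Space d :=
  (bandEnergy L V hbar x.1 x.2, bandVelocity L V hbar x.1 x.2)

/-- A fundamental cell of the dual lattice `⨁ j, (2π / L j) ℤ`. -/
def dualCell (L : Fin d → ℝ) : Set (Space d) :=
  cell fun j => 2 * Real.pi / L j

/-- Normalized Haar measure on the Brillouin zone `𝕋* = ℝ^d / ⨁ j, (2π / L j) ℤ`. -/
def brillouinMeasure (L : Fin d → ℝ) : Measure (Space d) :=
  (volume (dualCell L))⁻¹ • volume.restrict (dualCell L)

/-- The semiclassical measure `(2πℏ)^d (counting measure × Haar measure)` on `ℕ × 𝕋*`. -/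
def semiclassicalLiouville (L : Fin d → ℝ) (hbar : ℝ) : Measure (ℕ × Space d) :=
  ENNReal.ofReal ((2 * Real.pi * hbar) ^ d) • (Measure.count.prod (brillouinMeasure L))

/-- The semiclassical energy-velocity distribution `ν^ℏ`. -/
def semiclassicalMeasure (L : Fin d → ℝ) (V : Space d → ℝ) (hbar : ℝ) : Measure (ℝ × Space d) :=
  (semiclassicalLiouville L hbar).map (bandEnergyVelocity L V hbar)

end PeriodicMotion

end

open MeasureTheory Filter Topology
open scoped ContDiff ComplexConjugate

noncomputable section

namespace PeriodicMotion

variable {d : ℕ}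

/-! ### Supergradients of concave functions -/

section SupportingFunctionals

variable {F : Type*} [NormedAddCommGroup F] [InnerProductSpace ℝ F]

open InnerProductSpace

/-! Separability splits both sides into one-dimensional problems. Products of eigenfunctions on
circles form an eigenbasis on the torus, so for almost every quasimomentum `k` the pairs (energy,
velocity) are assembled from those of the factors, up to a renumbering of the bands that depends on
`k` but is invisible to a sum over all bands. Velocities survive the renumbering because of Ky Fan's
inequality: the sum of the `n` lowest eigenvalues, minus `n ħ²|k|²/2`, is concave in `k`, and the
mean momenta of any ascending eigenbasis provide a supergradient
(`continuous_and_ae_hasGradientAt`). No perturbation theory at band crossings is needed. Thus both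
measures are images of product measures (`classicalMeasure_eq`, `semiclassicalMeasure_eq`).

On a circle the energies obey a Weyl law, proved by traces of resolvent powers. The trace of
`K^(2s)` is the sum of `‖K^s e_m‖²` over plane waves, and `K^s e_m` equals `b(P, q)^s e_m` up to
`O(ħ)`, where `b` is the symbol of the resolvent and `P = ħ(κ_m + k)`. Integration over the
Brillouin zone unfolds the sum over `m` into an integral over all momenta
(`tendsto_lintegral_resolvent_pow`). Polynomial approximation then yields general functions of the
energy (`tendsto_integral_energy`).

The modulus of the velocity is asymptotically a function of the energy. The mean momentum is the
period times the constant current of a solution of the Schrödinger equation. Below the maximum of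
the potential a classically forbidden interval makes it `O(ħ²)` (`abs_meanMomentum_le_of_lt`). Above
the maximum, the two WKB amplitudes are nearly constant along a period, while quasiperiodicity
multiplies them by `exp(i(kl - S/ħ))` and `exp(i(kl + S/ħ))`, with `S` the action of a period. Both
factors can be close to 1 only if `sin(kl)` is small; for all other `k` one amplitude nearly
vanishes, and normalization forces the mean momentum to be `±l/T`, with `T` the classical traversal
time (`abs_meanMomentum_sub_le_of_gt`). The sign is left open, but `k ↦ 2π/l - k` preserves each
band energy and reverses each velocity, just as `p ↦ -p` does classically, so only `cos(u v)` enters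
the joint characteristic functions (`tendsto_integral_cexp`).

Finally, the weight `exp(-E)` makes all measures finite and the characteristic functions factorize
over coordinates. Lévy's continuity theorem gives weak convergence of the normalized weighted laws,
and testing with `exp(E) f` removes the weight (`tendsto_integral_of_tendsto_cexp`). On the
classical side the critical energies form a null set, off which each coordinate stays at bounded
distance from a uniform motion. -/

/-- Affine majorants that touch `G` at every point exhibit it as an infimum of affine functions. At
a convex combination `z` the two linear terms cancel. -/
theorem concaveOn_of_forall_le_add_inner {G : F → ℝ} {A : F → F}
    (h : ∀ x y, G y ≤ G x + ⟪A x, y - x⟫_ℝ) : ConcaveOn ℝ Set.univ G := by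
  refine ⟨convex_univ, fun x _ y _ s t hs ht hst => ?_⟩
  set z := s • x + t • y with hz
  have hx := h z x
  have hy := h z y
  have hzero : s * ⟪A z, x - z⟫_ℝ + t * ⟪A z, y - z⟫_ℝ = 0 := by
    rw [← real_inner_smul_right, ← real_inner_smul_right, ← inner_add_right]
    have : s • (x - z) + t • (y - z) = 0 := by
      have : s • (x - z) + t • (y - z) = z - (s + t) • z := by rw [hz]; module
      rw [this, hst, one_smul, sub_self]
    rw [this, inner_zero_right]
  simp only [smul_eq_mul]
  calc s * G x + t * G y ≤ s * (G z + ⟪A z, x - z⟫_ℝ) + t * (G z + ⟪A z, y - z⟫_ℝ) := by gcongr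
    _ = (s + t) * G z + (s * ⟪A z, x - z⟫_ℝ + t * ⟪A z, y - z⟫_ℝ) := by ring
    _ = G z := by rw [hst, hzero]; ring

variable [FiniteDimensional ℝ F]

/-- `y ↦ G y - ⟪A x, y⟫` attains its maximum at `x`, so its derivative vanishes there: at a point of
differentiability a supergradient has no freedom. -/
theorem hasGradientAt_of_forall_le_add_inner {G : F → ℝ} {A : F → F}
    (h : ∀ x y, G y ≤ G x + ⟪A x, y - x⟫_ℝ) {x : F} (hd : DifferentiableAt ℝ G x) :
    HasGradientAt G (A x) x := by
  have hmin : IsLocalMax (fun y => G y - ⟪A x, y⟫_ℝ) x := by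
    refine Eventually.of_forall fun y => ?_
    have := h x y
    rw [inner_sub_right] at this
    linarith
  have hL : HasFDerivAt (fun y => ⟪A x, y⟫_ℝ) (innerSL ℝ (A x)) x := (innerSL ℝ (A x)).hasFDerivAt
  have h0 := hmin.hasFDerivAt_eq_zero (hd.hasFDerivAt.sub hL)
  rw [hasGradientAt_iff_hasFDerivAt]
  have h1 : fderiv ℝ G x = innerSL ℝ (A x) := sub_eq_zero.1 h0
  have := hd.hasFDerivAt
  rw [h1] at this
  exact this

variable [MeasurableSpace F] [BorelSpace F]

/-- Rademacher's theorem on small neighbourhoods; being a null set is a local property. -/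
theorem ae_differentiableAt_of_locallyLipschitz {G : F → ℝ} (hG : LocallyLipschitz G)
    (μ : Measure F) [μ.IsAddHaarMeasure] : ∀ᵐ x ∂μ, DifferentiableAt ℝ G x := by
  rw [ae_iff]
  refine measure_null_of_locally_null _ fun x _ => ?_
  obtain ⟨K, t, ht, hK⟩ := hG x
  refine ⟨{y | ¬ DifferentiableAt ℝ G y} ∩ interior t,
    inter_mem self_mem_nhdsWithin (mem_nhdsWithin_of_mem_nhds (interior_mem_nhds.2 ht)), ?_⟩
  have h := (hK.mono interior_subset).ae_differentiableWithinAt_of_mem (μ := μ)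
  refine measure_mono_null ?_ (ae_iff.1 h)
  rintro y ⟨hy, hyt⟩ hy'
  exact hy ((hy' hyt).differentiableAt (isOpen_interior.mem_nhds hyt))

theorem ae_hasGradientAt_of_forall_le_add_inner {G : F → ℝ} {A : F → F}
    (h : ∀ x y, G y ≤ G x + ⟪A x, y - x⟫_ℝ) (μ : Measure F) [μ.IsAddHaarMeasure] :
    ∀ᵐ x ∂μ, HasGradientAt G (A x) x := by
  filter_upwards [ae_differentiableAt_of_locallyLipschitz
    (concaveOn_of_forall_le_add_inner h).locallyLipschitz μ] with x hx
  exact hasGradientAt_of_forall_le_add_inner h hx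

end SupportingFunctionals

/-! ### Bounded perturbations of diagonal operators: variational principle and group velocity -/

section DiagonalPlusBounded

open InnerProductSpace

variable {H : Type*} [NormedAddCommGroup H] [InnerProductSpace ℂ H] {ι : Type*}

/-- `ψ` is in the domain of `D + V` and `(D + V) ψ = f`, where `D` is the diagonal operator with
entries `a` in the basis `e`. -/
def IsImage (e : HilbertBasis ι ℂ H) (a : ι → ℝ) (V : H →L[ℂ] H) (ψ f : H) : Prop :=
  ∀ i, (a i : ℂ) * ⟪e i, ψ⟫_ℂ + ⟪e i, V ψ⟫_ℂ = ⟪e i, f⟫_ℂ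

variable {e : HilbertBasis ι ℂ H} {a : ι → ℝ} {V : H →L[ℂ] H}

theorem IsImage.smul {ψ f : H} (h : IsImage e a V ψ f) (c : ℂ) :
    IsImage e a V (c • ψ) (c • f) := fun i => by
  rw [map_smul, inner_smul_right, inner_smul_right, inner_smul_right, ← h i]; ring

/-- Symmetry of `D + V`: the entries of `D` are real, so they pass from one argument to the other in
Parseval's identity. The vectors `f - V ψ` and `g - V φ` play the roles of `D ψ` and `D φ`. -/
theorem IsImage.inner_eq (hV : ∀ x y, ⟪V x, y⟫_ℂ = ⟪x, V y⟫_ℂ) {ψ f φ g : H}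
    (h : IsImage e a V ψ f) (h' : IsImage e a V φ g) : ⟪ψ, g⟫_ℂ = ⟪f, φ⟫_ℂ := by
  have key : ⟪ψ, g - V φ⟫_ℂ = ⟪f - V ψ, φ⟫_ℂ := by
    rw [← e.tsum_inner_mul_inner, ← e.tsum_inner_mul_inner]
    refine tsum_congr fun i => ?_
    rw [inner_sub_right, ← h' i, add_sub_cancel_right, ← inner_conj_symm (f - V ψ),
      inner_sub_right, ← h i, add_sub_cancel_right, map_mul, Complex.conj_ofReal, inner_conj_symm]
    ring
  rw [inner_sub_right, inner_sub_left, hV] at key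
  exact sub_left_injective key

/-- An orthonormal basis of eigenvectors of `D + V`, in ascending order of the eigenvalues. -/
structure IsEigenbasis (e : HilbertBasis ι ℂ H) (a : ι → ℝ) (V : H →L[ℂ] H)
    (b : HilbertBasis ℕ ℂ H) (E : ℕ → ℝ) : Prop where
  monotone : Monotone E
  tendsto : Tendsto E atTop atTop
  image : ∀ n, IsImage e a V (b n) ((E n : ℂ) • b n)

theorem IsEigenbasis.hasSum_energy (hV : ∀ x y, ⟪V x, y⟫_ℂ = ⟪x, V y⟫_ℂ)
    {b : HilbertBasis ℕ ℂ H} {E : ℕ → ℝ} (h : IsEigenbasis e a V b E) {φ f : H}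
    (hφ : IsImage e a V φ f) :
    HasSum (fun m => E m * ‖⟪b m, φ⟫_ℂ‖ ^ 2) (⟪φ, f⟫_ℂ).re := by
  have h1 := Complex.hasSum_re (b.hasSum_inner_mul_inner φ f)
  convert h1 using 2 with m
  rw [(h.image m).inner_eq hV hφ, inner_smul_left, Complex.conj_ofReal,
    ← inner_conj_symm φ (b m), mul_left_comm, ← Complex.normSq_eq_conj_mul_self,
    Complex.normSq_eq_norm_sq]
  norm_cast

theorem hasSum_sq_norm_inner {κ : Type*} (b : HilbertBasis κ ℂ H) (φ : H) :
    HasSum (fun m => ‖⟪b m, φ⟫_ℂ‖ ^ 2) (‖φ‖ ^ 2) := by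
  have h1 := Complex.hasSum_re (b.hasSum_inner_mul_inner φ φ)
  rw [inner_self_eq_norm_sq_to_K] at h1
  convert h1 using 2 with m
  · rw [← inner_conj_symm φ (b m), ← Complex.normSq_eq_conj_mul_self, Complex.normSq_eq_norm_sq]
    norm_cast
  · norm_cast

/-- **Ky Fan's trace inequality** for an operator with an ascending eigenbasis. -/
theorem IsEigenbasis.sum_le (hV : ∀ x y, ⟪V x, y⟫_ℂ = ⟪x, V y⟫_ℂ)
    {b : HilbertBasis ℕ ℂ H} {E : ℕ → ℝ} (h : IsEigenbasis e a V b E) {n : ℕ} {φ f : Fin n → H}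
    (hφ : Orthonormal ℂ φ) (him : ∀ i, IsImage e a V (φ i) (f i)) :
    ∑ m ∈ Finset.range n, E m ≤ ∑ i, (⟪φ i, f i⟫_ℂ).re := by
  -- After subtraction of `E n`, the weights `∑ i, ‖⟪b m, φ i⟫‖²` multiply factors that are
  -- nonpositive for `m < n` and nonnegative from `n` on. Bessel's inequality keeps the weights in
  -- `[0, 1]`, so the sum is least when they are 1 below `n` and 0 afterwards.
  have h1 : HasSum (fun m => (E m - E n) * ∑ i, ‖⟪b m, φ i⟫_ℂ‖ ^ 2)
      (∑ i, ((⟪φ i, f i⟫_ℂ).re - E n)) := by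
    have := hasSum_sum (s := Finset.univ) fun i _ => (h.hasSum_energy hV (him i)).sub
      ((hasSum_sq_norm_inner b (φ i)).mul_left (E n))
    simp only [hφ.1, one_pow, mul_one] at this
    refine this.congr_fun ?_
    intro m
    rw [Finset.mul_sum]
    exact Finset.sum_congr rfl fun i _ => by ring
  have h2 : HasSum (fun m => if m < n then E m - E n else 0)
      (∑ m ∈ Finset.range n, (E m - E n)) := by
    have : HasSum (fun m => if m < n then E m - E n else 0)
        (∑ m ∈ Finset.range n, if m < n then E m - E n else 0) :=
      hasSum_sum_of_ne_finset_zero (fun m hm => if_neg (by simpa using hm))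
    convert this using 1
    exact Finset.sum_congr rfl fun m hm => (if_pos (by simpa using hm)).symm
  have h3 := hasSum_le (fun m => ?_) h2 h1
  · simp only [Finset.sum_sub_distrib, Finset.sum_const, Finset.card_range, Finset.card_univ,
      Fintype.card_fin] at h3
    linarith
  · have hw0 : 0 ≤ ∑ i, ‖⟪b m, φ i⟫_ℂ‖ ^ 2 := Finset.sum_nonneg fun i _ => sq_nonneg _
    have hw1 : ∑ i, ‖⟪b m, φ i⟫_ℂ‖ ^ 2 ≤ 1 := by
      have := hφ.sum_inner_products_le (b m) (s := Finset.univ)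
      rw [b.orthonormal.1 m, one_pow] at this
      simpa only [norm_inner_symm (b m)] using this
    split_ifs with hm
    · have := h.monotone hm.le
      nlinarith
    · have := h.monotone (not_lt.1 hm)
      exact mul_nonneg (by linarith) hw0

section Momentum

variable {F : Type*} [NormedAddCommGroup F] [InnerProductSpace ℝ F]

/-- The kinetic energies `|ℏ(κ i + k)|² / 2`. -/
def kinetic (hbar : ℝ) (κ : ι → F) (k : F) (i : ι) : ℝ := ‖hbar • (κ i + k)‖ ^ 2 / 2

/-- The expectation value of the momentum, whose values are `ℏ(κ i + k)`. -/
def meanMomentum (e : HilbertBasis ι ℂ H) (hbar : ℝ) (κ : ι → F) (k : F) (ψ : H) : F :=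
  ∑' i, ‖⟪e i, ψ⟫_ℂ‖ ^ 2 • (hbar • (κ i + k))

theorem kinetic_add (hbar : ℝ) (κ : ι → F) (k δ : F) (i : ι) :
    kinetic hbar κ (k + δ) i =
      kinetic hbar κ k i + hbar * ⟪hbar • (κ i + k), δ⟫_ℝ + hbar ^ 2 * ‖δ‖ ^ 2 / 2 := by
  unfold kinetic
  rw [← add_assoc, smul_add hbar (κ i + k), norm_add_sq_real, norm_smul hbar δ,
    real_inner_smul_right, mul_pow, Real.norm_eq_abs, sq_abs]
  ring

theorem kinetic_add_le (hbar : ℝ) (κ : ι → F) (k δ : F) (i : ι) :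
    kinetic hbar κ (k + δ) i ≤ 2 * kinetic hbar κ k i + hbar ^ 2 * ‖δ‖ ^ 2 := by
  unfold kinetic
  rw [← add_assoc, smul_add]
  have h1 := norm_add_le (hbar • (κ i + k)) (hbar • δ)
  have h2 : ‖hbar • δ‖ ^ 2 = hbar ^ 2 * ‖δ‖ ^ 2 := by
    rw [norm_smul, mul_pow, Real.norm_eq_abs, sq_abs]
  rw [← h2]
  nlinarith [norm_nonneg (hbar • (κ i + k) + hbar • δ), norm_nonneg (hbar • (κ i + k)),
    norm_nonneg (hbar • δ), sq_nonneg (‖hbar • (κ i + k)‖ - ‖hbar • δ‖)]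

theorem exists_inner_eq (e : HilbertBasis ι ℂ H) {x : ι → ℂ}
    (hx : Summable fun i => ‖x i‖ ^ 2) : ∃ f : H, ∀ i, ⟪e i, f⟫_ℂ = x i := by
  have hm : Memℓp x 2 := memℓp_gen (by simpa using hx)
  refine ⟨e.repr.symm ⟨x, hm⟩, fun i => ?_⟩
  rw [← e.repr_apply_apply, LinearIsometryEquiv.apply_symm_apply]

theorem IsImage.hasSum_kinetic {ψ f : H} (h : IsImage e a V ψ f) :
    HasSum (fun i => a i * ‖⟪e i, ψ⟫_ℂ‖ ^ 2) (⟪ψ, f - V ψ⟫_ℂ).re := by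
  have h1 := Complex.hasSum_re (e.hasSum_inner_mul_inner ψ (f - V ψ))
  convert h1 using 2 with i
  rw [inner_sub_right, ← h i, add_sub_cancel_right, ← inner_conj_symm ψ (e i), mul_left_comm,
    ← Complex.normSq_eq_conj_mul_self, Complex.normSq_eq_norm_sq]
  norm_cast

theorem IsImage.hasSum_momentum [CompleteSpace F] {hbar : ℝ} {κ : ι → F} {k : F} {ψ f : H}
    (h : IsImage e (kinetic hbar κ k) V ψ f) :
    HasSum (fun i => ‖⟪e i, ψ⟫_ℂ‖ ^ 2 • (hbar • (κ i + k))) (meanMomentum e hbar κ k ψ) := by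
  -- Momenta are dominated by kinetic energies: `|P| ≤ P²/2 + 1`.
  refine Summable.hasSum (.of_norm_bounded (h.hasSum_kinetic.summable.add
    (hasSum_sq_norm_inner e ψ).summable) fun i => ?_)
  rw [norm_smul, Real.norm_of_nonneg (sq_nonneg _)]
  unfold kinetic
  nlinarith [mul_nonneg (sq_nonneg ‖⟪e i, ψ⟫_ℂ‖) (sq_nonneg (‖hbar • (κ i + k)‖ - 1)),
    sq_nonneg ‖⟪e i, ψ⟫_ℂ‖]

/-- The domain does not depend on the quasimomentum, and the expected kinetic energy is an exact
quadratic polynomial in it, whose linear coefficient is given by the mean momentum. Hence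
eigenvectors at `k` are admissible trial states at `k + δ`, with explicit energies. -/
theorem IsImage.exists_image_add [CompleteSpace F] {hbar : ℝ} {κ : ι → F} {k : F} {ψ f : H}
    (h : IsImage e (kinetic hbar κ k) V ψ f) (δ : F) :
    ∃ f', IsImage e (kinetic hbar κ (k + δ)) V ψ f' ∧
      (⟪ψ, f'⟫_ℂ).re = (⟪ψ, f⟫_ℂ).re + hbar * ⟪meanMomentum e hbar κ k ψ, δ⟫_ℝ
        + hbar ^ 2 * ‖δ‖ ^ 2 / 2 * ‖ψ‖ ^ 2 := by
  obtain ⟨g, hg⟩ := exists_inner_eq e (x := fun i => (kinetic hbar κ (k + δ) i : ℂ) * ⟪e i, ψ⟫_ℂ)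
    (by
      refine .of_nonneg_of_le (fun i => sq_nonneg _) (fun i => ?_)
        (((hasSum_sq_norm_inner e (f - V ψ)).summable.mul_left 8).add
          ((hasSum_sq_norm_inner e ψ).summable.mul_left (2 * (hbar ^ 2 * ‖δ‖ ^ 2) ^ 2)))
      have h1 := kinetic_add_le hbar κ k δ i
      have h0 : 0 ≤ kinetic hbar κ (k + δ) i := by unfold kinetic; positivity
      have h0' : 0 ≤ kinetic hbar κ k i := by unfold kinetic; positivity
      have h2 : ‖⟪e i, f - V ψ⟫_ℂ‖ = kinetic hbar κ k i * ‖⟪e i, ψ⟫_ℂ‖ := by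
        rw [inner_sub_right, ← h i, add_sub_cancel_right, norm_mul, Complex.norm_real,
          Real.norm_of_nonneg h0']
      rw [norm_mul, Complex.norm_real, Real.norm_of_nonneg h0, h2]
      -- Combines `kinetic_add_le` with `(2x + y)² ≤ 8x² + 2y²`.
      have h3 : kinetic hbar κ (k + δ) i ^ 2 ≤
          8 * kinetic hbar κ k i ^ 2 + 2 * (hbar ^ 2 * ‖δ‖ ^ 2) ^ 2 := by
        nlinarith [sq_nonneg (2 * kinetic hbar κ k i - hbar ^ 2 * ‖δ‖ ^ 2),
          mul_nonneg (sq_nonneg hbar) (sq_nonneg ‖δ‖)]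
      nlinarith [sq_nonneg ‖⟪e i, ψ⟫_ℂ‖])
  have him : IsImage e (kinetic hbar κ (k + δ)) V ψ (g + V ψ) := fun i => by
    rw [inner_add_right, hg]
  refine ⟨g + V ψ, him, ?_⟩
  have h1 := him.hasSum_kinetic
  have h2 := (h.hasSum_kinetic.add
    ((h.hasSum_momentum.mapL (innerSL ℝ δ)).mul_left hbar)).add
    ((hasSum_sq_norm_inner e ψ).mul_left (hbar ^ 2 * ‖δ‖ ^ 2 / 2))
  have h3 := h1.unique (h2.congr_fun fun i => ?_)
  · simp only [inner_sub_right, Complex.sub_re, innerSL_apply_apply] at h3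
    rw [real_inner_comm]
    linarith
  · rw [kinetic_add, innerSL_apply_apply, real_inner_smul_right, real_inner_comm δ]
    ring

variable [FiniteDimensional ℝ F] [MeasurableSpace F] [BorelSpace F]

/-- Sorted eigenvalues are continuous functions of the quasimomentum; almost everywhere, their
gradient is the mean momentum in any ascending eigenbasis. -/
theorem continuous_and_ae_hasGradientAt (hV : ∀ x y, ⟪V x, y⟫_ℂ = ⟪x, V y⟫_ℂ) {hbar : ℝ}
    {κ : ι → F} {b : F → HilbertBasis ℕ ℂ H} {E : F → ℕ → ℝ}
    (h : ∀ k, IsEigenbasis e (kinetic hbar κ k) V (b k) (E k))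
    (μ : Measure F) [μ.IsAddHaarMeasure] (n : ℕ) :
    Continuous (fun k => E k n) ∧
    ∀ᵐ k ∂μ, HasGradientAt (fun k => E k n) (hbar • meanMomentum e hbar κ k (b k n)) k := by
  -- The subtracted multiple of `‖k‖²` absorbs the second-order terms of the trial energies, which
  -- are the same for every unit vector; what remains is an affine majorant with slope `A n x`.
  set G : ℕ → F → ℝ := fun n k => ∑ m ∈ Finset.range n, E k m - n * (hbar ^ 2 * ‖k‖ ^ 2 / 2)
  set A : ℕ → F → F := fun n k => hbar • ∑ m ∈ Finset.range n, meanMomentum e hbar κ k (b k m)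
    - (n * hbar ^ 2) • k
  have hGA : ∀ n x y, G n y ≤ G n x + ⟪A n x, y - x⟫_ℝ := by
    intro n x y
    choose f hf hf' using fun m => ((h x).image m).exists_image_add (y - x)
    rw [add_sub_cancel] at hf
    -- Ky Fan's inequality at `y`, tested with the `n` lowest eigenvectors at `x`.
    have h1 := (h y).sum_le hV (φ := fun i : Fin n => b x i) (f := fun i => f i)
      ((b x).orthonormal.comp _ Fin.val_injective) (fun i => hf i)
    have h2 : ∀ i : Fin n, (⟪b x i, f i⟫_ℂ).re = E x i +
        hbar * ⟪meanMomentum e hbar κ x (b x i), y - x⟫_ℝ + hbar ^ 2 * ‖y - x‖ ^ 2 / 2 := by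
      intro i
      rw [hf' i, (b x).orthonormal.1, inner_smul_right, inner_self_eq_norm_sq_to_K,
        (b x).orthonormal.1]
      simp
    rw [Finset.sum_congr rfl fun i _ => h2 i] at h1
    simp only [Finset.sum_add_distrib, Finset.sum_const, Finset.card_univ, Fintype.card_fin,
      nsmul_eq_mul, ← Finset.mul_sum, ← sum_inner] at h1
    rw [← Finset.sum_range (fun m => E x m),
      ← Finset.sum_range (fun m => meanMomentum e hbar κ x (b x m))] at h1
    have h3 : ‖y‖ ^ 2 = ‖x‖ ^ 2 + 2 * ⟪x, y - x⟫_ℝ + ‖y - x‖ ^ 2 := by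
      rw [← norm_add_sq_real, add_sub_cancel]
    simp only [G, A, inner_sub_left, real_inner_smul_left]
    rw [h3]
    linarith
  have hc : ∀ n, Continuous (G n) := fun n =>
    (concaveOn_of_forall_le_add_inner (hGA n)).locallyLipschitz.continuous
  -- A single eigenvalue is a difference of two consecutive sums. It inherits continuity and almost
  -- everywhere differentiability, although it is not itself concave up to a quadratic term.
  have hE : (fun k => E k n) = fun k => G (n + 1) k - G n k + hbar ^ 2 / 2 * ‖k‖ ^ 2 := by
    funext k
    simp only [G, Finset.sum_range_succ]
    push_cast
    ring
  rw [hE]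
  refine ⟨by have := hc n; have := hc (n + 1); fun_prop, ?_⟩
  filter_upwards [ae_hasGradientAt_of_forall_le_add_inner (hGA n) μ,
    ae_hasGradientAt_of_forall_le_add_inner (hGA (n + 1)) μ] with k h1 h2
  have h3 : HasGradientAt (fun k : F => hbar ^ 2 / 2 * ‖k‖ ^ 2) (hbar ^ 2 • k) k := by
    rw [hasGradientAt_iff_hasFDerivAt]
    have := ((hasFDerivAt_id (𝕜 := ℝ) k).norm_sq).const_mul (hbar ^ 2 / 2)
    refine this.congr_fderiv ?_
    ext x
    simp [InnerProductSpace.toDual_apply_apply]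
    ring
  have h4 := (h2.hasFDerivAt.sub h1.hasFDerivAt).add h3.hasFDerivAt
  rw [hasGradientAt_iff_hasFDerivAt]
  refine h4.congr_fderiv ?_
  rw [← map_sub, ← map_add]
  congr 1
  simp only [A, Finset.sum_range_succ]
  push_cast
  module

end Momentum

end DiagonalPlusBounded

/-! ### Ascending enumeration -/

section Sorting

/-- A family of reals with finite sublevel sets can be enumerated in ascending order. -/
theorem exists_monotone_enumeration {I : Type*} [Infinite I] {g : I → ℝ}
    (hg : ∀ R, {i | g i ≤ R}.Finite) :
    ∃ σ : ℕ ≃ I, Monotone (g ∘ σ) ∧ Tendsto (g ∘ σ) atTop atTop := by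
  have hcount : Countable I := by
    have : (Set.univ : Set I) = ⋃ n : ℕ, {i | g i ≤ n} := by
      ext i
      simpa using exists_nat_ge (g i)
    rw [← Set.countable_univ_iff, this]
    exact Set.countable_iUnion fun n => (hg n).countable
  obtain ⟨enc, henc⟩ := exists_injective_nat I
  -- Ties are broken by an injective code. In the resulting total order every element has finitely
  -- many predecessors, and their number `r` is the position sought.
  let f : I → ℝ ×ₗ ℕ := fun i => toLex (g i, enc i)
  have hf : Function.Injective f := fun i j hij => henc (by simpa [f] using (Prod.mk.inj hij).2)
  have hle : ∀ i j, f j < f i → g j ≤ g i := fun i j h => by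
    rcases Prod.Lex.toLex_lt_toLex.1 h with h | h
    · exact h.le
    · exact h.1.le
  have hfin : ∀ i, {j | f j < f i}.Finite := fun i => (hg (g i)).subset fun j h => hle i j h
  let r : I → ℕ := fun i => {j | f j < f i}.ncard
  have hr : ∀ i j, f j < f i → r j < r i := fun i j h =>
    Set.ncard_lt_ncard ⟨fun l hl => lt_trans hl h, fun h' => lt_irrefl (f j) (h' h)⟩ (hfin i)
  have hrinj : Function.Injective r := fun i j h => hf <| by
    rcases lt_trichotomy (f i) (f j) with h' | h' | h'
    · exact absurd h (hr _ _ h').ne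
    · exact h'
    · exact absurd h (hr _ _ h').ne'
  have hrsurj : Function.Surjective r := fun n => by
    -- Take an element with the least attained rank that is at least `n`. All its predecessors have
    -- ranks below `n`, so there are at most `n` of them.
    have hne : {m | n ≤ m ∧ m ∈ Set.range r}.Nonempty := by
      obtain ⟨m, hm, hnm⟩ := (Set.infinite_range_of_injective hrinj).exists_gt n
      exact ⟨m, hnm.le, hm⟩
    obtain ⟨hm, i, hi⟩ := Nat.sInf_mem hne
    refine ⟨i, le_antisymm ?_ (hi ▸ hm)⟩
    have hsub : r '' {j | f j < f i} ⊆ Set.Iio n := by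
      rintro _ ⟨j, hj, rfl⟩
      by_contra hcon
      have := Nat.sInf_le (s := {m | n ≤ m ∧ m ∈ Set.range r}) ⟨not_lt.1 hcon, j, rfl⟩
      exact absurd (hr _ _ hj) (by rw [hi]; exact not_lt.2 this)
    calc r i = (r '' {j | f j < f i}).ncard := (Set.ncard_image_of_injective _ hrinj).symm
      _ ≤ (Set.Iio n).ncard := Set.ncard_le_ncard hsub (Set.finite_Iio n)
      _ = n := by rw [← Finset.coe_Iio, Set.ncard_coe_finset, Nat.card_Iio]
  let σ := (Equiv.ofBijective r ⟨hrinj, hrsurj⟩).symm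
  have hσ : ∀ n, r (σ n) = n := fun n => (Equiv.ofBijective r ⟨hrinj, hrsurj⟩).apply_symm_apply n
  refine ⟨σ, fun m n hmn => ?_, ?_⟩
  · rcases lt_trichotomy (f (σ m)) (f (σ n)) with h | h | h
    · exact hle _ _ h
    · rw [Function.comp, Function.comp, hf h]
    · have := hr _ _ h
      rw [hσ, hσ] at this
      exact absurd this (not_lt.2 hmn)
  · refine tendsto_atTop.2 fun R => ?_
    rw [← Nat.cofinite_eq_atTop]
    have : {n | ¬ R ≤ (g ∘ σ) n} ⊆ σ ⁻¹' {i | g i ≤ R} := fun n hn => (not_le.1 hn).le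
    exact ((hg R).preimage σ.injective.injOn).subset this

end Sorting

/-! ### Resolvents, traces and existence of ascending eigenbases -/

section CompactResolvent

open InnerProductSpace

variable {H : Type*} [NormedAddCommGroup H] [InnerProductSpace ℂ H] {ι : Type*}

theorem hilbertBasis_ext {κ : Type*} (b : HilbertBasis κ ℂ H) {x y : H}
    (h : ∀ i, ⟪b i, x⟫_ℂ = ⟪b i, y⟫_ℂ) : x = y := by
  refine b.repr.injective (lp.ext (funext fun i => ?_))
  rw [b.repr_apply_apply, b.repr_apply_apply, h]

/-- The diagonal operator with entries `s` bounded by `r`. -/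
theorem exists_diagonal (e : HilbertBasis ι ℂ H) {s : ι → ℝ} {r : ℝ} (hr : 0 ≤ r)
    (hs : ∀ i, |s i| ≤ r) :
    ∃ D : H →L[ℂ] H, (∀ i x, ⟪e i, D x⟫_ℂ = s i * ⟪e i, x⟫_ℂ) ∧ ∀ x, ‖D x‖ ≤ r * ‖x‖ := by
  have hsq : ∀ i (x : H), ‖(s i : ℂ) * ⟪e i, x⟫_ℂ‖ ^ 2 ≤ r ^ 2 * ‖⟪e i, x⟫_ℂ‖ ^ 2 := by
    intro i x
    rw [norm_mul, mul_pow, Complex.norm_real, Real.norm_eq_abs]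
    gcongr
    exact hs i
  choose D hD using fun x : H => exists_inner_eq e (x := fun i => (s i : ℂ) * ⟪e i, x⟫_ℂ)
    (.of_nonneg_of_le (fun i => sq_nonneg _) (fun i => hsq i x)
      ((hasSum_sq_norm_inner e x).summable.mul_left (r ^ 2)))
  have hbound : ∀ x, ‖D x‖ ≤ r * ‖x‖ := fun x => by
    refine abs_le_of_sq_le_sq' ?_ (by positivity) |>.2
    rw [mul_pow]
    refine hasSum_le (fun i => ?_) (hasSum_sq_norm_inner e (D x))
      ((hasSum_sq_norm_inner e x).mul_left (r ^ 2))
    rw [hD]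
    exact hsq i x
  let D' : H →ₗ[ℂ] H :=
    { toFun := D
      map_add' := fun x y => hilbertBasis_ext e fun i => by
        simp only [hD, inner_add_right, mul_add]
      map_smul' := fun c x => hilbertBasis_ext e fun i => by
        simp only [hD, inner_smul_right, RingHom.id_apply]; ring }
  exact ⟨D'.mkContinuous r hbound, fun i x => hD x i, hbound⟩

/-- Truncations to finite index sets have finite rank and converge in operator norm, since the
omitted entries are uniformly small. -/
theorem isCompactOperator_of_diagonal [CompleteSpace H] (e : HilbertBasis ι ℂ H) {s : ι → ℝ}
    (hs : Tendsto s cofinite (𝓝 0)) {D : H →L[ℂ] H}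
    (hD : ∀ i x, ⟪e i, D x⟫_ℂ = s i * ⟪e i, x⟫_ℂ) : IsCompactOperator D := by
  classical
  let T : Finset ι → H →L[ℂ] H := fun t =>
    ∑ i ∈ t, (s i : ℂ) • (innerSL ℂ (e i)).smulRight (e i)
  have hT : ∀ t i x, ⟪e i, T t x⟫_ℂ = if i ∈ t then s i * ⟪e i, x⟫_ℂ else 0 := by
    intro t i x
    simp only [T, sum_apply, inner_sum, smul_apply,
      ContinuousLinearMap.smulRight_apply, innerSL_apply_apply, inner_smul_right,
      orthonormal_iff_ite.1 e.orthonormal]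
    simp
  have hTc : ∀ t, IsCompactOperator (T t) := fun t => by
    have : ∀ i ∈ t, (s i : ℂ) • (innerSL ℂ (e i)).smulRight (e i) ∈
        compactOperator (RingHom.id ℂ) H H := fun i _ => by
      refine Submodule.smul_mem _ _ ?_
      have h1 : IsCompactOperator (ContinuousLinearMap.toSpanSingleton ℂ (e i)) :=
        isCompactOperator_of_locallyCompactSpace_rng (ContinuousLinearMap.toSpanSingleton ℂ (e i))
      exact h1.comp_clm (innerSL ℂ (e i))
    exact Submodule.sum_mem _ this
  refine isCompactOperator_of_tendsto (l := atTop) (F := T) ?_ (Eventually.of_forall hTc)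
  rw [Metric.tendsto_atTop]
  intro ε hε
  have hfin := hs.eventually (Metric.ball_mem_nhds 0 (half_pos hε))
  rw [eventually_cofinite] at hfin
  refine ⟨hfin.toFinset, fun t ht => ?_⟩
  rw [dist_eq_norm]
  refine lt_of_le_of_lt (ContinuousLinearMap.opNorm_le_bound _ (half_pos hε).le fun x => ?_)
    (half_lt_self hε)
  refine abs_le_of_sq_le_sq' ?_ (by positivity) |>.2
  rw [mul_pow]
  refine hasSum_le (fun i => ?_) (hasSum_sq_norm_inner e _)
    ((hasSum_sq_norm_inner e x).mul_left ((ε / 2) ^ 2))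
  rw [sub_apply, inner_sub_right, hT, hD]
  split_ifs with hi
  · rw [sub_self, norm_zero, zero_pow two_ne_zero]; positivity
  · have h2 : |s i| < ε / 2 := by
      by_contra h
      exact hi (ht (hfin.mem_toFinset.2 (by simpa using h)))
    rw [zero_sub, norm_neg, norm_mul, mul_pow, Complex.norm_real, Real.norm_eq_abs]
    gcongr

variable {e : HilbertBasis ι ℂ H} {a : ι → ℝ} {V : H →L[ℂ] H} {M : ℝ}

/-- `K` is the resolvent `(D + V + M + 1)⁻¹`. -/
structure IsResolvent (e : HilbertBasis ι ℂ H) (a : ι → ℝ) (V : H →L[ℂ] H) (M : ℝ)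
    (K : H →L[ℂ] H) : Prop where
  image : ∀ f, IsImage e a V (K f) (f - ((M + 1 : ℝ) : ℂ) • K f)
  norm_le : ∀ f, ‖K f‖ ≤ ‖f‖
  norm_basis_le : ∀ i, ‖K (e i)‖ ≤ (M + 1) / (a i + M + 1)

/-- If `D₀` is the inverse of the diagonal part shifted by `M + 1`, the resolvent is `(1 + D₀ V)⁻¹
D₀`. The size of the shift gives `‖D₀ V‖ ≤ M / (M + 1) < 1`, so a Neumann series inverts the first
factor; compactness comes from `D₀`. -/
theorem exists_isResolvent [CompleteSpace H] (ha : ∀ i, 0 ≤ a i) (hM : ‖V‖ ≤ M) (hs : Tendsto a cofinite atTop) :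
    ∃ K : H →L[ℂ] H, IsResolvent e a V M K ∧ IsCompactOperator K := by
  have hM0 : 0 ≤ M := (norm_nonneg V).trans hM
  have hpos : ∀ i, 0 < a i + M + 1 := fun i => by linarith [ha i]
  obtain ⟨D, hD, hDb⟩ := exists_diagonal e (s := fun i => (a i + M + 1)⁻¹) (r := (M + 1)⁻¹)
    (by positivity) (fun i => by
      rw [abs_of_pos (inv_pos.2 (hpos i))]
      exact inv_anti₀ (by positivity) (by linarith [ha i]))
  have hDV : ‖-(D ∘L V)‖ < 1 := by
    have h1 : ‖D ∘L V‖ ≤ (M + 1)⁻¹ * M :=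
      (ContinuousLinearMap.opNorm_comp_le _ _).trans (mul_le_mul
        (D.opNorm_le_bound (by positivity) hDb) hM (norm_nonneg _) (by positivity))
    rw [norm_neg]
    refine h1.trans_lt ?_
    rw [inv_mul_lt_iff₀ (by positivity)]
    linarith
  obtain ⟨u, hu⟩ := isUnit_one_sub_of_norm_lt_one hDV
  set K : H →L[ℂ] H := (↑u⁻¹ : H →L[ℂ] H) ∘L D with hK
  have hKD : ∀ f, K f + D (V (K f)) = D f := fun f => by
    have h1 : (u : H →L[ℂ] H) * (↑u⁻¹ : H →L[ℂ] H) = 1 := u.mul_inv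
    have h2 := congrArg (fun T : H →L[ℂ] H => T (D f)) h1
    simp only [hu, sub_neg_eq_add, mul_apply_eq_comp, add_apply,
      one_apply_eq_self, ContinuousLinearMap.comp_apply] at h2
    exact h2
  have hbound : ∀ f, ‖K f‖ ≤ (M + 1) * ‖D f‖ := fun f => by
    have h1 : K f = D f - D (V (K f)) := eq_sub_of_add_eq (hKD f)
    have h2 : ‖D (V (K f))‖ ≤ (M + 1)⁻¹ * (M * ‖K f‖) :=
      (hDb _).trans (by gcongr; exact V.le_of_opNorm_le hM _)
    have h3 : ‖K f‖ ≤ ‖D f‖ + (M + 1)⁻¹ * (M * ‖K f‖) := by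
      calc ‖K f‖ = ‖D f - D (V (K f))‖ := by rw [← h1]
        _ ≤ ‖D f‖ + ‖D (V (K f))‖ := norm_sub_le _ _
        _ ≤ _ := by gcongr
    have h4 : (M + 1) * ‖K f‖ ≤ (M + 1) * ‖D f‖ + M * ‖K f‖ := by
      calc (M + 1) * ‖K f‖ ≤ (M + 1) * (‖D f‖ + (M + 1)⁻¹ * (M * ‖K f‖)) := by gcongr
        _ = _ := by field_simp
    linarith
  refine ⟨K, ⟨fun f i => ?_, fun f => ?_, fun i => ?_⟩, ?_⟩
  · have h1 := congrArg (fun x => ⟪e i, x⟫_ℂ) (hKD f)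
    simp only [inner_add_right, hD] at h1
    have h2 : ((a i : ℂ) + M + 1) ≠ 0 := by exact_mod_cast (hpos i).ne'
    push_cast at h1
    field_simp at h1
    rw [inner_sub_right, inner_smul_right]
    push_cast
    linear_combination h1
  · calc ‖K f‖ ≤ (M + 1) * ‖D f‖ := hbound f
      _ ≤ (M + 1) * ((M + 1)⁻¹ * ‖f‖) := by gcongr; exact hDb f
      _ = ‖f‖ := by field_simp
  · have h1 : D (e i) = (((a i + M + 1)⁻¹ : ℝ) : ℂ) • e i := hilbertBasis_ext e fun j => by
      classical
      rw [hD, inner_smul_right, orthonormal_iff_ite.1 e.orthonormal]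
      split_ifs with h
      · rw [h]
      · simp
    refine (hbound _).trans_eq ?_
    rw [h1, norm_smul, e.orthonormal.1, mul_one, Complex.norm_real,
      Real.norm_of_nonneg (inv_pos.2 (hpos i)).le, div_eq_mul_inv]
  · refine (isCompactOperator_of_diagonal e ?_ hD).clm_comp _
    exact tendsto_inv_atTop_zero.comp
      (tendsto_atTop_add_const_right _ _ (tendsto_atTop_add_const_right _ _ hs))

theorem IsImage.neg_le_energy (ha : ∀ i, 0 ≤ a i) (hM : ‖V‖ ≤ M) {ψ : H} (hψ : ‖ψ‖ = 1) {E : ℝ}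
    (h : IsImage e a V ψ ((E : ℂ) • ψ)) : -M ≤ E := by
  have h1 := h.hasSum_kinetic.nonneg fun i => mul_nonneg (ha i) (sq_nonneg _)
  have h2 : (⟪ψ, (E : ℂ) • ψ⟫_ℂ).re = E := by
    rw [inner_smul_right, inner_self_eq_norm_sq_to_K, hψ]; simp
  have h3 : |(⟪ψ, V ψ⟫_ℂ).re| ≤ M := by
    refine (Complex.abs_re_le_norm _).trans ((norm_inner_le_norm _ _).trans ?_)
    rw [hψ, one_mul]
    simpa [hψ] using V.le_of_opNorm_le hM ψ
  rw [inner_sub_right, Complex.sub_re, h2] at h1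
  linarith [(abs_le.1 h3).1]

namespace IsResolvent

variable {K : H →L[ℂ] H}

theorem symm (hV : ∀ x y, ⟪V x, y⟫_ℂ = ⟪x, V y⟫_ℂ) (hK : IsResolvent e a V M K) (f g : H) :
    ⟪K f, g⟫_ℂ = ⟪f, K g⟫_ℂ := by
  have h := (hK.image f).inner_eq hV (hK.image g)
  rw [inner_sub_right, inner_sub_left, inner_smul_right, inner_smul_left, Complex.conj_ofReal] at h
  exact sub_left_injective h

/-- Uniqueness in weak form: after the symmetry of the operator and of the resolvent have been used,
both sides have the same inner product with every `g`. -/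
theorem eq_of_image (hV : ∀ x y, ⟪V x, y⟫_ℂ = ⟪x, V y⟫_ℂ) (hK : IsResolvent e a V M K) {ψ f : H}
    (h : IsImage e a V ψ (f - ((M + 1 : ℝ) : ℂ) • ψ)) : K f = ψ := by
  refine ext_inner_left ℂ fun g => ?_
  have h1 := (hK.image g).inner_eq hV h
  rw [inner_sub_right, inner_sub_left, inner_smul_right, inner_smul_left, Complex.conj_ofReal] at h1
  rw [← hK.symm hV]
  exact sub_left_injective h1

theorem injective (hK : IsResolvent e a V M K) : Function.Injective K := by
  refine (injective_iff_map_eq_zero _).2 fun f hf => hilbertBasis_ext e fun i => ?_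
  have := hK.image f i
  rw [hf] at this
  simpa using this.symm

theorem apply_eigenvector (hV : ∀ x y, ⟪V x, y⟫_ℂ = ⟪x, V y⟫_ℂ) (hK : IsResolvent e a V M K)
    {ψ : H} {E : ℝ} (hE : -M ≤ E) (h : IsImage e a V ψ ((E : ℂ) • ψ)) :
    K ψ = (((E + M + 1)⁻¹ : ℝ) : ℂ) • ψ := by
  refine hK.eq_of_image hV ?_
  have h1 := h.smul (((E + M + 1)⁻¹ : ℝ) : ℂ)
  convert h1 using 1
  have : ((E : ℂ) + M + 1) ≠ 0 := by
    have : 0 < E + M + 1 := by linarith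
    exact_mod_cast this.ne'
  rw [smul_smul, smul_smul, sub_eq_iff_eq_add, ← add_smul]
  push_cast
  field_simp
  rw [show (E : ℂ) + (M + 1) = E + M + 1 by ring, div_self this, one_smul]

theorem pow_symm (hV : ∀ x y, ⟪V x, y⟫_ℂ = ⟪x, V y⟫_ℂ) (hK : IsResolvent e a V M K) (s : ℕ)
    (f g : H) : ⟪(K ^ s) f, g⟫_ℂ = ⟪f, (K ^ s) g⟫_ℂ := by
  induction s generalizing f g with
  | zero => simp
  | succ s ih =>
    rw [pow_succ, mul_apply_eq_comp, ih, hK.symm hV, ← mul_apply_eq_comp,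
      ← pow_succ', pow_succ]

theorem pow_apply_eigenvector (hV : ∀ x y, ⟪V x, y⟫_ℂ = ⟪x, V y⟫_ℂ) (hK : IsResolvent e a V M K)
    {ψ : H} {E : ℝ} (hE : -M ≤ E) (h : IsImage e a V ψ ((E : ℂ) • ψ)) (s : ℕ) :
    (K ^ s) ψ = ((((E + M + 1)⁻¹) ^ s : ℝ) : ℂ) • ψ := by
  induction s with
  | zero => simp
  | succ s ih =>
    rw [pow_succ, mul_apply_eq_comp, hK.apply_eigenvector hV hE h, map_smul, ih,
      smul_smul, pow_succ, mul_comm]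
    push_cast
    rfl

/-- Both sides are the squared Hilbert–Schmidt norm of `K ^ s`, computed in the eigenbasis and in
the reference basis. With values in `ℝ≥0∞` the double sum may be exchanged before anything is known
to be finite. -/
theorem tsum_pow_eq (hV : ∀ x y, ⟪V x, y⟫_ℂ = ⟪x, V y⟫_ℂ) (hK : IsResolvent e a V M K)
    {κ : Type*} (b : HilbertBasis κ ℂ H) {E : κ → ℝ} (hE : ∀ n, -M ≤ E n)
    (h : ∀ n, IsImage e a V (b n) ((E n : ℂ) • b n)) (s : ℕ) :
    ∑' n, ENNReal.ofReal (((E n + M + 1)⁻¹) ^ (2 * s)) =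
      ∑' i, ENNReal.ofReal (‖(K ^ s) (e i)‖ ^ 2) := by
  have h1 : ∀ n, ENNReal.ofReal (((E n + M + 1)⁻¹) ^ (2 * s)) =
      ∑' i, ENNReal.ofReal (((E n + M + 1)⁻¹) ^ (2 * s) * ‖⟪e i, b n⟫_ℂ‖ ^ 2) := fun n => by
    have h2 := (hasSum_sq_norm_inner e (b n)).mul_left (((E n + M + 1)⁻¹) ^ (2 * s))
    rw [b.orthonormal.1, one_pow, mul_one] at h2
    rw [← ENNReal.ofReal_tsum_of_nonneg (fun i => ?_) h2.summable, h2.tsum_eq]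
    rw [pow_mul]; positivity
  have h3 : ∀ i, ENNReal.ofReal (‖(K ^ s) (e i)‖ ^ 2) =
      ∑' n, ENNReal.ofReal (((E n + M + 1)⁻¹) ^ (2 * s) * ‖⟪e i, b n⟫_ℂ‖ ^ 2) := fun i => by
    have h2 := hasSum_sq_norm_inner b ((K ^ s) (e i))
    rw [← h2.tsum_eq, ENNReal.ofReal_tsum_of_nonneg (fun i => sq_nonneg _) h2.summable]
    refine tsum_congr fun n => ?_
    rw [← hK.pow_symm hV, hK.pow_apply_eigenvector hV (hE n) (h n), inner_smul_left,
      Complex.conj_ofReal, norm_mul, mul_pow, Complex.norm_real, norm_inner_symm, ← norm_pow,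
      ← pow_mul, Real.norm_of_nonneg (by rw [mul_comm s, pow_mul]; positivity), mul_comm s]
  simp_rw [h1, h3]
  exact ENNReal.tsum_comm

theorem tsum_sq_lt_top (hK : IsResolvent e a V M K) (ha : ∀ i, 0 ≤ a i) (hM : 0 ≤ M)
    (hs : Summable fun i => ((a i + 1) ^ 2)⁻¹) :
    ∑' i, ENNReal.ofReal (‖K (e i)‖ ^ 2) < ⊤ := by
  have h1 : Summable fun i => ‖K (e i)‖ ^ 2 := by
    refine .of_nonneg_of_le (fun i => sq_nonneg _) (fun i => ?_) (hs.mul_left ((M + 1) ^ 2))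
    have h2 := hK.norm_basis_le i
    have h3 : (M + 1) / (a i + M + 1) ≤ (M + 1) / (a i + 1) := by
      have := ha i
      gcongr
      linarith
    rw [← inv_pow, ← mul_pow, ← div_eq_mul_inv]
    gcongr
    exact h2.trans h3
  exact h1.tsum_ofReal_lt_top

end IsResolvent

theorem tendsto_atTop_of_summable_inv_sq {ι : Type*} {a : ι → ℝ} (ha : ∀ i, 0 ≤ a i)
    (hs : Summable fun i => ((a i + 1) ^ 2)⁻¹) : Tendsto a cofinite atTop := by
  refine tendsto_atTop.2 fun R => ?_
  have h1 := hs.tendsto_cofinite_zero.eventually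
    (gt_mem_nhds (show (0 : ℝ) < ((|R| + 1) ^ 2)⁻¹ by positivity))
  filter_upwards [h1] with i hi
  have h2 : 0 < a i + 1 := by linarith [ha i]
  have h3 := lt_of_pow_lt_pow_left₀ 2 h2.le ((inv_lt_inv₀ (by positivity) (by positivity)).1 hi)
  linarith [le_abs_self R]

/-- `D + V` has an ascending eigenbasis when the squared resolvent of `D` is of trace class. -/
theorem exists_isEigenbasis [CompleteSpace H] [Infinite ι] (hV : ∀ x y, ⟪V x, y⟫_ℂ = ⟪x, V y⟫_ℂ)
    (ha : ∀ i, 0 ≤ a i) (hs : Summable fun i => ((a i + 1) ^ 2)⁻¹) :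
    ∃ b E, IsEigenbasis e a V b E := by
  have hlim := tendsto_atTop_of_summable_inv_sq ha hs
  have hM0 := norm_nonneg V
  obtain ⟨K, hK, hKc⟩ := exists_isResolvent (e := e) ha (le_refl ‖V‖) hlim
  have hsymm : (K : H →ₗ[ℂ] H).IsSymmetric := hK.symm hV
  let W : ℂ → Submodule ℂ H := fun μ => Module.End.eigenspace (K : Module.End ℂ H) μ
  have hmem : ∀ μ x, x ∈ W μ ↔ K x = μ • x := fun μ x => Module.End.mem_eigenspace_iff
  have hW0 : W 0 = ⊥ := (Submodule.eq_bot_iff _).2 fun x hx => hK.injective <|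
    show K x = K 0 by rw [(hmem 0 x).1 hx, zero_smul, map_zero]
  have hfd : ∀ μ, FiniteDimensional ℂ (W μ) := fun μ => by
    by_cases hμ : μ = 0
    · rw [hμ, hW0]; infer_instance
    · exact ContinuousLinearMap.finite_dimensional_eigenspace hKc μ hμ
  -- Orthonormal bases of all eigenspaces of `K` together; a number that is no eigenvalue
  -- contributes the empty type `Fin 0`.
  let I := Σ μ : ℂ, Fin (Module.finrank ℂ (W μ))
  let v : I → H := fun p => (stdOrthonormalBasis ℂ (W p.1) p.2 : H)
  have hv : Orthonormal ℂ v :=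
    hsymm.orthogonalFamily_eigenspaces.orthonormal_sigma_orthonormal
      fun μ => (stdOrthonormalBasis ℂ (W μ)).orthonormal
  have hvbot : (Submodule.span ℂ (Set.range v))ᗮ = ⊥ := by
    refine (Submodule.eq_bot_iff _).2 fun x hx => ?_
    have hx' : x ∈ (⨆ μ, W μ)ᗮ := by
      rw [← Submodule.iInf_orthogonal, Submodule.mem_iInf]
      intro μ
      rw [Submodule.mem_orthogonal]
      intro w hw
      have h1 := congrArg Subtype.val ((stdOrthonormalBasis ℂ (W μ)).sum_repr ⟨w, hw⟩)
      simp only [Submodule.coe_sum, Submodule.coe_smul] at h1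
      rw [← h1, sum_inner]
      refine Finset.sum_eq_zero fun i _ => ?_
      rw [inner_smul_left, Submodule.inner_right_of_mem_orthogonal
        (Submodule.subset_span (Set.mem_range_self (f := v) ⟨μ, i⟩)) hx, mul_zero]
    rwa [ContinuousLinearMap.orthogonalComplement_iSup_eigenspaces_eq_bot hKc hsymm,
      Submodule.mem_bot] at hx'
  have hKv : ∀ p : I, K (v p) = p.1 • v p := fun p => (hmem _ _).1 (Subtype.mem _)
  -- Eigenvalues of `K` are nonzero by injectivity and real by symmetry, so each one is `(E + ‖V‖ +
  -- 1)⁻¹` for a real `E`, an eigenvalue of `D + V`.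
  have hμ0 : ∀ p : I, p.1 ≠ 0 := fun p h0 => by
    have h1 := hv.1 p
    rw [hK.injective (show K (v p) = K 0 by rw [hKv, h0, zero_smul, map_zero]), norm_zero] at h1
    exact zero_ne_one h1
  have hμr : ∀ p : I, ((p.1.re : ℝ) : ℂ) = p.1 := fun p => by
    have h1 := hsymm (v p) (v p)
    simp only [ContinuousLinearMap.coe_coe, hKv, inner_smul_left, inner_smul_right,
      inner_self_eq_norm_sq_to_K, hv.1] at h1
    exact Complex.conj_eq_iff_re.1 (by simpa using h1)
  let E : I → ℝ := fun p => p.1.re⁻¹ - (‖V‖ + 1)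
  have him : ∀ p, IsImage e a V (v p) ((E p : ℂ) • v p) := fun p => by
    have h1 := (hK.image (v p)).smul (p.1⁻¹)
    have h2 := hμ0 p
    have h3 : (E p : ℂ) = p.1⁻¹ - ((‖V‖ + 1 : ℝ) : ℂ) := by
      simp only [E, Complex.ofReal_sub, Complex.ofReal_inv, hμr]
    rw [hKv, inv_smul_smul₀ h2] at h1
    convert h1 using 1
    rw [h3]
    match_scalars
    field_simp
  have hE : ∀ p, -‖V‖ ≤ E p := fun p => (him p).neg_le_energy ha le_rfl (hv.1 p)
  let b : HilbertBasis I ℂ H := HilbertBasis.mkOfOrthogonalEqBot hv hvbot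
  have hbv : ∀ p, b p = v p := fun p => congrFun (HilbertBasis.coe_mkOfOrthogonalEqBot hv hvbot) p
  -- Finitely many eigenvectors would make `H` finite-dimensional, against the infinite orthonormal
  -- family `e`.
  have hinf : Infinite I := by
    by_contra hfin
    rw [not_infinite_iff_finite] at hfin
    have := Fintype.ofFinite I
    have : FiniteDimensional ℂ H := b.toOrthonormalBasis.toBasis.finiteDimensional_of_finite
    exact not_finite_iff_infinite.2 ‹Infinite ι› e.orthonormal.linearIndependent.finite
  -- The resolvent is Hilbert–Schmidt, so `∑ (E + ‖V‖ + 1)⁻²` converges and only finitely many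
  -- eigenvalues lie below any bound.
  have hfin : ∀ R, {p | E p ≤ R}.Finite := fun R => by
    have h1 : ∑' p, ENNReal.ofReal (((E p + ‖V‖ + 1)⁻¹) ^ (2 * 1)) ≠ ⊤ := by
      rw [hK.tsum_pow_eq hV b hE (fun p => by rw [hbv]; exact him p), pow_one]
      exact (hK.tsum_sq_lt_top ha hM0 hs).ne
    have h2 := ENNReal.finite_const_le_of_tsum_ne_top h1
      (ε := ENNReal.ofReal (((|R| + ‖V‖ + 1)⁻¹) ^ 2)) (by simp; positivity)
    refine h2.subset fun p hp => ENNReal.ofReal_le_ofReal ?_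
    have h3 : 0 < E p + ‖V‖ + 1 := by linarith [hE p]
    have h4 : E p ≤ |R| := le_trans hp (le_abs_self R)
    rw [mul_one]
    gcongr
  obtain ⟨σ, hmono, htend⟩ := exists_monotone_enumeration hfin
  have hspan : (Submodule.span ℂ (Set.range (v ∘ σ)))ᗮ = ⊥ := by
    rwa [σ.surjective.range_comp]
  refine ⟨HilbertBasis.mkOfOrthogonalEqBot (hv.comp σ σ.injective) hspan, E ∘ σ, hmono, htend,
    fun n => ?_⟩
  rw [HilbertBasis.coe_mkOfOrthogonalEqBot]
  exact him (σ n)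

end CompactResolvent

/-! ### Multiplication operators on `L²` -/

section Multiplication

open InnerProductSpace
open scoped ENNReal

variable {α : Type*} [MeasurableSpace α] {μ : Measure α}

theorem inner_eq_integral (f g : Lp ℂ 2 μ) : ⟪f, g⟫_ℂ = ∫ q, conj (f q) * g q ∂μ := by
  rw [L2.inner_def]
  simp only [RCLike.inner_apply']

theorem norm_sq_eq_integral (f : Lp ℂ 2 μ) : ‖f‖ ^ 2 = ∫ q, ‖f q‖ ^ 2 ∂μ := by
  have h := inner_eq_integral f f
  rw [inner_self_eq_norm_sq_to_K] at h
  have h2 : ∀ q, conj (f q) * f q = ((‖f q‖ ^ 2 : ℝ) : ℂ) := fun q => by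
    rw [← Complex.normSq_eq_conj_mul_self, Complex.normSq_eq_norm_sq]
  simp_rw [h2] at h
  rw [integral_complex_ofReal] at h
  exact Complex.ofReal_injective (by simpa using h)

theorem memLp_mul_of_bounded {W : α → ℝ} (hW : AEStronglyMeasurable W μ) {M : ℝ}
    (hM : ∀ x, |W x| ≤ M) {f : α → ℂ} (hf : MemLp f 2 μ) : MemLp (fun x => (W x : ℂ) * f x) 2 μ := by
  refine hf.of_le_mul (c := M)
    ((Complex.continuous_ofReal.comp_aestronglyMeasurable hW).mul hf.1)
    (Eventually.of_forall fun x => ?_)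
  rw [norm_mul, Complex.norm_real, Real.norm_eq_abs]
  gcongr
  exact hM x

theorem exists_mulOp {W : α → ℝ} (hW : AEStronglyMeasurable W μ) {M : ℝ} (hM0 : 0 ≤ M)
    (hM : ∀ x, |W x| ≤ M) :
    ∃ T : Lp ℂ 2 μ →L[ℂ] Lp ℂ 2 μ, (∀ f, T f =ᵐ[μ] fun x => (W x : ℂ) * f x) ∧ ‖T‖ ≤ M := by
  have hmem : ∀ f : Lp ℂ 2 μ, MemLp (fun x => (W x : ℂ) * f x) 2 μ := fun f =>
    memLp_mul_of_bounded hW hM (Lp.memLp f)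
  let T : Lp ℂ 2 μ →ₗ[ℂ] Lp ℂ 2 μ :=
    { toFun := fun f => (hmem f).toLp
      map_add' := fun f g => by
        refine Lp.ext ?_
        filter_upwards [(hmem (f + g)).coeFn_toLp, (hmem f).coeFn_toLp, (hmem g).coeFn_toLp,
          Lp.coeFn_add f g, Lp.coeFn_add (hmem f).toLp (hmem g).toLp] with x h1 h2 h3 h4 h5
        rw [h1, h5, h4, Pi.add_apply, Pi.add_apply, h2, h3, mul_add]
      map_smul' := fun c f => by
        refine Lp.ext ?_
        filter_upwards [(hmem (c • f)).coeFn_toLp, (hmem f).coeFn_toLp,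
          Lp.coeFn_smul c f, Lp.coeFn_smul c (hmem f).toLp] with x h1 h2 h3 h4
        rw [h1, RingHom.id_apply, h4, h3, Pi.smul_apply, Pi.smul_apply, h2, smul_eq_mul,
          smul_eq_mul, mul_left_comm] }
  have hT : ∀ f, T f =ᵐ[μ] fun x => (W x : ℂ) * f x := fun f => (hmem f).coeFn_toLp
  have hb : ∀ f, ‖T f‖ ≤ M * ‖f‖ := fun f => by
    refine Lp.norm_le_mul_norm_of_ae_le_mul ?_
    filter_upwards [hT f] with x hx
    rw [hx, norm_mul, Complex.norm_real, Real.norm_eq_abs]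
    gcongr
    exact hM x
  exact ⟨T.mkContinuous M hb, hT, T.mkContinuous_norm_le hM0 hb⟩

open Classical in
/-- Multiplication by a bounded real function on `L²(μ)`. -/
def mulOp (μ : Measure α) (W : α → ℝ) : Lp ℂ 2 μ →L[ℂ] Lp ℂ 2 μ :=
  if h : ∃ T : Lp ℂ 2 μ →L[ℂ] Lp ℂ 2 μ, ∀ f, T f =ᵐ[μ] fun x => (W x : ℂ) * f x
  then h.choose else 0

theorem mulOp_ae {W : α → ℝ} (hW : AEStronglyMeasurable W μ) {M : ℝ} (hM0 : 0 ≤ M)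
    (hM : ∀ x, |W x| ≤ M) (f : Lp ℂ 2 μ) : mulOp μ W f =ᵐ[μ] fun x => (W x : ℂ) * f x := by
  obtain ⟨T, hT, -⟩ := exists_mulOp hW hM0 hM
  have h : ∃ T : Lp ℂ 2 μ →L[ℂ] Lp ℂ 2 μ, ∀ f, T f =ᵐ[μ] fun x => (W x : ℂ) * f x := ⟨T, hT⟩
  rw [mulOp, dif_pos h]
  exact h.choose_spec f

theorem norm_mulOp_le {W : α → ℝ} (hW : AEStronglyMeasurable W μ) {M : ℝ} (hM0 : 0 ≤ M)
    (hM : ∀ x, |W x| ≤ M) : ‖mulOp μ W‖ ≤ M := by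
  obtain ⟨T, hT, hTM⟩ := exists_mulOp hW hM0 hM
  have : mulOp μ W = T := by
    ext1 f
    exact Lp.ext ((mulOp_ae hW hM0 hM f).trans (hT f).symm)
  rwa [this]

theorem mulOp_symm {W : α → ℝ} (hW : AEStronglyMeasurable W μ) {M : ℝ} (hM0 : 0 ≤ M)
    (hM : ∀ x, |W x| ≤ M) (f g : Lp ℂ 2 μ) : ⟪mulOp μ W f, g⟫_ℂ = ⟪f, mulOp μ W g⟫_ℂ := by
  rw [inner_eq_integral, inner_eq_integral]
  refine integral_congr_ae ?_
  filter_upwards [mulOp_ae hW hM0 hM f, mulOp_ae hW hM0 hM g] with x h1 h2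
  rw [h1, h2, map_mul, Complex.conj_ofReal]
  ring

end Multiplication

/-! ### Fourier basis on a circle -/

section Circle

open InnerProductSpace

/-- Lebesgue measure on a period interval. -/
abbrev circleMeasure (l : ℝ) : Measure ℝ := volume.restrict (Set.Ico 0 l)

/-- The Hilbert space `L²(ℝ / l ℤ)`. -/
abbrev CircleL2 (l : ℝ) : Type := Lp ℂ 2 (circleMeasure l)

/-- The normalized exponentials with period `l`. -/
def circleFun (l : ℝ) (m : ℤ) (q : ℝ) : ℂ :=
  ((√l)⁻¹ : ℝ) * Complex.exp (((2 * Real.pi * m / l * q : ℝ) : ℂ) * Complex.I)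

theorem norm_circleFun (l : ℝ) (m : ℤ) (q : ℝ) : ‖circleFun l m q‖ = (√l)⁻¹ := by
  rw [circleFun, norm_mul, Complex.norm_exp_ofReal_mul_I, mul_one, Complex.norm_real,
    Real.norm_of_nonneg (by positivity)]

theorem contDiff_circleFun (l : ℝ) (m : ℤ) {n : WithTop ℕ∞} : ContDiff ℝ n (circleFun l m) := by
  unfold circleFun
  refine contDiff_const.mul (Complex.contDiff_exp.comp ?_)
  exact ContDiff.mul (Complex.ofRealCLM.contDiff.comp (contDiff_const.mul contDiff_id))
    contDiff_const

theorem continuous_circleFun (l : ℝ) (m : ℤ) : Continuous (circleFun l m) :=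
  (contDiff_circleFun l m (n := 0)).continuous

theorem hasDerivAt_circleFun (l : ℝ) (m : ℤ) (q : ℝ) :
    HasDerivAt (circleFun l m) (((2 * Real.pi * m / l : ℝ) : ℂ) * Complex.I * circleFun l m q) q := by
  have h1 : HasDerivAt (fun q : ℝ => ((2 * Real.pi * m / l * q : ℝ) : ℂ))
      ((2 * Real.pi * m / l : ℝ) : ℂ) q := by
    have := ((hasDerivAt_id q).const_mul (2 * Real.pi * m / l)).ofReal_comp
    simpa using this
  have h2 := ((h1.mul_const Complex.I).cexp).const_mul (((√l)⁻¹ : ℝ) : ℂ)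
  refine h2.congr_deriv ?_
  rw [circleFun]; ring

theorem circleFun_add_period {l : ℝ} (hl : 0 < l) (m : ℤ) (q : ℝ) :
    circleFun l m (q + l) = circleFun l m q := by
  unfold circleFun
  congr 1
  have : (((2 * Real.pi * m / l * (q + l) : ℝ) : ℂ) * Complex.I) =
      ((2 * Real.pi * m / l * q : ℝ) : ℂ) * Complex.I + m * (2 * Real.pi * Complex.I) := by
    have : (l : ℂ) ≠ 0 := by exact_mod_cast hl.ne'
    push_cast
    field_simp
  rw [this, Complex.exp_periodic.int_mul m]

theorem conj_circleFun (l : ℝ) (m : ℤ) (q : ℝ) : conj (circleFun l m q) = circleFun l (-m) q := by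
  unfold circleFun
  rw [map_mul, Complex.conj_ofReal, ← Complex.exp_conj, map_mul, Complex.conj_I, Complex.conj_ofReal]
  push_cast
  congr 2
  ring

theorem memLp_circleFun (l : ℝ) (m : ℤ) : MemLp (circleFun l m) 2 (circleMeasure l) :=
  MemLp.of_bound (continuous_circleFun l m).aestronglyMeasurable ((√l)⁻¹)
    (Eventually.of_forall fun q => (norm_circleFun l m q).le)

theorem intervalIntegral_eq_circle {E : Type*} [NormedAddCommGroup E] [NormedSpace ℝ E]
    {l : ℝ} (hl : 0 < l) (f : ℝ → E) :
    ∫ q, f q ∂(circleMeasure l) = ∫ q in (0 : ℝ)..l, f q := by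
  rw [intervalIntegral.integral_of_le hl.le, circleMeasure, restrict_Ico_eq_restrict_Ioc]

theorem inner_toLp_circleFun (l : ℝ) (m : ℤ) (f : CircleL2 l) :
    ⟪(memLp_circleFun l m).toLp, f⟫_ℂ = ∫ q, conj (circleFun l m q) * f q ∂(circleMeasure l) := by
  rw [inner_eq_integral]
  refine integral_congr_ae ?_
  filter_upwards [(memLp_circleFun l m).coeFn_toLp] with q hq
  rw [hq]

theorem orthonormal_circleFun {l : ℝ} (hl : 0 < l) :
    Orthonormal ℂ fun m => (memLp_circleFun l m).toLp := by
  rw [orthonormal_iff_ite]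
  intro m n
  have h1 : ⟪(memLp_circleFun l m).toLp, (memLp_circleFun l n).toLp⟫_ℂ =
      ∫ q in (0 : ℝ)..l, (l : ℂ)⁻¹ * Complex.exp ((2 * Real.pi * (n - m : ℤ) / l * Complex.I) * q) := by
    rw [inner_toLp_circleFun, ← intervalIntegral_eq_circle hl]
    refine integral_congr_ae ?_
    filter_upwards [(memLp_circleFun l n).coeFn_toLp] with q hq
    rw [hq, conj_circleFun, circleFun, circleFun, mul_mul_mul_comm, ← Complex.exp_add]
    congr 1
    · rw [← Complex.ofReal_mul, ← mul_inv, Real.mul_self_sqrt hl.le, Complex.ofReal_inv]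
    · push_cast; congr 1; ring
  rw [h1]
  have hl' : (l : ℂ) ≠ 0 := by exact_mod_cast hl.ne'
  split_ifs with h
  · subst h
    simp [hl']
  · have hc : (2 * Real.pi * (n - m : ℤ) / l * Complex.I : ℂ) ≠ 0 := by
      have : ((n - m : ℤ) : ℂ) ≠ 0 := by exact_mod_cast sub_ne_zero.2 (Ne.symm h)
      have hpi : (Real.pi : ℂ) ≠ 0 := by exact_mod_cast Real.pi_ne_zero
      exact mul_ne_zero (div_ne_zero (mul_ne_zero (mul_ne_zero two_ne_zero hpi) this) hl')
        Complex.I_ne_zero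
    rw [intervalIntegral.integral_const_mul, integral_exp_mul_complex hc]
    have : (2 * Real.pi * (n - m : ℤ) / l * Complex.I * l : ℂ) =
        (n - m : ℤ) * (2 * Real.pi * Complex.I) := by
      field_simp
    rw [this, Complex.exp_int_mul_two_pi_mul_I]
    simp

/-- By Parseval's identity for Fourier coefficients, a vector orthogonal to all exponentials has
norm zero. -/
theorem span_circleFun_orthogonal {l : ℝ} (hl : 0 < l) :
    (Submodule.span ℂ (Set.range fun m : ℤ => (memLp_circleFun l m).toLp))ᗮ = ⊥ := by
  refine (Submodule.eq_bot_iff _).2 fun f hf => ?_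
  have hmem : MemLp f 2 (volume.restrict (Set.Ioc 0 l)) := by
    rw [← restrict_Ico_eq_restrict_Ioc]; exact Lp.memLp f
  have h1 := tsum_sq_fourierCoeffOn hl hmem
  have h2 : ∀ m, fourierCoeffOn hl f m = 0 := fun m => by
    have h3 : ⟪(memLp_circleFun l m).toLp, f⟫_ℂ = 0 :=
      Submodule.inner_right_of_mem_orthogonal (Submodule.subset_span (Set.mem_range_self m)) hf
    rw [inner_toLp_circleFun, intervalIntegral_eq_circle hl] at h3
    rw [fourierCoeffOn_eq_integral]
    have h4 : ∀ q : ℝ, fourier (-m) (q : AddCircle (l - 0)) • f q =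
        (√l : ℂ) * (conj (circleFun l m q) * f q) := fun q => by
      rw [smul_eq_mul, fourier_coe_apply, conj_circleFun, circleFun, ← mul_assoc, ← mul_assoc,
        ← Complex.ofReal_mul, mul_inv_cancel₀ (Real.sqrt_pos.2 hl).ne', Complex.ofReal_one, one_mul]
      congr 2
      push_cast
      rw [sub_zero]
      ring
    simp_rw [h4]
    rw [intervalIntegral.integral_const_mul, h3, mul_zero, smul_zero]
  simp only [h2, norm_zero, ne_eq, OfNat.ofNat_ne_zero, not_false_eq_true, zero_pow, tsum_zero,
    sub_zero] at h1
  rw [← intervalIntegral_eq_circle hl, ← norm_sq_eq_integral] at h1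
  have h5 := (smul_eq_zero.1 h1.symm).resolve_left (inv_ne_zero hl.ne')
  exact norm_eq_zero.1 (pow_eq_zero_iff two_ne_zero |>.1 h5)

/-- The Fourier basis of `L²(ℝ / l ℤ)`. -/
def circleBasis {l : ℝ} (hl : 0 < l) : HilbertBasis ℤ ℂ (CircleL2 l) :=
  HilbertBasis.mkOfOrthogonalEqBot (orthonormal_circleFun hl) (span_circleFun_orthogonal hl)

theorem circleBasis_eq {l : ℝ} (hl : 0 < l) (m : ℤ) :
    circleBasis hl m = (memLp_circleFun l m).toLp :=
  congrFun (HilbertBasis.coe_mkOfOrthogonalEqBot _ _) m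

theorem circleBasis_ae {l : ℝ} (hl : 0 < l) (m : ℤ) :
    circleBasis hl m =ᵐ[circleMeasure l] circleFun l m := by
  rw [circleBasis_eq]; exact (memLp_circleFun l m).coeFn_toLp

theorem inner_circleBasis {l : ℝ} (hl : 0 < l) (m : ℤ) (f : CircleL2 l) :
    ⟪circleBasis hl m, f⟫_ℂ = ∫ q, conj (circleFun l m q) * f q ∂(circleMeasure l) := by
  rw [circleBasis_eq, inner_toLp_circleFun]

end Circle

/-! ### Tensor products of `L²` functions on the torus -/

section Tensor

open InnerProductSpace
open scoped ENNReal

theorem measurePreserving_toLp_cell (L : Fin d → ℝ) :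
    MeasurePreserving (WithLp.toLp 2 : (Fin d → ℝ) → Space d)
      (Measure.pi fun j => circleMeasure (L j)) (volume.restrict (cell L)) := by
  have h := (PiLp.volume_preserving_toLp (Fin d)).restrict_preimage_emb
    (MeasurableEquiv.toLp 2 (Fin d → ℝ)).measurableEmbedding (cell L)
  have h2 : (WithLp.toLp 2 : (Fin d → ℝ) → Space d) ⁻¹' cell L =
      Set.univ.pi fun j => Set.Ico 0 (L j) := by
    ext x; simp [cell]
  rw [h2, volume_pi, Measure.restrict_pi_pi] at h
  exact h

theorem integral_cell (L : Fin d → ℝ) {E : Type*} [NormedAddCommGroup E] [NormedSpace ℝ E]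
    (f : Space d → E) :
    ∫ q in cell L, f q = ∫ x, f (WithLp.toLp 2 x) ∂(Measure.pi fun j => circleMeasure (L j)) :=
  ((measurePreserving_toLp_cell L).integral_comp
    (MeasurableEquiv.toLp 2 (Fin d → ℝ)).measurableEmbedding f).symm

theorem integral_cell_prod (L : Fin d → ℝ) (f : Fin d → ℝ → ℂ) :
    ∫ q in cell L, ∏ j, f j (q j) = ∏ j, ∫ x, f j x ∂(circleMeasure (L j)) := by
  rw [integral_cell]
  exact integral_fintype_prod_eq_prod f

theorem integrable_cell_prod {L : Fin d → ℝ} {f : Fin d → ℝ → ℂ}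
    (hf : ∀ j, Integrable (f j) (circleMeasure (L j))) :
    Integrable (fun q : Space d => ∏ j, f j (q j)) (volume.restrict (cell L)) :=
  ((measurePreserving_toLp_cell L).integrable_comp_emb
    (MeasurableEquiv.toLp 2 (Fin d → ℝ)).measurableEmbedding).1 (Integrable.fintype_prod_dep hf)

theorem quasiMeasurePreserving_eval_cell (L : Fin d → ℝ) (j : Fin d) :
    Measure.QuasiMeasurePreserving (fun q : Space d => q j) (volume.restrict (cell L))
      (circleMeasure (L j)) := by
  have h1 := (Measure.quasiMeasurePreserving_eval (μ := fun j => circleMeasure (L j)) j).comp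
    (((measurePreserving_toLp_cell L).symm
      (MeasurableEquiv.toLp 2 (Fin d → ℝ))).quasiMeasurePreserving)
  exact h1

theorem memLp_prod {L : Fin d → ℝ} {φ : Fin d → ℝ → ℂ}
    (hφ : ∀ j, MemLp (φ j) 2 (circleMeasure (L j))) :
    MemLp (fun q : Space d => ∏ j, φ j (q j)) 2 (volume.restrict (cell L)) := by
  have hm : AEStronglyMeasurable (fun q : Space d => ∏ j, φ j (q j)) (volume.restrict (cell L)) :=
    Finset.aestronglyMeasurable_fun_prod _ fun j _ =>
      (hφ j).1.comp_quasiMeasurePreserving (quasiMeasurePreserving_eval_cell L j)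
  rw [memLp_two_iff_integrable_sq_norm hm]
  have h1 := integrable_cell_prod (L := L) (f := fun j x => ((‖φ j x‖ ^ 2 : ℝ) : ℂ))
    fun j => ((memLp_two_iff_integrable_sq_norm (hφ j).1).1 (hφ j)).ofReal
  refine h1.re.congr (Eventually.of_forall fun q => ?_)
  simp only [← Complex.ofReal_prod, RCLike.re_to_complex, Complex.ofReal_re, norm_prod,
    Finset.prod_pow]

/-- The product `q ↦ ∏ j, φ j (q j)` of square integrable functions. -/
def tensor {L : Fin d → ℝ} (φ : ∀ j, CircleL2 (L j)) : TorusL2 L :=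
  (memLp_prod fun j => Lp.memLp (φ j)).toLp

variable {L : Fin d → ℝ}

theorem tensor_ae (φ : ∀ j, CircleL2 (L j)) :
    tensor φ =ᵐ[volume.restrict (cell L)] fun q => ∏ j, φ j (q j) :=
  (memLp_prod fun j => Lp.memLp (φ j)).coeFn_toLp

theorem tensor_ae_of_ae {φ : ∀ j, CircleL2 (L j)} {f : Fin d → ℝ → ℂ}
    (h : ∀ j, φ j =ᵐ[circleMeasure (L j)] f j) :
    tensor φ =ᵐ[volume.restrict (cell L)] fun q => ∏ j, f j (q j) := by
  have h1 : ∀ᵐ q ∂(volume.restrict (cell L)), ∀ j, φ j (q j) = f j (q j) :=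
    ae_all_iff.2 fun j => (quasiMeasurePreserving_eval_cell L j).ae (h j)
  filter_upwards [tensor_ae φ, h1] with q hq hq1
  rw [hq]
  exact Finset.prod_congr rfl fun j _ => hq1 j

theorem inner_tensor (φ χ : ∀ j, CircleL2 (L j)) :
    ⟪tensor φ, tensor χ⟫_ℂ = ∏ j, ⟪φ j, χ j⟫_ℂ := by
  simp only [inner_eq_integral]
  rw [← integral_cell_prod]
  refine integral_congr_ae ?_
  filter_upwards [tensor_ae φ, tensor_ae χ] with q h1 h2
  rw [h1, h2, map_prod, Finset.prod_mul_distrib]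

theorem norm_tensor (φ : ∀ j, CircleL2 (L j)) : ‖tensor φ‖ = ∏ j, ‖φ j‖ := by
  have h := inner_tensor φ φ
  simp only [inner_self_eq_norm_sq_to_K] at h
  have h2 : ‖tensor φ‖ ^ 2 = (∏ j, ‖φ j‖) ^ 2 := by
    rw [← Finset.prod_pow]
    exact Complex.ofReal_injective (by simpa using h)
  exact (pow_left_inj₀ (norm_nonneg _) (Finset.prod_nonneg fun j _ => norm_nonneg _)
    two_ne_zero).1 h2

theorem tensor_update_add (φ : ∀ j, CircleL2 (L j)) (j : Fin d) (x y : CircleL2 (L j)) :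
    tensor (Function.update φ j (x + y)) =
      tensor (Function.update φ j x) + tensor (Function.update φ j y) := by
  refine Lp.ext ?_
  filter_upwards [tensor_ae (Function.update φ j (x + y)), tensor_ae (Function.update φ j x),
    tensor_ae (Function.update φ j y), Lp.coeFn_add (tensor (Function.update φ j x))
      (tensor (Function.update φ j y)),
    (quasiMeasurePreserving_eval_cell L j).ae (Lp.coeFn_add x y)] with q h1 h2 h3 h4 h5
  rw [h4, Pi.add_apply, h1, h2, h3, ← Finset.mul_prod_erase _ _ (Finset.mem_univ j),
    ← Finset.mul_prod_erase _ _ (Finset.mem_univ j), ← Finset.mul_prod_erase _ _ (Finset.mem_univ j)]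
  simp only [Function.update_self]
  rw [h5, Pi.add_apply, add_mul]
  congr 2 <;>
  · refine Finset.prod_congr rfl fun i hi => ?_
    simp only [Function.update_of_ne (Finset.ne_of_mem_erase hi)]

theorem tensor_update_smul (φ : ∀ j, CircleL2 (L j)) (j : Fin d) (c : ℂ) (x : CircleL2 (L j)) :
    tensor (Function.update φ j (c • x)) = c • tensor (Function.update φ j x) := by
  refine Lp.ext ?_
  filter_upwards [tensor_ae (Function.update φ j (c • x)), tensor_ae (Function.update φ j x),
    Lp.coeFn_smul c (tensor (Function.update φ j x)),
    (quasiMeasurePreserving_eval_cell L j).ae (Lp.coeFn_smul c x)] with q h1 h2 h3 h4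
  rw [h3, Pi.smul_apply, h1, h2, ← Finset.mul_prod_erase _ _ (Finset.mem_univ j),
    ← Finset.mul_prod_erase _ _ (Finset.mem_univ j)]
  simp only [Function.update_self]
  rw [h4, Pi.smul_apply, smul_eq_mul, smul_eq_mul, mul_assoc]
  congr 2
  refine Finset.prod_congr rfl fun i hi => ?_
  simp only [Function.update_of_ne (Finset.ne_of_mem_erase hi)]

/-- The tensor product as a function of the `j`-th factor. -/
def tensorSlot (φ : ∀ j, CircleL2 (L j)) (j : Fin d) : CircleL2 (L j) →L[ℂ] TorusL2 L :=
  LinearMap.mkContinuous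
    { toFun := fun x => tensor (Function.update φ j x)
      map_add' := tensor_update_add φ j
      map_smul' := tensor_update_smul φ j }
    (∏ i ∈ Finset.univ.erase j, ‖φ i‖) fun x => le_of_eq <| by
      simp only [LinearMap.coe_mk, AddHom.coe_mk]
      rw [norm_tensor, ← Finset.mul_prod_erase _ _ (Finset.mem_univ j), mul_comm]
      simp only [Function.update_self]
      congr 1
      refine Finset.prod_congr rfl fun i hi => ?_
      simp only [Function.update_of_ne (Finset.ne_of_mem_erase hi)]

theorem tensorSlot_apply (φ : ∀ j, CircleL2 (L j)) (j : Fin d) (x : CircleL2 (L j)) :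
    tensorSlot φ j x = tensor (Function.update φ j x) := rfl

/-- Induction on the set of slots that are allowed to hold arbitrary vectors: releasing one more
slot is the expansion of its entry in the basis, by continuity of the tensor product in that slot.
-/
theorem tensor_orthogonal_of_basis {κ : Type*} (b : ∀ j, HilbertBasis κ ℂ (CircleL2 (L j)))
    {ψ : TorusL2 L} (h : ∀ n : Fin d → κ, ⟪ψ, tensor fun j => b j (n j)⟫_ℂ = 0)
    (φ : ∀ j, CircleL2 (L j)) : ⟪ψ, tensor φ⟫_ℂ = 0 := by
  have key : ∀ s : Finset (Fin d), ∀ φ : ∀ j, CircleL2 (L j),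
      (∀ j ∉ s, ∃ n, φ j = b j n) → ⟪ψ, tensor φ⟫_ℂ = 0 := by
    intro s
    induction s using Finset.induction_on with
    | empty =>
      intro φ hφ
      choose n hn using fun j => hφ j (Finset.notMem_empty j)
      rw [funext hn]
      exact h n
    | insert j s hj ih =>
      intro φ hφ
      let T : CircleL2 (L j) →L[ℂ] ℂ := (innerSL ℂ ψ) ∘L tensorSlot φ j
      have hT : ∀ n, T (b j n) = 0 := fun n => ih _ fun i hi => by
        by_cases hij : i = j
        · subst hij; exact ⟨n, Function.update_self ..⟩
        · rw [Function.update_of_ne hij]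
          exact hφ i (by simp [hij, hi])
      have h1 : HasSum (fun n => T ((b j).repr (φ j) n • b j n)) (T (φ j)) :=
        ((b j).hasSum_repr (φ j)).mapL T
      simp only [map_smul, hT, smul_zero] at h1
      have h2 := h1.unique hasSum_zero
      simpa [T, tensorSlot_apply] using h2
  exact key Finset.univ φ fun j hj => absurd (Finset.mem_univ j) hj

/-- Tensor products of indicator functions show that the integral of `ψ` over every box vanishes.
Boxes form a generating π-system, so all its set integrals vanish. -/
theorem eq_zero_of_tensor_orthogonal {ψ : TorusL2 L}
    (h : ∀ φ : ∀ j, CircleL2 (L j), ⟪ψ, tensor φ⟫_ℂ = 0) : ψ = 0 := by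
  set μ := Measure.pi fun j => circleMeasure (L j)
  have hmp := measurePreserving_toLp_cell L
  have hemb := (MeasurableEquiv.toLp 2 (Fin d → ℝ)).measurableEmbedding
  have hfin : IsFiniteMeasure (volume.restrict (cell L)) := by
    rw [← hmp.map_eq]; infer_instance
  have hψ : Integrable ψ (volume.restrict (cell L)) := (Lp.memLp ψ).integrable one_le_two
  set g : (Fin d → ℝ) → ℂ := fun x => ψ (WithLp.toLp 2 x)
  have hg : Integrable g μ := (hmp.integrable_comp_emb hemb).2 hψ
  have hrect : ∀ t : Fin d → Set ℝ, (∀ j, MeasurableSet (t j)) →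
      ∫ x in Set.univ.pi t, g x ∂μ = 0 := fun t ht => by
    have hmem : ∀ j, MemLp ((t j).indicator fun _ => (1 : ℂ)) 2 (circleMeasure (L j)) := fun j =>
      memLp_indicator_const 2 (ht j) 1 (Or.inr (measure_ne_top _ _))
    have h1 := h fun j => (hmem j).toLp
    rw [← inner_conj_symm, map_eq_zero, inner_eq_integral] at h1
    have h2 := tensor_ae_of_ae (L := L) fun j => (hmem j).coeFn_toLp
    have h3 : ∫ q in cell L, conj (∏ j, (t j).indicator (fun _ => (1 : ℂ)) (q j)) * ψ q = 0 := by
      rw [← h1]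
      refine integral_congr_ae ?_
      filter_upwards [h2] with q hq
      rw [hq]
    rw [integral_cell] at h3
    rw [← h3, ← integral_indicator (MeasurableSet.univ_pi ht)]
    refine integral_congr_ae (Eventually.of_forall fun x => ?_)
    by_cases hx : x ∈ Set.univ.pi t
    · have : ∀ j, x j ∈ t j := fun j => hx j trivial
      simp [hx, this, g]
    · obtain ⟨j, hj⟩ : ∃ j, x j ∉ t j := by simpa using hx
      have h4 : ∏ j, (t j).indicator (fun _ => (1 : ℂ)) (x j) = 0 :=
        Finset.prod_eq_zero (Finset.mem_univ j) (Set.indicator_of_notMem hj _)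
      rw [Set.indicator_of_notMem hx]
      change 0 = conj (∏ j, (t j).indicator (fun _ => (1 : ℂ)) (x j)) * _
      rw [h4, map_zero, zero_mul]
  have hall : ∀ s, MeasurableSet s → ∫ x in s, g x ∂μ = 0 := by
    have huniv : ∫ x, g x ∂μ = 0 := by
      have := hrect (fun _ => Set.univ) fun _ => MeasurableSet.univ
      simpa using this
    refine MeasurableSpace.induction_on_inter (C := fun s _ => ∫ x in s, g x ∂μ = 0)
      generateFrom_pi.symm isPiSystem_pi (by simp) ?_ ?_ ?_
    · rintro _ ⟨t, ht, rfl⟩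
      exact hrect t fun j => ht j trivial
    · intro t ht ih
      rw [setIntegral_compl ht hg, ih, huniv, sub_zero]
    · intro f hd hm ih
      rw [integral_iUnion hm hd hg.integrableOn]
      simp [ih]
  have h0 : g =ᵐ[μ] 0 := hg.ae_eq_zero_of_forall_setIntegral_eq_zero fun s hs _ => hall s hs
  refine (Lp.eq_zero_iff_ae_eq_zero).2 ?_
  have h4 := (hmp.symm (MeasurableEquiv.toLp 2 (Fin d → ℝ))).quasiMeasurePreserving.ae h0
  exact h4

/-- The tensor products of orthonormal bases form an orthonormal basis. -/
def tensorBasis {κ : Type*} (b : ∀ j, HilbertBasis κ ℂ (CircleL2 (L j))) :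
    HilbertBasis (Fin d → κ) ℂ (TorusL2 L) :=
  HilbertBasis.mkOfOrthogonalEqBot (v := fun n => tensor fun j => b j (n j))
    (by
      classical
      rw [orthonormal_iff_ite]
      intro m n
      simp only [inner_tensor, orthonormal_iff_ite.1 (b _).orthonormal, Finset.prod_ite_zero,
        Finset.prod_const_one, Finset.mem_univ, true_implies, funext_iff])
    ((Submodule.eq_bot_iff _).2 fun ψ hψ => eq_zero_of_tensor_orthogonal <|
      tensor_orthogonal_of_basis b fun n => by
        rw [← inner_conj_symm, Submodule.inner_right_of_mem_orthogonal
          (Submodule.subset_span (Set.mem_range_self n)) hψ, map_zero])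

theorem tensorBasis_apply {κ : Type*} (b : ∀ j, HilbertBasis κ ℂ (CircleL2 (L j)))
    (n : Fin d → κ) : tensorBasis b n = tensor fun j => b j (n j) := by
  rw [tensorBasis, HilbertBasis.coe_mkOfOrthogonalEqBot]

end Tensor

/-! ### Partial integration for periodic functions -/

section PartialIntegration

theorem integrable_conj_mul {α : Type*} [MeasurableSpace α] {μ : Measure α} (f g : Lp ℂ 2 μ) :
    Integrable (fun q => conj (f q) * g q) μ := by
  have := L2.integrable_inner (𝕜 := ℂ) f g
  simpa only [RCLike.inner_apply'] using this

theorem isCompact_closedCell (L : Fin d → ℝ) :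
    IsCompact (WithLp.toLp 2 '' (Set.univ.pi fun j => Set.Icc 0 (L j)) : Set (Space d)) :=
  (isCompact_univ_pi fun _ => isCompact_Icc).image (PiLp.continuous_toLp 2 _)

theorem cell_subset_closedCell (L : Fin d → ℝ) :
    cell L ⊆ WithLp.toLp 2 '' (Set.univ.pi fun j => Set.Icc 0 (L j)) := fun q hq =>
  ⟨q.ofLp, fun j _ => Set.Ico_subset_Icc_self (hq j), rfl⟩

theorem measurableSet_cell (L : Fin d → ℝ) : MeasurableSet (cell L) := by
  have : cell L = ⋂ j, (fun q : Space d => q j) ⁻¹' Set.Ico 0 (L j) := by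
    ext q; simp [cell]
  rw [this]
  exact MeasurableSet.iInter fun j => (by fun_prop : Measurable fun q : Space d => q j)
    measurableSet_Ico

instance isFiniteMeasure_cell (L : Fin d → ℝ) : IsFiniteMeasure (volume.restrict (cell L)) := by
  rw [← (measurePreserving_toLp_cell L).map_eq]; infer_instance

theorem memLp_cell_of_continuous (L : Fin d → ℝ) {f : Space d → ℂ} (hf : Continuous f)
    (p : ENNReal) : MemLp f p (volume.restrict (cell L)) := by
  obtain ⟨C, hC⟩ := (isCompact_closedCell L).exists_bound_of_continuousOn hf.continuousOn
  refine MemLp.of_bound hf.aestronglyMeasurable C ?_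
  filter_upwards [ae_restrict_mem (measurableSet_cell L)] with q hq
  exact hC q (cell_subset_closedCell L hq)

theorem integrable_cell_of_continuous (L : Fin d → ℝ) {f : Space d → ℂ} (hf : Continuous f) :
    Integrable f (volume.restrict (cell L)) :=
  memLp_one_iff_integrable.1 (memLp_cell_of_continuous L hf 1)

/-- By Fubini the `j`-th coordinate may be integrated first. On a line in this direction the
integral is the difference of the values of `F` at two points one period apart. -/
theorem integral_cell_fderiv {L : Fin d → ℝ} (hL : ∀ j, 0 < L j) {F : Space d → ℂ}
    (hF : ContDiff ℝ 1 F) (hper : IsLatticePeriodic L F) (j : Fin d) :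
    ∫ q in cell L, fderiv ℝ F q (EuclideanSpace.single j 1) = 0 := by
  have hcont : Continuous fun q => fderiv ℝ F q (EuclideanSpace.single j 1) :=
    (hF.continuous_fderiv one_ne_zero).clm_apply continuous_const
  have hint := integrable_cell_of_continuous L hcont
  rw [integral_cell]
  rw [← (measurePreserving_toLp_cell L).integrable_comp_emb
    (MeasurableEquiv.toLp 2 (Fin d → ℝ)).measurableEmbedding] at hint
  obtain _ | n := d
  · exact j.elim0
  set e := (MeasurableEquiv.piFinSuccAbove (fun _ : Fin (n + 1) => ℝ) j).symm
  have hmp := (measurePreserving_piFinSuccAbove (fun j => circleMeasure (L j)) j).symm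
  rw [← hmp.integrable_comp_emb e.measurableEmbedding] at hint
  rw [← hmp.integral_comp e.measurableEmbedding]
  refine (integral_prod_symm _ hint).trans (integral_eq_zero_of_ae (Eventually.of_forall fun y => ?_))
  simp only [Function.comp_apply]
  set base : Space (n + 1) := WithLp.toLp 2 (j.insertNth (0 : ℝ) y)
  have hline : ∀ x : ℝ, WithLp.toLp 2 (e (x, y)) =
      base + x • (EuclideanSpace.single j (1 : ℝ) : Space (n + 1)) := by
    intro x
    ext i
    refine Fin.succAboveCases j ?_ (fun i => ?_) i
    · simp [base, e]
    · simp [base, e]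
  have hder : ∀ x : ℝ, HasDerivAt (fun x => F (WithLp.toLp 2 (e (x, y))))
      (fderiv ℝ F (WithLp.toLp 2 (e (x, y))) (EuclideanSpace.single j 1)) x := by
    intro x
    simp only [hline]
    have h1 : HasDerivAt (fun x : ℝ => base + x • (EuclideanSpace.single j (1 : ℝ) : Space (n + 1)))
        (EuclideanSpace.single j (1 : ℝ)) x := by
      simpa using ((hasDerivAt_id x).smul_const
        (EuclideanSpace.single j (1 : ℝ) : Space (n + 1))).const_add base
    exact ((hF.differentiable one_ne_zero _).hasFDerivAt).comp_hasDerivAt x h1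
  have hc : Continuous fun x : ℝ =>
      fderiv ℝ F (WithLp.toLp 2 (e (x, y))) (EuclideanSpace.single j 1) := by
    simp only [hline]
    exact hcont.comp (by fun_prop)
  simp only [Pi.zero_apply]
  rw [intervalIntegral_eq_circle (hL j)]
  rw [intervalIntegral.integral_eq_sub_of_hasDerivAt (fun x _ => hder x)
    (hc.intervalIntegrable _ _), sub_eq_zero, hline, hline, zero_smul, add_zero, ← hper j base]
  congr 2
  ext i
  simp

variable {L : Fin d → ℝ}

theorem IsLatticePeriodic.fderiv {φ : Space d → ℂ} (h : IsLatticePeriodic L φ) (v : Space d) :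
    IsLatticePeriodic L fun q => fderiv ℝ φ q v := fun j q => by
  have h1 : (fun q => φ (q + EuclideanSpace.single j (L j))) = φ := funext (h j)
  have h2 := fderiv_comp_add_right (𝕜 := ℝ) (f := φ) (x := q) (EuclideanSpace.single j (L j))
  rw [h1] at h2
  simp only [h2]

theorem IsLatticePeriodic.blochMomentum {φ : Space d → ℂ} (h : IsLatticePeriodic L φ)
    (hbar : ℝ) (k : Space d) (j : Fin d) : IsLatticePeriodic L (blochMomentum hbar k j φ) :=
  fun i q => by
    have h1 := h.fderiv (EuclideanSpace.single j 1) i q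
    simp only at h1
    simp only [PeriodicMotion.blochMomentum, h i q, h1]

theorem contDiff_blochMomentum {φ : Space d → ℂ} (h : ContDiff ℝ ∞ φ) (hbar : ℝ) (k : Space d)
    (j : Fin d) : ContDiff ℝ ∞ (blochMomentum hbar k j φ) := by
  unfold blochMomentum
  have h1 : ContDiff ℝ ∞ fun q => fderiv ℝ φ q (EuclideanSpace.single j 1) :=
    (h.fderiv_right (m := ∞) (by simp)).clm_apply contDiff_const
  exact (contDiff_const.mul h1).add (contDiff_const.mul h)

/-- The integrands differ by `iħ` times a partial derivative of the periodic function `conj φ * χ`;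
the real shift `ħ k j` drops out. -/
theorem integral_conj_blochMomentum (hL : ∀ j, 0 < L j) {φ χ : Space d → ℂ}
    (hφ : ContDiff ℝ ∞ φ) (hχ : ContDiff ℝ ∞ χ) (hφp : IsLatticePeriodic L φ)
    (hχp : IsLatticePeriodic L χ) (hbar : ℝ) (k : Space d) (j : Fin d) :
    ∫ q in cell L, conj (blochMomentum hbar k j φ q) * χ q =
      ∫ q in cell L, conj (φ q) * blochMomentum hbar k j χ q := by
  have hc : ContDiff ℝ ∞ fun q => conj (φ q) := Complex.conjCLE.contDiff.comp hφ
  have hF : ContDiff ℝ 1 fun q => conj (φ q) * χ q := (hc.mul hχ).of_le (by simp)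
  have hFp : IsLatticePeriodic L fun q => conj (φ q) * χ q := fun i q => by
    simp only [hφp i q, hχp i q]
  have h0 := integral_cell_fderiv hL hF hFp j
  have hd1 : ∀ q, HasFDerivAt (fun q => conj (φ q)) (Complex.conjCLE.toContinuousLinearMap.comp
      (fderiv ℝ φ q)) q := fun q =>
    Complex.conjCLE.hasFDerivAt.comp q (hφ.differentiable (by simp) q).hasFDerivAt
  have hd : ∀ q, fderiv ℝ (fun q => conj (φ q) * χ q) q (EuclideanSpace.single j 1) =
      conj (fderiv ℝ φ q (EuclideanSpace.single j 1)) * χ q +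
        conj (φ q) * fderiv ℝ χ q (EuclideanSpace.single j 1) := fun q => by
    have h : fderiv ℝ (fun q => conj (φ q) * χ q) q = _ :=
      ((hd1 q).mul (hχ.differentiable (by simp) q).hasFDerivAt).fderiv
    rw [h]
    simp
    ring
  have hi1 : Integrable (fun q => conj (blochMomentum hbar k j φ q) * χ q)
      (volume.restrict (cell L)) := integrable_cell_of_continuous L
    ((Complex.continuous_conj.comp (contDiff_blochMomentum hφ hbar k j).continuous).mul
      hχ.continuous)
  have hi2 : Integrable (fun q => conj (φ q) * blochMomentum hbar k j χ q)
      (volume.restrict (cell L)) := integrable_cell_of_continuous L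
    (hc.continuous.mul (contDiff_blochMomentum hχ hbar k j).continuous)
  rw [← sub_eq_zero, ← integral_sub hi1 hi2]
  have h1 : ∀ q, conj (blochMomentum hbar k j φ q) * χ q - conj (φ q) * blochMomentum hbar k j χ q
      = Complex.I * hbar *
        fderiv ℝ (fun q => conj (φ q) * χ q) q (EuclideanSpace.single j 1) := fun q => by
    rw [hd]
    simp only [blochMomentum, map_add, map_mul, map_neg, Complex.conj_I, Complex.conj_ofReal]
    ring
  simp_rw [h1]
  rw [integral_const_mul, h0, mul_zero]

end PartialIntegration

/-! ### The Bloch operator in the Fourier basis -/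

section TorusBasis

open InnerProductSpace

/-- The dual lattice vector with index `n`. -/
def dualVector (L : Fin d → ℝ) (n : Fin d → ℤ) : Space d :=
  WithLp.toLp 2 fun j => 2 * Real.pi * n j / L j

/-- The normalized exponentials on the torus. -/
def torusFun (L : Fin d → ℝ) (n : Fin d → ℤ) (q : Space d) : ℂ :=
  ∏ j, circleFun (L j) (n j) (q j)

theorem contDiff_torusFun (L : Fin d → ℝ) (n : Fin d → ℤ) {r : WithTop ℕ∞} :
    ContDiff ℝ r (torusFun L n) := by
  unfold torusFun
  exact contDiff_prod fun j _ => (contDiff_circleFun _ _).comp (by fun_prop)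

theorem isLatticePeriodic_torusFun {L : Fin d → ℝ} (hL : ∀ j, 0 < L j) (n : Fin d → ℤ) :
    IsLatticePeriodic L (torusFun L n) := fun j q => by
  refine Finset.prod_congr rfl fun i _ => ?_
  by_cases h : i = j
  · subst h
    simpa using circleFun_add_period (hL i) (n i) (q i)
  · simp [h]

theorem blochMomentum_torusFun (L : Fin d → ℝ) (n : Fin d → ℤ) (hbar : ℝ) (k : Space d)
    (j : Fin d) (q : Space d) : blochMomentum hbar k j (torusFun L n) q =
      (((hbar • (dualVector L n + k)) j : ℝ) : ℂ) * torusFun L n q := by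
  have h1 : HasDerivAt (fun t : ℝ => torusFun L n (q + t • (EuclideanSpace.single j 1 : Space d)))
      (fderiv ℝ (torusFun L n) q (EuclideanSpace.single j 1)) 0 := by
    have h2 := ((contDiff_torusFun L n (r := 1)).differentiable one_ne_zero q).hasFDerivAt
    refine h2.comp_hasDerivAt_of_eq (0 : ℝ) ?_ (by simp)
    simpa using ((hasDerivAt_id (0 : ℝ)).smul_const
      (EuclideanSpace.single j 1 : Space d)).const_add q
  have h3 : HasDerivAt (fun t : ℝ => torusFun L n (q + t • (EuclideanSpace.single j 1 : Space d)))
      (((2 * Real.pi * n j / L j : ℝ) : ℂ) * Complex.I * torusFun L n q) 0 := by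
    have h4 : ∀ t : ℝ, torusFun L n (q + t • (EuclideanSpace.single j 1 : Space d)) =
        circleFun (L j) (n j) (q j + t) *
          ∏ i ∈ Finset.univ.erase j, circleFun (L i) (n i) (q i) := fun t => by
      rw [torusFun, ← Finset.mul_prod_erase _ _ (Finset.mem_univ j)]
      congr 1
      · simp
      · refine Finset.prod_congr rfl fun i hi => ?_
        simp [Finset.ne_of_mem_erase hi]
    simp_rw [h4]
    have h5 : HasDerivAt (fun t : ℝ => circleFun (L j) (n j) (q j + t))
        (((2 * Real.pi * n j / L j : ℝ) : ℂ) * Complex.I * circleFun (L j) (n j) (q j)) 0 := by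
      have h6 := hasDerivAt_circleFun (L j) (n j) (q j + 0)
      rw [add_zero] at h6
      have := HasDerivAt.comp_const_add (f := circleFun (L j) (n j)) (q j) 0 (by rwa [add_zero])
      exact this
    refine (h5.mul_const _).congr_deriv ?_
    rw [torusFun, ← Finset.mul_prod_erase _ _ (Finset.mem_univ j)]
    ring
  rw [blochMomentum, h1.unique h3]
  simp only [dualVector, PiLp.smul_apply, PiLp.add_apply, smul_eq_mul]
  push_cast
  linear_combination (-(hbar : ℂ) * (2 * Real.pi * n j / L j) * torusFun L n q) * Complex.I_mul_I

theorem blochMomentum_blochMomentum_torusFun (L : Fin d → ℝ) (n : Fin d → ℤ) (hbar : ℝ)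
    (k : Space d) (j : Fin d) (q : Space d) :
    blochMomentum hbar k j (blochMomentum hbar k j (torusFun L n)) q =
        (((hbar • (dualVector L n + k)) j : ℝ) : ℂ) ^ 2 * torusFun L n q := by
  have h3 : blochMomentum hbar k j (torusFun L n) = fun q =>
      (((hbar • (dualVector L n + k)) j : ℝ) : ℂ) * torusFun L n q :=
    funext fun q => blochMomentum_torusFun L n hbar k j q
  have h4 : blochMomentum hbar k j (fun q =>
      (((hbar • (dualVector L n + k)) j : ℝ) : ℂ) * torusFun L n q) q =
      (((hbar • (dualVector L n + k)) j : ℝ) : ℂ) * blochMomentum hbar k j (torusFun L n) q := by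
    simp only [blochMomentum]
    rw [fderiv_const_mul ((contDiff_torusFun L n (r := 1)).differentiable one_ne_zero q)]
    simp only [smul_apply, smul_eq_mul]
    ring
  rw [h3, h4, blochMomentum_torusFun]
  ring

variable {L : Fin d → ℝ}

/-- The Fourier basis of `L²(𝕋)`. -/
def torusBasis (hL : ∀ j, 0 < L j) : HilbertBasis (Fin d → ℤ) ℂ (TorusL2 L) :=
  tensorBasis fun j => circleBasis (hL j)

theorem torusBasis_ae (hL : ∀ j, 0 < L j) (n : Fin d → ℤ) :
    torusBasis hL n =ᵐ[volume.restrict (cell L)] torusFun L n := by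
  rw [torusBasis, tensorBasis_apply]
  exact tensor_ae_of_ae fun j => circleBasis_ae (hL j) (n j)

theorem integral_conj_kinetic (hL : ∀ j, 0 < L j) {φ : Space d → ℂ} (hφ : ContDiff ℝ ∞ φ)
    (hφp : IsLatticePeriodic L φ) (hbar : ℝ) (k : Space d) (n : Fin d → ℤ) :
    ∫ q in cell L, conj ((1 / 2 : ℂ) *
        ∑ j, blochMomentum hbar k j (blochMomentum hbar k j φ) q) * torusFun L n q =
      (kinetic hbar (dualVector L) k n : ℂ) * ∫ q in cell L, conj (φ q) * torusFun L n q := by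
  have hs := contDiff_torusFun L n (r := ∞)
  have hsp := isLatticePeriodic_torusFun hL n
  have h1 : ∀ j, ∫ q in cell L,
      conj (blochMomentum hbar k j (blochMomentum hbar k j φ) q) * torusFun L n q =
      (((hbar • (dualVector L n + k)) j : ℝ) : ℂ) ^ 2 *
        ∫ q in cell L, conj (φ q) * torusFun L n q := fun j => by
    rw [integral_conj_blochMomentum hL (contDiff_blochMomentum hφ hbar k j) hs
      (hφp.blochMomentum hbar k j) hsp,
      integral_conj_blochMomentum hL hφ (contDiff_blochMomentum hs hbar k j) hφp
      (hsp.blochMomentum hbar k j)]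
    simp_rw [blochMomentum_blochMomentum_torusFun, mul_left_comm (conj _)]
    rw [integral_const_mul]
  have h5 : ∀ q, conj ((1 / 2 : ℂ) *
        ∑ j, blochMomentum hbar k j (blochMomentum hbar k j φ) q) * torusFun L n q =
      (1 / 2 : ℂ) * ∑ j, conj (blochMomentum hbar k j (blochMomentum hbar k j φ) q) *
        torusFun L n q := fun q => by
    rw [← Finset.sum_mul, ← mul_assoc, map_mul, map_sum, map_div₀, map_one, map_ofNat]
  simp_rw [h5]
  rw [integral_const_mul, integral_finsetSum]
  · simp only [h1, ← Finset.sum_mul, ← mul_assoc]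
    congr 1
    rw [kinetic, EuclideanSpace.norm_sq_eq]
    simp only [Real.norm_eq_abs, sq_abs]
    push_cast
    ring
  · intro j _
    exact integrable_cell_of_continuous L ((Complex.continuous_conj.comp (contDiff_blochMomentum
      (contDiff_blochMomentum hφ hbar k j) hbar k j).continuous).mul hs.continuous)

variable {V : Space d → ℝ} {M : ℝ}

/-- Translates the distributional definition into Fourier coefficients. One direction tests with
plane waves, which diagonalize the kinetic part. For the other, a smooth periodic `φ` lies in the
domain with image `blochExpr`, and the symmetry of the operator moves it onto `ψ`. -/
theorem isBlochImage_iff (hL : ∀ j, 0 < L j) (hV : Continuous V) (hM0 : 0 ≤ M)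
    (hM : ∀ q, |V q| ≤ M) (hbar : ℝ) (k : Space d) (ψ f : TorusL2 L) :
    IsBlochImage L V hbar k ψ f ↔ IsImage (torusBasis hL) (kinetic hbar (dualVector L) k)
      (mulOp (volume.restrict (cell L)) V) ψ f := by
  have hVm := hV.aestronglyMeasurable (μ := volume.restrict (cell L))
  constructor
  · intro h n
    have h1 := h (torusFun L n) (contDiff_torusFun L n) (isLatticePeriodic_torusFun hL n)
    have h2 : ∀ q, blochExpr V hbar k (torusFun L n) q =
        (kinetic hbar (dualVector L) k n + V q : ℂ) * torusFun L n q := fun q => by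
      simp only [blochExpr, blochMomentum_blochMomentum_torusFun]
      rw [← Finset.sum_mul, kinetic, EuclideanSpace.norm_sq_eq]
      simp only [Real.norm_eq_abs, sq_abs]
      push_cast
      ring
    rw [inner_eq_integral, inner_eq_integral, inner_eq_integral, ← integral_const_mul,
      ← integral_add ((integrable_conj_mul _ _).const_mul _) (integrable_conj_mul _ _)]
    trans ∫ q in cell L, conj (torusFun L n q) * f q
    · rw [← h1]
      refine integral_congr_ae ?_
      filter_upwards [torusBasis_ae hL n, mulOp_ae hVm hM0 hM ψ] with q h3 h4
      rw [h2, h3, h4, map_mul, map_add, Complex.conj_ofReal, Complex.conj_ofReal]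
      ring
    · refine integral_congr_ae ?_
      filter_upwards [torusBasis_ae hL n] with q h3
      rw [h3]
  · intro h φ hφ hφp
    have hc0 : Continuous fun q => (1 / 2 : ℂ) *
        ∑ j, blochMomentum hbar k j (blochMomentum hbar k j φ) q :=
      continuous_const.mul (continuous_finsetSum _ fun j _ => (contDiff_blochMomentum
        (contDiff_blochMomentum hφ hbar k j) hbar k j).continuous)
    have m0 := memLp_cell_of_continuous L hc0 2
    have m1 := memLp_cell_of_continuous L hφ.continuous 2
    have him : IsImage (torusBasis hL) (kinetic hbar (dualVector L) k)
        (mulOp (volume.restrict (cell L)) V) m1.toLp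
        (m0.toLp + mulOp (volume.restrict (cell L)) V m1.toLp) := fun n => by
      rw [inner_add_right]
      congr 1
      rw [← inner_conj_symm, ← inner_conj_symm (torusBasis hL n) m0.toLp, ← Complex.conj_ofReal,
        ← map_mul]
      congr 1
      rw [inner_eq_integral, inner_eq_integral]
      trans (kinetic hbar (dualVector L) k n : ℂ) * ∫ q in cell L, conj (φ q) * torusFun L n q
      · congr 1
        refine integral_congr_ae ?_
        filter_upwards [m1.coeFn_toLp, torusBasis_ae hL n] with q h1 h2
        rw [h1, h2]
      · rw [← integral_conj_kinetic hL hφ hφp]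
        refine integral_congr_ae ?_
        filter_upwards [m0.coeFn_toLp, torusBasis_ae hL n] with q h1 h2
        rw [h1, h2]
    have h2 := him.inner_eq (mulOp_symm hVm hM0 hM) h
    rw [inner_eq_integral, inner_eq_integral] at h2
    trans ∫ q in cell L, conj ((m0.toLp + mulOp (volume.restrict (cell L)) V m1.toLp :
        TorusL2 L) q) * ψ q
    · refine integral_congr_ae ?_
      filter_upwards [m0.coeFn_toLp, m1.coeFn_toLp, mulOp_ae hVm hM0 hM m1.toLp,
        Lp.coeFn_add m0.toLp (mulOp (volume.restrict (cell L)) V m1.toLp)] with q h3 h4 h5 h6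
      rw [h6, Pi.add_apply, h5, h4, h3, blochExpr]
    · rw [← h2]
      refine integral_congr_ae ?_
      filter_upwards [m1.coeFn_toLp] with q h3
      rw [h3]

end TorusBasis

/-! ### Product eigenfunctions and their momenta -/

section Separable

open InnerProductSpace

/-- The `m`-th dual lattice point of the circle of length `l`. -/
def circleDual (l : ℝ) (m : ℤ) : ℝ := 2 * Real.pi * m / l

variable {L : Fin d → ℝ}

theorem kinetic_dualVector (L : Fin d → ℝ) (hbar : ℝ) (k : Space d) (n : Fin d → ℤ) :
    kinetic hbar (dualVector L) k n = ∑ j, kinetic hbar (circleDual (L j)) (k j) (n j) := by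
  simp only [kinetic, EuclideanSpace.norm_sq_eq, Finset.sum_div]
  rfl

theorem inner_torusBasis_tensor (hL : ∀ j, 0 < L j) (n : Fin d → ℤ) (φ : ∀ j, CircleL2 (L j)) :
    ⟪torusBasis hL n, tensor φ⟫_ℂ = ∏ j, ⟪circleBasis (hL j) (n j), φ j⟫_ℂ := by
  rw [torusBasis, tensorBasis_apply, inner_tensor]

theorem inner_torusBasis_tensor_update (hL : ∀ j, 0 < L j) (n : Fin d → ℤ)
    (φ : ∀ j, CircleL2 (L j)) (j : Fin d) (f : CircleL2 (L j)) :
    ⟪torusBasis hL n, tensor (Function.update φ j f)⟫_ℂ = ⟪circleBasis (hL j) (n j), f⟫_ℂ *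
      ∏ i ∈ Finset.univ.erase j, ⟪circleBasis (hL i) (n i), φ i⟫_ℂ := by
  rw [inner_torusBasis_tensor, ← Finset.mul_prod_erase _ _ (Finset.mem_univ j)]
  simp only [Function.update_self]
  congr 1
  refine Finset.prod_congr rfl fun i hi => ?_
  simp only [Function.update_of_ne (Finset.ne_of_mem_erase hi)]

variable {V : Space d → ℝ} {W : Fin d → ℝ → ℝ} {M : ℝ}

theorem coeFn_finsetSum {α ι : Type*} [MeasurableSpace α] {μ : Measure α} (s : Finset ι)
    (f : ι → Lp ℂ 2 μ) : ∀ᵐ q ∂μ, (∑ i ∈ s, f i : Lp ℂ 2 μ) q = ∑ i ∈ s, f i q := by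
  classical
  induction s using Finset.induction_on with
  | empty =>
    filter_upwards [Lp.coeFn_zero ℂ 2 μ] with q h
    simpa using h
  | insert i s hi ih =>
    rw [Finset.sum_insert hi]
    filter_upwards [ih, Lp.coeFn_add (f i) (∑ i ∈ s, f i)] with q h1 h2
    rw [h2, Pi.add_apply, h1, Finset.sum_insert hi]

theorem mulOp_tensor (hV : Continuous V) (hW : ∀ j, Continuous (W j)) (hM0 : 0 ≤ M)
    (hVM : ∀ q, |V q| ≤ M) (hWM : ∀ j x, |W j x| ≤ M) (hsep : ∀ q : Space d, V q = ∑ j, W j (q j))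
    (φ : ∀ j, CircleL2 (L j)) :
    mulOp (volume.restrict (cell L)) V (tensor φ) =
      ∑ j, tensor (Function.update φ j (mulOp (circleMeasure (L j)) (W j) (φ j))) := by
  refine Lp.ext ?_
  have h1 : ∀ᵐ q ∂(volume.restrict (cell L)), ∀ j,
      mulOp (circleMeasure (L j)) (W j) (φ j) (q j) = (W j (q j) : ℂ) * φ j (q j) :=
    ae_all_iff.2 fun j => (quasiMeasurePreserving_eval_cell L j).ae
      (mulOp_ae (hW j).aestronglyMeasurable hM0 (hWM j) (φ j))
  have h2 : ∀ᵐ q ∂(volume.restrict (cell L)), ∀ j,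
      tensor (Function.update φ j (mulOp (circleMeasure (L j)) (W j) (φ j))) q =
        ∏ i, Function.update φ j (mulOp (circleMeasure (L j)) (W j) (φ j)) i (q i) :=
    ae_all_iff.2 fun j => tensor_ae _
  have h3 := coeFn_finsetSum (μ := volume.restrict (cell L)) Finset.univ
    fun j => tensor (Function.update φ j (mulOp (circleMeasure (L j)) (W j) (φ j)))
  filter_upwards [h1, h2, h3, mulOp_ae hV.aestronglyMeasurable hM0 hVM (tensor φ), tensor_ae φ]
    with q h1 h2 h3 h4 h5
  rw [h4, h5, h3, hsep]
  push_cast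
  rw [Finset.sum_mul]
  refine Finset.sum_congr rfl fun j _ => ?_
  rw [h2, ← Finset.mul_prod_erase _ _ (Finset.mem_univ j),
    ← Finset.mul_prod_erase _ _ (Finset.mem_univ j), ← mul_assoc]
  simp only [Function.update_self]
  rw [h1]
  congr 1
  refine Finset.prod_congr rfl fun i hi => ?_
  simp only [Function.update_of_ne (Finset.ne_of_mem_erase hi)]

/-- In each Fourier coefficient the kinetic energy and the potential are sums over the coordinates,
and the `j`-th summand involves only the eigenvalue equation of the `j`-th factor. -/
theorem isImage_tensor (hL : ∀ j, 0 < L j) (hV : Continuous V) (hW : ∀ j, Continuous (W j))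
    (hM0 : 0 ≤ M) (hVM : ∀ q, |V q| ≤ M) (hWM : ∀ j x, |W j x| ≤ M)
    (hsep : ∀ q : Space d, V q = ∑ j, W j (q j)) {hbar : ℝ} {k : Space d}
    {φ : ∀ j, CircleL2 (L j)} {E : Fin d → ℝ}
    (h : ∀ j, IsImage (circleBasis (hL j)) (kinetic hbar (circleDual (L j)) (k j))
      (mulOp (circleMeasure (L j)) (W j)) (φ j) ((E j : ℂ) • φ j)) :
    IsImage (torusBasis hL) (kinetic hbar (dualVector L) k)
      (mulOp (volume.restrict (cell L)) V) (tensor φ) (((∑ j, E j : ℝ) : ℂ) • tensor φ) := by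
  intro n
  rw [mulOp_tensor hV hW hM0 hVM hWM hsep, inner_sum, inner_smul_right, kinetic_dualVector]
  push_cast
  rw [Finset.sum_mul, Finset.sum_mul, ← Finset.sum_add_distrib]
  refine Finset.sum_congr rfl fun j _ => ?_
  have h1 := h j (n j)
  rw [inner_smul_right] at h1
  rw [inner_torusBasis_tensor_update, inner_torusBasis_tensor,
    ← Finset.mul_prod_erase _ _ (Finset.mem_univ j), ← mul_assoc, ← mul_assoc, ← add_mul, h1]

/-- Here `g` is the momentum operator applied to `ψ`, which is in `L²` because the kinetic energy is
finite. It turns the mean momentum into an inner product, and inner products factorize over tensors.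
-/
theorem IsImage.exists_momentum {H : Type*} [NormedAddCommGroup H] [InnerProductSpace ℂ H]
    {ι : Type*} {e : HilbertBasis ι ℂ H} {V : H →L[ℂ] H} {hbar : ℝ} {κ : ι → ℝ} {k : ℝ} {ψ f : H}
    (h : IsImage e (kinetic hbar κ k) V ψ f) :
    ∃ g, (∀ i, ⟪e i, g⟫_ℂ = ((hbar * (κ i + k) : ℝ) : ℂ) * ⟪e i, ψ⟫_ℂ) ∧
      ((meanMomentum e hbar κ k ψ : ℝ) : ℂ) = ⟪ψ, g⟫_ℂ := by
  obtain ⟨g, hg⟩ := exists_inner_eq e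
    (x := fun i => ((hbar * (κ i + k) : ℝ) : ℂ) * ⟪e i, ψ⟫_ℂ) (by
      refine (h.hasSum_kinetic.summable.mul_left 2).congr fun i => ?_
      rw [norm_mul, mul_pow, kinetic, Complex.norm_real, smul_eq_mul]
      ring)
  refine ⟨g, hg, ?_⟩
  have h1 := e.hasSum_inner_mul_inner ψ g
  have h2 := Complex.hasSum_ofReal.2 h.hasSum_momentum
  refine h2.unique (h1.congr_fun fun i => ?_)
  rw [hg, ← inner_conj_symm ψ (e i), mul_left_comm, ← Complex.normSq_eq_conj_mul_self,
    Complex.normSq_eq_norm_sq, smul_eq_mul, smul_eq_mul]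
  push_cast
  ring

/-- The `j`-th momentum component acts on the slot `j` alone; the other factors contribute their
squared norms, which are 1. -/
theorem meanMomentum_tensor (hL : ∀ j, 0 < L j) (hV : Continuous V) (hW : ∀ j, Continuous (W j))
    (hM0 : 0 ≤ M) (hVM : ∀ q, |V q| ≤ M) (hWM : ∀ j x, |W j x| ≤ M)
    (hsep : ∀ q : Space d, V q = ∑ j, W j (q j)) {hbar : ℝ} {k : Space d}
    {φ : ∀ j, CircleL2 (L j)} {E : Fin d → ℝ} (hφ : ∀ j, ‖φ j‖ = 1)
    (h : ∀ j, IsImage (circleBasis (hL j)) (kinetic hbar (circleDual (L j)) (k j))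
      (mulOp (circleMeasure (L j)) (W j)) (φ j) ((E j : ℂ) • φ j)) (j : Fin d) :
    meanMomentum (torusBasis hL) hbar (dualVector L) k (tensor φ) j =
      meanMomentum (circleBasis (hL j)) hbar (circleDual (L j)) (k j) (φ j) := by
  obtain ⟨g, hg, hg'⟩ := (h j).exists_momentum
  have him := isImage_tensor hL hV hW hM0 hVM hWM hsep h
  have h1 := Complex.hasSum_ofReal.2 (him.hasSum_momentum.mapL (EuclideanSpace.proj j : _ →L[ℝ] ℝ))
  have h2 := (torusBasis hL).hasSum_inner_mul_inner (tensor φ) (tensor (Function.update φ j g))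
  have h3 : ⟪tensor φ, tensor (Function.update φ j g)⟫_ℂ = ⟪φ j, g⟫_ℂ := by
    rw [inner_tensor, ← Finset.mul_prod_erase _ _ (Finset.mem_univ j)]
    simp only [Function.update_self]
    rw [Finset.prod_eq_one, mul_one]
    intro i hi
    rw [Function.update_of_ne (Finset.ne_of_mem_erase hi), inner_self_eq_norm_sq_to_K, hφ]
    simp
  rw [h3, ← hg'] at h2
  have h4 := h1.unique (h2.congr_fun fun n => ?_)
  · exact Complex.ofReal_injective h4
  · rw [inner_torusBasis_tensor_update, hg, mul_assoc,
      Finset.mul_prod_erase Finset.univ (fun i => ⟪circleBasis (hL i) (n i), φ i⟫_ℂ)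
        (Finset.mem_univ j), ← inner_torusBasis_tensor, ← inner_conj_symm (tensor φ), mul_left_comm,
      ← Complex.normSq_eq_conj_mul_self, Complex.normSq_eq_norm_sq]
    simp only [EuclideanSpace.coe_proj, PiLp.smul_apply, PiLp.add_apply, smul_eq_mul, dualVector,
      circleDual]
    push_cast
    ring

end Separable

/-! ### Identification of the band functions -/

section BandEnergy

open InnerProductSpace

/-- Reindexing of a Hilbert basis. -/
def reindexBasis {κ κ' H : Type*} [NormedAddCommGroup H] [InnerProductSpace ℂ H] [CompleteSpace H]
    (b : HilbertBasis κ ℂ H) (σ : κ' ≃ κ) : HilbertBasis κ' ℂ H :=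
  HilbertBasis.mkOfOrthogonalEqBot (v := b ∘ σ) (b.orthonormal.comp σ σ.injective) (by
    rw [σ.surjective.range_comp]
    refine (Submodule.eq_bot_iff _).2 fun x hx => hilbertBasis_ext b fun i => ?_
    rw [inner_zero_right]
    exact Submodule.inner_right_of_mem_orthogonal (Submodule.subset_span (Set.mem_range_self i)) hx)

theorem reindexBasis_apply {κ κ' H : Type*} [NormedAddCommGroup H] [InnerProductSpace ℂ H]
    [CompleteSpace H] (b : HilbertBasis κ ℂ H) (σ : κ' ≃ κ) (i : κ') :
    reindexBasis b σ i = b (σ i) := by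
  rw [reindexBasis, HilbertBasis.coe_mkOfOrthogonalEqBot, Function.comp_apply]

variable {L : Fin d → ℝ} {V : Space d → ℝ} {M : ℝ}

/-- Eigenvectors to different eigenvalues are orthogonal, so the spectral subspace up to `R` is
spanned by the finitely many `b m` with `E m ≤ R`, and its rank counts them. Monotonicity of `E`
turns the condition `rank ≥ n + 1` into `E n ≤ R`, since numbering starts at 0. -/
theorem bandEnergy_eq (hL : ∀ j, 0 < L j) (hV : Continuous V) (hM0 : 0 ≤ M)
    (hM : ∀ q, |V q| ≤ M) {hbar : ℝ} {k : Space d} {b : HilbertBasis ℕ ℂ (TorusL2 L)} {E : ℕ → ℝ}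
    (h : IsEigenbasis (torusBasis hL) (kinetic hbar (dualVector L) k)
      (mulOp (volume.restrict (cell L)) V) b E) (n : ℕ) : bandEnergy L V hbar n k = E n := by
  have hsymm := mulOp_symm (hV.aestronglyMeasurable (μ := volume.restrict (cell L))) hM0 hM
  have hspan : ∀ R, spectralSubspace L V hbar k R =
      Submodule.span ℂ (Set.range fun m : {m // E m ≤ R} => b m) := by
    intro R
    refine le_antisymm (Submodule.span_le.2 ?_) (Submodule.span_mono ?_)
    · rintro ψ ⟨E', hE', hψ⟩
      rw [isBlochImage_iff hL hV hM0 hM] at hψ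
      have h0 : ∀ m, ¬ E m ≤ R → ⟪b m, ψ⟫_ℂ = 0 := by
        intro m hm
        have h1 := (h.image m).inner_eq hsymm hψ
        rw [inner_smul_right, inner_smul_left, Complex.conj_ofReal] at h1
        have h2 : ((E' : ℂ) - E m) * ⟪b m, ψ⟫_ℂ = 0 := by rw [sub_mul, h1, sub_self]
        refine (mul_eq_zero.1 h2).resolve_left ?_
        have : E' ≠ E m := fun h => hm (h ▸ hE')
        exact_mod_cast sub_ne_zero.2 this
      have hfin : {m | E m ≤ R}.Finite := by
        have := h.tendsto.eventually (eventually_gt_atTop R)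
        rw [← Nat.cofinite_eq_atTop, eventually_cofinite] at this
        simpa using this
      have h1 : HasSum (fun m => b.repr ψ m • b m) (∑ m ∈ hfin.toFinset, b.repr ψ m • b m) :=
        hasSum_sum_of_ne_finset_zero fun m hm => by
          rw [b.repr_apply_apply, h0 m (by simpa using hm), zero_smul]
      rw [(b.hasSum_repr ψ).unique h1]
      exact Submodule.sum_mem _ fun m hm => Submodule.smul_mem _ _
        (Submodule.subset_span ⟨⟨m, by simpa using hm⟩, rfl⟩)
    · rintro _ ⟨⟨m, hm⟩, rfl⟩
      exact ⟨E m, hm, (isBlochImage_iff hL hV hM0 hM _ _ _ _).2 (h.image m)⟩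
  have hrank : ∀ R, Module.rank ℂ (spectralSubspace L V hbar k R) = Cardinal.mk {m // E m ≤ R} := by
    intro R
    rw [hspan]
    refine (rank_span (b.orthonormal.linearIndependent.comp (Subtype.val : {m // E m ≤ R} → ℕ)
      Subtype.val_injective)).trans ?_
    exact Cardinal.mk_range_eq _ (b.orthonormal.linearIndependent.injective.comp
      Subtype.val_injective)
  have hset : {R : ℝ | ((n + 1 : ℕ) : Cardinal) ≤ Module.rank ℂ (spectralSubspace L V hbar k R)} =
      Set.Ici (E n) := by
    ext R
    rw [Set.mem_ofPred_eq, hrank, Set.mem_Ici]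
    constructor
    · intro h1
      by_contra h2
      have h3 : {m | E m ≤ R} ⊆ Set.Iio n := fun m hm => by
        by_contra h4
        exact h2 ((h.monotone (not_lt.1 h4)).trans hm)
      have h4 := h1.trans (Cardinal.mk_le_mk_of_subset h3)
      rw [Cardinal.mk_fintype, Fintype.card_ofFinset (Finset.Iio n) (by simp), Nat.card_Iio,
        Nat.cast_le] at h4
      omega
    · intro h1
      have h3 : Set.Iio (n + 1) ⊆ {m | E m ≤ R} := fun m hm =>
        (h.monotone (Nat.lt_succ_iff.1 hm)).trans h1
      have h4 := Cardinal.mk_le_mk_of_subset h3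
      rwa [Cardinal.mk_fintype, Fintype.card_ofFinset (Finset.Iio (n + 1)) (by simp),
        Nat.card_Iio] at h4
  rw [bandEnergy, hset, csInf_Ici]

end BandEnergy

/-! ### Folding of integrals over the line -/

section FoldedSums

open ENNReal

/-- The translates of a period interval tile the line. This is the mechanism by which the Brillouin
zone together with the dual lattice becomes momentum space. -/
theorem tsum_setLIntegral_Ico_add {p : ℝ} (hp : 0 < p) (F : ℝ → ℝ≥0∞) :
    ∑' m : ℤ, ∫⁻ x in Set.Ico 0 p, F (x + m * p) = ∫⁻ x, F x := by
  rw [← setLIntegral_univ, ← iUnion_Ico_add_zsmul hp 0,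
    lintegral_iUnion (fun _ => measurableSet_Ico) (Set.pairwise_disjoint_Ico_add_zsmul 0 p)]
  refine tsum_congr fun m => ?_
  have h := (measurePreserving_add_right volume ((m : ℝ) * p)).setLIntegral_comp_preimage_emb
    (measurableEmbedding_addRight _) F (Set.Ico (0 + m • p) (0 + (m + 1) • p))
  rw [← h, Set.preimage_add_const_Ico]
  congr 3 <;> simp [add_mul]

theorem lintegral_comp_mul_left {h : ℝ} (hh : 0 < h) (F : ℝ → ℝ≥0∞) :
    ENNReal.ofReal h * ∫⁻ x, F (h * x) = ∫⁻ x, F x := by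
  have h1 := (Homeomorph.mulLeft₀ h hh.ne').measurableEmbedding.lintegral_map F (μ := volume)
  rw [Homeomorph.coe_mulLeft₀, Real.map_volume_mul_left hh.ne', lintegral_smul_measure,
    abs_inv, abs_of_pos hh, ENNReal.ofReal_inv_of_pos hh] at h1
  rw [← h1, smul_eq_mul, ← mul_assoc, ENNReal.mul_inv_cancel (by simpa using hh) (by simp), one_mul]

theorem lintegral_inv_one_add_sq :
    ∫⁻ x : ℝ, ENNReal.ofReal ((1 + x ^ 2)⁻¹) = ENNReal.ofReal Real.pi := by
  rw [← integral_univ_inv_one_add_sq, ofReal_integral_eq_lintegral_ofReal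
    integrable_inv_one_add_sq (Eventually.of_forall fun x => by positivity)]

/-- Equidistant sums of `1 / (1 + x²)` are bounded independently of the offset. -/
theorem tsum_inv_one_add_sq_le {h : ℝ} (hh : 0 < h) (a : ℝ) :
    ∑' m : ℤ, ENNReal.ofReal (h * (1 + (a + h * m) ^ 2)⁻¹) ≤
      ENNReal.ofReal ((2 + 2 * h ^ 2) * Real.pi) := by
  -- Each term is compared with an integral over an interval of length `h`, using `1 + (y + x)² ≤ (2
  -- + 2h²)(1 + y²)` for `|x| ≤ h`.
  have h1 : ∀ m : ℤ, ENNReal.ofReal (h * (1 + (a + h * m) ^ 2)⁻¹) ≤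
      ∫⁻ x in Set.Ico 0 h, ENNReal.ofReal ((2 + 2 * h ^ 2) * (1 + (a + (x + m * h)) ^ 2)⁻¹) := by
    intro m
    calc _ = ∫⁻ _ in Set.Ico 0 h, ENNReal.ofReal ((1 + (a + h * m) ^ 2)⁻¹) := by
          rw [setLIntegral_const, Real.volume_Ico, sub_zero, ENNReal.ofReal_mul hh.le, mul_comm]
      _ ≤ _ := by
          refine setLIntegral_mono' measurableSet_Ico fun x hx => ENNReal.ofReal_le_ofReal ?_
          rw [← div_eq_mul_inv, inv_eq_one_div, div_le_div_iff₀ (by positivity) (by positivity)]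
          have h2 : x ^ 2 ≤ h ^ 2 := pow_le_pow_left₀ hx.1 hx.2.le 2
          nlinarith [sq_nonneg (a + h * m - x), mul_nonneg (sq_nonneg h) (sq_nonneg (a + h * m))]
  refine (ENNReal.tsum_le_tsum h1).trans_eq ?_
  rw [tsum_setLIntegral_Ico_add hh fun x => ENNReal.ofReal ((2 + 2 * h ^ 2) * (1 + (a + x) ^ 2)⁻¹),
    lintegral_add_left_eq_self (fun x => ENNReal.ofReal ((2 + 2 * h ^ 2) * (1 + x ^ 2)⁻¹)) a]
  simp_rw [ENNReal.ofReal_mul (show (0 : ℝ) ≤ 2 + 2 * h ^ 2 by positivity)]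
  rw [lintegral_const_mul' _ _ ENNReal.ofReal_ne_top, lintegral_inv_one_add_sq]

end FoldedSums

/-! ### The Bloch operators on a circle -/

theorem kinetic_nonneg {F : Type*} [NormedAddCommGroup F] [InnerProductSpace ℝ F] {ι : Type*}
    (hbar : ℝ) (κ : ι → F) (k : F) (i : ι) : 0 ≤ kinetic hbar κ k i := by
  rw [kinetic]; positivity

theorem inv_kinetic_add_one_sq_le (hbar l k : ℝ) (m : ℤ) :
    ((kinetic hbar (circleDual l) k m + 1) ^ 2)⁻¹ ≤
      (1 + (hbar * k + hbar * (2 * Real.pi / l) * m) ^ 2)⁻¹ := by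
  have h : kinetic hbar (circleDual l) k m =
      (hbar * k + hbar * (2 * Real.pi / l) * m) ^ 2 / 2 := by
    rw [kinetic, circleDual, Real.norm_eq_abs, sq_abs, smul_eq_mul]
    ring
  rw [h]
  refine inv_anti₀ (by positivity) ?_
  nlinarith [sq_nonneg ((hbar * k + hbar * (2 * Real.pi / l) * m) ^ 2)]

theorem summable_inv_kinetic_add_one_sq {hbar l : ℝ} (hh : 0 < hbar) (hl : 0 < l) (k : ℝ) :
    Summable fun m : ℤ => ((kinetic hbar (circleDual l) k m + 1) ^ 2)⁻¹ := by
  have hp : 0 < hbar * (2 * Real.pi / l) := by positivity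
  have h := ENNReal.summable_toReal ((tsum_inv_one_add_sq_le hp (hbar * k)).trans_lt
    ENNReal.ofReal_lt_top).ne
  have h1 := h.mul_left (hbar * (2 * Real.pi / l))⁻¹
  refine h1.of_nonneg_of_le (fun m => by positivity) fun m => ?_
  rw [ENNReal.toReal_ofReal (by positivity), inv_mul_cancel_left₀ hp.ne']
  exact inv_kinetic_add_one_sq_le hbar l k m

/-- A periodic potential of class `C²` on the circle of length `l`. -/
structure CirclePotential (l : ℝ) where
  toFun : ℝ → ℝ
  bound : ℝ
  length_pos : 0 < l
  contDiff : ContDiff ℝ 2 toFun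
  periodic : Function.Periodic toFun l
  abs_le : ∀ q, |toFun q| ≤ bound

namespace CirclePotential

variable {l : ℝ} (W : CirclePotential l)

theorem bound_nonneg : 0 ≤ W.bound := (abs_nonneg _).trans (W.abs_le 0)

theorem continuous : Continuous W.toFun := W.contDiff.continuous

/-- The Fourier basis of the circle. -/
def fourier : HilbertBasis ℤ ℂ (CircleL2 l) := circleBasis W.length_pos

/-- Multiplication by the potential. -/
def op : CircleL2 l →L[ℂ] CircleL2 l := mulOp (circleMeasure l) W.toFun

theorem op_symm (f g : CircleL2 l) : inner ℂ (W.op f) g = inner ℂ f (W.op g) :=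
  mulOp_symm W.continuous.aestronglyMeasurable W.bound_nonneg W.abs_le f g

theorem norm_op_le : ‖W.op‖ ≤ W.bound :=
  norm_mulOp_le W.continuous.aestronglyMeasurable W.bound_nonneg W.abs_le

/-- Eigenbasis and eigenvalues of `½ (D + ℏk)² + W` on the circle. -/
def eigenpair (hbar k : ℝ) : HilbertBasis ℕ ℂ (CircleL2 l) × (ℕ → ℝ) :=
  @Classical.epsilon _ ⟨(reindexBasis W.fourier Equiv.intEquivNat.symm, 0)⟩
    fun p => IsEigenbasis W.fourier (kinetic hbar (circleDual l) k) W.op p.1 p.2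

/-- Eigenfunctions of `½ (D + ℏk)² + W`. -/
def state (hbar k : ℝ) : HilbertBasis ℕ ℂ (CircleL2 l) := (W.eigenpair hbar k).1

/-- Eigenvalues of `½ (D + ℏk)² + W` in ascending order. -/
def energy (hbar : ℝ) (n : ℕ) (k : ℝ) : ℝ := (W.eigenpair hbar k).2 n

/-- Group velocities. -/
def velocity (hbar : ℝ) (n : ℕ) (k : ℝ) : ℝ := hbar⁻¹ * deriv (W.energy hbar n) k

variable {hbar : ℝ}

theorem isEigenbasis (hh : 0 < hbar) (k : ℝ) :
    IsEigenbasis W.fourier (kinetic hbar (circleDual l) k) W.op (W.state hbar k)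
      (fun n => W.energy hbar n k) := by
  obtain ⟨b, E, h⟩ := exists_isEigenbasis W.op_symm (e := W.fourier)
    (fun i => kinetic_nonneg hbar (circleDual l) k i)
    (summable_inv_kinetic_add_one_sq hh W.length_pos k)
  exact @Classical.epsilon_spec _ (fun p : HilbertBasis ℕ ℂ (CircleL2 l) × (ℕ → ℝ) =>
    IsEigenbasis W.fourier (kinetic hbar (circleDual l) k) W.op p.1 p.2) ⟨(b, E), h⟩

theorem neg_bound_le_energy (hh : 0 < hbar) (n : ℕ) (k : ℝ) : -W.bound ≤ W.energy hbar n k := by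
  refine IsImage.neg_le_energy (fun i => kinetic_nonneg hbar (circleDual l) k i) W.norm_op_le ?_
    ((W.isEigenbasis hh k).image n)
  exact (W.state hbar k).orthonormal.1 n

theorem continuous_energy (hh : 0 < hbar) (n : ℕ) : Continuous (W.energy hbar n) :=
  (continuous_and_ae_hasGradientAt W.op_symm (fun k => W.isEigenbasis hh k) volume n).1

theorem measurable_velocity (n : ℕ) : Measurable (W.velocity hbar n) :=
  (measurable_deriv _).const_mul _

/-- Differentiability of the sorted energies makes the arbitrary choice of eigenvectors in `state`
harmless: outside a null set the mean momentum is forced. -/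
theorem ae_velocity_eq (hh : 0 < hbar) : ∀ᵐ k, ∀ n,
    W.velocity hbar n k = meanMomentum W.fourier hbar (circleDual l) k (W.state hbar k n) := by
  refine ae_all_iff.2 fun n => ?_
  filter_upwards [(continuous_and_ae_hasGradientAt W.op_symm
    (fun k => W.isEigenbasis hh k) volume n).2] with k hk
  rw [velocity, hk.hasDerivAt'.deriv, smul_eq_mul, inv_mul_cancel_left₀ hh.ne']

end CirclePotential

theorem Periodic.exists_abs_le {l : ℝ} (hl : 0 < l) {f : ℝ → ℝ} (hf : Continuous f)
    (hp : Function.Periodic f l) : ∃ M, ∀ q, |f q| ≤ M := by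
  obtain ⟨M, hM⟩ := (isCompact_Icc (a := (0 : ℝ)) (b := l)).exists_bound_of_continuousOn
    hf.continuousOn
  refine ⟨M, fun q => ?_⟩
  obtain ⟨y, hy, h⟩ := hp.exists_mem_Ico₀ hl q
  rw [h]
  exact hM y ⟨hy.1, hy.2.le⟩

/-! ### Reduction of the torus to circles -/

variable {L : Fin d → ℝ} {V : Space d → ℝ}

/-- A separable periodic potential is the sum of circle potentials. -/
theorem exists_circlePotential (hd : 0 < d) (hL : ∀ j, 0 < L j) (hV : ContDiff ℝ 2 V)
    (hper : IsLatticePeriodic L V)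
    (hsep : ∃ W : Fin d → ℝ → ℝ, ∀ q : Space d, V q = ∑ j, W j (q j)) :
    ∃ W : ∀ j, CirclePotential (L j), ∀ q : Space d, V q = ∑ j, (W j).toFun (q j) := by
  obtain ⟨U, hU⟩ := hsep
  -- The given summands carry no stated regularity or periodicity. Restrictions of `V` to the
  -- coordinate axes inherit both and agree with the summands up to constants; the share `V 0 / d`
  -- makes the constants add up, which needs `d ≠ 0`.
  set F : Fin d → ℝ → ℝ := fun j s => V (EuclideanSpace.single j s) - V 0 + V 0 / d with hF
  have hF1 : ∀ j s, F j s = U j s - U j 0 + V 0 / d := by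
    intro j s
    simp only [hF, add_left_inj]
    rw [hU, hU, ← Finset.sum_sub_distrib, Finset.sum_eq_single j]
    · simp
    · intro i _ hi
      simp [hi]
    · simp
  have hF2 : ∀ j, ContDiff ℝ 2 (F j) := by
    intro j
    refine ((hV.comp ?_).sub contDiff_const).add contDiff_const
    have : (EuclideanSpace.single j : ℝ → Space d) =
        fun s : ℝ => s • (EuclideanSpace.single j (1 : ℝ) : Space d) := by
      ext s i
      by_cases h : i = j <;> simp [h]
    rw [this]
    exact contDiff_id.smul contDiff_const
  have hF3 : ∀ j, Function.Periodic (F j) (L j) := by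
    intro j s
    simp only [hF, add_left_inj, sub_left_inj]
    rw [← hper j (EuclideanSpace.single j s)]
    congr 1
    ext i
    by_cases h : i = j <;> simp [h]
  choose M hM using fun j => Periodic.exists_abs_le (hL j) (hF2 j).continuous (hF3 j)
  refine ⟨fun j => ⟨F j, M j, hL j, hF2 j, hF3 j, hM j⟩, fun q => ?_⟩
  have hd' : (d : ℝ) ≠ 0 := by exact_mod_cast hd.ne'
  simp only [hF1]
  rw [Finset.sum_add_distrib, Finset.sum_sub_distrib, ← hU, Finset.sum_const, Finset.card_univ,
    Fintype.card_fin, nsmul_eq_mul, mul_div_cancel₀ _ hd']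
  have : V 0 = ∑ j, U j 0 := by rw [hU]; rfl
  rw [← this]
  ring

section Joint

variable {W : ∀ j, CirclePotential (L j)} {hbar : ℝ}

theorem abs_le_sum_bound (hsep : ∀ q : Space d, V q = ∑ j, (W j).toFun (q j)) (q : Space d) :
    |V q| ≤ ∑ j, (W j).bound := by
  rw [hsep]
  exact (Finset.abs_sum_le_sum_abs _ _).trans (Finset.sum_le_sum fun j _ => (W j).abs_le _)

/-- Every summand is at least `-|M|`, so a bound on the sum bounds each of the `d` energies
separately. -/
theorem finite_sum_le {E : Fin d → ℕ → ℝ} {M : ℝ} (hE : ∀ j n, -M ≤ E j n)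
    (hlim : ∀ j, Tendsto (E j) atTop atTop) (R : ℝ) :
    {n : Fin d → ℕ | ∑ j, E j (n j) ≤ R}.Finite := by
  have h1 : ∀ j, {m | E j m ≤ R + d * |M|}.Finite := by
    intro j
    have := (hlim j).eventually (eventually_gt_atTop (R + d * |M|))
    rw [← Nat.cofinite_eq_atTop, eventually_cofinite] at this
    simpa using this
  refine (Set.Finite.pi' h1).subset fun n hn j => ?_
  have h2 : ∑ i ∈ Finset.univ.erase j, -|M| ≤ ∑ i ∈ Finset.univ.erase j, E i (n i) :=
    Finset.sum_le_sum fun i _ => (neg_le_neg (le_abs_self M)).trans (hE i _)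
  have h3 : ∑ i, E i (n i) ≤ R := hn
  rw [← Finset.add_sum_erase _ _ (Finset.mem_univ j)] at h3
  rw [Finset.sum_const, nsmul_eq_mul] at h2
  have h4 : ((Finset.univ.erase j).card : ℝ) ≤ d := by
    exact_mod_cast (Finset.card_erase_le).trans_eq (Finset.card_fin d)
  show E j (n j) ≤ R + d * |M|
  nlinarith [abs_nonneg M]

/-- The eigenfunctions of the separable problem are products. -/
theorem exists_productEigenbasis (hd : 0 < d) (hL : ∀ j, 0 < L j)
    (hsep : ∀ q : Space d, V q = ∑ j, (W j).toFun (q j)) (hh : 0 < hbar) (k : Space d) :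
    ∃ σ : ℕ ≃ (Fin d → ℕ), IsEigenbasis (torusBasis hL) (kinetic hbar (dualVector L) k)
      (mulOp (volume.restrict (cell L)) V)
      (reindexBasis (tensorBasis fun j => (W j).state hbar (k j)) σ)
      (fun n => ∑ j, (W j).energy hbar (σ n j) (k j)) := by
  have hV : Continuous V := by
    rw [show V = fun q => ∑ j, (W j).toFun (q j) from funext hsep]
    exact continuous_finsetSum _ fun j _ => (W j).continuous.comp (by fun_prop)
  set M := ∑ j, (W j).bound with hM
  have hM0 : 0 ≤ M := Finset.sum_nonneg fun j _ => (W j).bound_nonneg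
  have hle : ∀ j, (W j).bound ≤ M := fun j =>
    Finset.single_le_sum (fun i _ => (W i).bound_nonneg) (Finset.mem_univ j)
  have : Nonempty (Fin d) := ⟨⟨0, hd⟩⟩
  obtain ⟨σ, h1, h2⟩ := exists_monotone_enumeration
    (g := fun n : Fin d → ℕ => ∑ j, (W j).energy hbar (n j) (k j))
    (finite_sum_le (E := fun j n => (W j).energy hbar n (k j)) (M := M)
      (fun j n => (neg_le_neg (hle j)).trans ((W j).neg_bound_le_energy hh n _))
      fun j => ((W j).isEigenbasis hh (k j)).tendsto)
  refine ⟨σ, h1, h2, fun n => ?_⟩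
  rw [reindexBasis_apply, tensorBasis_apply]
  exact isImage_tensor hL hV (fun j => (W j).continuous) hM0 (abs_le_sum_bound hsep)
    (fun j q => ((W j).abs_le q).trans (hle j)) hsep
    fun j => ((W j).isEigenbasis hh (k j)).image (σ n j)

theorem continuous_bandEnergy (hd : 0 < d) (hL : ∀ j, 0 < L j)
    (hsep : ∀ q : Space d, V q = ∑ j, (W j).toFun (q j)) (hh : 0 < hbar) (n : ℕ) :
    Continuous (bandEnergy L V hbar n) := by
  have hV : Continuous V := by
    rw [show V = fun q => ∑ j, (W j).toFun (q j) from funext hsep]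
    exact continuous_finsetSum _ fun j _ => (W j).continuous.comp (by fun_prop)
  have hM0 : 0 ≤ ∑ j, (W j).bound := Finset.sum_nonneg fun j _ => (W j).bound_nonneg
  choose σ hσ using exists_productEigenbasis (W := W) hd hL hsep hh
  have h := (continuous_and_ae_hasGradientAt (mulOp_symm (hV.aestronglyMeasurable
    (μ := volume.restrict (cell L))) hM0 (abs_le_sum_bound hsep)) hσ volume n).1
  exact h.congr fun k => (bandEnergy_eq hL hV hM0 (abs_le_sum_bound hsep) (hσ k) n).symm

/-- For almost every quasimomentum, the joint distribution of energies and velocities of the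
separable problem is the sum of the ones of the factors. -/
theorem ae_bandEnergyVelocity_eq (hd : 0 < d) (hL : ∀ j, 0 < L j)
    (hsep : ∀ q : Space d, V q = ∑ j, (W j).toFun (q j)) (hh : 0 < hbar) :
    ∀ᵐ k : Space d, ∃ σ : ℕ ≃ (Fin d → ℕ), ∀ n, bandEnergyVelocity L V hbar (n, k) =
      (∑ j, (W j).energy hbar (σ n j) (k j),
        WithLp.toLp 2 fun j => (W j).velocity hbar (σ n j) (k j)) := by
  have hV : Continuous V := by
    rw [show V = fun q => ∑ j, (W j).toFun (q j) from funext hsep]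
    exact continuous_finsetSum _ fun j _ => (W j).continuous.comp (by fun_prop)
  set M := ∑ j, (W j).bound with hM
  have hM0 : 0 ≤ M := Finset.sum_nonneg fun j _ => (W j).bound_nonneg
  have hle : ∀ j, (W j).bound ≤ M := fun j =>
    Finset.single_le_sum (fun i _ => (W i).bound_nonneg) (Finset.mem_univ j)
  -- The ordering `σ k` is chosen independently for each `k`; the differentiability result asks for
  -- an ascending eigenbasis at each point and for no regularity in `k`.
  choose σ hσ using exists_productEigenbasis (W := W) hd hL hsep hh
  have hE : ∀ n k, bandEnergy L V hbar n k = ∑ j, (W j).energy hbar (σ k n j) (k j) := fun n k =>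
    bandEnergy_eq hL hV hM0 (abs_le_sum_bound hsep) (hσ k) n
  have h1 := ae_all_iff.2 fun n => (continuous_and_ae_hasGradientAt (mulOp_symm
    (hV.aestronglyMeasurable (μ := volume.restrict (cell L))) hM0 (abs_le_sum_bound hsep))
    hσ volume n).2
  have hq : ∀ j : Fin d, Measure.QuasiMeasurePreserving (fun k : Space d => k j) := fun j =>
    (Measure.quasiMeasurePreserving_eval (fun _ : Fin d => (volume : Measure ℝ)) j).comp
      (PiLp.volume_preserving_ofLp (Fin d)).quasiMeasurePreserving
  have h2 : ∀ᵐ k : Space d, ∀ j n, (W j).velocity hbar n (k j) =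
      meanMomentum (W j).fourier hbar (circleDual (L j)) (k j) ((W j).state hbar (k j) n) :=
    ae_all_iff.2 fun j => (hq j).ae ((W j).ae_velocity_eq hh)
  filter_upwards [h1, h2] with k h1 h2
  refine ⟨σ k, fun n => Prod.ext (hE n k) ?_⟩
  have h3 : HasGradientAt (bandEnergy L V hbar n) _ k :=
    (h1 n).congr_of_eventuallyEq (Eventually.of_forall fun k => hE n k)
  rw [bandEnergyVelocity, bandVelocity, if_pos h3.differentiableAt, h3.gradient,
    inv_smul_smul₀ hh.ne', reindexBasis_apply, tensorBasis_apply]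
  ext j
  refine Eq.trans ?_ (h2 j _).symm
  exact meanMomentum_tensor hL hV (fun j => (W j).continuous) hM0 (abs_le_sum_bound hsep)
    (fun j q => ((W j).abs_le q).trans (hle j)) hsep
    (fun j => ((W j).state hbar (k j)).orthonormal.1 _)
    (fun j => ((W j).isEigenbasis hh (k j)).image (σ k n j)) j

theorem measurable_bandVelocity (n : ℕ) : Measurable (bandVelocity L V hbar n) := by
  classical
  refine Measurable.ite (measurableSet_of_differentiableAt ℝ _) ?_ measurable_const
  refine Measurable.const_smul (M := ℝ) (X := Space d) ?_ hbar⁻¹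
  exact (InnerProductSpace.toDual ℝ (Space d)).symm.continuous.measurable.comp
    (measurable_fderiv ℝ _)

theorem measurable_bandEnergyVelocity (hd : 0 < d) (hL : ∀ j, 0 < L j)
    (hsep : ∀ q : Space d, V q = ∑ j, (W j).toFun (q j)) (hh : 0 < hbar) :
    Measurable (bandEnergyVelocity L V hbar) :=
  measurable_from_prod_countable_right fun n =>
    (continuous_bandEnergy hd hL hsep hh n).measurable.prodMk (measurable_bandVelocity n)

end Joint

/-! ### Periodic `C²` functions in the operator domain -/

section CircleImage

open InnerProductSpace

variable {l : ℝ}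

theorem memLp_circle_of_continuous {f : ℝ → ℂ} (hf : Continuous f) :
    MemLp f 2 (circleMeasure l) := by
  obtain ⟨C, hC⟩ := (isCompact_Icc (a := (0 : ℝ)) (b := l)).exists_bound_of_continuousOn
    hf.continuousOn
  refine MemLp.of_bound hf.aestronglyMeasurable C ?_
  filter_upwards [ae_restrict_mem measurableSet_Ico] with q hq
  exact hC q ⟨hq.1, hq.2.le⟩

/-- The class of a continuous function in `L²`. -/
def circleClass (l : ℝ) (f : C(ℝ, ℂ)) : CircleL2 l :=
  (memLp_circle_of_continuous f.continuous).toLp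

theorem circleClass_ae (f : C(ℝ, ℂ)) : circleClass l f =ᵐ[circleMeasure l] f :=
  (memLp_circle_of_continuous f.continuous).coeFn_toLp

theorem inner_circleBasis_circleClass (hl : 0 < l) (n : ℤ) (f : C(ℝ, ℂ)) :
    ⟪circleBasis hl n, circleClass l f⟫_ℂ =
      ∫ q, conj (circleFun l n q) * f q ∂(circleMeasure l) := by
  rw [inner_circleBasis]
  refine integral_congr_ae ?_
  filter_upwards [circleClass_ae f] with q hq
  rw [hq]

theorem norm_circleClass_sq (f : C(ℝ, ℂ)) :
    ‖circleClass l f‖ ^ 2 = ∫ q, ‖f q‖ ^ 2 ∂(circleMeasure l) := by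
  rw [norm_sq_eq_integral]
  refine integral_congr_ae ?_
  filter_upwards [circleClass_ae f] with q hq
  rw [hq]

theorem norm_circleClass_le (hl : 0 < l) {f : C(ℝ, ℂ)} {C : ℝ} (hC : 0 ≤ C)
    (hf : ∀ q, ‖f q‖ ≤ C * (√l)⁻¹) : ‖circleClass l f‖ ≤ C := by
  refine (sq_le_sq₀ (norm_nonneg _) hC).1 ?_
  rw [norm_circleClass_sq]
  calc ∫ q, ‖f q‖ ^ 2 ∂(circleMeasure l) ≤ ∫ _, (C * (√l)⁻¹) ^ 2 ∂(circleMeasure l) := by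
        refine integral_mono_of_nonneg (Eventually.of_forall fun q => sq_nonneg _)
          (integrable_const _) (Eventually.of_forall fun q => ?_)
        exact pow_le_pow_left₀ (norm_nonneg _) (hf q) 2
    _ = C ^ 2 := by
        rw [integral_const, measureReal_restrict_apply_univ, Real.volume_real_Ico_of_le hl.le,
          sub_zero, smul_eq_mul, mul_pow, inv_pow, Real.sq_sqrt hl.le]
        field_simp

/-- Partial integration, with boundary terms that cancel by periodicity. -/
theorem integral_conj_circleFun_mul_deriv (hl : 0 < l) (n : ℤ) {ψ ψ' : ℝ → ℂ}
    (h : ∀ q, HasDerivAt ψ (ψ' q) q) (hc : Continuous ψ') (hp : ψ l = ψ 0) :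
    ∫ q, conj (circleFun l n q) * ψ' q ∂(circleMeasure l) =
      (circleDual l n : ℂ) * Complex.I * ∫ q, conj (circleFun l n q) * ψ q ∂(circleMeasure l) := by
  simp only [conj_circleFun]
  rw [intervalIntegral_eq_circle hl, intervalIntegral_eq_circle hl,
    intervalIntegral.integral_mul_deriv_eq_deriv_mul (fun q _ => hasDerivAt_circleFun l (-n) q)
      (fun q _ => h q) ((continuous_const.mul (continuous_circleFun l _)).intervalIntegrable _ _)
      (hc.intervalIntegrable _ _), hp]
  have h0 : circleFun l (-n) l = circleFun l (-n) 0 := by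
    simpa using circleFun_add_period hl (-n) 0
  rw [h0, sub_self, zero_sub, ← intervalIntegral.integral_const_mul,
    ← intervalIntegral.integral_neg]
  refine intervalIntegral.integral_congr fun q _ => ?_
  simp only [circleDual]
  push_cast
  ring

namespace CirclePotential

variable (W : CirclePotential l)

/-- On periodic functions of class `C²` the Bloch operator acts as a differential operator. -/
theorem isImage_circleClass {hbar k : ℝ} {ψ f : C(ℝ, ℂ)} {ψ' ψ'' : ℝ → ℂ}
    (h1 : ∀ q, HasDerivAt ψ (ψ' q) q) (h2 : ∀ q, HasDerivAt ψ' (ψ'' q) q) (hc : Continuous ψ'')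
    (hp1 : ψ l = ψ 0) (hp2 : ψ' l = ψ' 0)
    (hf : ∀ q, f q = (hbar ^ 2 / 2 * k ^ 2 + W.toFun q) * ψ q
      - Complex.I * hbar ^ 2 * k * ψ' q - hbar ^ 2 / 2 * ψ'' q) :
    IsImage W.fourier (kinetic hbar (circleDual l) k) W.op (circleClass l ψ) (circleClass l f) := by
  intro n
  have hc1 : Continuous ψ' := continuous_iff_continuousAt.2 fun q => (h2 q).continuousAt
  have hcf := (continuous_circleFun l n)
  have hop : ⟪W.fourier n, W.op (circleClass l ψ)⟫_ℂ =
      ∫ q, conj (circleFun l n q) * (W.toFun q * ψ q) ∂(circleMeasure l) := by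
    rw [fourier, inner_circleBasis]
    refine integral_congr_ae ?_
    filter_upwards [circleClass_ae ψ, mulOp_ae W.continuous.aestronglyMeasurable W.bound_nonneg
      W.abs_le (circleClass l ψ)] with q hq1 hq2
    rw [op, hq2, hq1]
  have e1 := integral_conj_circleFun_mul_deriv W.length_pos n h1 hc1 hp1
  have e2 := integral_conj_circleFun_mul_deriv W.length_pos n h2 hc hp2
  have hint : ∀ {g : ℝ → ℂ}, Continuous g → IntervalIntegrable g volume 0 l := fun hg =>
    hg.intervalIntegrable _ _
  rw [hop, fourier, inner_circleBasis_circleClass, inner_circleBasis_circleClass]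
  simp only [hf]
  have hs : ∫ q, conj (circleFun l n q) * ((hbar ^ 2 / 2 * k ^ 2 + W.toFun q) * ψ q
      - Complex.I * hbar ^ 2 * k * ψ' q - hbar ^ 2 / 2 * ψ'' q) ∂(circleMeasure l) =
      hbar ^ 2 / 2 * k ^ 2 * (∫ q, conj (circleFun l n q) * ψ q ∂(circleMeasure l)) +
      (∫ q, conj (circleFun l n q) * (W.toFun q * ψ q) ∂(circleMeasure l)) -
      Complex.I * hbar ^ 2 * k * (∫ q, conj (circleFun l n q) * ψ' q ∂(circleMeasure l)) -
      hbar ^ 2 / 2 * ∫ q, conj (circleFun l n q) * ψ'' q ∂(circleMeasure l) := by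
    have hW := W.continuous
    have hψ := ψ.continuous
    have hcc : Continuous fun q => conj (circleFun l n q) := Complex.continuous_conj.comp hcf
    simp only [intervalIntegral_eq_circle W.length_pos]
    rw [← intervalIntegral.integral_const_mul, ← intervalIntegral.integral_const_mul,
      ← intervalIntegral.integral_const_mul,
      ← intervalIntegral.integral_add (hint (by fun_prop)) (hint (by fun_prop)),
      ← intervalIntegral.integral_sub (hint (by fun_prop)) (hint (by fun_prop)),
      ← intervalIntegral.integral_sub (hint (by fun_prop)) (hint (by fun_prop))]
    refine intervalIntegral.integral_congr fun q _ => ?_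
    ring
  rw [hs, e2, e1]
  have hk : (kinetic hbar (circleDual l) k n : ℂ) = hbar ^ 2 * (circleDual l n + k) ^ 2 / 2 := by
    rw [kinetic, Real.norm_eq_abs, sq_abs, smul_eq_mul]
    push_cast
    ring
  rw [hk]
  linear_combination (hbar ^ 2 * k * circleDual l n *
    (∫ q, conj (circleFun l n q) * ψ q ∂(circleMeasure l)) + hbar ^ 2 / 2 * circleDual l n ^ 2 *
    ∫ q, conj (circleFun l n q) * ψ q ∂(circleMeasure l)) * Complex.I_sq

end CirclePotential

end CircleImage

/-! ### Approximate eigenfunction calculus for the resolvent -/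

namespace CirclePotential

open InnerProductSpace

variable {l : ℝ} (W : CirclePotential l)

theorem hasDerivAt (q : ℝ) : HasDerivAt W.toFun (deriv W.toFun q) q :=
  ((W.contDiff.differentiable (by norm_num)) q).hasDerivAt

theorem hasDerivAt_deriv (q : ℝ) : HasDerivAt (deriv W.toFun) (deriv (deriv W.toFun) q) q :=
  (W.contDiff.differentiable_deriv_two q).hasDerivAt

theorem continuous_deriv : Continuous (deriv W.toFun) :=
  W.contDiff.differentiable_deriv_two.continuous

theorem continuous_deriv_deriv : Continuous (deriv (deriv W.toFun)) := by
  have h : ContDiff ℝ 1 (deriv W.toFun) := ContDiff.deriv' (n := 1) W.contDiff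
  exact (ContDiff.deriv' (n := 0) h).continuous

theorem periodic_deriv : Function.Periodic (deriv W.toFun) l := by
  intro q
  rw [← deriv_comp_add_const, show (fun x => W.toFun (x + l)) = W.toFun from funext W.periodic]

theorem periodic_deriv_deriv : Function.Periodic (deriv (deriv W.toFun)) l := by
  intro q
  rw [← deriv_comp_add_const,
    show (fun x => deriv W.toFun (x + l)) = deriv W.toFun from funext W.periodic_deriv]

/-- A common bound of the first two derivatives. -/
theorem exists_abs_deriv_le : ∃ C, 0 ≤ C ∧ (∀ q, |deriv W.toFun q| ≤ C) ∧
    ∀ q, |deriv (deriv W.toFun) q| ≤ C := by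
  obtain ⟨C1, h1⟩ := Periodic.exists_abs_le W.length_pos W.continuous_deriv W.periodic_deriv
  obtain ⟨C2, h2⟩ := Periodic.exists_abs_le W.length_pos W.continuous_deriv_deriv
    W.periodic_deriv_deriv
  exact ⟨max C1 C2, (abs_nonneg _).trans ((h1 0).trans (le_max_left _ _)),
    fun q => (h1 q).trans (le_max_left _ _), fun q => (h2 q).trans (le_max_right _ _)⟩

/-- The symbol `(p² / 2 + W(q) + M + 1)⁻¹` of the resolvent. -/
def resolventSymbol (p q : ℝ) : ℝ := (p ^ 2 / 2 + W.toFun q + (W.bound + 1))⁻¹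

theorem one_add_le (p q : ℝ) : p ^ 2 / 2 + 1 ≤ p ^ 2 / 2 + W.toFun q + (W.bound + 1) := by
  linarith [neg_le_of_abs_le (W.abs_le q)]

theorem resolventSymbol_pos (p q : ℝ) : 0 < W.resolventSymbol p q :=
  inv_pos.2 ((by positivity : (0 : ℝ) < p ^ 2 / 2 + 1).trans_le (W.one_add_le p q))

theorem resolventSymbol_le (p q : ℝ) : W.resolventSymbol p q ≤ (p ^ 2 / 2 + 1)⁻¹ :=
  inv_anti₀ (by positivity) (W.one_add_le p q)

theorem inv_sq_add_one_le_one (p : ℝ) : (p ^ 2 / 2 + 1)⁻¹ ≤ 1 :=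
  inv_le_one_of_one_le₀ (by linarith [sq_nonneg p])

theorem resolventSymbol_le_one (p q : ℝ) : W.resolventSymbol p q ≤ 1 :=
  (W.resolventSymbol_le p q).trans (inv_sq_add_one_le_one p)

theorem abs_mul_resolventSymbol_le (p q : ℝ) : |p| * W.resolventSymbol p q ≤ 1 := by
  calc |p| * W.resolventSymbol p q ≤ |p| * (p ^ 2 / 2 + 1)⁻¹ := by
        gcongr; exact W.resolventSymbol_le p q
    _ ≤ 1 := by
        rw [← div_eq_mul_inv, div_le_one (by positivity)]
        nlinarith [sq_abs p, sq_nonneg (|p| - 1)]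

theorem resolventSymbol_mul (p q : ℝ) :
    W.resolventSymbol p q * (p ^ 2 / 2 + W.toFun q + (W.bound + 1)) = 1 :=
  inv_mul_cancel₀ ((by positivity : (0 : ℝ) < p ^ 2 / 2 + 1).trans_le (W.one_add_le p q)).ne'

theorem continuous_resolventSymbol (p : ℝ) : Continuous (W.resolventSymbol p) :=
  ((continuous_const.add W.continuous).add continuous_const).inv₀ fun q =>
    ((by positivity : (0 : ℝ) < p ^ 2 / 2 + 1).trans_le (W.one_add_le p q)).ne'

theorem periodic_resolventSymbol (p : ℝ) : Function.Periodic (W.resolventSymbol p) l := fun q => by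
  rw [resolventSymbol, resolventSymbol, W.periodic]

theorem hasDerivAt_resolventSymbol (p q : ℝ) : HasDerivAt (W.resolventSymbol p)
    (-(W.resolventSymbol p q ^ 2 * deriv W.toFun q)) q := by
  have h := (((W.hasDerivAt q).const_add (p ^ 2 / 2)).add_const (W.bound + 1)).fun_inv
    ((by positivity : (0 : ℝ) < p ^ 2 / 2 + 1).trans_le (W.one_add_le p q)).ne'
  refine h.congr_deriv ?_
  rw [resolventSymbol, inv_pow]
  ring

theorem hasDerivAt_resolventSymbol_pow (p : ℝ) (s : ℕ) (q : ℝ) :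
    HasDerivAt (fun q => W.resolventSymbol p q ^ (s + 1))
      (-((s + 1) * W.resolventSymbol p q ^ (s + 2) * deriv W.toFun q)) q := by
  refine ((W.hasDerivAt_resolventSymbol p q).fun_pow (s + 1)).congr_deriv ?_
  push_cast
  ring

theorem hasDerivAt_deriv_resolventSymbol_pow (p : ℝ) (s : ℕ) (q : ℝ) :
    HasDerivAt (fun q => -((s + 1) * W.resolventSymbol p q ^ (s + 2) * deriv W.toFun q))
      ((s + 1) * (s + 2) * W.resolventSymbol p q ^ (s + 3) * deriv W.toFun q ^ 2
        - (s + 1) * W.resolventSymbol p q ^ (s + 2) * deriv (deriv W.toFun) q) q := by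
  refine ((((W.hasDerivAt_resolventSymbol_pow p (s + 1) q).const_mul ((s : ℝ) + 1)).mul
    (W.hasDerivAt_deriv q)).neg).congr_deriv ?_
  push_cast
  ring

/-- The modulated plane wave `b(P, q)^s e_m(q)`. -/
def modulated (s : ℕ) (p : ℝ) (m : ℤ) : C(ℝ, ℂ) where
  toFun q := (W.resolventSymbol p q ^ s : ℝ) * circleFun l m q
  continuous_toFun := (Complex.continuous_ofReal.comp
    ((W.continuous_resolventSymbol p).pow s)).mul (continuous_circleFun l m)

/-- The remainder in the approximate inversion of the Bloch operator. -/
def remainder (s : ℕ) (hbar p : ℝ) (m : ℤ) : C(ℝ, ℂ) where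
  toFun q := (-Complex.I * p * (-((s + 1) * W.resolventSymbol p q ^ (s + 2) * deriv W.toFun q) : ℝ)
    - hbar / 2 * ((s + 1) * (s + 2) * W.resolventSymbol p q ^ (s + 3) * deriv W.toFun q ^ 2
        - (s + 1) * W.resolventSymbol p q ^ (s + 2) * deriv (deriv W.toFun) q : ℝ)) *
      circleFun l m q
  continuous_toFun := by
    have h1 := W.continuous_resolventSymbol p
    have h2 := W.continuous_deriv
    have h3 := W.continuous_deriv_deriv
    have h4 := continuous_circleFun l m
    fun_prop

theorem modulated_apply (s : ℕ) (p : ℝ) (m : ℤ) (q : ℝ) :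
    W.modulated s p m q = (W.resolventSymbol p q ^ s : ℝ) * circleFun l m q := rfl

theorem remainder_apply (s : ℕ) (hbar p : ℝ) (m : ℤ) (q : ℝ) : W.remainder s hbar p m q =
    (-Complex.I * p * (-((s + 1) * W.resolventSymbol p q ^ (s + 2) * deriv W.toFun q) : ℝ)
    - hbar / 2 * ((s + 1) * (s + 2) * W.resolventSymbol p q ^ (s + 3) * deriv W.toFun q ^ 2
        - (s + 1) * W.resolventSymbol p q ^ (s + 2) * deriv (deriv W.toFun) q : ℝ)) *
      circleFun l m q := rfl

/-- The only unbounded coefficient is the momentum `p`, and it comes with a factor `b^(s+2)`. One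
power of `b` compensates it, because `|p| b ≤ 1`, and the remaining `b^(s+1)` still provides the
decay `(p²/2 + 1)⁻¹`. -/
theorem exists_norm_remainder_le (s : ℕ) : ∃ C, 0 ≤ C ∧ ∀ hbar p m q, 0 < hbar → hbar ≤ 1 →
    ‖W.remainder s hbar p m q‖ ≤ C * (p ^ 2 / 2 + 1)⁻¹ * (√l)⁻¹ := by
  obtain ⟨D, hD, h1, h2⟩ := W.exists_abs_deriv_le
  refine ⟨(s + 1) * D + ((s + 1) * (s + 2) * D ^ 2 + (s + 1) * D), by positivity,
    fun hbar p m q hh hh1 => ?_⟩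
  set b := W.resolventSymbol p q with hb
  set c := (p ^ 2 / 2 + 1)⁻¹ with hc
  have hb0 : 0 < b := W.resolventSymbol_pos p q
  have hb1 : b ≤ 1 := W.resolventSymbol_le_one p q
  have hbc : b ≤ c := W.resolventSymbol_le p q
  have hpb : |p| * b ≤ 1 := W.abs_mul_resolventSymbol_le p q
  have hbs : ∀ n, b ^ (n + 1) ≤ c := fun n => by
    rw [pow_succ]
    calc b ^ n * b ≤ 1 * b := by gcongr; exact pow_le_one₀ hb0.le hb1
      _ ≤ c := by linarith
  have e1 : ‖-Complex.I * p * (-((s + 1) * b ^ (s + 2) * deriv W.toFun q) : ℝ)‖ ≤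
      (s + 1) * D * c := by
    rw [norm_mul, norm_mul, norm_neg, Complex.norm_I, one_mul, Complex.norm_real, Complex.norm_real,
      Real.norm_eq_abs, Real.norm_eq_abs, abs_neg, abs_mul, abs_mul, abs_of_pos (by positivity :
      (0 : ℝ) < s + 1), abs_of_pos (by positivity : 0 < b ^ (s + 2))]
    calc |p| * ((s + 1) * b ^ (s + 2) * |deriv W.toFun q|)
        = (s + 1) * (|p| * b) * b ^ (s + 1) * |deriv W.toFun q| := by ring
      _ ≤ (s + 1) * 1 * c * D := by
          gcongr
          · exact hbs s
          · exact h1 q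
      _ = _ := by ring
  have e2 : ‖((s + 1) * (s + 2) * b ^ (s + 3) * deriv W.toFun q ^ 2
        - (s + 1) * b ^ (s + 2) * deriv (deriv W.toFun) q : ℝ)‖ ≤
      ((s + 1) * (s + 2) * D ^ 2 + (s + 1) * D) * c := by
    refine (norm_sub_le _ _).trans ?_
    rw [Real.norm_eq_abs, Real.norm_eq_abs, abs_mul _ (deriv W.toFun q ^ 2),
      abs_mul _ (deriv (deriv W.toFun) q), abs_of_pos (by positivity :
      (0 : ℝ) < (s + 1) * (s + 2) * b ^ (s + 3)), abs_of_pos (by positivity : 0 < (s + 1) * b ^ (s + 2)),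
      abs_pow]
    calc _ ≤ (s + 1) * (s + 2) * c * D ^ 2 + (s + 1) * c * D := by
          gcongr
          · exact hbs (s + 2)
          · exact h1 q
          · exact hbs (s + 1)
          · exact h2 q
      _ = _ := by ring
  rw [remainder_apply, norm_mul, norm_circleFun]
  refine mul_le_mul_of_nonneg_right ?_ (by positivity)
  refine (norm_sub_le _ _).trans ?_
  have e3 : ‖(hbar / 2 : ℂ)‖ ≤ 1 := by
    rw [norm_div, Complex.norm_real, Real.norm_of_nonneg hh.le]
    norm_num
    linarith
  rw [norm_mul (hbar / 2 : ℂ), Complex.norm_real]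
  calc _ ≤ (s + 1) * D * c + 1 * (((s + 1) * (s + 2) * D ^ 2 + (s + 1) * D) * c) := by gcongr
    _ = _ := by ring

/-- Approximate inversion: `(H + M + 1) b^{s+1} e_m = b^s e_m + ℏ r`. -/
theorem isImage_modulated (s : ℕ) (hbar k : ℝ) (m : ℤ) :
    IsImage W.fourier (kinetic hbar (circleDual l) k) W.op
      (circleClass l (W.modulated (s + 1) (hbar * (circleDual l m + k)) m))
      (circleClass l (W.modulated s (hbar * (circleDual l m + k)) m +
        (hbar : ℂ) • W.remainder s hbar (hbar * (circleDual l m + k)) m -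
        ((W.bound + 1 : ℝ) : ℂ) • W.modulated (s + 1) (hbar * (circleDual l m + k)) m)) := by
  set p := hbar * (circleDual l m + k) with hp
  set G := fun q => W.resolventSymbol p q ^ (s + 1) with hG
  set G' := fun q => -((s + 1) * W.resolventSymbol p q ^ (s + 2) * deriv W.toFun q) with hG'
  set G'' := fun q => (s + 1) * (s + 2) * W.resolventSymbol p q ^ (s + 3) * deriv W.toFun q ^ 2
        - (s + 1) * W.resolventSymbol p q ^ (s + 2) * deriv (deriv W.toFun) q with hG''
  have hd1 : ∀ q, HasDerivAt (fun q => (G q : ℂ)) (G' q : ℂ) q := fun q =>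
    (W.hasDerivAt_resolventSymbol_pow p s q).ofReal_comp
  have hd2 : ∀ q, HasDerivAt (fun q => (G' q : ℂ)) (G'' q : ℂ) q := fun q =>
    (W.hasDerivAt_deriv_resolventSymbol_pow p s q).ofReal_comp
  have he : ∀ q, HasDerivAt (circleFun l m) ((circleDual l m : ℂ) * Complex.I * circleFun l m q) q :=
    hasDerivAt_circleFun l m
  have hcG'' : Continuous fun q => (G'' q : ℂ) := by
    have h1 := W.continuous_resolventSymbol p
    have h2 := W.continuous_deriv
    have h3 := W.continuous_deriv_deriv
    fun_prop
  have hcG' : Continuous fun q => (G' q : ℂ) := by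
    have h1 := W.continuous_resolventSymbol p
    have h2 := W.continuous_deriv
    fun_prop
  have hcG : Continuous fun q => (G q : ℂ) := by
    have h1 := W.continuous_resolventSymbol p
    fun_prop
  have hce := continuous_circleFun l m
  have hb : W.resolventSymbol p l = W.resolventSymbol p 0 := by
    simpa using W.periodic_resolventSymbol p 0
  have hW' : deriv W.toFun l = deriv W.toFun 0 := by simpa using W.periodic_deriv 0
  have he0 : circleFun l m l = circleFun l m 0 := by
    simpa using circleFun_add_period W.length_pos m 0
  have hψ : ⇑(W.modulated (s + 1) p m) = fun q => (G q : ℂ) * circleFun l m q :=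
    funext fun q => W.modulated_apply _ _ _ _
  clear_value G G' G''
  refine W.isImage_circleClass
    (ψ' := fun q => (G' q + circleDual l m * Complex.I * G q) * circleFun l m q)
    (ψ'' := fun q => (G'' q + 2 * (circleDual l m * Complex.I) * G' q +
      (circleDual l m * Complex.I) ^ 2 * G q) * circleFun l m q) (fun q => ?_) (fun q => ?_)
    (by fun_prop) ?_ ?_ fun q => ?_
  · rw [hψ]
    refine ((hd1 q).fun_mul (he q)).congr_deriv ?_
    ring
  · refine (((hd2 q).fun_add ((hd1 q).const_mul _)).fun_mul (he q)).congr_deriv ?_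
    ring
  · rw [modulated_apply, modulated_apply, he0, hb]
  · simp only [hG, hG', hb, hW', he0]
  · rw [ContinuousMap.sub_apply, ContinuousMap.add_apply, ContinuousMap.smul_apply,
      ContinuousMap.smul_apply, modulated_apply, modulated_apply, remainder_apply, smul_eq_mul,
      smul_eq_mul]
    rw [← congrFun hG' q, ← congrFun hG'' q, ← congrFun hG q]
    have h1 : (W.resolventSymbol p q ^ s : ℝ) =
        G q * (p ^ 2 / 2 + W.toFun q + (W.bound + 1)) := by
      rw [congrFun hG q, pow_succ (W.resolventSymbol p q) s, mul_assoc, W.resolventSymbol_mul, mul_one]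
    rw [h1, hp]
    push_cast
    linear_combination (hbar ^ 2 / 2 * circleDual l m ^ 2 * G q * circleFun l m q +
      hbar ^ 2 * k * circleDual l m * G q * circleFun l m q) * Complex.I_sq

end CirclePotential

/-! ### Trace asymptotics of resolvent powers -/

namespace CirclePotential

open InnerProductSpace
open scoped ENNReal

variable {l : ℝ} (W : CirclePotential l)

theorem circleClass_modulated_zero (p : ℝ) (m : ℤ) :
    circleClass l (W.modulated 0 p m) = W.fourier m := by
  refine Lp.ext ?_
  filter_upwards [circleClass_ae (l := l) (W.modulated 0 p m), circleBasis_ae W.length_pos m]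
    with q h1 h2
  rw [h1, fourier, h2, modulated_apply, pow_zero, Complex.ofReal_one, one_mul]

theorem norm_modulated_sq (s : ℕ) (p : ℝ) (m : ℤ) :
    ‖circleClass l (W.modulated s p m)‖ ^ 2 =
      l⁻¹ * ∫ q, W.resolventSymbol p q ^ (2 * s) ∂(circleMeasure l) := by
  rw [norm_circleClass_sq, ← integral_const_mul]
  refine integral_congr_ae (Eventually.of_forall fun q => ?_)
  simp only
  rw [modulated_apply, norm_mul, norm_circleFun, Complex.norm_real, mul_pow, inv_pow,
    Real.sq_sqrt W.length_pos.le, norm_pow, Real.norm_of_nonneg (W.resolventSymbol_pos p q).le,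
    ← pow_mul, mul_comm s 2, mul_comm]

theorem norm_modulated_le (s : ℕ) (p : ℝ) (m : ℤ) :
    ‖circleClass l (W.modulated (s + 1) p m)‖ ≤ (p ^ 2 / 2 + 1)⁻¹ := by
  refine norm_circleClass_le W.length_pos (by positivity) fun q => ?_
  rw [modulated_apply, norm_mul, norm_circleFun, Complex.norm_real,
    Real.norm_of_nonneg (pow_nonneg (W.resolventSymbol_pos p q).le _)]
  gcongr
  rw [pow_succ]
  calc _ ≤ 1 * W.resolventSymbol p q := by
        gcongr
        · exact (W.resolventSymbol_pos p q).le
        · exact pow_le_one₀ (W.resolventSymbol_pos p q).le (W.resolventSymbol_le_one p q)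
    _ ≤ _ := by rw [one_mul]; exact W.resolventSymbol_le p q

/-- Since `(H + M + 1) b^(s+1) e_m = b^s e_m + ħ r`, the error at `s + 1` is `K` applied to the
error at `s`, minus `ħ K r`. As `K` is a contraction, the errors merely add up. -/
theorem exists_norm_resolvent_pow_sub_le (s : ℕ) : ∃ C, 0 ≤ C ∧ ∀ hbar k m K, 0 < hbar →
    hbar ≤ 1 → IsResolvent W.fourier (kinetic hbar (circleDual l) k) W.op W.bound K →
    ‖(K ^ s) (W.fourier m) - circleClass l (W.modulated s (hbar * (circleDual l m + k)) m)‖ ≤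
      hbar * (C * ((hbar * (circleDual l m + k)) ^ 2 / 2 + 1)⁻¹) := by
  induction s with
  | zero =>
    refine ⟨0, le_rfl, fun hbar k m K hh hh1 hK => ?_⟩
    rw [circleClass_modulated_zero, pow_zero, one_apply_eq_self, sub_self, norm_zero, zero_mul,
      mul_zero]
  | succ s ih =>
    obtain ⟨C, hC, h⟩ := ih
    obtain ⟨D, hD, hr⟩ := W.exists_norm_remainder_le s
    refine ⟨C + D, by positivity, fun hbar k m K hh hh1 hK => ?_⟩
    set p := hbar * (circleDual l m + k) with hp
    have h1 := hK.eq_of_image W.op_symm (ψ := circleClass l (W.modulated (s + 1) p m))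
      (f := circleClass l (W.modulated s p m) + (hbar : ℂ) • circleClass l (W.remainder s hbar p m))
      (W.isImage_modulated s hbar k m)
    have h2 : (K ^ (s + 1)) (W.fourier m) - circleClass l (W.modulated (s + 1) p m) =
        K ((K ^ s) (W.fourier m) - circleClass l (W.modulated s p m)) -
          (hbar : ℂ) • K (circleClass l (W.remainder s hbar p m)) := by
      rw [← h1, map_add, map_sub, map_smul, pow_succ', mul_apply_eq_comp]
      abel
    rw [h2]
    have h3 : ‖circleClass l (W.remainder s hbar p m)‖ ≤ D * (p ^ 2 / 2 + 1)⁻¹ :=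
      norm_circleClass_le W.length_pos (by positivity) fun q => hr hbar p m q hh hh1
    calc _ ≤ _ := norm_sub_le _ _
      _ ≤ hbar * (C * (p ^ 2 / 2 + 1)⁻¹) + hbar * (D * (p ^ 2 / 2 + 1)⁻¹) := by
          rw [norm_smul, Complex.norm_real, Real.norm_of_nonneg hh.le]
          exact add_le_add ((hK.norm_le _).trans (h hbar k m K hh hh1 hK))
            (mul_le_mul_of_nonneg_left ((hK.norm_le _).trans h3) hh.le)
      _ = _ := by ring

/-- The norm of `b^(s+1) e_m` and the error of the approximation both carry the factor `(p²/2 +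
1)⁻¹`, so the error of the square carries its square, which is integrable over all momenta. -/
theorem exists_abs_norm_sq_sub_le (s : ℕ) : ∃ C, 0 ≤ C ∧ ∀ hbar k m K, 0 < hbar →
    hbar ≤ 1 → IsResolvent W.fourier (kinetic hbar (circleDual l) k) W.op W.bound K →
    |‖(K ^ (s + 1)) (W.fourier m)‖ ^ 2 -
      ‖circleClass l (W.modulated (s + 1) (hbar * (circleDual l m + k)) m)‖ ^ 2| ≤
      hbar * (C * (((hbar * (circleDual l m + k)) ^ 2 / 2 + 1)⁻¹) ^ 2) := by
  obtain ⟨C, hC, h⟩ := W.exists_norm_resolvent_pow_sub_le (s + 1)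
  refine ⟨C * (2 + C), by positivity, fun hbar k m K hh hh1 hK => ?_⟩
  have h1 := h hbar k m K hh hh1 hK
  set p := hbar * (circleDual l m + k) with hp
  set c := (p ^ 2 / 2 + 1)⁻¹ with hc
  have hc0 : 0 ≤ c := by positivity
  set x := (K ^ (s + 1)) (W.fourier m)
  set y := circleClass l (W.modulated (s + 1) p m)
  have hy : ‖y‖ ≤ c := W.norm_modulated_le s p m
  have h2 : |‖x‖ - ‖y‖| ≤ hbar * (C * c) := (abs_norm_sub_norm_le x y).trans h1
  have h3 : ‖x‖ ≤ c + C * c := by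
    have := (_root_.abs_le.1 h2).2
    nlinarith [mul_nonneg hC hc0]
  rw [sq_sub_sq, abs_mul, abs_of_nonneg (by positivity : 0 ≤ ‖x‖ + ‖y‖)]
  calc (‖x‖ + ‖y‖) * |‖x‖ - ‖y‖| ≤ ((2 + C) * c) * (hbar * (C * c)) := by
        gcongr
        linarith
    _ = _ := by ring

/-- Normalized counting measure of bands times Haar measure on the Brillouin zone. -/
def bandMeasure (l hbar : ℝ) : Measure (ℕ × ℝ) :=
  ENNReal.ofReal (hbar * l) • Measure.count.prod (volume.restrict (Set.Ico 0 (2 * Real.pi / l)))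

theorem lintegral_bandMeasure {hbar : ℝ} {f : ℕ × ℝ → ℝ≥0∞} (hf : Measurable f) :
    ∫⁻ x, f x ∂(bandMeasure l hbar) = ENNReal.ofReal (hbar * l) *
      ∫⁻ k in Set.Ico 0 (2 * Real.pi / l), ∑' n, f (n, k) := by
  rw [bandMeasure, lintegral_smul_measure, lintegral_prod_symm _ hf.aemeasurable, smul_eq_mul]
  simp only [lintegral_count]

/-- The points `κ_m + k`, with `m` an integer and `k` in the Brillouin zone, fill the line once; `p
= ħ(κ_m + k)` absorbs the factor `ħ`. -/
theorem lintegral_fold {hbar : ℝ} (hl : 0 < l) (hh : 0 < hbar) (F : ℝ → ℝ≥0∞) (hF : Measurable F) :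
    ENNReal.ofReal (hbar * l) * ∫⁻ k in Set.Ico 0 (2 * Real.pi / l),
      ∑' m, F (hbar * (circleDual l m + k)) = ENNReal.ofReal l * ∫⁻ p, F p := by
  have hp : 0 < 2 * Real.pi / l := by positivity
  rw [lintegral_tsum fun m => by fun_prop, ← lintegral_comp_mul_left hh F,
    ← tsum_setLIntegral_Ico_add hp fun x => F (hbar * x), mul_comm hbar l,
    ENNReal.ofReal_mul hl.le, mul_assoc]
  congr 4 with m
  refine lintegral_congr fun k => ?_
  rw [circleDual]
  congr 1
  ring

theorem lintegral_inv_sq_lt_top : ∫⁻ p : ℝ, ENNReal.ofReal (((p ^ 2 / 2 + 1)⁻¹) ^ 2) < ⊤ := by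
  refine lt_of_le_of_lt (lintegral_mono fun p => ENNReal.ofReal_le_ofReal ?_)
    (lintegral_inv_one_add_sq.trans_lt ENNReal.ofReal_lt_top)
  rw [inv_pow]
  exact inv_anti₀ (by positivity) (by nlinarith [sq_nonneg (p ^ 2)])

/-- Phase space `ℝ × (ℝ / l ℤ)` with Liouville measure. -/
def phaseMeasure (l : ℝ) : Measure (ℝ × ℝ) := volume.prod (circleMeasure l)

theorem measurable_resolventSymbol : Measurable fun x : ℝ × ℝ => W.resolventSymbol x.1 x.2 := by
  have := W.continuous.measurable
  unfold resolventSymbol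
  fun_prop

theorem lintegral_phase_resolventSymbol_lt_top (s : ℕ) :
    ∫⁻ x, ENNReal.ofReal (W.resolventSymbol x.1 x.2 ^ (2 * (s + 1))) ∂(phaseMeasure l) < ⊤ := by
  rw [phaseMeasure, lintegral_prod _ (W.measurable_resolventSymbol.pow_const _).ennreal_ofReal.aemeasurable]
  calc _ ≤ ∫⁻ p : ℝ, ENNReal.ofReal (((p ^ 2 / 2 + 1)⁻¹) ^ 2) * ENNReal.ofReal l := by
        refine lintegral_mono fun p => ?_
        calc _ ≤ ∫⁻ _ : ℝ, ENNReal.ofReal (((p ^ 2 / 2 + 1)⁻¹) ^ 2) ∂(circleMeasure l) := by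
              refine lintegral_mono fun q => ENNReal.ofReal_le_ofReal ?_
              have h0 := (W.resolventSymbol_pos p q).le
              calc _ ≤ W.resolventSymbol p q ^ 2 :=
                    pow_le_pow_of_le_one h0 (W.resolventSymbol_le_one p q) (by omega)
                _ ≤ _ := by gcongr; exact W.resolventSymbol_le p q
          _ = _ := by
              rw [lintegral_const, Measure.restrict_apply_univ, Real.volume_Ico, sub_zero]
    _ < ⊤ := by
        rw [lintegral_mul_const _ (by fun_prop)]
        exact ENNReal.mul_lt_top lintegral_inv_sq_lt_top ENNReal.ofReal_lt_top

variable {hbar : ℝ}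

theorem measurable_energy (hh : 0 < hbar) : Measurable fun x : ℕ × ℝ => W.energy hbar x.1 x.2 :=
  measurable_from_prod_countable_right fun n => (W.continuous_energy hh n).measurable

theorem one_le_energy_add (hh : 0 < hbar) (n : ℕ) (k : ℝ) :
    1 ≤ W.energy hbar n k + (W.bound + 1) := by
  linarith [W.neg_bound_le_energy hh n k]

/-- Resolvent moments of the band energies converge to the ones of the classical energy. -/
theorem tendsto_lintegral_resolvent_pow (s : ℕ) :
    Tendsto (fun hbar => ∫⁻ x, ENNReal.ofReal
      (((W.energy hbar x.1 x.2 + (W.bound + 1))⁻¹) ^ (2 * (s + 1))) ∂(bandMeasure l hbar))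
      (𝓝[>] 0) (𝓝 (∫⁻ x, ENNReal.ofReal (W.resolventSymbol x.1 x.2 ^ (2 * (s + 1)))
        ∂(phaseMeasure l))) := by
  obtain ⟨C, hC, hCb⟩ := W.exists_abs_norm_sq_sub_le s
  set J := ∫⁻ x, ENNReal.ofReal (W.resolventSymbol x.1 x.2 ^ (2 * (s + 1))) ∂(phaseMeasure l) with hJ
  have hJtop : J < ⊤ := W.lintegral_phase_resolventSymbol_lt_top s
  set I := fun hbar => ∫⁻ x, ENNReal.ofReal
      (((W.energy hbar x.1 x.2 + (W.bound + 1))⁻¹) ^ (2 * (s + 1))) ∂(bandMeasure l hbar) with hI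
  set D := ENNReal.ofReal l * ∫⁻ p : ℝ, ENNReal.ofReal (C * ((p ^ 2 / 2 + 1)⁻¹) ^ 2) with hD
  have hDtop : D < ⊤ := by
    refine ENNReal.mul_lt_top ENNReal.ofReal_lt_top ?_
    simp_rw [ENNReal.ofReal_mul hC]
    rw [lintegral_const_mul _ (by fun_prop)]
    exact ENNReal.mul_lt_top ENNReal.ofReal_lt_top lintegral_inv_sq_lt_top
  -- The squared norm of `b^(s+1) e_m`. It depends on `m` and `k` only through `p`, which is what
  -- permits the unfolding.
  set N := fun p : ℝ => l⁻¹ * ∫ q, W.resolventSymbol p q ^ (2 * (s + 1)) ∂(circleMeasure l) with hN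
  have hNint : ∀ p, ENNReal.ofReal l * ENNReal.ofReal (N p) =
      ∫⁻ q, ENNReal.ofReal (W.resolventSymbol p q ^ (2 * (s + 1))) ∂(circleMeasure l) := by
    intro p
    have hb := W.continuous_resolventSymbol p
    rw [hN, ← ENNReal.ofReal_mul W.length_pos.le, mul_inv_cancel_left₀ W.length_pos.ne',
      ofReal_integral_eq_lintegral_ofReal]
    · refine ((hb.pow _).integrableOn_Icc (a := 0) (b := l)).mono_set Set.Ico_subset_Icc_self
    · exact Eventually.of_forall fun q => pow_nonneg (W.resolventSymbol_pos p q).le _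
  have hNmeas : Measurable fun p => ENNReal.ofReal (N p) := by
    have h1 : (fun p => ENNReal.ofReal (N p)) = fun p => (ENNReal.ofReal l)⁻¹ *
        ∫⁻ q, ENNReal.ofReal (W.resolventSymbol p q ^ (2 * (s + 1))) ∂(circleMeasure l) := by
      ext p
      rw [← hNint, ← mul_assoc, ENNReal.inv_mul_cancel (by simpa using W.length_pos) (by simp),
        one_mul]
    rw [h1]
    exact (Measurable.lintegral_prod_right'
      (W.measurable_resolventSymbol.pow_const _).ennreal_ofReal).const_mul _
  have hNJ : ENNReal.ofReal l * ∫⁻ p, ENNReal.ofReal (N p) = J := by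
    rw [← lintegral_const_mul _ hNmeas, hJ, phaseMeasure,
      lintegral_prod _ (W.measurable_resolventSymbol.pow_const _).ennreal_ofReal.aemeasurable]
    exact lintegral_congr hNint
  have key : ∀ hbar, 0 < hbar → hbar ≤ 1 → I hbar ≤ J + ENNReal.ofReal hbar * D ∧
      J ≤ I hbar + ENNReal.ofReal hbar * D := by
    intro hbar hh hh1
    set A := fun k : ℝ => ∑' n, ENNReal.ofReal
      (((W.energy hbar n k + (W.bound + 1))⁻¹) ^ (2 * (s + 1))) with hA
    set B := fun k : ℝ => ∑' m : ℤ, ENNReal.ofReal (N (hbar * (circleDual l m + k))) with hB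
    set R := fun k : ℝ => ∑' m : ℤ, ENNReal.ofReal
      (C * (((hbar * (circleDual l m + k)) ^ 2 / 2 + 1)⁻¹) ^ 2) with hR
    have hIA : I hbar = ENNReal.ofReal (hbar * l) * ∫⁻ k in Set.Ico 0 (2 * Real.pi / l), A k :=
      lintegral_bandMeasure (((W.measurable_energy hh).add_const _).inv.pow_const _).ennreal_ofReal
    have hJB : J = ENNReal.ofReal (hbar * l) * ∫⁻ k in Set.Ico 0 (2 * Real.pi / l), B k := by
      rw [← hNJ, ← lintegral_fold W.length_pos hh _ hNmeas]
    have hDR : D = ENNReal.ofReal (hbar * l) * ∫⁻ k in Set.Ico 0 (2 * Real.pi / l), R k := by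
      rw [hD, ← lintegral_fold W.length_pos hh
        (fun p => ENNReal.ofReal (C * ((p ^ 2 / 2 + 1)⁻¹) ^ 2)) (by fun_prop)]
    have hRm : Measurable R := Measurable.tsum fun m => by fun_prop
    -- For fixed `k` the eigenvalue sum `A k` is a trace; evaluated in the Fourier basis it is
    -- compared with the classical sum `B k` term by term.
    have hpt : ∀ k, A k ≤ B k + ENNReal.ofReal hbar * R k ∧ B k ≤ A k + ENNReal.ofReal hbar * R k := by
      intro k
      obtain ⟨K, hK, -⟩ := exists_isResolvent (e := W.fourier)
        (fun i => kinetic_nonneg hbar (circleDual l) k i) W.norm_op_le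
        (tendsto_atTop_of_summable_inv_sq (fun i => kinetic_nonneg hbar (circleDual l) k i)
          (summable_inv_kinetic_add_one_sq hh W.length_pos k))
      have hAK : A k = ∑' m, ENNReal.ofReal (‖(K ^ (s + 1)) (W.fourier m)‖ ^ 2) := by
        rw [← hK.tsum_pow_eq W.op_symm (W.state hbar k) (fun n => W.neg_bound_le_energy hh n k)
          (W.isEigenbasis hh k).image]
        simp only [hA, add_assoc]
      have hd : ∀ m, |‖(K ^ (s + 1)) (W.fourier m)‖ ^ 2 - N (hbar * (circleDual l m + k))| ≤
          hbar * (C * (((hbar * (circleDual l m + k)) ^ 2 / 2 + 1)⁻¹) ^ 2) := fun m => by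
        rw [hN]
        simp only
        rw [← W.norm_modulated_sq _ _ m]
        exact hCb hbar k m K hh hh1 hK
      rw [hAK, hB, hR]
      simp only
      rw [← ENNReal.tsum_mul_left, ← ENNReal.tsum_add, ← ENNReal.tsum_add]
      have hN0 : ∀ p, 0 ≤ N p := fun p => mul_nonneg (inv_nonneg.2 W.length_pos.le)
        (integral_nonneg fun q => pow_nonneg (W.resolventSymbol_pos p q).le _)
      constructor
      · refine ENNReal.tsum_le_tsum fun m => ?_
        rw [← ENNReal.ofReal_mul hh.le, ← ENNReal.ofReal_add (hN0 _) (by positivity)]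
        exact ENNReal.ofReal_le_ofReal (by linarith [(_root_.abs_le.1 (hd m)).2])
      · refine ENNReal.tsum_le_tsum fun m => ?_
        rw [← ENNReal.ofReal_mul hh.le, ← ENNReal.ofReal_add (by positivity) (by positivity)]
        exact ENNReal.ofReal_le_ofReal (by linarith [(_root_.abs_le.1 (hd m)).1])
    rw [hIA, hJB, hDR, mul_left_comm (ENNReal.ofReal hbar), ← mul_add, ← mul_add,
      ← lintegral_const_mul _ hRm, ← lintegral_add_right _ (hRm.const_mul _),
      ← lintegral_add_right _ (hRm.const_mul _)]
    exact ⟨mul_le_mul_right (lintegral_mono fun k => (hpt k).1) _,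
      mul_le_mul_right (lintegral_mono fun k => (hpt k).2) _⟩
  have h0 : Tendsto (fun hbar : ℝ => ENNReal.ofReal hbar * D) (𝓝[>] 0) (𝓝 0) := by
    have h1 : Tendsto (fun hbar : ℝ => ENNReal.ofReal hbar) (𝓝[>] 0) (𝓝 0) := by
      have := (ENNReal.continuous_ofReal.tendsto 0).mono_left (nhdsWithin_le_nhds (s := Set.Ioi 0))
      simpa using this
    simpa using ENNReal.Tendsto.mul_const h1 (Or.inr hDtop.ne)
  have hev : ∀ᶠ hbar : ℝ in 𝓝[>] 0, 0 < hbar ∧ hbar ≤ 1 := by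
    filter_upwards [Ioc_mem_nhdsGT (zero_lt_one (α := ℝ))] with h hh using hh
  refine tendsto_of_tendsto_of_tendsto_of_le_of_le'
    (g := fun hbar => J - ENNReal.ofReal hbar * D) (h := fun hbar => J + ENNReal.ofReal hbar * D)
    ?_ ?_ ?_ ?_
  · simpa using ENNReal.Tendsto.sub tendsto_const_nhds h0 (Or.inl hJtop.ne)
  · simpa using tendsto_const_nhds.add h0
  · filter_upwards [hev] with hbar h
    exact tsub_le_iff_right.2 (key hbar h.1 h.2).2
  · filter_upwards [hev] with hbar h
    exact (key hbar h.1 h.2).1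

end CirclePotential

/-- Convergence of the moments `∫ y^{s+1}` of functions with values in `(0, 1]` implies convergence
of `∫ y g(y)` for every continuous `g`. -/
theorem tendsto_integral_mul_comp_of_moments {ι : Type*} {α β : Type} [MeasurableSpace α]
    [MeasurableSpace β] {F : Filter ι} {μ : ι → Measure α} {ν : Measure β} {Y : ι → α → ℝ} {Z : β → ℝ}
    (hY : ∀ᶠ i in F, Measurable (Y i) ∧ ∀ x, Y i x ∈ Set.Ioc (0 : ℝ) 1) (hZ : Measurable Z)
    (hZ1 : ∀ x, Z x ∈ Set.Ioc (0 : ℝ) 1)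
    (hfin : ∫⁻ x, ENNReal.ofReal (Z x) ∂ν < ⊤)
    (h : ∀ s : ℕ, Tendsto (fun i => ∫⁻ x, ENNReal.ofReal (Y i x ^ (s + 1)) ∂(μ i)) F
      (𝓝 (∫⁻ x, ENNReal.ofReal (Z x ^ (s + 1)) ∂ν)))
    {g : ℝ → ℝ} (hg : ContinuousOn g (Set.Icc 0 1)) :
    Tendsto (fun i => ∫ x, Y i x * g (Y i x) ∂(μ i)) F (𝓝 (∫ x, Z x * g (Z x) ∂ν)) := by
  have hpow : ∀ y ∈ Set.Ioc (0 : ℝ) 1, ∀ s : ℕ, ‖y ^ (s + 1)‖ ≤ y := fun y hy s => by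
    rw [Real.norm_of_nonneg (pow_nonneg hy.1.le _)]
    simpa using pow_le_pow_of_le_one hy.1.le hy.2 (Nat.le_add_left 1 s)
  have hintZ : Integrable Z ν := ⟨hZ.aestronglyMeasurable, by
    rw [hasFiniteIntegral_iff_ofReal (Eventually.of_forall fun x => (hZ1 x).1.le)]; exact hfin⟩
  have hlt : ∀ᶠ i in F, ∫⁻ x, ENNReal.ofReal (Y i x) ∂(μ i) < ⊤ := by
    have := h 0
    simp only [zero_add, pow_one] at this
    exact this.eventually (gt_mem_nhds hfin)
  have hintY : ∀ᶠ i in F, Integrable (Y i) (μ i) := by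
    filter_upwards [hY, hlt] with i h1 h2
    exact ⟨h1.1.aestronglyMeasurable, by
      rw [hasFiniteIntegral_iff_ofReal (Eventually.of_forall fun x => (h1.2 x).1.le)]; exact h2⟩
  have hpZ : ∀ s : ℕ, Integrable (fun x => Z x ^ (s + 1)) ν := fun s =>
    hintZ.mono' (hZ.pow_const _).aestronglyMeasurable
      (Eventually.of_forall fun x => hpow _ (hZ1 x) s)
  have hpY : ∀ᶠ i in F, ∀ s : ℕ, Integrable (fun x => Y i x ^ (s + 1)) (μ i) := by
    filter_upwards [hY, hintY] with i h1 h2 s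
    exact h2.mono' (h1.1.pow_const _).aestronglyMeasurable
      (Eventually.of_forall fun x => hpow _ (h1.2 x) s)
  have hmom : ∀ s : ℕ, Tendsto (fun i => ∫ x, Y i x ^ (s + 1) ∂(μ i)) F
      (𝓝 (∫ x, Z x ^ (s + 1) ∂ν)) := by
    intro s
    have h1 := (ENNReal.tendsto_toReal (((hpZ s).lintegral_lt_top).ne)).comp (h s)
    rw [← integral_eq_lintegral_of_nonneg_ae (Eventually.of_forall fun x =>
      pow_nonneg (hZ1 x).1.le _) (hZ.pow_const _).aestronglyMeasurable] at h1
    refine h1.congr' ?_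
    filter_upwards [hY] with i h2
    rw [Function.comp_apply, ← integral_eq_lintegral_of_nonneg_ae (Eventually.of_forall fun x =>
      pow_nonneg (h2.2 x).1.le _) (h2.1.pow_const _).aestronglyMeasurable]
  have hpoly : ∀ P : Polynomial ℝ, Tendsto (fun i => ∫ x, Y i x * P.eval (Y i x) ∂(μ i)) F
      (𝓝 (∫ x, Z x * P.eval (Z x) ∂ν)) := by
    intro P
    have e : ∀ y : ℝ, y * P.eval y = ∑ s ∈ Finset.range (P.natDegree + 1), P.coeff s * y ^ (s + 1) :=
      fun y => by
        rw [Polynomial.eval_eq_sum_range, Finset.mul_sum]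
        exact Finset.sum_congr rfl fun s _ => by ring
    simp only [e]
    rw [integral_finsetSum _ fun s _ => (hpZ s).const_mul _]
    simp only [integral_const_mul]
    refine (tendsto_finsetSum _ fun s _ => (hmom s).const_mul (P.coeff s)).congr' ?_
    filter_upwards [hpY] with i h1
    rw [integral_finsetSum _ fun s _ => (h1 s).const_mul _]
    simp only [integral_const_mul]
  have hpolyZ : ∀ P : Polynomial ℝ, Integrable (fun x => Z x * P.eval (Z x)) ν := fun P => by
    obtain ⟨C, hC⟩ := isCompact_Icc.exists_bound_of_continuousOn (P.continuousOn (s := Set.Icc (0 : ℝ) 1))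
    exact hintZ.mul_bdd (P.continuous.measurable.comp hZ).aestronglyMeasurable
      (Eventually.of_forall fun x => hC _ (Set.Ioc_subset_Icc_self (hZ1 x)))
  have hpolyY : ∀ᶠ i in F, ∀ P : Polynomial ℝ,
      Integrable (fun x => Y i x * P.eval (Y i x)) (μ i) := by
    filter_upwards [hY, hintY] with i h1 h2 P
    obtain ⟨C, hC⟩ := isCompact_Icc.exists_bound_of_continuousOn (P.continuousOn (s := Set.Icc (0 : ℝ) 1))
    exact h2.mul_bdd (P.continuous.measurable.comp h1.1).aestronglyMeasurable
      (Eventually.of_forall fun x => hC _ (Set.Ioc_subset_Icc_self (h1.2 x)))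
  have hgmeas : ∀ {γ : Type} [MeasurableSpace γ] {X : γ → ℝ}, Measurable X →
      (∀ x, X x ∈ Set.Ioc (0 : ℝ) 1) → Measurable fun x => g (X x) := by
    intro γ _ X hX hX1
    have h1 : Measurable fun y : Set.Icc (0 : ℝ) 1 => g y :=
      (continuousOn_iff_continuous_domRestrict.1 hg).measurable
    exact h1.comp (hX.subtype_mk (h := fun x => Set.Ioc_subset_Icc_self (hX1 x)))
  obtain ⟨Cg, hCg⟩ := isCompact_Icc.exists_bound_of_continuousOn hg
  have hgZ : Integrable (fun x => Z x * g (Z x)) ν :=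
    hintZ.mul_bdd (hgmeas hZ hZ1).aestronglyMeasurable
      (Eventually.of_forall fun x => hCg _ (Set.Ioc_subset_Icc_self (hZ1 x)))
  have hgY : ∀ᶠ i in F, Integrable (fun x => Y i x * g (Y i x)) (μ i) := by
    filter_upwards [hY, hintY] with i h1 h2
    exact h2.mul_bdd (hgmeas h1.1 h1.2).aestronglyMeasurable
      (Eventually.of_forall fun x => hCg _ (Set.Ioc_subset_Icc_self (h1.2 x)))
  have hclose : ∀ {γ : Type} [MeasurableSpace γ] {ρ : Measure γ} {X : γ → ℝ} {P : Polynomial ℝ}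
      {δ : ℝ}, 0 ≤ δ → (∀ y ∈ Set.Icc (0 : ℝ) 1, |P.eval y - g y| < δ) →
      (∀ x, X x ∈ Set.Ioc (0 : ℝ) 1) → Integrable X ρ →
      Integrable (fun x => X x * P.eval (X x)) ρ → Integrable (fun x => X x * g (X x)) ρ →
      |∫ x, X x * P.eval (X x) ∂ρ - ∫ x, X x * g (X x) ∂ρ| ≤ δ * ∫ x, X x ∂ρ := by
    intro γ _ ρ X P δ hδ hP hX1 hX hXP hXg
    rw [← integral_sub hXP hXg, ← integral_const_mul, ← Real.norm_eq_abs]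
    refine norm_integral_le_of_norm_le (hX.const_mul δ) (Eventually.of_forall fun x => ?_)
    rw [← mul_sub, norm_mul, Real.norm_of_nonneg (hX1 x).1.le, mul_comm]
    exact mul_le_mul_of_nonneg_right (hP _ (Set.Ioc_subset_Icc_self (hX1 x))).le (hX1 x).1.le
  rw [Metric.tendsto_nhds]
  intro ε hε
  set J := ∫ x, Z x ∂ν with hJ
  have hJ0 : 0 ≤ J := integral_nonneg fun x => (hZ1 x).1.le
  -- Replacing `g` by a polynomial within `δ` on `[0, 1]` costs at most `δ ∫ Y` and `δ ∫ Z`. The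
  -- first moments are eventually below `J + 1`, so each replacement costs less than `ε / 4`.
  set δ := ε / (4 * (J + 1)) with hδ
  have hδ0 : 0 < δ := by positivity
  obtain ⟨P, hP⟩ := exists_polynomial_near_of_continuousOn 0 1 g hg δ hδ0
  have hJY : ∀ᶠ i in F, ∫ x, Y i x ∂(μ i) < J + 1 := by
    have := hmom 0
    simp only [zero_add, pow_one] at this
    exact this.eventually (gt_mem_nhds (lt_add_one J))
  filter_upwards [hY, hintY, hpolyY, hgY, hJY, Metric.tendsto_nhds.1 (hpoly P) (ε / 2) (by positivity)]
    with i h1 h2 h3 h4 h5 h6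
  have c1 := hclose hδ0.le hP h1.2 h2 (h3 P) h4
  have c2 := hclose hδ0.le hP hZ1 hintZ (hpolyZ P) hgZ
  have c3 : δ * (J + 1) = ε / 4 := by rw [hδ]; field_simp
  have c4 : δ * ∫ x, Y i x ∂(μ i) < ε / 4 := by
    rw [← c3]; exact mul_lt_mul_of_pos_left h5 hδ0
  have c5 : δ * J < ε / 4 := by
    rw [← c3]; exact mul_lt_mul_of_pos_left (lt_add_one J) hδ0
  rw [Real.dist_eq] at h6 ⊢
  rw [abs_lt] at h6 ⊢
  have d1 := abs_le.1 c1
  have d2 := abs_le.1 c2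
  constructor <;> linarith

/-! ### Weyl law for the energies -/

namespace CirclePotential

variable {l : ℝ} (W : CirclePotential l) {hbar : ℝ}

/-- The classical energy. -/
def classicalEnergy (x : ℝ × ℝ) : ℝ := x.1 ^ 2 / 2 + W.toFun x.2

theorem continuous_classicalEnergy : Continuous W.classicalEnergy := by
  have := W.continuous
  unfold classicalEnergy
  fun_prop

theorem one_le_classicalEnergy_add (x : ℝ × ℝ) : 1 ≤ W.classicalEnergy x + (W.bound + 1) :=
  (le_add_of_nonneg_left (by positivity)).trans (W.one_add_le x.1 x.2)

/-- The substitution `y = (E + c)⁻²`, with inverse `E = 1/√y - c`, writes `g E` in the form `y *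
(…)` required by the moment theorem. -/
theorem rpow_identity {c E : ℝ} (h : 1 ≤ E + c) (g : ℝ → ℝ) :
    ((E + c)⁻¹) ^ 2 * ((((E + c)⁻¹) ^ 2)⁻¹ * g ((√(((E + c)⁻¹) ^ 2))⁻¹ - c)) = g E := by
  have h0 : 0 < E + c := by linarith
  rw [Real.sqrt_sq (by positivity), inv_inv, add_sub_cancel_right, ← mul_assoc,
    mul_inv_cancel₀ (by positivity), one_mul]

/-- The point `y = 0` corresponds to infinite energy. There the expression has value 0, because `0⁻¹
= 0`, and decay of `g` faster than `(E + c)⁻²` is exactly continuity at this point. -/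
theorem continuousOn_inv_mul_comp {c : ℝ} {g : ℝ → ℝ} (hg : Continuous g)
    (hlim : Tendsto (fun E => (E + c) ^ 2 * g E) atTop (𝓝 0)) :
    ContinuousOn (fun y : ℝ => y⁻¹ * g ((√y)⁻¹ - c)) (Set.Icc 0 1) := by
  intro y hy
  rcases hy.1.eq_or_lt with h | h
  · subst h
    refine ContinuousWithinAt.mono ?_ Set.Icc_subset_Ici_self
    rw [← continuousWithinAt_Ioi_iff_Ici, ContinuousWithinAt, inv_zero, zero_mul]
    have h1 : Tendsto (fun y : ℝ => (√y)⁻¹ - c) (𝓝[>] 0) atTop := by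
      refine tendsto_atTop_add_const_right _ (-c) (tendsto_inv_nhdsGT_zero.comp ?_)
      refine tendsto_nhdsWithin_iff.2 ⟨?_, ?_⟩
      · have := (Real.continuous_sqrt.tendsto 0).mono_left (nhdsWithin_le_nhds (s := Set.Ioi 0))
        simpa using this
      · filter_upwards [self_mem_nhdsWithin] with y hy using Real.sqrt_pos.2 hy
    refine (hlim.comp h1).congr' ?_
    filter_upwards [self_mem_nhdsWithin] with y hy
    rw [Function.comp_apply, sub_add_cancel, inv_pow, Real.sq_sqrt (le_of_lt hy)]
  · refine ContinuousAt.continuousWithinAt ?_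
    refine (continuousAt_inv₀ h.ne').mul (hg.continuousAt.comp ?_)
    exact ((Real.continuous_sqrt.continuousAt).inv₀ (Real.sqrt_pos.2 h).ne').sub continuousAt_const

theorem integrable_resolvent_phase :
    Integrable (fun x => ((W.classicalEnergy x + (W.bound + 1))⁻¹) ^ 2) (phaseMeasure l) := by
  refine ⟨(((W.continuous_classicalEnergy.measurable.add_const _).inv).pow_const
    2).aestronglyMeasurable, ?_⟩
  rw [hasFiniteIntegral_iff_ofReal (Eventually.of_forall fun x => sq_nonneg _)]
  exact W.lintegral_phase_resolventSymbol_lt_top 0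

/-- Weyl asymptotics: convergence of the energy distribution. -/
theorem tendsto_integral_energy {g : ℝ → ℝ} (hg : Continuous g)
    (hlim : Tendsto (fun E => (E + (W.bound + 1)) ^ 2 * g E) atTop (𝓝 0)) :
    Tendsto (fun hbar => ∫ x, g (W.energy hbar x.1 x.2) ∂(bandMeasure l hbar)) (𝓝[>] 0)
      (𝓝 (∫ x, g (W.classicalEnergy x) ∂(phaseMeasure l))) := by
  have hmem : ∀ E : ℝ, 1 ≤ E + (W.bound + 1) →
      ((E + (W.bound + 1))⁻¹) ^ 2 ∈ Set.Ioc (0 : ℝ) 1 := fun E hE => by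
    have h0 : 0 < E + (W.bound + 1) := by linarith
    exact ⟨by positivity, pow_le_one₀ (by positivity) (inv_le_one_of_one_le₀ hE)⟩
  have hm : Measurable fun x => ((W.classicalEnergy x + (W.bound + 1))⁻¹) ^ 2 :=
    ((W.continuous_classicalEnergy.measurable.add_const _).inv).pow_const 2
  have h := tendsto_integral_mul_comp_of_moments (F := 𝓝[>] (0 : ℝ))
    (μ := fun hbar => bandMeasure l hbar) (ν := phaseMeasure l)
    (Y := fun hbar x => ((W.energy hbar x.1 x.2 + (W.bound + 1))⁻¹) ^ 2)
    (Z := fun x => ((W.classicalEnergy x + (W.bound + 1))⁻¹) ^ 2) (by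
      filter_upwards [self_mem_nhdsWithin] with hbar hh
      exact ⟨(((W.measurable_energy hh).add_const _).inv).pow_const 2,
        fun x => hmem _ (W.one_le_energy_add hh _ _)⟩) hm
    (fun x => hmem _ (W.one_le_classicalEnergy_add x)) (W.lintegral_phase_resolventSymbol_lt_top 0)
    (fun s => by
      simp only [← pow_mul]
      exact W.tendsto_lintegral_resolvent_pow s) (continuousOn_inv_mul_comp hg hlim)
  simp only [rpow_identity (W.one_le_classicalEnergy_add _)] at h
  refine h.congr' ?_
  filter_upwards [self_mem_nhdsWithin] with hbar hh
  simp only [rpow_identity (W.one_le_energy_add hh _ _)]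

end CirclePotential

/-! ### Absolutely convergent Fourier series -/

section FourierSeries

open InnerProductSpace

variable {l : ℝ}

/-- The sum of an absolutely convergent Fourier series. -/
def fourierSum (l : ℝ) (x : ℤ → ℂ) (q : ℝ) : ℂ := ∑' m, x m * circleFun l m q

theorem norm_mul_circleFun (x : ℤ → ℂ) (m : ℤ) (q : ℝ) :
    ‖x m * circleFun l m q‖ = ‖x m‖ * (√l)⁻¹ := by rw [norm_mul, norm_circleFun]

theorem hasSum_fourierSum {x : ℤ → ℂ} (hx : Summable fun m => ‖x m‖) (q : ℝ) :
    HasSum (fun m => x m * circleFun l m q) (fourierSum l x q) := by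
  refine Summable.hasSum (Summable.of_norm ?_)
  simp only [norm_mul_circleFun]
  exact hx.mul_right _

theorem continuous_fourierSum {x : ℤ → ℂ} (hx : Summable fun m => ‖x m‖) :
    Continuous (fourierSum l x) :=
  continuous_tsum (fun m => continuous_const.mul (continuous_circleFun l m)) (hx.mul_right (√l)⁻¹)
    fun m q => (norm_mul_circleFun x m q).le

theorem fourierSum_add_period (hl : 0 < l) (x : ℤ → ℂ) (q : ℝ) :
    fourierSum l x (q + l) = fourierSum l x q := by
  simp only [fourierSum, circleFun_add_period hl]

theorem fourierSum_const_mul (c : ℂ) (x : ℤ → ℂ) (q : ℝ) :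
    fourierSum l (fun m => c * x m) q = c * fourierSum l x q := by
  simp only [fourierSum, mul_assoc, tsum_mul_left]

theorem fourierSum_add {x y : ℤ → ℂ} (hx : Summable fun m => ‖x m‖) (hy : Summable fun m => ‖y m‖)
    (q : ℝ) : fourierSum l (fun m => x m + y m) q = fourierSum l x q + fourierSum l y q := by
  have h := (hasSum_fourierSum (l := l) hx q).add (hasSum_fourierSum (l := l) hy q)
  simp only [← add_mul] at h
  exact h.tsum_eq

theorem hasDerivAt_fourierSum {x : ℤ → ℂ} (hx : Summable fun m => ‖x m‖)
    (hx' : Summable fun m => ‖(circleDual l m : ℂ) * Complex.I * x m‖) (q : ℝ) :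
    HasDerivAt (fourierSum l x)
      (fourierSum l (fun m => (circleDual l m : ℂ) * Complex.I * x m) q) q := by
  refine hasDerivAt_tsum (g := fun m q => x m * circleFun l m q)
    (g' := fun m q => (circleDual l m : ℂ) * Complex.I * x m * circleFun l m q)
    (hx'.mul_right (√l)⁻¹) (fun m y => ?_)
    (fun m y => (norm_mul_circleFun (fun m => (circleDual l m : ℂ) * Complex.I * x m) m y).le)
    (hasSum_fourierSum hx q).summable q
  refine ((hasDerivAt_circleFun l m y).const_mul (x m)).congr_deriv ?_
  rw [circleDual]
  ring

theorem inner_circleBasis_fourierSum (hl : 0 < l) {x : ℤ → ℂ} (hx : Summable fun m => ‖x m‖)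
    (n : ℤ) : ⟪circleBasis hl n, circleClass l ⟨fourierSum l x, continuous_fourierSum hx⟩⟫_ℂ =
      x n := by
  rw [inner_circleBasis_circleClass]
  have h1 : ∀ m : ℤ, ∫ q, conj (circleFun l n q) * (x m * circleFun l m q) ∂(circleMeasure l) =
      if m = n then x n else 0 := by
    intro m
    have h2 : ⟪circleBasis hl n, circleBasis hl m⟫_ℂ =
        ∫ q, conj (circleFun l n q) * circleFun l m q ∂(circleMeasure l) := by
      rw [inner_circleBasis]
      refine integral_congr_ae ?_
      filter_upwards [circleBasis_ae hl m] with q hq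
      rw [hq]
    simp only [mul_left_comm]
    rw [integral_const_mul, ← h2, orthonormal_iff_ite.1 (circleBasis hl).orthonormal]
    by_cases h : n = m
    · subst h; simp
    · simp [h, Ne.symm h]
  have h3 := hasSum_integral_of_summable_integral_norm (μ := circleMeasure l)
    (F := fun (m : ℤ) q => conj (circleFun l n q) * (x m * circleFun l m q)) (fun m => by
      have h1 := continuous_circleFun l n
      have h2 := continuous_circleFun l m
      exact ((Complex.continuous_conj.comp h1).mul
        (continuous_const.mul h2)).integrableOn_Icc.mono_set Set.Ico_subset_Icc_self) (by
      have h4 : ∀ m : ℤ, ∫ q, ‖conj (circleFun l n q) * (x m * circleFun l m q)‖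
          ∂(circleMeasure l) = ‖x m‖ * (l * ((√l)⁻¹ * (√l)⁻¹)) := by
        intro m
        simp only [norm_mul, RCLike.norm_conj, norm_circleFun]
        rw [integral_const, measureReal_restrict_apply_univ, Real.volume_real_Ico_of_le hl.le]
        simp only [sub_zero, smul_eq_mul]
        ring
      simp only [h4]
      exact hx.mul_right _)
  simp only [h1] at h3
  have h5 := (hasSum_ite_eq n (x n)).unique h3
  rw [h5]
  refine integral_congr_ae (Eventually.of_forall fun q => ?_)
  simp only
  rw [tsum_mul_left]
  rfl

end FourierSeries

/-! ### Eigenfunctions as solutions of the Schrödinger equation -/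

section BlochSolution

open InnerProductSpace

/-- `Ψ` is a normalized solution of `-(ħ²/2) Ψ'' + W Ψ = E Ψ` with derivative `Φ`, satisfying the
quasiperiodic boundary conditions with quasimomentum `k`. -/
structure IsBlochSolution (W : ℝ → ℝ) (l hbar k E : ℝ) (Ψ Φ : ℝ → ℂ) : Prop where
  continuous_fst : Continuous Ψ
  continuous_snd : Continuous Φ
  hasDerivAt_fst : ∀ q, HasDerivAt Ψ (Φ q) q
  hasDerivAt_snd : ∀ q ∈ Set.Ioo 0 l, HasDerivAt Φ ((2 / hbar ^ 2 * (W q - E) : ℝ) * Ψ q) q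
  boundary_fst : Ψ l = Complex.exp ((k * l : ℝ) * Complex.I) * Ψ 0
  boundary_snd : Φ l = Complex.exp ((k * l : ℝ) * Complex.I) * Φ 0
  normalized : ∫ q in (0 : ℝ)..l, ‖Ψ q‖ ^ 2 = 1

namespace CirclePotential

variable {l : ℝ} (W : CirclePotential l) {hbar k E : ℝ} {ψ : CircleL2 l}

theorem summable_inv_one_add_sq (hh : 0 < hbar) (hl : 0 < l) (k : ℝ) :
    Summable fun m : ℤ => (1 + (hbar * (circleDual l m + k)) ^ 2)⁻¹ := by
  have hp : 0 < hbar * (2 * Real.pi / l) := by positivity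
  have h := ENNReal.summable_toReal ((tsum_inv_one_add_sq_le hp (hbar * k)).trans_lt
    ENNReal.ofReal_lt_top).ne
  refine (h.mul_left (hbar * (2 * Real.pi / l))⁻¹).congr fun m => ?_
  rw [ENNReal.toReal_ofReal (by positivity), inv_mul_cancel_left₀ hp.ne', circleDual]
  congr 3
  ring

/-- The eigenvalue equation makes the coefficients square-summable with weight `1 + P²` inside the
norm. Pairing with the square-summable sequence `(1 + |P|) / (1 + P²)` gives absolute summability
with weight `1 + |P|`, enough for a once differentiable Fourier series. -/
theorem summable_coeff (hh : 0 < hbar)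
    (h : IsImage W.fourier (kinetic hbar (circleDual l) k) W.op ψ ((E : ℂ) • ψ)) :
    Summable fun m => (1 + |hbar * (circleDual l m + k)|) * ‖⟪W.fourier m, ψ⟫_ℂ‖ := by
  -- The added `½ ψ` makes the coefficient of this vector exactly `(1 + P²)/2` times that of `ψ`.
  have h1 : Summable fun m => ‖⟪W.fourier m, (E : ℂ) • ψ - W.op ψ + (1 / 2 : ℂ) • ψ⟫_ℂ‖ ^ 2 :=
    (hasSum_sq_norm_inner W.fourier _).summable
  have h2 := summable_inv_one_add_sq hh W.length_pos k
  refine (h1.add (h2.mul_left 4)).of_nonneg_of_le (fun m => by positivity) fun m => ?_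
  set P := hbar * (circleDual l m + k) with hP
  have e1 : ⟪W.fourier m, (E : ℂ) • ψ - W.op ψ + (1 / 2 : ℂ) • ψ⟫_ℂ =
      (((1 + P ^ 2) / 2 : ℝ) : ℂ) * ⟪W.fourier m, ψ⟫_ℂ := by
    rw [inner_add_right, inner_sub_right, ← h m, add_sub_cancel_right, inner_smul_right, kinetic,
      Real.norm_eq_abs, sq_abs, smul_eq_mul, ← hP]
    push_cast
    ring
  rw [e1, norm_mul, Complex.norm_real, Real.norm_of_nonneg (by positivity)]
  set c := ‖⟪W.fourier m, ψ⟫_ℂ‖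
  set y := (1 + P ^ 2) * c / 2
  have hy : (1 + P ^ 2) / 2 * c = y := by ring
  rw [hy]
  have hc : c = 2 * y * (1 + P ^ 2)⁻¹ := by
    simp only [y]; field_simp
  set z := (1 + |P|) * (1 + P ^ 2)⁻¹ with hz
  have hz2 : z ^ 2 ≤ 2 * (1 + P ^ 2)⁻¹ := by
    rw [hz, mul_pow, inv_pow, ← div_eq_mul_inv, ← div_eq_mul_inv, div_le_div_iff₀ (by positivity)
      (by positivity)]
    nlinarith [sq_nonneg (|P| - 1), sq_abs P, mul_nonneg (sq_nonneg (|P| - 1)) (by positivity :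
      0 ≤ 1 + P ^ 2)]
  calc (1 + |P|) * c = 2 * y * z := by rw [hc, hz]; ring
    _ ≤ y ^ 2 + z ^ 2 := two_mul_le_add_sq y z
    _ ≤ _ := by linarith [(by positivity : 0 ≤ (1 + P ^ 2)⁻¹)]

/-- Eigenfunctions on the circle are classical solutions of the Schrödinger equation, and their
mean momentum is the integral of the current density. -/
theorem exists_isBlochSolution (hh : 0 < hbar) (hψ : ‖ψ‖ = 1)
    (h : IsImage W.fourier (kinetic hbar (circleDual l) k) W.op ψ ((E : ℂ) • ψ)) :
    ∃ Ψ Φ, IsBlochSolution W.toFun l hbar k E Ψ Φ ∧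
      meanMomentum W.fourier hbar (circleDual l) k ψ =
        ∫ q in (0 : ℝ)..l, hbar * (conj (Ψ q) * Φ q).im := by
  have hl := W.length_pos
  set c := fun m => ⟪W.fourier m, ψ⟫_ℂ with hcdef
  have hs := W.summable_coeff hh h
  have hc : Summable fun m => ‖c m‖ := hs.of_nonneg_of_le (fun m => norm_nonneg _) fun m =>
    le_mul_of_one_le_left (norm_nonneg _) (by linarith [abs_nonneg (hbar * (circleDual l m + k))])
  have hpc : Summable fun m => ‖(((circleDual l m + k : ℝ) : ℂ) * Complex.I) * c m‖ := by
    refine (hs.mul_left hbar⁻¹).of_nonneg_of_le (fun m => norm_nonneg _) fun m => ?_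
    rw [norm_mul, norm_mul, Complex.norm_I, mul_one, Complex.norm_real, Real.norm_eq_abs, abs_mul,
      abs_of_pos hh]
    rw [← mul_assoc]
    gcongr
    rw [mul_add, inv_mul_cancel_left₀ hh.ne']
    have : 0 ≤ hbar⁻¹ * 1 := by positivity
    linarith
  have hκc : Summable fun m => ‖(circleDual l m : ℂ) * Complex.I * c m‖ := by
    refine (hpc.add (hc.mul_left |k|)).of_nonneg_of_le (fun m => norm_nonneg _) fun m => ?_
    have e : (circleDual l m : ℂ) * Complex.I * c m =
        (((circleDual l m + k : ℝ) : ℂ) * Complex.I) * c m - (k * Complex.I) * c m := by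
      push_cast; ring
    rw [e]
    refine (norm_sub_le _ _).trans_eq ?_
    rw [norm_mul (k * Complex.I : ℂ), norm_mul (k : ℂ), Complex.norm_I, mul_one, Complex.norm_real,
      Real.norm_eq_abs]
  -- `F` represents `ψ` and `G` represents `(d/dq + ik) ψ`. Multiplication by `z = exp(ikq)` turns
  -- this into an ordinary derivative and shifts `k` into the boundary condition.
  set F := fourierSum l c with hF
  set G := fourierSum l fun m => (((circleDual l m + k : ℝ) : ℂ) * Complex.I) * c m with hG
  have hFc : Continuous F := continuous_fourierSum hc
  have hGc : Continuous G := continuous_fourierSum hpc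
  set z := fun q : ℝ => Complex.exp ((k * q : ℝ) * Complex.I) with hz
  have hzc : Continuous z := by fun_prop
  have hzn : ∀ q, ‖z q‖ = 1 := fun q => Complex.norm_exp_ofReal_mul_I _
  have hzd : ∀ q, HasDerivAt z (k * Complex.I * z q) q := fun q => by
    have h1 : HasDerivAt (fun q : ℝ => ((k * q : ℝ) : ℂ) * Complex.I) (k * Complex.I) q := by
      have := ((hasDerivAt_id q).const_mul k).ofReal_comp.mul_const Complex.I
      simpa using this
    refine h1.cexp.congr_deriv ?_
    rw [mul_comm]
  have hFψ : circleClass l ⟨F, hFc⟩ = ψ :=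
    hilbertBasis_ext W.fourier fun m => inner_circleBasis_fourierSum hl hc m
  have hψae : ψ =ᵐ[circleMeasure l] F := by
    conv_lhs => rw [← hFψ]
    exact circleClass_ae _
  set Ψ := fun q => z q * F q with hΨ
  set Φ := fun q => z q * G q with hΦ
  have hΨd : ∀ q, HasDerivAt Ψ (Φ q) q := by
    intro q
    refine ((hzd q).mul (hasDerivAt_fourierSum hc hκc q)).congr_deriv ?_
    have e : G q = fourierSum l (fun m => (circleDual l m : ℂ) * Complex.I * c m) q +
        k * Complex.I * F q := by
      rw [hG, hF, ← fourierSum_const_mul, ← fourierSum_add hκc]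
      · congr 1
        ext m
        push_cast
        ring
      · simp only [norm_mul]
        exact hc.mul_left _
    rw [hΦ]
    simp only
    rw [e]
    ring
  -- The Fourier series of the second derivative need not converge absolutely, so the equation is
  -- first obtained in integrated form. Parseval pairs the `L²` class of the second derivative with
  -- the indicator of `(0, q]` times `conj z`; termwise integration reassembles the absolutely
  -- convergent series of `G` at `q` and at `0`.
  have hint : ∀ q ∈ Set.Icc 0 l, Φ q = Φ 0 + ∫ t in (0 : ℝ)..q,
      ((2 / hbar ^ 2 * (W.toFun t - E) : ℝ) : ℂ) * Ψ t := by
    intro q hq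
    set g : CircleL2 l := (2 / hbar ^ 2 : ℂ) • (W.op ψ - (E : ℂ) • ψ) with hg
    set χ : ℝ → ℂ := (Set.Ioc 0 q).indicator fun t => conj (z t) with hχ
    have hχm : MemLp χ 2 (circleMeasure l) := by
      refine MemLp.of_bound ((Complex.continuous_conj.comp hzc).measurable.indicator
        measurableSet_Ioc).aestronglyMeasurable 1 (Eventually.of_forall fun t => ?_)
      refine (norm_indicator_le_norm_self _ _).trans ?_
      rw [RCLike.norm_conj, hzn]
    have hpair : ∀ (f : CircleL2 l) (f' : ℝ → ℂ), f =ᵐ[circleMeasure l] f' →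
        ⟪hχm.toLp, f⟫_ℂ = ∫ t in (0 : ℝ)..q, z t * f' t := by
      intro f f' hf
      rw [inner_eq_integral]
      have h1 : ∫ t, conj ((hχm.toLp χ : ℝ → ℂ) t) * f t ∂(circleMeasure l) =
          ∫ t, (Set.Ioc 0 q).indicator (fun t => z t * f' t) t ∂(circleMeasure l) := by
        refine integral_congr_ae ?_
        filter_upwards [hχm.coeFn_toLp, hf] with t h1 h2
        rw [h1, h2, hχ]
        by_cases ht : t ∈ Set.Ioc 0 q
        · rw [Set.indicator_of_mem ht, Set.indicator_of_mem ht, Complex.conj_conj]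
        · rw [Set.indicator_of_notMem ht, Set.indicator_of_notMem ht, map_zero, zero_mul]
      rw [h1, intervalIntegral_eq_circle hl, intervalIntegral.integral_of_le hl.le,
        setIntegral_indicator measurableSet_Ioc, intervalIntegral.integral_of_le hq.1,
        Set.inter_eq_right.2 (Set.Ioc_subset_Ioc_right hq.2)]
    have hgae : g =ᵐ[circleMeasure l] fun t => ((2 / hbar ^ 2 * (W.toFun t - E) : ℝ) : ℂ) * F t := by
      have e1 := Lp.coeFn_smul (2 / hbar ^ 2 : ℂ) (W.op ψ - (E : ℂ) • ψ)
      have e2 := Lp.coeFn_sub (W.op ψ) ((E : ℂ) • ψ)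
      have e3 := Lp.coeFn_smul (E : ℂ) ψ
      have e4 := mulOp_ae (μ := circleMeasure l) W.continuous.aestronglyMeasurable W.bound_nonneg
        W.abs_le ψ
      filter_upwards [e1, e2, e3, e4, hψae] with t e1 e2 e3 e4 e5
      rw [e1, Pi.smul_apply, e2, Pi.sub_apply, e3, Pi.smul_apply, op, e4, e5, smul_eq_mul,
        smul_eq_mul]
      push_cast
      ring
    have h1 := W.fourier.hasSum_inner_mul_inner (hχm.toLp χ) g
    rw [hpair g _ hgae] at h1
    have h2 : ∀ m, ⟪hχm.toLp χ, W.fourier m⟫_ℂ * ⟪W.fourier m, g⟫_ℂ =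
        z q * ((((circleDual l m + k : ℝ) : ℂ) * Complex.I) * c m * circleFun l m q) -
        z 0 * ((((circleDual l m + k : ℝ) : ℂ) * Complex.I) * c m * circleFun l m 0) := by
      intro m
      have e1 : ⟪W.fourier m, g⟫_ℂ = -((circleDual l m + k : ℝ) : ℂ) ^ 2 * c m := by
        have hm := h m
        rw [hg, inner_smul_right, inner_sub_right, ← hm, kinetic, Real.norm_eq_abs, sq_abs,
          smul_eq_mul]
        have : (hbar : ℂ) ≠ 0 := by exact_mod_cast hh.ne'
        push_cast
        field_simp
        ring
      have e2 : ∀ t, HasDerivAt (fun t => z t * circleFun l m t)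
          ((((circleDual l m + k : ℝ) : ℂ) * Complex.I) * (z t * circleFun l m t)) t := fun t => by
        refine ((hzd t).mul (hasDerivAt_circleFun l m t)).congr_deriv ?_
        rw [circleDual]
        push_cast
        ring
      have e3 : ∫ t in (0 : ℝ)..q, (((circleDual l m + k : ℝ) : ℂ) * Complex.I) *
          (z t * circleFun l m t) = z q * circleFun l m q - z 0 * circleFun l m 0 := by
        refine intervalIntegral.integral_eq_sub_of_hasDerivAt (fun t _ => e2 t) ?_
        have := continuous_circleFun l m
        exact Continuous.intervalIntegrable (by fun_prop) _ _
      rw [intervalIntegral.integral_const_mul] at e3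
      rw [hpair (W.fourier m) _ (circleBasis_ae hl m), e1]
      linear_combination (((circleDual l m + k : ℝ) : ℂ) * Complex.I) * c m * e3 -
        (∫ t in (0 : ℝ)..q, z t * circleFun l m t) * ((circleDual l m + k : ℝ) : ℂ) ^ 2 * c m *
          Complex.I_sq
    simp only [h2] at h1
    have h3 := ((hasSum_fourierSum (l := l) hpc q).mul_left (z q)).sub
      ((hasSum_fourierSum (l := l) hpc 0).mul_left (z 0))
    have h4 := h3.unique h1
    refine sub_eq_iff_eq_add'.1 (h4.trans (intervalIntegral.integral_congr fun t _ => ?_))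
    simp only [hΨ]
    ring
  have hΨc : Continuous Ψ := hzc.mul hFc
  have hΦc : Continuous Φ := hzc.mul hGc
  have hFl : F l = F 0 := by simpa using fourierSum_add_period hl c 0
  have hGl : G l = G 0 := by simpa using fourierSum_add_period hl _ 0
  have hz0 : z 0 = 1 := by simp [hz]
  have hzF : ∀ q, ‖Ψ q‖ = ‖F q‖ := fun q => by rw [hΨ]; simp only; rw [norm_mul, hzn, one_mul]
  refine ⟨Ψ, Φ, ⟨hΨc, hΦc, hΨd, fun q hq => ?_, ?_, ?_, ?_⟩, ?_⟩
  · have hcont : Continuous fun t => ((2 / hbar ^ 2 * (W.toFun t - E) : ℝ) : ℂ) * Ψ t := by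
      have := W.continuous
      fun_prop
    refine HasDerivAt.congr_of_eventuallyEq ((intervalIntegral.integral_hasDerivAt_right
      (hcont.intervalIntegrable 0 q) (hcont.stronglyMeasurableAtFilter _ _) hcont.continuousAt).const_add
        (Φ 0)) ?_
    filter_upwards [Ioo_mem_nhds hq.1 hq.2] with t ht using hint t ⟨ht.1.le, ht.2.le⟩
  · show z l * F l = z l * (z 0 * F 0)
    rw [hFl, hz0, one_mul]
  · show z l * G l = z l * (z 0 * G 0)
    rw [hGl, hz0, one_mul]
  · simp only [hzF]
    rw [← intervalIntegral_eq_circle hl, ← one_pow 2, ← hψ, norm_sq_eq_integral]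
    refine integral_congr_ae ?_
    filter_upwards [hψae] with q hq
    rw [hq]
  · obtain ⟨g, hg1, hg2⟩ := h.exists_momentum
    have hg3 : g = (-Complex.I * hbar) • circleClass l ⟨G, hGc⟩ :=
      hilbertBasis_ext W.fourier fun m => by
        rw [hg1, inner_smul_right]
        have h1 : ⟪W.fourier m, circleClass l ⟨G, hGc⟩⟫_ℂ = _ :=
          inner_circleBasis_fourierSum hl hpc m
        rw [h1]
        push_cast
        linear_combination hbar * (circleDual l m + k) * ⟪W.fourier m, ψ⟫_ℂ * Complex.I_sq
    have h1 : ⟪ψ, circleClass l ⟨G, hGc⟩⟫_ℂ = ∫ q in (0 : ℝ)..l, conj (Ψ q) * Φ q := by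
      rw [inner_eq_integral, ← intervalIntegral_eq_circle hl]
      refine integral_congr_ae ?_
      filter_upwards [hψae, circleClass_ae (l := l) ⟨G, hGc⟩] with q h1 h2
      rw [h1, h2]
      show _ = conj (z q * F q) * (z q * G q)
      rw [map_mul, mul_mul_mul_comm, ← Complex.normSq_eq_conj_mul_self, Complex.normSq_eq_norm_sq,
        hzn]
      simp
    rw [hg3, inner_smul_right, h1] at hg2
    have h2 := congrArg Complex.re hg2
    rw [Complex.ofReal_re] at h2
    rw [h2, intervalIntegral.integral_const_mul]
    have h3 : (∫ q in (0 : ℝ)..l, (conj (Ψ q) * Φ q).im) =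
        (∫ q in (0 : ℝ)..l, conj (Ψ q) * Φ q).im := by
      have hi : IntervalIntegrable (fun q => conj (Ψ q) * Φ q) volume 0 l :=
        ((Complex.continuous_conj.comp hΨc).mul hΦc).intervalIntegrable _ _
      exact Complex.imCLM.intervalIntegral_comp_comm hi
    rw [h3]
    simp

end CirclePotential

end BlochSolution

/-! ### Conserved current and tunnelling -/

namespace IsBlochSolution

variable {W : ℝ → ℝ} {l hbar k E : ℝ} {Ψ Φ : ℝ → ℂ}

theorem im_eq_inner (z w : ℂ) : (conj z * w).im = inner ℝ (Complex.I * z) w := by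
  rw [Complex.inner]
  simp [Complex.mul_re, Complex.mul_im]
  ring

/-- The current density is constant. -/
theorem current_eq (h : IsBlochSolution W l hbar k E Ψ Φ) {q : ℝ} (hq : q ∈ Set.Icc 0 l) :
    (conj (Ψ q) * Φ q).im = (conj (Ψ 0) * Φ 0).im := by
  rcases hq.1.eq_or_lt with h0 | h0
  · rw [← h0]
  have hcont : Continuous fun q => (conj (Ψ q) * Φ q).im :=
    Complex.continuous_im.comp ((Complex.continuous_conj.comp h.continuous_fst).mul h.continuous_snd)
  obtain ⟨x, hx, hs⟩ := exists_hasDerivAt_eq_slope (fun q => (conj (Ψ q) * Φ q).im) (fun _ => 0) h0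
    hcont.continuousOn fun x hx => by
      have h1 := ((h.hasDerivAt_fst x).const_mul Complex.I).inner ℝ
        (h.hasDerivAt_snd x ⟨hx.1, hx.2.trans_le hq.2⟩)
      simp only [im_eq_inner]
      refine h1.congr_deriv ?_
      generalize 2 / hbar ^ 2 * (W x - E) = r
      simp only [Complex.inner]
      simp [Complex.mul_re, Complex.mul_im]
      ring
  rw [eq_comm, div_eq_zero_iff] at hs
  rcases hs with hs | hs
  · exact sub_eq_zero.1 hs
  · exact absurd hs (sub_ne_zero.2 h0.ne')

theorem integral_current (h : IsBlochSolution W l hbar k E Ψ Φ) (hl : 0 < l) :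
    ∫ q in (0 : ℝ)..l, hbar * (conj (Ψ q) * Φ q).im = l * (hbar * (conj (Ψ 0) * Φ 0).im) := by
  rw [intervalIntegral.integral_congr (g := fun _ => hbar * (conj (Ψ 0) * Φ 0).im)]
  · rw [intervalIntegral.integral_const, smul_eq_mul, sub_zero]
  · intro q hq
    rw [Set.uIcc_of_le hl.le] at hq
    simp only
    rw [h.current_eq hq]

/-- Below the maximum of the potential, tunnelling suppresses the current. -/
theorem abs_current_le (h : IsBlochSolution W l hbar k E Ψ Φ) (hW : Continuous W) (hh : 0 < hbar)
    {a b δ : ℝ} (ha : 0 < a) (hab : a < b) (hb : b < l) (hδ : 0 < δ)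
    (hE : ∀ q ∈ Set.Icc a b, E + δ ≤ W q) :
    |hbar * (conj (Ψ 0) * Φ 0).im| ≤ 3 * (b - a) ^ 2 /
      (√(2 * δ) * ∫ q in a..b, (q - a) ^ 2 * (b - q) ^ 2) * hbar ^ 2 := by
  set J := hbar * (conj (Ψ 0) * Φ 0).im with hJ
  set s := √(2 * δ) with hs
  have hs0 : 0 < s := Real.sqrt_pos.2 (by positivity)
  have hs2 : s ^ 2 = 2 * δ := Real.sq_sqrt (by positivity)
  set X := ∫ q in a..b, (q - a) ^ 2 * (b - q) ^ 2 with hX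
  have hX0 : 0 < X := by
    refine intervalIntegral.intervalIntegral_pos_of_pos_on
      (Continuous.intervalIntegrable (by fun_prop) _ _) (fun q hq => ?_) hab
    have h1 := sub_pos.2 hq.1
    have h2 := sub_pos.2 hq.2
    positivity
  have hΨc := h.continuous_fst
  have hΦc := h.continuous_snd
  -- This weight and its first derivative vanish at `a` and `b`, so two partial integrations move
  -- the second derivative of the density `‖Ψ‖²` onto the weight without boundary terms.
  set χ : ℝ → ℝ := fun q => (q - a) ^ 2 * (b - q) ^ 2 with hχ
  set χ' : ℝ → ℝ := fun q => 2 * (q - a) * (b - q) ^ 2 - (q - a) ^ 2 * (2 * (b - q)) with hχ'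
  set χ'' : ℝ → ℝ := fun q => 2 * (b - q) ^ 2 - 8 * ((q - a) * (b - q)) + 2 * (q - a) ^ 2 with hχ''
  have e1 : ∀ q : ℝ, HasDerivAt (fun q : ℝ => q - a) 1 q := fun q => (hasDerivAt_id q).sub_const a
  have e2 : ∀ q : ℝ, HasDerivAt (fun q : ℝ => b - q) (-1) q := fun q => by
    simpa using (hasDerivAt_id q).const_sub b
  have hd1 : ∀ q, HasDerivAt χ (χ' q) q := fun q => by
    refine (((e1 q).fun_pow 2).fun_mul ((e2 q).fun_pow 2)).congr_deriv ?_
    simp only [hχ']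
    push_cast
    ring
  have hd2 : ∀ q, HasDerivAt χ' (χ'' q) q := fun q => by
    refine ((((e1 q).const_mul 2).fun_mul ((e2 q).fun_pow 2)).fun_sub
      (((e1 q).fun_pow 2).fun_mul ((e2 q).const_mul 2))).congr_deriv ?_
    simp only [hχ'']
    push_cast
    ring
  set ρ : ℝ → ℝ := fun q => ‖Ψ q‖ ^ 2 with hρ
  set ρ' : ℝ → ℝ := fun q => 2 * inner ℝ (Ψ q) (Φ q) with hρ'
  set ρ'' : ℝ → ℝ := fun q => 2 * (‖Φ q‖ ^ 2 + 2 / hbar ^ 2 * (W q - E) * ‖Ψ q‖ ^ 2) with hρ''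
  have hd3 : ∀ q, HasDerivAt ρ (ρ' q) q := fun q => (h.hasDerivAt_fst q).norm_sq
  have hd4 : ∀ q ∈ Set.Ioo 0 l, HasDerivAt ρ' (ρ'' q) q := fun q hq => by
    refine (((h.hasDerivAt_fst q).inner ℝ (h.hasDerivAt_snd q hq)).const_mul 2).congr_deriv ?_
    simp only [hρ'']
    rw [real_inner_self_eq_norm_sq, ← Complex.real_smul, real_inner_smul_right,
      real_inner_self_eq_norm_sq, add_comm]
  have hρ''c : Continuous ρ'' := by fun_prop
  have hρc : Continuous ρ := by fun_prop
  have hχc : Continuous χ := by fun_prop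
  have hχ''c : Continuous χ'' := by fun_prop
  have hint : ∀ {f : ℝ → ℝ}, Continuous f → IntervalIntegrable f volume a b := fun hf =>
    hf.intervalIntegrable _ _
  have hibp : ∫ q in a..b, (χ q * ρ'' q - χ'' q * ρ q) = 0 := by
    have h1 := intervalIntegral.integral_eq_sub_of_hasDerivAt (a := a) (b := b)
      (f := fun q => χ q * ρ' q - χ' q * ρ q) (f' := fun q => χ q * ρ'' q - χ'' q * ρ q)
      (fun q hq => by
        rw [Set.uIcc_of_le hab.le] at hq
        refine (((hd1 q).fun_mul (hd4 q ⟨ha.trans_le hq.1, hq.2.trans_lt hb⟩)).fun_sub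
          ((hd2 q).fun_mul (hd3 q))).congr_deriv ?_
        ring) (hint (by fun_prop))
    rw [h1]
    simp [hχ, hχ']
  rw [intervalIntegral.integral_sub (hint (by fun_prop)) (hint (by fun_prop)), sub_eq_zero] at hibp
  -- In the forbidden interval `ρ'' ≥ 2(‖Φ‖² + (2δ/ħ²)‖Ψ‖²)`. The inequality of the means bounds
  -- this below by a multiple of `‖Ψ‖‖Φ‖/ħ`, and `ħ‖Ψ‖‖Φ‖` dominates the current `J`, which is the
  -- same at all points.
  have hlow : 4 * s * |J| / hbar ^ 2 * X ≤ ∫ q in a..b, χ q * ρ'' q := by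
    rw [hX, ← intervalIntegral.integral_const_mul]
    refine intervalIntegral.integral_mono_on hab.le (hint (by fun_prop)) (hint (by fun_prop))
      fun q hq => ?_
    rw [mul_comm]
    refine mul_le_mul_of_nonneg_left ?_ (by positivity)
    have h1 : |J| ≤ hbar * (‖Ψ q‖ * ‖Φ q‖) := by
      rw [hJ, ← h.current_eq ⟨(ha.trans_le hq.1).le, (hq.2.trans_lt hb).le⟩, abs_mul, abs_of_pos hh]
      refine mul_le_mul_of_nonneg_left ((Complex.abs_im_le_norm _).trans_eq ?_) hh.le
      rw [norm_mul, RCLike.norm_conj]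
    have h2 : δ ≤ W q - E := by linarith [hE q hq]
    calc 4 * s * |J| / hbar ^ 2 ≤ 4 * s * (hbar * (‖Ψ q‖ * ‖Φ q‖)) / hbar ^ 2 := by gcongr
      _ = 2 * (2 * ‖Φ q‖ * (s * ‖Ψ q‖ / hbar)) := by field_simp; ring
      _ ≤ 2 * (‖Φ q‖ ^ 2 + (s * ‖Ψ q‖ / hbar) ^ 2) := by
          gcongr; exact two_mul_le_add_sq _ _
      _ = 2 * (‖Φ q‖ ^ 2 + 2 / hbar ^ 2 * δ * ‖Ψ q‖ ^ 2) := by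
          rw [div_pow, mul_pow, hs2]; ring
      _ ≤ ρ'' q := by simp only [hρ'']; gcongr
  -- Here normalization enters: the density has total mass 1, so the upper bound does not depend on
  -- `ħ`, and `|J|` is left with `ħ²`.
  have hup : ∫ q in a..b, χ'' q * ρ q ≤ 12 * (b - a) ^ 2 := by
    calc ∫ q in a..b, χ'' q * ρ q ≤ ∫ q in a..b, 12 * (b - a) ^ 2 * ρ q := by
          refine intervalIntegral.integral_mono_on hab.le (hint (by fun_prop)) (hint (by fun_prop))
            fun q hq => mul_le_mul_of_nonneg_right ?_ (by positivity)
          simp only [hχ'']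
          have h1 := sub_nonneg.2 hq.1
          have h2 := sub_nonneg.2 hq.2
          nlinarith [mul_nonneg h1 h2]
      _ ≤ 12 * (b - a) ^ 2 * ∫ q in (0 : ℝ)..l, ρ q := by
          rw [intervalIntegral.integral_const_mul]
          gcongr
          refine intervalIntegral.integral_mono_interval ha.le hab.le hb.le
            (Eventually.of_forall fun q => by positivity) (hρc.intervalIntegrable _ _)
      _ = _ := by rw [h.normalized, mul_one]
  have hfin := (hlow.trans_eq hibp).trans hup
  rw [div_mul_eq_mul_div, div_le_iff₀ (by positivity)] at hfin
  rw [div_mul_eq_mul_div, le_div_iff₀ (by positivity)]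
  nlinarith

end IsBlochSolution

/-! ### WKB amplitudes -/

section Amplitudes

variable {hbar : ℝ} {g g' g'' S : ℝ → ℝ} {Ψ Φ : ℝ → ℂ}

/-- The coefficient of `Ψ` with respect to the approximate solution `g e^{iS/ħ}`. -/
def amplitude (hbar : ℝ) (g g' S : ℝ → ℝ) (Ψ Φ : ℝ → ℂ) (q : ℝ) : ℂ :=
  Complex.I * hbar / 2 * Complex.exp ((-(S q / hbar) : ℝ) * Complex.I) *
    (Ψ q * (g' q - Complex.I / (hbar * g q)) - Φ q * g q)

/-- The amplitude is `iħ/2` times the Wronskian-type expression `Ψ y' - Φ y` with `y = g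
exp(-iS/ħ)`. As `S' = g⁻²`, the function `y` solves the Schrödinger equation up to the term `g''
exp(-iS/ħ)`, and only this term survives in the derivative. -/
theorem hasDerivAt_amplitude {q : ℝ} (hh : 0 < hbar) (hg0 : 0 < g q) (hg : HasDerivAt g (g' q) q)
    (hg' : HasDerivAt g' (g'' q) q) (hS : HasDerivAt S ((g q ^ 2)⁻¹) q)
    (hΨ : HasDerivAt Ψ (Φ q) q)
    (hΦ : HasDerivAt Φ ((-((g q ^ 4)⁻¹ / hbar ^ 2) : ℝ) * Ψ q) q) :
    HasDerivAt (amplitude hbar g g' S Ψ Φ) (Complex.I * hbar / 2 *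
      Complex.exp ((-(S q / hbar) : ℝ) * Complex.I) * (g'' q * Ψ q)) q := by
  have hh' : (hbar : ℂ) ≠ 0 := by exact_mod_cast hh.ne'
  have hg0' : (g q : ℂ) ≠ 0 := by exact_mod_cast hg0.ne'
  have h1 : HasDerivAt (fun q => ((-(S q / hbar) : ℝ) : ℂ) * Complex.I)
      (((-((g q ^ 2)⁻¹ / hbar) : ℝ) : ℂ) * Complex.I) q :=
    ((hS.div_const hbar).neg).ofReal_comp.mul_const Complex.I
  have h2 : HasDerivAt (fun q => Complex.I / (hbar * g q : ℂ))
      (-(Complex.I * (hbar * g' q)) / (hbar * g q) ^ 2) q := by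
    have := (hasDerivAt_const q Complex.I).fun_div (hg.ofReal_comp.const_mul (hbar : ℂ))
      (mul_ne_zero hh' hg0')
    simpa using this
  have h3 := (((h1.cexp).const_mul (Complex.I * hbar / 2)).fun_mul
    ((hΨ.fun_mul (hg'.ofReal_comp.fun_sub h2)).fun_sub (hΦ.fun_mul hg.ofReal_comp)))
  refine h3.congr_deriv ?_
  push_cast
  field_simp
  linear_combination Ψ q * Complex.I_sq

end Amplitudes

section Amplitudes

variable {hbar : ℝ} {g g' g'' S : ℝ → ℝ} {Ψ Φ : ℝ → ℂ}

theorem conj_amplitude (q : ℝ) : conj (amplitude hbar g g' S (fun q => conj (Ψ q))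
    (fun q => conj (Φ q)) q) = -(Complex.I * hbar / 2) *
      Complex.exp ((S q / hbar : ℝ) * Complex.I) *
      (Ψ q * (g' q + Complex.I / (hbar * g q)) - Φ q * g q) := by
  have h1 : conj (Complex.exp ((-(S q / hbar) : ℝ) * Complex.I)) =
      Complex.exp ((S q / hbar : ℝ) * Complex.I) := by
    rw [← Complex.exp_conj, map_mul, Complex.conj_ofReal, Complex.conj_I]
    push_cast
    congr 1
    ring
  rw [amplitude, map_mul, map_mul, h1]
  simp only [map_sub, map_mul, map_div₀, Complex.conj_conj, Complex.conj_I, Complex.conj_ofReal,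
    map_ofNat]
  ring

/-- Recombination of a solution from its amplitudes. -/
theorem eq_mul_amplitude_add {q : ℝ} (hh : 0 < hbar) (hg0 : 0 < g q) :
    Ψ q = g q * (Complex.exp ((S q / hbar : ℝ) * Complex.I) * amplitude hbar g g' S Ψ Φ q +
      Complex.exp ((-(S q / hbar) : ℝ) * Complex.I) *
        conj (amplitude hbar g g' S (fun q => conj (Ψ q)) (fun q => conj (Φ q)) q)) := by
  have hh' : (hbar : ℂ) ≠ 0 := by exact_mod_cast hh.ne'
  have hg0' : (g q : ℂ) ≠ 0 := by exact_mod_cast hg0.ne'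
  have h1 : Complex.exp ((S q / hbar : ℝ) * Complex.I) *
      Complex.exp ((-(S q / hbar) : ℝ) * Complex.I) = 1 := by
    rw [← Complex.exp_add, ← add_mul, ← Complex.ofReal_add, add_neg_cancel, Complex.ofReal_zero,
      zero_mul, Complex.exp_zero]
  rw [conj_amplitude, amplitude]
  have h2 : (g q : ℂ) * (Complex.I * hbar / 2 * (Ψ q * (g' q - Complex.I / (hbar * g q)) - Φ q * g q)
      - Complex.I * hbar / 2 * (Ψ q * (g' q + Complex.I / (hbar * g q)) - Φ q * g q)) = Ψ q := by
    field_simp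
    linear_combination (-2 * Ψ q) * Complex.I_sq
  linear_combination -h2 - (g q : ℂ) * (Complex.I * hbar / 2 *
      (Ψ q * (g' q - Complex.I / (hbar * g q)) - Φ q * g q)
      - Complex.I * hbar / 2 * (Ψ q * (g' q + Complex.I / (hbar * g q)) - Φ q * g q)) * (h1)

/-- The current is the difference of the intensities of the right-moving and the left-moving wave;
interference terms do not contribute. -/
theorem norm_amplitude_sq_sub {q : ℝ} (hh : 0 < hbar) (hg0 : 0 < g q) :
    ‖amplitude hbar g g' S Ψ Φ q‖ ^ 2 -
      ‖amplitude hbar g g' S (fun q => conj (Ψ q)) (fun q => conj (Φ q)) q‖ ^ 2 =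
      hbar * (conj (Ψ q) * Φ q).im := by
  have h1 : ‖amplitude hbar g g' S Ψ Φ q‖ ^ 2 = hbar ^ 2 / 4 *
      Complex.normSq (Ψ q * (g' q - Complex.I / (hbar * g q)) - Φ q * g q) := by
    rw [amplitude, norm_mul, norm_mul, Complex.norm_exp_ofReal_mul_I, mul_one, mul_pow,
      ← Complex.normSq_eq_norm_sq (_ - _)]
    congr 1
    rw [norm_div, norm_mul, Complex.norm_I, Complex.norm_real, one_mul, div_pow, Real.norm_eq_abs,
      sq_abs]
    norm_num
  have h2 : ‖amplitude hbar g g' S (fun q => conj (Ψ q)) (fun q => conj (Φ q)) q‖ ^ 2 =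
      hbar ^ 2 / 4 * Complex.normSq (Ψ q * (g' q + Complex.I / (hbar * g q)) - Φ q * g q) := by
    rw [← RCLike.norm_conj, conj_amplitude, norm_mul, norm_mul, Complex.norm_exp_ofReal_mul_I,
      mul_one, mul_pow, ← Complex.normSq_eq_norm_sq (_ - _)]
    congr 1
    rw [norm_neg, norm_div, norm_mul, Complex.norm_I, Complex.norm_real, one_mul, div_pow,
      Real.norm_eq_abs, sq_abs]
    norm_num
  have h3 : Complex.I / (hbar * g q : ℂ) = ((hbar * g q)⁻¹ : ℝ) * Complex.I := by
    push_cast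
    rw [div_eq_mul_inv, mul_comm]
  rw [h1, h2, h3]
  simp only [Complex.normSq_apply, Complex.mul_re, Complex.mul_im, Complex.sub_re, Complex.sub_im,
    Complex.add_re, Complex.add_im, Complex.ofReal_re, Complex.ofReal_im, Complex.I_re,
    Complex.I_im, Complex.conj_re, Complex.conj_im]
  field_simp
  ring

set_option maxHeartbeats 1000000 in
/-- The elementary estimate behind the semiclassical quantization of the velocity. -/
theorem abs_mul_current_sub_one_le {l σ τ T J : ℝ} {g : ℝ → ℝ} {α β Ψ : ℝ → ℂ} {θ : ℝ → ℝ} {ω₁ ω₂ : ℂ}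
    (hl : 0 < l) (hσ : 0 < σ) (hσ1 : σ ≤ 1) (hτ : 0 ≤ τ) (hτσ : 48 * τ ≤ σ)
    (hg : Continuous g) (hg0 : ∀ q, 0 < g q)
    (hα : ContinuousOn α (Set.Icc 0 l)) (hβ : ContinuousOn β (Set.Icc 0 l)) (hΨ : Continuous Ψ)
    (hosc : ∀ N, (∀ q ∈ Set.Icc 0 l, ‖α q‖ + ‖β q‖ ≤ N) → ∀ q ∈ Set.Icc 0 l,
      ‖α q - α 0‖ ≤ τ * N ∧ ‖β q - β 0‖ ≤ τ * N)
    (hrec : ∀ q ∈ Set.Icc 0 l, Ψ q = g q * (Complex.exp ((θ q : ℝ) * Complex.I) * α q +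
      Complex.exp ((-θ q : ℝ) * Complex.I) * β q))
    (h1 : α l = ω₁ * α 0) (h2 : β l = ω₂ * β 0) (hω : σ ≤ ‖ω₁ - 1‖ ∨ σ ≤ ‖ω₂ - 1‖)
    (hJ : J = ‖α 0‖ ^ 2 - ‖β 0‖ ^ 2) (hT : T = ∫ q in (0 : ℝ)..l, g q ^ 2)
    (hn : ∫ q in (0 : ℝ)..l, ‖Ψ q‖ ^ 2 = 1) : |T * |J| - 1| ≤ 56 * τ / σ := by
  obtain ⟨q₀, hq₀, hmax⟩ := isCompact_Icc.exists_isMaxOn (Set.nonempty_Icc.2 hl.le)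
    (hα.norm.add hβ.norm)
  set N := ‖α q₀‖ + ‖β q₀‖ with hN
  have hle : ∀ q ∈ Set.Icc 0 l, ‖α q‖ + ‖β q‖ ≤ N := fun q hq => hmax hq
  have hosc' := hosc N hle
  set n := ‖α 0‖ + ‖β 0‖ with hn0
  have hn00 : 0 ≤ n := by positivity
  have hτ4 : τ ≤ 1 / 48 := by linarith
  -- The oscillation hypothesis is relative to the maximum `N`, which can in turn be bounded by the
  -- values at `0` because `τ` is small.
  have hNn : N ≤ 2 * n := by
    have e1 := hosc' q₀ hq₀
    have e2 : ‖α q₀‖ ≤ ‖α 0‖ + ‖α q₀ - α 0‖ := norm_le_norm_add_norm_sub' _ _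
    have e3 : ‖β q₀‖ ≤ ‖β 0‖ + ‖β q₀ - β 0‖ := norm_le_norm_add_norm_sub' _ _
    have hN0 : 0 ≤ N := by positivity
    nlinarith [e1.1, e1.2]
  set ε := 2 * τ / σ with hε
  have hε0 : 0 ≤ ε := by positivity
  have hεσ : ε * σ = 2 * τ := by rw [hε]; field_simp
  have hε1 : ε ≤ 1 / 24 := by rw [hε, div_le_iff₀ hσ]; linarith
  have hτε : 2 * τ ≤ ε := by rw [← hεσ]; nlinarith
  have ha : ∀ q ∈ Set.Icc 0 l, ‖α q - α 0‖ ≤ ε * n := fun q hq => by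
    have := (hosc' q hq).1
    nlinarith
  have hb : ∀ q ∈ Set.Icc 0 l, ‖β q - β 0‖ ≤ ε * n := fun q hq => by
    have := (hosc' q hq).2
    nlinarith
  have hsmall : ∀ {a : ℂ} {f : ℝ → ℂ}, f l = a * f 0 → σ ≤ ‖a - 1‖ → ‖f l - f 0‖ ≤ τ * N →
      ‖f 0‖ ≤ ε * n := fun {a f} e1 e2 e3 => by
    have e4 : f l - f 0 = (a - 1) * f 0 := by rw [e1]; ring
    rw [e4, norm_mul] at e3
    have e5 : σ * ‖f 0‖ ≤ 2 * τ * n := by nlinarith [norm_nonneg (f 0)]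
    rw [← hεσ] at e5
    by_contra hlt
    push Not at hlt
    nlinarith
  have hlmem : l ∈ Set.Icc 0 l := ⟨hl.le, le_rfl⟩
  -- The boundary condition turns the small oscillation `α l - α 0` into `(ω₁ - 1) α 0`, and
  -- likewise for `β`. The amplitude whose factor stays away from 1 must therefore be small.
  have hcase : ‖α 0‖ ≤ ε * n ∨ ‖β 0‖ ≤ ε * n := hω.imp
    (fun h => hsmall h1 h (hosc' l hlmem).1) fun h => hsmall h2 h (hosc' l hlmem).2
  have hJn : |(|J| - n ^ 2)| ≤ 2 * ε * n ^ 2 := by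
    have e1 : J = (‖α 0‖ - ‖β 0‖) * n := by rw [hJ, hn0]; ring
    have e2 : |J| = |‖α 0‖ - ‖β 0‖| * n := by rw [e1, abs_mul, abs_of_nonneg hn00]
    have e3 : |‖α 0‖ - ‖β 0‖| ≤ n := by
      rw [abs_le]; constructor <;> linarith [norm_nonneg (α 0), norm_nonneg (β 0)]
    have e4 : n - 2 * (ε * n) ≤ |‖α 0‖ - ‖β 0‖| := by
      rcases hcase with h | h
      · have := neg_le_abs (‖α 0‖ - ‖β 0‖); linarith
      · have := le_abs_self (‖α 0‖ - ‖β 0‖); linarith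
    rw [e2, abs_le]
    constructor <;> nlinarith
  -- With one amplitude negligible there is no interference, and `‖Ψ‖²` follows `n² g²`.
  have hx : ∀ q ∈ Set.Icc 0 l, |‖Ψ q‖ ^ 2 - n ^ 2 * g q ^ 2| ≤ 12 * ε * n ^ 2 * g q ^ 2 := by
    intro q hq
    set x := ‖Complex.exp ((θ q : ℝ) * Complex.I) * α q +
      Complex.exp ((-θ q : ℝ) * Complex.I) * β q‖ with hxdef
    have e1 : ‖Ψ q‖ = g q * x := by
      rw [hrec q hq, norm_mul, Complex.norm_real, Real.norm_of_nonneg (hg0 q).le]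
    have ea : ‖Complex.exp ((θ q : ℝ) * Complex.I) * α q‖ = ‖α q‖ := by
      rw [norm_mul, Complex.norm_exp_ofReal_mul_I, one_mul]
    have eb : ‖Complex.exp ((-θ q : ℝ) * Complex.I) * β q‖ = ‖β q‖ := by
      rw [norm_mul, Complex.norm_exp_ofReal_mul_I, one_mul]
    have x1 : x ≤ ‖α q‖ + ‖β q‖ := by rw [← ea, ← eb]; exact norm_add_le _ _
    have x2 : ‖α q‖ - ‖β q‖ ≤ x := by
      rw [← ea, ← eb, hxdef]
      have := norm_sub_norm_le (Complex.exp ((θ q : ℝ) * Complex.I) * α q)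
        (-(Complex.exp ((-θ q : ℝ) * Complex.I) * β q))
      rwa [norm_neg, sub_neg_eq_add] at this
    have x3 : ‖β q‖ - ‖α q‖ ≤ x := by
      rw [← ea, ← eb, hxdef, add_comm]
      have := norm_sub_norm_le (Complex.exp ((-θ q : ℝ) * Complex.I) * β q)
        (-(Complex.exp ((θ q : ℝ) * Complex.I) * α q))
      rwa [norm_neg, sub_neg_eq_add] at this
    have y1 : |‖α q‖ - ‖α 0‖| ≤ ε * n := (abs_norm_sub_norm_le _ _).trans (ha q hq)
    have y2 : |‖β q‖ - ‖β 0‖| ≤ ε * n := (abs_norm_sub_norm_le _ _).trans (hb q hq)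
    rw [abs_le] at y1 y2
    have hxn : |x - n| ≤ 4 * (ε * n) := by
      rw [abs_le]
      have hen : 0 ≤ ε * n := by positivity
      refine ⟨?_, by linarith⟩
      rcases hcase with h | h
      · linarith
      · linarith
    have e2 : |x ^ 2 - n ^ 2| ≤ 12 * ε * n ^ 2 := by
      have x0 : 0 ≤ x := norm_nonneg _
      have x4 : x + n ≤ 3 * n := by
        have := (abs_le.1 hxn).2
        nlinarith
      rw [sq_sub_sq, abs_mul, abs_of_nonneg (by positivity)]
      calc (x + n) * |x - n| ≤ (3 * n) * (4 * (ε * n)) := by gcongr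
        _ = _ := by ring
    rw [e1, mul_pow, mul_comm (n ^ 2), ← mul_sub, abs_mul, abs_of_nonneg (sq_nonneg (g q)), mul_comm]
    exact mul_le_mul_of_nonneg_right e2 (sq_nonneg _)
  have hg2 : ∀ c : ℝ, IntervalIntegrable (fun q => c * g q ^ 2) volume 0 l := fun c =>
    Continuous.intervalIntegrable (by fun_prop) _ _
  have hΨ2 : IntervalIntegrable (fun q => ‖Ψ q‖ ^ 2) volume 0 l :=
    Continuous.intervalIntegrable (by fun_prop) _ _
  -- Normalization of `Ψ` forces `n² T` to be close to 1, while `|J|` is close to `n²`.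
  set m := n ^ 2 * T with hm
  have hT0 : 0 ≤ T := by
    rw [hT]; exact intervalIntegral.integral_nonneg hl.le fun q _ => sq_nonneg _
  have hm1 : |1 - m| ≤ 12 * ε * m := by
    have e1 : 1 - m = ∫ q in (0 : ℝ)..l, (‖Ψ q‖ ^ 2 - n ^ 2 * g q ^ 2) := by
      rw [intervalIntegral.integral_sub hΨ2 (hg2 _), hn, intervalIntegral.integral_const_mul, ← hT]
    have e2 : 12 * ε * m = ∫ q in (0 : ℝ)..l, 12 * ε * n ^ 2 * g q ^ 2 := by
      rw [intervalIntegral.integral_const_mul, ← hT, hm]; ring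
    rw [e1, e2, ← Real.norm_eq_abs]
    refine intervalIntegral.norm_integral_le_of_norm_le hl.le (Eventually.of_forall fun q hq => ?_)
      (hg2 _)
    exact hx q ⟨hq.1.le, hq.2⟩
  have hm0 : 0 ≤ m := by positivity
  have hm2 : m ≤ 2 := by
    have := (abs_le.1 hm1).1
    nlinarith
  have hfin : |T * |J| - m| ≤ 2 * ε * m := by
    rw [hm, mul_comm (n ^ 2), ← mul_sub, abs_mul, abs_of_nonneg hT0]
    calc T * |(|J| - n ^ 2)| ≤ T * (2 * ε * n ^ 2) := by gcongr
      _ = _ := by ring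
  -- The two errors `2εm` and `12εm` add to `14εm ≤ 28ε`, by `m ≤ 2`, and `ε = 2τ/σ`.
  have e56 : 56 * τ / σ = 28 * ε := by rw [hε]; ring
  rw [e56]
  rw [abs_le] at hm1 hfin ⊢
  constructor <;> nlinarith

end Amplitudes

/-- The left-moving amplitude is the conjugate of the right-moving amplitude of the conjugate
solution, so the estimates are needed for one direction only. -/
theorem IsBlochSolution.star {W : ℝ → ℝ} {l hbar k E : ℝ} {Ψ Φ : ℝ → ℂ}
    (h : IsBlochSolution W l hbar k E Ψ Φ) :
    IsBlochSolution W l hbar (-k) E (fun q => conj (Ψ q)) (fun q => conj (Φ q)) := by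
  have hd : ∀ {f : ℝ → ℂ} {f' : ℂ} {q : ℝ}, HasDerivAt f f' q →
      HasDerivAt (fun q => conj (f q)) (conj f') q := fun {f f' q} hf =>
    (Complex.conjCLE.toContinuousLinearMap.hasFDerivAt).comp_hasDerivAt q hf
  have hb : conj (Complex.exp ((k * l : ℝ) * Complex.I)) =
      Complex.exp ((-k * l : ℝ) * Complex.I) := by
    rw [← Complex.exp_conj, map_mul, Complex.conj_ofReal, Complex.conj_I]
    push_cast
    congr 1
    ring
  refine ⟨Complex.continuous_conj.comp h.continuous_fst, Complex.continuous_conj.comp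
    h.continuous_snd, fun q => hd (h.hasDerivAt_fst q), fun q hq => ?_, ?_, ?_, ?_⟩
  · refine (hd (h.hasDerivAt_snd q hq)).congr_deriv ?_
    rw [map_mul, Complex.conj_ofReal]
  · rw [h.boundary_fst, map_mul, hb]
  · rw [h.boundary_snd, map_mul, hb]
  · simpa only [RCLike.norm_conj] using h.normalized

/-! ### Oscillation and boundary phases of the amplitudes -/

section Amplitudes

variable {W : ℝ → ℝ} {l hbar k E : ℝ} {g g' g'' S : ℝ → ℝ} {Ψ Φ : ℝ → ℂ}

theorem continuous_amplitude (hh : 0 < hbar) (hg0 : ∀ q, 0 < g q) (hg : Continuous g)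
    (hg' : Continuous g') (hS : Continuous S) (hΨ : Continuous Ψ) (hΦ : Continuous Φ) :
    Continuous (amplitude hbar g g' S Ψ Φ) := by
  have h1 : Continuous fun q => Complex.I / (hbar * g q : ℂ) :=
    continuous_const.div (by fun_prop) fun q => mul_ne_zero (by exact_mod_cast hh.ne')
      (by exact_mod_cast (hg0 q).ne')
  unfold amplitude
  fun_prop

theorem norm_amplitude_sub_le (h : IsBlochSolution W l hbar k E Ψ Φ) (hh : 0 < hbar)
    (hg0 : ∀ q, 0 < g q) (hg : ∀ q, HasDerivAt g (g' q) q) (hg' : ∀ q, HasDerivAt g' (g'' q) q)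
    (hg'' : Continuous g'') (hS : ∀ q, HasDerivAt S ((g q ^ 2)⁻¹) q)
    (hgW : ∀ q, (g q ^ 4)⁻¹ = 2 * (E - W q)) {N : ℝ}
    (hN : ∀ q ∈ Set.Icc 0 l, |g'' q| * ‖Ψ q‖ ≤ N) {q : ℝ} (hq : q ∈ Set.Icc 0 l) :
    ‖amplitude hbar g g' S Ψ Φ q - amplitude hbar g g' S Ψ Φ 0‖ ≤ hbar / 2 * l * N := by
  have hgc : Continuous g := continuous_iff_continuousAt.2 fun q => (hg q).continuousAt
  have hgc' : Continuous g' := continuous_iff_continuousAt.2 fun q => (hg' q).continuousAt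
  have hSc : Continuous S := continuous_iff_continuousAt.2 fun q => (hS q).continuousAt
  have hΨ := h.continuous_fst
  have hN0 : 0 ≤ N := (by positivity : 0 ≤ |g'' q| * ‖Ψ q‖).trans (hN q hq)
  have h1 := intervalIntegral.integral_eq_sub_of_hasDerivAt_of_le hq.1
    (continuous_amplitude hh hg0 hgc hgc' hSc hΨ h.continuous_snd).continuousOn
    (f' := fun q => Complex.I * hbar / 2 *
      Complex.exp ((-(S q / hbar) : ℝ) * Complex.I) * (g'' q * Ψ q)) (fun x hx =>
      hasDerivAt_amplitude hh (hg0 x) (hg x) (hg' x) (hS x) (h.hasDerivAt_fst x) (by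
        refine (h.hasDerivAt_snd x ⟨hx.1, hx.2.trans_le hq.2⟩).congr_deriv ?_
        rw [hgW]
        congr 2
        ring)) (Continuous.intervalIntegrable (by fun_prop) _ _)
  rw [← h1]
  have h2 := intervalIntegral.norm_integral_le_of_norm_le_const (a := 0) (b := q)
    (C := hbar / 2 * N) (f := fun q => Complex.I * hbar / 2 *
      Complex.exp ((-(S q / hbar) : ℝ) * Complex.I) * (g'' q * Ψ q)) fun x hx => by
    rw [Set.uIoc_of_le hq.1] at hx
    rw [norm_mul, norm_mul, Complex.norm_exp_ofReal_mul_I, mul_one, norm_mul, Complex.norm_real,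
      Real.norm_eq_abs]
    have e : ‖(Complex.I * hbar / 2 : ℂ)‖ = hbar / 2 := by
      rw [norm_div, norm_mul, Complex.norm_I, Complex.norm_real, one_mul, Real.norm_of_nonneg hh.le]
      norm_num
    rw [e]
    exact mul_le_mul_of_nonneg_left (hN x ⟨hx.1.le, hx.2.trans hq.2⟩) (by positivity)
  refine h2.trans ?_
  rw [sub_zero, abs_of_nonneg hq.1]
  calc hbar / 2 * N * q ≤ hbar / 2 * N * l := by gcongr; exact hq.2
    _ = _ := by ring

/-- Over a period the solution gains the Bloch phase, from which the amplitude subtracts the phase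
`S l / ħ` of the approximate solution; the prefactor `g` is periodic. -/
theorem amplitude_boundary (h : IsBlochSolution W l hbar k E Ψ Φ) (hgl : g l = g 0)
    (hgl' : g' l = g' 0) (hS0 : S 0 = 0) : amplitude hbar g g' S Ψ Φ l =
      Complex.exp ((k * l - S l / hbar : ℝ) * Complex.I) * amplitude hbar g g' S Ψ Φ 0 := by
  rw [amplitude, amplitude, h.boundary_fst, h.boundary_snd, hgl, hgl', hS0]
  have e : Complex.exp ((k * l - S l / hbar : ℝ) * Complex.I) =
      Complex.exp ((k * l : ℝ) * Complex.I) * Complex.exp ((-(S l / hbar) : ℝ) * Complex.I) := by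
    rw [← Complex.exp_add]
    push_cast
    congr 1
    ring
  rw [e, zero_div, neg_zero, Complex.ofReal_zero, zero_mul, Complex.exp_zero]
  ring

/-- If both exponentials were close to 1, both `sin a - sin b` and `sin a + sin b` would be small,
hence also `sin a`. With `a = kl` the bad quasimomenta do not depend on the energy. -/
theorem abs_sin_le_norm_exp_sub_one (a b : ℝ) :
    |Real.sin a| ≤ ‖Complex.exp ((a - b : ℝ) * Complex.I) - 1‖ ∨
      |Real.sin a| ≤ ‖Complex.exp ((a + b : ℝ) * Complex.I) - 1‖ := by
  have key : ∀ x y : ℝ, |Real.sin x - Real.sin y| ≤ ‖Complex.exp ((x - y : ℝ) * Complex.I) - 1‖ := by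
    intro x y
    have h1 : Complex.exp ((x : ℝ) * Complex.I) - Complex.exp ((y : ℝ) * Complex.I) =
        Complex.exp ((y : ℝ) * Complex.I) * (Complex.exp ((x - y : ℝ) * Complex.I) - 1) := by
      rw [mul_sub, ← Complex.exp_add, mul_one]
      congr 2
      push_cast
      ring
    have h2 : Real.sin x - Real.sin y =
        (Complex.exp ((x : ℝ) * Complex.I) - Complex.exp ((y : ℝ) * Complex.I)).im := by
      rw [Complex.sub_im, Complex.exp_ofReal_mul_I_im, Complex.exp_ofReal_mul_I_im]
    rw [h2]
    refine (Complex.abs_im_le_norm _).trans_eq ?_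
    rw [h1, norm_mul, Complex.norm_exp_ofReal_mul_I, one_mul]
  have h1 := key a b
  have h2 := key a (-b)
  rw [Real.sin_neg, sub_neg_eq_add, sub_neg_eq_add] at h2
  by_contra hcon
  push Not at hcon
  have h3 : |2 * Real.sin a| ≤ |Real.sin a - Real.sin b| + |Real.sin a + Real.sin b| := by
    have e : 2 * Real.sin a = (Real.sin a - Real.sin b) + (Real.sin a + Real.sin b) := by ring
    rw [e]
    exact abs_add_le _ _
  rw [abs_mul, abs_two] at h3
  linarith

end Amplitudes

/-! ### Velocity estimates below and above the potential maximum -/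

namespace CirclePotential

variable {l : ℝ} (W : CirclePotential l)

/-- The maximum of the potential. -/
def maxValue : ℝ := ⨆ q, W.toFun q

theorem le_maxValue (q : ℝ) : W.toFun q ≤ W.maxValue :=
  le_ciSup (f := W.toFun) ⟨W.bound, by rintro _ ⟨q, rfl⟩; exact (le_abs_self _).trans (W.abs_le q)⟩ q

theorem exists_eq_maxValue : ∃ q ∈ Set.Icc 0 l, W.toFun q = W.maxValue := by
  obtain ⟨q, hq, hmax⟩ := isCompact_Icc.exists_isMaxOn
    (Set.nonempty_Icc.2 W.length_pos.le) W.continuous.continuousOn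
  refine ⟨q, hq, le_antisymm (W.le_maxValue q) (ciSup_le fun x => ?_)⟩
  obtain ⟨y, hy, h⟩ := W.periodic.exists_mem_Ico₀ W.length_pos x
  rw [h]
  exact hmax ⟨hy.1, hy.2.le⟩

/-- The time needed to traverse a period at energy `E`. -/
def travelTime (E : ℝ) : ℝ := ∫ q in (0 : ℝ)..l, (√(2 * (E - W.toFun q)))⁻¹

/-- The absolute value of the asymptotic velocity at energy `E`. -/
def meanSpeed (E : ℝ) : ℝ := if W.maxValue < E then l / W.travelTime E else 0

theorem continuous_inv_sqrt {E : ℝ} (hE : W.maxValue < E) :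
    Continuous fun q => (√(2 * (E - W.toFun q)))⁻¹ := by
  refine Continuous.inv₀ ?_ fun q => (Real.sqrt_pos.2 ?_).ne'
  · have := W.continuous
    fun_prop
  · linarith [W.le_maxValue q]

theorem le_travelTime {E R : ℝ} (hE : W.maxValue < E) (hR : E ≤ R) :
    l / √(2 * (R + W.bound)) ≤ W.travelTime E := by
  have h1 : ∫ _ in (0 : ℝ)..l, (√(2 * (R + W.bound)))⁻¹ = l / √(2 * (R + W.bound)) := by
    rw [intervalIntegral.integral_const, sub_zero, smul_eq_mul, div_eq_mul_inv]
  rw [← h1, travelTime]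
  refine intervalIntegral.integral_mono_on W.length_pos.le (by simp)
    ((W.continuous_inv_sqrt hE).intervalIntegrable _ _) fun q _ => ?_
  refine inv_anti₀ (Real.sqrt_pos.2 (by linarith [W.le_maxValue q])) (Real.sqrt_le_sqrt ?_)
  linarith [neg_le_of_abs_le (W.abs_le q)]

theorem travelTime_pos {E : ℝ} (hE : W.maxValue < E) : 0 < W.travelTime E := by
  refine intervalIntegral.intervalIntegral_pos_of_pos_on
    ((W.continuous_inv_sqrt hE).intervalIntegrable _ _) (fun q _ => ?_) W.length_pos
  exact inv_pos.2 (Real.sqrt_pos.2 (by linarith [W.le_maxValue q]))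

/-- Near a maximum of the potential there is an interval on which it exceeds the energy by `δ / 2`,
and the tunnelling estimate applies there with constants independent of the energy and
quasimomentum. -/
theorem abs_meanMomentum_le_of_lt {δ : ℝ} (hδ : 0 < δ) : ∃ C, 0 < C ∧ ∀ hbar k E Ψ Φ, 0 < hbar →
    IsBlochSolution W.toFun l hbar k E Ψ Φ → E ≤ W.maxValue - δ →
    |∫ q in (0 : ℝ)..l, hbar * (conj (Ψ q) * Φ q).im| ≤ C * hbar ^ 2 := by
  have hl := W.length_pos
  obtain ⟨q₀, hq₀, hmax⟩ := W.exists_eq_maxValue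
  obtain ⟨r, hr, hball⟩ := Metric.continuousAt_iff.1 (W.continuous.continuousAt (x := q₀)) (δ / 2)
    (by positivity)
  obtain ⟨a, b, ha, hab, hb, hsub⟩ : ∃ a b, 0 < a ∧ a < b ∧ b < l ∧
      ∀ q ∈ Set.Icc a b, |q - q₀| < r := by
    -- The maximum may sit at an endpoint of the period, whereas the Schrödinger equation is only
    -- available in the open interval; hence the interval is chosen beside it.
    have h1 : max 0 (q₀ - r) < min l (q₀ + r) := by
      rw [max_lt_iff, lt_min_iff, lt_min_iff]
      exact ⟨⟨hl, by linarith [hq₀.1]⟩, by linarith [hq₀.2], by linarith⟩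
    obtain ⟨a, ha1, ha2⟩ := exists_between h1
    obtain ⟨b, hb1, hb2⟩ := exists_between ha2
    refine ⟨a, b, (le_max_left _ _).trans_lt ha1, hb1, hb2.trans_le (min_le_left _ _),
      fun q hq => abs_lt.2 ⟨?_, ?_⟩⟩
    · linarith [hq.1, (le_max_right 0 (q₀ - r)).trans_lt ha1]
    · linarith [hq.2, hb2.trans_le (min_le_right l (q₀ + r))]
  set C := 3 * (b - a) ^ 2 / (√(2 * (δ / 2)) * ∫ q in a..b, (q - a) ^ 2 * (b - q) ^ 2) with hC
  refine ⟨l * |C| + 1, by positivity, fun hbar k E Ψ Φ hh h hE => ?_⟩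
  rw [h.integral_current hl, abs_mul, abs_of_pos hl]
  have h1 := h.abs_current_le W.continuous hh ha hab hb (half_pos hδ) fun q hq => by
    have := hball (hsub q hq)
    rw [Real.dist_eq, hmax] at this
    linarith [(abs_lt.1 this).1]
  calc l * |hbar * (conj (Ψ 0) * Φ 0).im| ≤ l * (|C| * hbar ^ 2) := by
        gcongr
        exact h1.trans (by gcongr; exact le_abs_self _)
    _ ≤ _ := by nlinarith [sq_nonneg hbar]

/-- The WKB prefactor is `g = (2(E - W))^(-1/4)`, so `g²` is the inverse classical speed and its
integral the traversal time. Since `E - W ≥ δ`, both `g` and `g''` are bounded uniformly in the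
energy, and the amplitudes oscillate by a relative amount `O(ħ)`. -/
theorem abs_meanMomentum_sub_le_of_gt {δ R : ℝ} (hδ : 0 < δ) : ∃ C, 0 < C ∧ ∀ hbar k E Ψ Φ,
    0 < hbar → IsBlochSolution W.toFun l hbar k E Ψ Φ → W.maxValue + δ ≤ E → E ≤ R →
    C * hbar ≤ |Real.sin (k * l)| →
    |(|∫ q in (0 : ℝ)..l, hbar * (conj (Ψ q) * Φ q).im| - l / W.travelTime E)| ≤
      C * hbar / |Real.sin (k * l)| := by
  have hl := W.length_pos
  obtain ⟨D, hD, hD1, hD2⟩ := W.exists_abs_deriv_le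
  set G := (2 * δ) ^ (-1 / 4 : ℝ) with hG
  set G2 := 5 / 4 * (2 * δ) ^ (-9 / 4 : ℝ) * D ^ 2 + 1 / 2 * (2 * δ) ^ (-5 / 4 : ℝ) * D with hG2
  have hG0 : 0 ≤ G := by positivity
  have hG20 : 0 ≤ G2 := by positivity
  set c := G2 * G / 2 with hc
  set v := √(2 * (R + W.bound)) with hv
  -- With `τ = ħcl` and `σ = |sin(kl)|`, the first summand ensures `48τ ≤ σ`, and the second carries
  -- the final error `56τ/σ` times the bound `v` of `l / T`.
  refine ⟨48 * (c * l) + 56 * (c * l) * v + 1, by positivity,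
    fun hbar k E Ψ Φ hh h hE hER hk => ?_⟩
  set C := 48 * (c * l) + 56 * (c * l) * v + 1 with hCdef
  have hEm : W.maxValue < E := by linarith
  set y : ℝ → ℝ := fun q => 2 * (E - W.toFun q) with hy
  have hyδ : ∀ q, 2 * δ ≤ y q := fun q => by simp only [hy]; linarith [W.le_maxValue q]
  have hy0 : ∀ q, 0 < y q := fun q => (by positivity : 0 < 2 * δ).trans_le (hyδ q)
  have hyd : ∀ q, HasDerivAt y (-(2 * deriv W.toFun q)) q := fun q => by
    have := ((W.hasDerivAt q).const_sub E).const_mul 2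
    simpa using this
  set g : ℝ → ℝ := fun q => y q ^ (-1 / 4 : ℝ) with hg
  set g' : ℝ → ℝ := fun q => 1 / 2 * y q ^ (-5 / 4 : ℝ) * deriv W.toFun q with hg'
  set g'' : ℝ → ℝ := fun q => 5 / 4 * y q ^ (-9 / 4 : ℝ) * deriv W.toFun q ^ 2 +
    1 / 2 * y q ^ (-5 / 4 : ℝ) * deriv (deriv W.toFun) q with hg''
  have hg0 : ∀ q, 0 < g q := fun q => Real.rpow_pos_of_pos (hy0 q) _
  have hgd : ∀ q, HasDerivAt g (g' q) q := fun q => by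
    refine ((hyd q).rpow_const (Or.inl (hy0 q).ne') (p := -1 / 4)).congr_deriv ?_
    simp only [hg']
    norm_num
    ring
  have hgd' : ∀ q, HasDerivAt g' (g'' q) q := fun q => by
    refine ((((hyd q).rpow_const (Or.inl (hy0 q).ne') (p := -5 / 4)).const_mul
      (1 / 2)).fun_mul (W.hasDerivAt_deriv q)).congr_deriv ?_
    simp only [hg'']
    norm_num
    ring
  have hyc : Continuous y := by
    have := W.continuous
    fun_prop
  have hypow : ∀ p : ℝ, Continuous fun q => y q ^ p := fun p =>
    hyc.rpow_const fun q => Or.inl (hy0 q).ne'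
  have hgc : Continuous g := hypow _
  have hg''c : Continuous g'' := by
    have h1 := W.continuous_deriv
    have h2 := W.continuous_deriv_deriv
    have h3 := hypow (-9 / 4)
    have h4 := hypow (-5 / 4)
    fun_prop
  have hg4 : ∀ q, (g q ^ 4)⁻¹ = 2 * (E - W.toFun q) := fun q => by
    have : g q ^ 4 = (y q)⁻¹ := by
      simp only [hg]
      rw [← Real.rpow_natCast, ← Real.rpow_mul (hy0 q).le, ← Real.rpow_neg_one]
      norm_num
    rw [this, inv_inv]
  have hg2 : ∀ q, g q ^ 2 = (√(2 * (E - W.toFun q)))⁻¹ := fun q => by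
    simp only [hg]
    rw [← Real.rpow_natCast, ← Real.rpow_mul (hy0 q).le, Real.sqrt_eq_rpow,
      ← Real.rpow_neg (hy0 q).le]
    norm_num
  have hS2c : Continuous fun q => (g q ^ 2)⁻¹ := (hgc.pow 2).inv₀ fun q => (pow_pos (hg0 q) 2).ne'
  set S : ℝ → ℝ := fun q => ∫ x in (0 : ℝ)..q, (g x ^ 2)⁻¹ with hS
  have hSd : ∀ q, HasDerivAt S ((g q ^ 2)⁻¹) q := fun q =>
    intervalIntegral.integral_hasDerivAt_right (hS2c.intervalIntegrable _ _)
      (hS2c.stronglyMeasurableAtFilter _ _) hS2c.continuousAt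
  have hS0 : S 0 = 0 := intervalIntegral.integral_same
  have hyl : y l = y 0 := by
    have : W.toFun l = W.toFun 0 := by simpa using W.periodic 0
    simp only [hy, this]
  have hgl : g l = g 0 := by simp only [hg, hyl]
  have hgl' : g' l = g' 0 := by
    have : deriv W.toFun l = deriv W.toFun 0 := by simpa using W.periodic_deriv 0
    simp only [hg', hyl, this]
  have hyp : ∀ q, ∀ p : ℝ, p ≤ 0 → y q ^ p ≤ (2 * δ) ^ p := fun q p hp =>
    Real.rpow_le_rpow_of_nonpos (by positivity) (hyδ q) hp
  have hgG : ∀ q, g q ≤ G := fun q => hyp q _ (by norm_num)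
  have hgG2 : ∀ q, |g'' q| ≤ G2 := fun q => by
    have p1 := Real.rpow_pos_of_pos (hy0 q) (-9 / 4)
    have p2 := Real.rpow_pos_of_pos (hy0 q) (-5 / 4)
    simp only [hg'']
    refine (abs_add_le _ _).trans ?_
    rw [abs_mul, abs_mul, abs_mul, abs_mul, abs_of_pos p1, abs_of_pos p2, abs_pow, hG2,
      abs_of_pos (by norm_num : (0 : ℝ) < 5 / 4), abs_of_pos (by norm_num : (0 : ℝ) < 1 / 2)]
    exact add_le_add (mul_le_mul (mul_le_mul_of_nonneg_left (hyp q _ (by norm_num)) (by norm_num))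
      (pow_le_pow_left₀ (abs_nonneg _) (hD1 q) 2) (by positivity) (by positivity))
      (mul_le_mul (mul_le_mul_of_nonneg_left (hyp q _ (by norm_num)) (by norm_num)) (hD2 q)
        (abs_nonneg _) (by positivity))
  set α := amplitude hbar g g' S Ψ Φ with hα
  set β' := amplitude hbar g g' S (fun q => conj (Ψ q)) (fun q => conj (Φ q)) with hβ'
  set β : ℝ → ℂ := fun q => conj (β' q) with hβ
  have hgc' : Continuous g' := continuous_iff_continuousAt.2 fun q => (hgd' q).continuousAt
  have hSc : Continuous S := continuous_iff_continuousAt.2 fun q => (hSd q).continuousAt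
  have hs := h.star
  have hαc : Continuous α :=
    continuous_amplitude hh hg0 hgc hgc' hSc h.continuous_fst h.continuous_snd
  have hβc' : Continuous β' :=
    continuous_amplitude hh hg0 hgc hgc' hSc hs.continuous_fst hs.continuous_snd
  have hβn : ∀ q, ‖β q‖ = ‖β' q‖ := fun q => RCLike.norm_conj _
  have hrec : ∀ q, Ψ q = g q * (Complex.exp ((S q / hbar : ℝ) * Complex.I) * α q +
      Complex.exp ((-(S q / hbar) : ℝ) * Complex.I) * β q) := fun q => eq_mul_amplitude_add hh (hg0 q)
  have hσ0 : 0 < |Real.sin (k * l)| := lt_of_lt_of_le (by positivity) hk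
  have hτ0 : 0 ≤ hbar * (c * l) := by positivity
  have hJ := norm_amplitude_sq_sub (g' := g') (S := S) (Ψ := Ψ) (Φ := Φ) hh (hg0 0)
  have hΨN : ∀ N, (∀ q ∈ Set.Icc 0 l, ‖α q‖ + ‖β q‖ ≤ N) → ∀ q ∈ Set.Icc 0 l,
      |g'' q| * ‖Ψ q‖ ≤ G2 * (G * N) := fun N hN q hq => by
    have e1 : ‖Ψ q‖ ≤ G * N := by
      rw [hrec q, norm_mul, Complex.norm_real, Real.norm_of_nonneg (hg0 q).le]
      have e2 : ‖Complex.exp ((S q / hbar : ℝ) * Complex.I) * α q +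
          Complex.exp ((-(S q / hbar) : ℝ) * Complex.I) * β q‖ ≤ ‖α q‖ + ‖β q‖ := by
        refine (norm_add_le _ _).trans_eq ?_
        rw [norm_mul, norm_mul, Complex.norm_exp_ofReal_mul_I, Complex.norm_exp_ofReal_mul_I,
          one_mul, one_mul]
      exact mul_le_mul (hgG q) (e2.trans (hN q hq)) (norm_nonneg _) hG0
    exact mul_le_mul (hgG2 q) e1 (norm_nonneg _) hG20
  have hT : W.travelTime E = ∫ q in (0 : ℝ)..l, g q ^ 2 := by
    rw [travelTime]; simp only [hg2]
  have hmain := abs_mul_current_sub_one_le (T := W.travelTime E)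
    (J := hbar * (conj (Ψ 0) * Φ 0).im) (τ := hbar * (c * l)) (α := α) (β := β)
    (θ := fun q => S q / hbar) (g := g) hl hσ0 (Real.abs_sin_le_one _) hτ0 (by
      refine le_trans ?_ hk
      rw [hCdef]
      have : 0 ≤ 56 * (c * l) * v := by positivity
      nlinarith) hgc hg0 hαc.continuousOn (Complex.continuous_conj.comp hβc').continuousOn
    h.continuous_fst (fun N hN q hq => by
      have e := hΨN N hN
      constructor
      · refine (norm_amplitude_sub_le h hh hg0 hgd hgd' hg''c hSd hg4 e hq).trans_eq ?_
        rw [hc]; ring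
      · have e1 := norm_amplitude_sub_le hs hh hg0 hgd hgd' hg''c hSd hg4 (N := G2 * (G * N))
          (fun q hq => by rw [RCLike.norm_conj]; exact e q hq) hq
        rw [hβ]
        simp only
        rw [← map_sub, RCLike.norm_conj]
        refine e1.trans_eq ?_
        rw [hc]; ring) (fun q _ => hrec q)
    (amplitude_boundary h hgl hgl' hS0) (by
      have e := congrArg conj (amplitude_boundary hs hgl hgl' hS0)
      rw [map_mul, ← Complex.exp_conj, map_mul, Complex.conj_ofReal, Complex.conj_I] at e
      exact e) (by
      have e := abs_sin_le_norm_exp_sub_one (k * l) (S l / hbar)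
      refine e.imp_right fun e => e.trans_eq ?_
      congr 3
      push_cast
      ring) (by rw [← hJ, hβn]) hT h.normalized
  rw [h.integral_current hl, abs_mul, abs_of_pos hl]
  set J := hbar * (conj (Ψ 0) * Φ 0).im
  have hTpos := W.travelTime_pos hEm
  have hlT : l / W.travelTime E ≤ v := by
    have e := W.le_travelTime hEm hER
    have hv0 : 0 < v := Real.sqrt_pos.2 (by
      have := neg_le_of_abs_le (W.abs_le 0)
      have := W.le_maxValue 0
      linarith)
    rw [div_le_iff₀ hv0] at e
    rw [div_le_iff₀ hTpos]
    linarith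
  have e1 : l * |J| - l / W.travelTime E =
      l / W.travelTime E * (W.travelTime E * |J| - 1) := by
    field_simp
  rw [e1, abs_mul, abs_of_pos (div_pos hl hTpos)]
  calc l / W.travelTime E * |W.travelTime E * |J| - 1|
      ≤ v * (56 * (hbar * (c * l)) / |Real.sin (k * l)|) := by gcongr
    _ = (56 * (c * l) * v) * hbar / |Real.sin (k * l)| := by ring
    _ ≤ C * hbar / |Real.sin (k * l)| := by
        gcongr
        rw [hCdef]
        have : 0 ≤ 48 * (c * l) := by positivity
        linarith

end CirclePotential

/-! ### Reflection symmetry and uniform trace bounds -/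

namespace CirclePotential

open InnerProductSpace
open scoped ENNReal

variable {l : ℝ} (W : CirclePotential l) {hbar : ℝ}

/-- Complex conjugation followed by a shift of the Fourier index. -/
theorem exists_conjugation : ∃ J : CircleL2 l → CircleL2 l,
    (∀ f g, ⟪J f, J g⟫_ℂ = conj ⟪f, g⟫_ℂ) ∧
    (∀ m f, ⟪W.fourier m, J f⟫_ℂ = conj ⟪W.fourier (-m - 1), f⟫_ℂ) ∧
    (∀ (c : ℝ) f, J ((c : ℂ) • f) = (c : ℂ) • J f) ∧ ∀ f, W.op (J f) = J (W.op f) := by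
  -- Plain conjugation would reverse `k` to `-k`. The extra factor shifts the result by a dual
  -- lattice vector, so that the reflection `k ↦ 2π/l - k` maps the chosen Brillouin cell to itself
  -- up to an endpoint.
  set u : ℝ → ℂ := fun q => Complex.exp ((-(2 * Real.pi / l * q) : ℝ) * Complex.I) with hu
  have hun : ∀ q, ‖u q‖ = 1 := fun q => Complex.norm_exp_ofReal_mul_I _
  have hconj : ∀ q, conj (u q) * u q = 1 := fun q => by
    rw [← Complex.normSq_eq_conj_mul_self, Complex.normSq_eq_norm_sq, hun]; simp
  have huc : Continuous u := by fun_prop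
  have hmem : ∀ f : CircleL2 l, MemLp (fun q => u q * conj (f q)) 2 (circleMeasure l) := fun f => by
    refine (Lp.memLp f).of_le (huc.aestronglyMeasurable.mul
      (Complex.continuous_conj.comp_aestronglyMeasurable (Lp.aestronglyMeasurable f)))
      (Eventually.of_forall fun q => ?_)
    rw [norm_mul, hun, one_mul, RCLike.norm_conj]
  set J : CircleL2 l → CircleL2 l := fun f => (hmem f).toLp with hJ
  have hJae : ∀ f, J f =ᵐ[circleMeasure l] fun q => u q * conj (f q) := fun f =>
    (hmem f).coeFn_toLp
  refine ⟨J, fun f g => ?_, fun m f => ?_, fun c f => ?_, fun f => ?_⟩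
  · rw [inner_eq_integral, inner_eq_integral, ← integral_conj]
    refine integral_congr_ae ?_
    filter_upwards [hJae f, hJae g] with q h1 h2
    rw [h1, h2, map_mul, map_mul, mul_mul_mul_comm, hconj, one_mul]
  · rw [fourier, inner_circleBasis, inner_circleBasis, ← integral_conj]
    refine integral_congr_ae ?_
    filter_upwards [hJae f] with q h1
    have h2 : conj (circleFun l m q) * u q = circleFun l (-m - 1) q := by
      rw [conj_circleFun, circleFun, circleFun, hu, mul_assoc, ← Complex.exp_add]
      congr 2
      push_cast
      ring
    rw [h1, map_mul, Complex.conj_conj, ← mul_assoc, h2]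
  · refine Lp.ext ?_
    filter_upwards [hJae ((c : ℂ) • f), Lp.coeFn_smul (c : ℂ) (J f), Lp.coeFn_smul (c : ℂ) f,
      hJae f] with q h1 h2 h3 h4
    rw [h1, h2, h3, Pi.smul_apply, Pi.smul_apply, h4, smul_eq_mul, smul_eq_mul, map_mul,
      Complex.conj_ofReal]
    ring
  · have hop : ∀ f, W.op f =ᵐ[circleMeasure l] fun q => (W.toFun q : ℂ) * f q :=
      mulOp_ae W.continuous.aestronglyMeasurable W.bound_nonneg W.abs_le
    refine Lp.ext ?_
    filter_upwards [hJae (W.op f), hop f, hop (J f), hJae f] with q h1 h2 h3 h4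
    rw [h3, h1, h2, h4, map_mul, Complex.conj_ofReal]
    ring

theorem kinetic_reflect (hbar k : ℝ) (m : ℤ) :
    kinetic hbar (circleDual l) (2 * Real.pi / l - k) m =
      kinetic hbar (circleDual l) k (-m - 1) := by
  rw [kinetic, kinetic, Real.norm_eq_abs, Real.norm_eq_abs, sq_abs, sq_abs, smul_eq_mul,
    smul_eq_mul, circleDual, circleDual]
  push_cast
  ring

/-- Conjugated eigenvectors are trial vectors of the same energies in Ky Fan's inequality at the
reflected quasimomentum. Reflection is an involution, so the inequality becomes an equality when it
is applied twice. -/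
theorem sum_energy_reflect_le (hh : 0 < hbar) (n : ℕ) (k : ℝ) :
    ∑ i ∈ Finset.range n, W.energy hbar i (2 * Real.pi / l - k) ≤
      ∑ i ∈ Finset.range n, W.energy hbar i k := by
  obtain ⟨J, h1, h2, h3, h4⟩ := W.exists_conjugation
  have himg : ∀ {ψ f : CircleL2 l}, IsImage W.fourier (kinetic hbar (circleDual l) k) W.op ψ f →
      IsImage W.fourier (kinetic hbar (circleDual l) (2 * Real.pi / l - k)) W.op (J ψ) (J f) :=
    fun {ψ f} h m => by
      have e := congrArg conj (h (-m - 1))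
      rw [map_add, map_mul, Complex.conj_ofReal, ← h2, ← h2, ← h2, ← h4, ← kinetic_reflect] at e
      exact e
  have horth : Orthonormal ℂ fun i : Fin n => J (W.state hbar k i) := by
    rw [orthonormal_iff_ite]
    intro i j
    rw [h1, orthonormal_iff_ite.1 (W.state hbar k).orthonormal]
    simp only [Fin.val_inj]
    split_ifs <;> simp
  have h := IsEigenbasis.sum_le W.op_symm (W.isEigenbasis hh (2 * Real.pi / l - k)) horth
    (f := fun i : Fin n => ((W.energy hbar i k : ℝ) : ℂ) • J (W.state hbar k i)) fun i => by
      have e := himg ((W.isEigenbasis hh k).image i)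
      rwa [h3] at e
  refine h.trans_eq ?_
  rw [Finset.sum_range]
  refine Finset.sum_congr rfl fun i _ => ?_
  rw [inner_smul_right, inner_self_eq_norm_sq_to_K, horth.1 i]
  simp

/-- Reflection symmetry of the band functions. -/
theorem energy_reflect (hh : 0 < hbar) (n : ℕ) (k : ℝ) :
    W.energy hbar n (2 * Real.pi / l - k) = W.energy hbar n k := by
  have h : ∀ n, ∑ i ∈ Finset.range n, W.energy hbar i (2 * Real.pi / l - k) =
      ∑ i ∈ Finset.range n, W.energy hbar i k := fun n => by
    refine le_antisymm (W.sum_energy_reflect_le hh n k) ?_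
    have := W.sum_energy_reflect_le hh n (2 * Real.pi / l - k)
    rwa [sub_sub_cancel] at this
  have h1 := h (n + 1)
  rw [Finset.sum_range_succ, Finset.sum_range_succ, h n] at h1
  exact add_left_cancel h1

theorem velocity_reflect (hh : 0 < hbar) (n : ℕ) (k : ℝ) :
    W.velocity hbar n (2 * Real.pi / l - k) = -W.velocity hbar n k := by
  have h : W.energy hbar n = fun k => W.energy hbar n (2 * Real.pi / l - k) :=
    funext fun k => (W.energy_reflect hh n k).symm
  rw [velocity, velocity]
  conv_rhs => rw [h, deriv_comp_const_sub]
  ring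

/-- Uniform bound for the resolvent trace. -/
theorem tsum_resolvent_sq_le (hh : 0 < hbar) (k : ℝ) : ENNReal.ofReal hbar *
    ∑' n, ENNReal.ofReal (((W.energy hbar n k + (W.bound + 1))⁻¹) ^ 2) ≤
      ENNReal.ofReal ((W.bound + 1) ^ 2 * (l / (2 * Real.pi)) *
        ((2 + 2 * (hbar * (2 * Real.pi / l)) ^ 2) * Real.pi)) := by
  have hl := W.length_pos
  have hM := W.bound_nonneg
  have ha := fun i => kinetic_nonneg hbar (circleDual l) k i
  obtain ⟨K, hK, -⟩ := exists_isResolvent (e := W.fourier) ha W.norm_op_le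
    (tendsto_atTop_of_summable_inv_sq ha (summable_inv_kinetic_add_one_sq hh hl k))
  have h1 : ∑' n, ENNReal.ofReal (((W.energy hbar n k + (W.bound + 1))⁻¹) ^ 2) =
      ∑' m, ENNReal.ofReal (‖K (W.fourier m)‖ ^ 2) := by
    have := hK.tsum_pow_eq W.op_symm (W.state hbar k) (fun n => W.neg_bound_le_energy hh n k)
      (W.isEigenbasis hh k).image 1
    simpa only [add_assoc, mul_one, pow_one] using this
  have hp : 0 < hbar * (2 * Real.pi / l) := by positivity
  rw [h1, ← ENNReal.tsum_mul_left, ENNReal.ofReal_mul (by positivity)]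
  refine le_trans ?_ (mul_le_mul_right (tsum_inv_one_add_sq_le hp (hbar * k)) _)
  rw [← ENNReal.tsum_mul_left]
  refine ENNReal.tsum_le_tsum fun m => ?_
  rw [← ENNReal.ofReal_mul hh.le, ← ENNReal.ofReal_mul (by positivity)]
  refine ENNReal.ofReal_le_ofReal ?_
  have h2 : ‖K (W.fourier m)‖ ^ 2 ≤ (W.bound + 1) ^ 2 *
      (1 + (hbar * k + hbar * (2 * Real.pi / l) * m) ^ 2)⁻¹ := by
    refine le_trans ?_ (mul_le_mul_of_nonneg_left (inv_kinetic_add_one_sq_le hbar l k m)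
      (by positivity))
    rw [← inv_pow, ← mul_pow, ← div_eq_mul_inv]
    refine pow_le_pow_left₀ (norm_nonneg _) ((hK.norm_basis_le m).trans ?_) 2
    exact div_le_div_of_nonneg_left (by positivity) (by linarith [ha m]) (by linarith [ha m])
  calc hbar * ‖K (W.fourier m)‖ ^ 2 ≤ hbar * ((W.bound + 1) ^ 2 *
      (1 + (hbar * k + hbar * (2 * Real.pi / l) * m) ^ 2)⁻¹) := by gcongr
    _ = _ := by field_simp

theorem measurable_velocity_prod : Measurable fun x : ℕ × ℝ => W.velocity hbar x.1 x.2 :=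
  measurable_from_prod_countable_right fun n => W.measurable_velocity n

/-- Averages of energy weights over the bands are controlled by the resolvent trace. -/
theorem lintegral_energy_le (hh : 0 < hbar) {b : ℝ → ℝ≥0∞} (hb : Measurable b) :
    ∫⁻ x, ENNReal.ofReal (((W.energy hbar x.1 x.2 + (W.bound + 1))⁻¹) ^ 2) * b x.2
      ∂(bandMeasure l hbar) ≤ ENNReal.ofReal ((W.bound + 1) ^ 2 * (l / (2 * Real.pi)) *
        ((2 + 2 * (hbar * (2 * Real.pi / l)) ^ 2) * Real.pi) * l) *
        ∫⁻ k in Set.Ico 0 (2 * Real.pi / l), b k := by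
  have hl := W.length_pos
  have hM := W.bound_nonneg
  have hm : Measurable fun x : ℕ × ℝ =>
      ENNReal.ofReal (((W.energy hbar x.1 x.2 + (W.bound + 1))⁻¹) ^ 2) * b x.2 :=
    (((W.measurable_energy hh).add_const _).inv.pow_const _).ennreal_ofReal.mul
      (hb.comp measurable_snd)
  rw [lintegral_bandMeasure hm,
    ← lintegral_const_mul' _ _ ENNReal.ofReal_ne_top, ← lintegral_const_mul' _ _ ENNReal.ofReal_ne_top]
  refine lintegral_mono fun k => ?_
  simp only
  rw [ENNReal.tsum_mul_right, ← mul_assoc, ENNReal.ofReal_mul hh.le, mul_right_comm (ENNReal.ofReal hbar),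
    ENNReal.ofReal_mul (p := _ * _) (by positivity)]
  gcongr
  exact W.tsum_resolvent_sq_le hh k

theorem exp_neg_le {c E : ℝ} (h : 1 ≤ E + c) :
    Real.exp (-E) ≤ 2 * Real.exp c * ((E + c)⁻¹) ^ 2 := by
  have h0 : 0 < E + c := by linarith
  have h1 := Real.quadratic_le_exp_of_nonneg h0.le
  have h2 : Real.exp (-E) = Real.exp c * (Real.exp (E + c))⁻¹ := by
    rw [← Real.exp_neg, ← Real.exp_add]; congr 1; ring
  have h3 : (Real.exp (E + c))⁻¹ ≤ 2 * ((E + c)⁻¹) ^ 2 := by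
    have e : 2 * ((E + c)⁻¹) ^ 2 = ((E + c) ^ 2 / 2)⁻¹ := by rw [inv_pow, inv_div]; ring
    rw [e]
    exact inv_anti₀ (by positivity) (by linarith)
  rw [h2]
  calc Real.exp c * (Real.exp (E + c))⁻¹ ≤ Real.exp c * (2 * ((E + c)⁻¹) ^ 2) := by gcongr
    _ = _ := by ring

theorem integrable_exp_neg_energy (hh : 0 < hbar) :
    Integrable (fun x : ℕ × ℝ => Real.exp (-W.energy hbar x.1 x.2)) (bandMeasure l hbar) := by
  have hm := (W.measurable_energy hh).neg.exp
  refine ⟨hm.aestronglyMeasurable, ?_⟩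
  rw [hasFiniteIntegral_iff_ofReal (Eventually.of_forall fun x => (Real.exp_pos _).le)]
  calc ∫⁻ x, ENNReal.ofReal (Real.exp (-W.energy hbar x.1 x.2)) ∂(bandMeasure l hbar)
      ≤ ∫⁻ x, ENNReal.ofReal (((W.energy hbar x.1 x.2 + (W.bound + 1))⁻¹) ^ 2) *
        ENNReal.ofReal (2 * Real.exp (W.bound + 1)) ∂(bandMeasure l hbar) := by
        refine lintegral_mono fun x => ?_
        rw [← ENNReal.ofReal_mul (by positivity), mul_comm]
        exact ENNReal.ofReal_le_ofReal (exp_neg_le (W.one_le_energy_add hh _ _))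
    _ ≤ _ := W.lintegral_energy_le hh (b := fun _ => ENNReal.ofReal (2 * Real.exp (W.bound + 1)))
        measurable_const
    _ < ⊤ := by
        refine ENNReal.mul_lt_top ENNReal.ofReal_lt_top ?_
        rw [lintegral_const, Measure.restrict_apply_univ, Real.volume_Ico]
        exact ENNReal.mul_lt_top ENNReal.ofReal_lt_top ENNReal.ofReal_lt_top

theorem integrable_exp_neg_classicalEnergy :
    Integrable (fun x => Real.exp (-W.classicalEnergy x)) (phaseMeasure l) := by
  have hm := W.continuous_classicalEnergy.measurable.neg.exp
  refine (W.integrable_resolvent_phase.const_mul (2 * Real.exp (W.bound + 1))).mono'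
    hm.aestronglyMeasurable (Eventually.of_forall fun x => ?_)
  rw [Real.norm_of_nonneg (Real.exp_pos _).le]
  exact exp_neg_le (W.one_le_classicalEnergy_add x)

/-- Reflection of the quasimomentum preserves the band measure. -/
theorem measurePreserving_reflect (hbar : ℝ) :
    MeasurePreserving (fun x : ℕ × ℝ => (x.1, 2 * Real.pi / l - x.2)) (bandMeasure l hbar)
      (bandMeasure l hbar) := by
  have h1 : MeasurePreserving (fun k : ℝ => 2 * Real.pi / l - k)
      (volume.restrict (Set.Ico 0 (2 * Real.pi / l)))
      (volume.restrict (Set.Ico 0 (2 * Real.pi / l))) := by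
    have h := (Measure.measurePreserving_sub_left (volume : Measure ℝ) (2 * Real.pi / l)).restrict_preimage
      (measurableSet_Ioc (a := 0) (b := 2 * Real.pi / l))
    rw [Set.preimage_const_sub_Ioc, sub_self, sub_zero, restrict_Ico_eq_restrict_Ioc.symm] at h
    exact h
  have h2 := (MeasurePreserving.id (Measure.count : Measure ℕ)).prod h1
  exact h2.smul_measure _

end CirclePotential

/-- A continuous cutoff vanishing near `M` and near `+∞`. -/
def cutoff (M : ℝ) (m : ℕ) (E : ℝ) : ℝ :=
  min 1 (max 0 ((m + 1) * |E - M| - 1)) * min 1 (max 0 (m + 1 - E))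

theorem continuous_cutoff (M : ℝ) (m : ℕ) : Continuous (cutoff M m) := by
  unfold cutoff
  fun_prop

theorem cutoff_mem (M : ℝ) (m : ℕ) (E : ℝ) : cutoff M m E ∈ Set.Icc (0 : ℝ) 1 := by
  have h : ∀ x : ℝ, 0 ≤ min 1 (max 0 x) := fun x => le_min zero_le_one (le_max_left _ _)
  exact ⟨mul_nonneg (h _) (h _), mul_le_one₀ (min_le_left _ _) (h _) (min_le_left _ _)⟩

theorem cutoff_eq_zero_of_near {M E : ℝ} {m : ℕ} (h : (m + 1) * |E - M| ≤ 1) :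
    cutoff M m E = 0 := by
  rw [cutoff, max_eq_left (by linarith), min_eq_right zero_le_one, zero_mul]

theorem cutoff_eq_zero_of_ge {M E : ℝ} {m : ℕ} (h : (m + 1 : ℝ) ≤ E) : cutoff M m E = 0 := by
  rw [cutoff, max_eq_left (by linarith : (m + 1 - E : ℝ) ≤ 0), min_eq_right zero_le_one, mul_zero]

theorem tendsto_cutoff {M E : ℝ} (h : E ≠ M) :
    Tendsto (fun m => cutoff M m E) atTop (𝓝 1) := by
  have h0 : 0 < |E - M| := abs_pos.2 (sub_ne_zero.2 h)
  refine tendsto_const_nhds.congr' ?_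
  filter_upwards [tendsto_natCast_atTop_atTop.eventually_ge_atTop E,
    (tendsto_natCast_atTop_atTop (R := ℝ)).eventually_ge_atTop (2 / |E - M|)] with m h1 h2
  rw [div_le_iff₀ h0] at h2
  rw [cutoff, min_eq_left (le_max_of_le_right (by linarith)),
    min_eq_left (le_max_of_le_right (by linarith)), one_mul]

theorem abs_cos_sub_cos_le_two (x y : ℝ) : |Real.cos x - Real.cos y| ≤ 2 := by
  rw [_root_.abs_le]
  have := Real.neg_one_le_cos x
  have := Real.cos_le_one x
  have := Real.neg_one_le_cos y
  have := Real.cos_le_one y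
  constructor <;> linarith

theorem tendsto_of_approximation {α : Type*} {l : Filter α} {F : α → ℝ} {a : ℝ}
    {Fm A : ℕ → α → ℝ} {am η : ℕ → ℝ} (h1 : ∀ m, Tendsto (Fm m) l (𝓝 (am m)))
    (h2 : ∀ m, ∀ᶠ x in l, |F x - Fm m x| ≤ A m x) (h3 : ∀ m, Tendsto (A m) l (𝓝 (η m)))
    (h4 : ∀ m, |a - am m| ≤ η m) (h5 : Tendsto η atTop (𝓝 0)) : Tendsto F l (𝓝 a) := by
  rw [Metric.tendsto_nhds]
  intro ε hε
  obtain ⟨m, hm⟩ := (h5.eventually_lt_const (show (0 : ℝ) < ε / 4 by positivity)).exists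
  filter_upwards [h2 m, (h3 m).eventually_lt_const hm,
    Metric.tendsto_nhds.1 (h1 m) (ε / 4) (by positivity)] with x e1 e2 e3
  rw [Real.dist_eq] at e3 ⊢
  have e4 := h4 m
  calc |F x - a| = |(F x - Fm m x) + (Fm m x - am m) - (a - am m)| := by congr 1; ring
    _ ≤ |F x - Fm m x| + |Fm m x - am m| + |a - am m| :=
        (abs_sub _ _).trans (by gcongr; exact abs_add_le _ _)
    _ < ε := by linarith

theorem tendsto_sq_mul_of_abs_le_exp {g : ℝ → ℝ} (h : ∀ E, |g E| ≤ Real.exp (-E)) (c : ℝ) :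
    Tendsto (fun E => (E + c) ^ 2 * g E) atTop (𝓝 0) := by
  have h1 := ((Real.tendsto_pow_mul_exp_neg_atTop_nhds_zero 2).comp
    (tendsto_atTop_add_const_right atTop c tendsto_id)).mul_const (Real.exp c)
  rw [zero_mul] at h1
  refine squeeze_zero_norm (fun E => ?_) h1
  rw [norm_mul, Real.norm_of_nonneg (sq_nonneg _)]
  simp only [Function.comp_apply, id_eq]
  rw [mul_assoc, ← Real.exp_add, show -(E + c) + c = -E by ring]
  gcongr
  exact h E

/-! ### Joint limit of energy and absolute velocity -/

namespace CirclePotential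

open scoped ENNReal

variable {l : ℝ} (W : CirclePotential l) {hbar : ℝ}

theorem continuousAt_meanSpeed {E : ℝ} (hE : E ≠ W.maxValue) : ContinuousAt W.meanSpeed E := by
  rcases lt_or_gt_of_ne hE with h | h
  · refine (continuousAt_const (y := (0 : ℝ))).congr ?_
    filter_upwards [Iio_mem_nhds h] with x hx
    rw [meanSpeed, if_neg (not_lt.2 (le_of_lt hx))]
  · obtain ⟨r, hr1, hr2⟩ := exists_between h
    -- Replacing `E` by `max E r` keeps the integrand away from its singularity, so continuity of
    -- the parametric integral holds on the whole line.
    have h1 : Continuous fun E => W.travelTime (max E r) := by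
      refine intervalIntegral.continuous_parametric_intervalIntegral_of_continuous' ?_ 0 l
      have := W.continuous
      refine Continuous.inv₀ (by fun_prop) fun x => (Real.sqrt_pos.2 ?_).ne'
      linarith [W.le_maxValue x.2, le_max_right x.1 r]
    have h2 : ∀ E, W.maxValue < max E r := fun E => hr1.trans_le (le_max_right _ _)
    have h3 : Continuous fun E => l / W.travelTime (max E r) :=
      continuous_const.div h1 fun E => (W.travelTime_pos (h2 E)).ne'
    refine h3.continuousAt.congr ?_
    filter_upwards [Ioi_mem_nhds hr2] with x hx
    rw [max_eq_left (le_of_lt hx), meanSpeed, if_pos (hr1.trans hx)]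

theorem measurable_meanSpeed : Measurable W.meanSpeed := by
  classical
  have h : W.meanSpeed = (Set.Ioi W.maxValue).piecewise W.meanSpeed fun _ => 0 := by
    funext E
    by_cases hE : W.maxValue < E
    · exact (Set.piecewise_eq_of_mem (Set.Ioi W.maxValue) _ _ hE).symm
    · exact (if_neg hE).trans (Set.piecewise_eq_of_notMem (Set.Ioi W.maxValue) _ (fun _ => (0 : ℝ)) hE).symm
  rw [h]
  exact ContinuousOn.measurable_piecewise
    (fun E hE => (W.continuousAt_meanSpeed (ne_of_gt hE)).continuousWithinAt)
    continuousOn_const measurableSet_Ioi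

/-- The cutoff vanishes in a neighbourhood of the critical energy, so the behaviour of the mean
speed there is immaterial. -/
theorem continuous_cutoff_mul (m : ℕ) (u : ℝ) :
    Continuous fun E => cutoff W.maxValue m E * Real.cos (u * W.meanSpeed E) := by
  refine continuous_iff_continuousAt.2 fun E => ?_
  by_cases hE : E = W.maxValue
  · refine (continuousAt_const (y := (0 : ℝ))).congr ?_
    have h : Continuous fun E => ((m : ℝ) + 1) * |E - W.maxValue| := by fun_prop
    filter_upwards [h.continuousAt.eventually_lt (continuousAt_const (y := (1 : ℝ)))
      (show ((m : ℝ) + 1) * |E - W.maxValue| < 1 by simp [hE])] with x hx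
    rw [cutoff_eq_zero_of_near hx.le, zero_mul]
  · have h1 := W.continuousAt_meanSpeed hE
    exact (continuous_cutoff _ m).continuousAt.mul
      (Real.continuous_cos.continuousAt.comp (continuousAt_const.mul h1))

theorem ae_bandMeasure {P : ℝ → Prop} (h : ∀ᵐ k, P k) : ∀ᵐ x ∂(bandMeasure l hbar), P x.2 :=
  Measure.ae_smul_measure (Measure.quasiMeasurePreserving_snd.ae (ae_restrict_of_ae h)) _

theorem ae_sin_ne_zero (hl : 0 < l) : ∀ᵐ k : ℝ, Real.sin (k * l) ≠ 0 := by
  have h : ({k | Real.sin (k * l) ≠ 0}ᶜ : Set ℝ) ⊆ Set.range fun n : ℤ => n * Real.pi / l := by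
    intro k hk
    simp only [Set.mem_compl_iff, Set.mem_ofPred_eq, not_not] at hk
    obtain ⟨n, hn⟩ := Real.sin_eq_zero_iff.1 hk
    exact ⟨n, by simp only; rw [hn, mul_div_cancel_right₀ _ hl.ne']⟩
  exact measure_mono_null h ((Set.countable_range _).measure_zero _)

/-- For each position at most two momenta have a prescribed energy. -/
theorem ae_classicalEnergy_ne (r : ℝ) : ∀ᵐ x ∂(phaseMeasure l), W.classicalEnergy x ≠ r := by
  have hs : MeasurableSet {x | W.classicalEnergy x = r} :=
    W.continuous_classicalEnergy.measurable (measurableSet_singleton r)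
  have h : phaseMeasure l {x | W.classicalEnergy x = r} = 0 := by
    rw [phaseMeasure, Measure.prod_apply_symm hs, lintegral_eq_zero_of_ae_eq_zero]
    refine Eventually.of_forall fun q => ?_
    refine measure_mono_null (t := {√(2 * (r - W.toFun q)), -√(2 * (r - W.toFun q))}) (fun p hp => ?_)
      (Set.Finite.measure_zero (by simp) _)
    have hp' : p ^ 2 / 2 + W.toFun q = r := hp
    have h2 : p ^ 2 = (√(2 * (r - W.toFun q))) ^ 2 := by
      rw [Real.sq_sqrt (by nlinarith [sq_nonneg p])]
      linarith
    simpa using sq_eq_sq_iff_eq_or_eq_neg.1 h2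
  exact measure_eq_zero_iff_ae_notMem.1 h

/-- Comparison of the semiclassical with the classical velocity, away from the critical energy. -/
theorem exists_cutoff_mul_abs_cos_sub_le (m : ℕ) (u : ℝ) : ∃ C, 0 < C ∧ ∀ hbar, 0 < hbar →
    ∀ᵐ k, ∀ n, cutoff W.maxValue m (W.energy hbar n k) *
      |Real.cos (u * W.velocity hbar n k) - Real.cos (u * W.meanSpeed (W.energy hbar n k))| ≤
        C * hbar ^ 2 + min 2 (C * hbar / |Real.sin (k * l)|) := by
  have hm : (0 : ℝ) < m + 1 := by positivity
  have hδ : (0 : ℝ) < ((m : ℝ) + 1)⁻¹ := by positivity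
  obtain ⟨C₁, hC₁, h1⟩ := W.abs_meanMomentum_le_of_lt hδ
  obtain ⟨C₂, hC₂, h2⟩ := W.abs_meanMomentum_sub_le_of_gt (R := m + 1) hδ
  -- The summand `2 * C₂` covers the quasimomenta with `|sin(kl)| < C₂ ħ`, where no WKB estimate is
  -- available: there `Cħ/|sin(kl)|` exceeds the trivial bound 2.
  refine ⟨|u| * C₁ + (|u| + 2) * C₂, by positivity, fun hbar hh => ?_⟩
  filter_upwards [W.ae_velocity_eq hh, ae_sin_ne_zero W.length_pos] with k hk hsin n
  set E := W.energy hbar n k with hE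
  obtain ⟨Ψ, Φ, hΨ, hv⟩ := W.exists_isBlochSolution hh ((W.state hbar k).orthonormal.1 n)
    ((W.isEigenbasis hh k).image n)
  rw [← hk n] at hv
  have hc := cutoff_mem W.maxValue m E
  have hs : 0 < |Real.sin (k * l)| := abs_pos.2 hsin
  have hmin : 0 ≤ min 2 ((|u| * C₁ + (|u| + 2) * C₂) * hbar / |Real.sin (k * l)|) := by positivity
  have htwo : |Real.cos (u * W.velocity hbar n k) - Real.cos (u * W.meanSpeed E)| ≤ 2 :=
    abs_cos_sub_cos_le_two _ _
  by_cases hnear : (m + 1) * |E - W.maxValue| ≤ 1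
  · rw [cutoff_eq_zero_of_near hnear, zero_mul]
    positivity
  by_cases hbig : (m + 1 : ℝ) ≤ E
  · rw [cutoff_eq_zero_of_ge hbig, zero_mul]
    positivity
  refine (mul_le_of_le_one_left (abs_nonneg _) hc.2).trans ?_
  have hfar : ((m : ℝ) + 1)⁻¹ < |E - W.maxValue| := by
    rw [inv_lt_iff_one_lt_mul₀ hm]
    linarith
  rcases lt_abs.1 hfar with hlt | hlt
  · refine le_add_of_nonneg_of_le (by positivity) (le_min htwo ?_)
    rcases le_or_gt (C₂ * hbar) |Real.sin (k * l)| with h | h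
    · have h3 := h2 hbar k E Ψ Φ hh hΨ (by linarith) (not_le.1 hbig).le h
      rw [← hv] at h3
      have hS : W.meanSpeed E = l / W.travelTime E := if_pos (by linarith)
      -- Only the modulus of the velocity is controlled; evenness of the cosine makes this
      -- sufficient.
      have h4 : Real.cos (u * W.velocity hbar n k) = Real.cos (u * |W.velocity hbar n k|) := by
        rcases abs_choice (W.velocity hbar n k) with e | e
        · rw [e]
        · rw [e, mul_neg, Real.cos_neg]
      rw [h4, hS]
      refine (Real.abs_cos_sub_cos_le _ _).trans ?_
      rw [← mul_sub, abs_mul]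
      calc |u| * |(|W.velocity hbar n k| - l / W.travelTime E)|
          ≤ |u| * (C₂ * hbar / |Real.sin (k * l)|) := by gcongr
        _ = (|u| * C₂) * hbar / |Real.sin (k * l)| := by ring
        _ ≤ _ := by
          gcongr
          nlinarith [mul_nonneg (abs_nonneg u) hC₁.le]
    · refine htwo.trans ?_
      rw [le_div_iff₀ hs]
      have e1 : 0 ≤ |u| * C₁ * hbar := by positivity
      have e2 : 0 ≤ |u| * C₂ * hbar := by positivity
      nlinarith
  · have h3 := h1 hbar k E Ψ Φ hh hΨ (by linarith)
    rw [← hv] at h3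
    have hS : W.meanSpeed E = 0 := if_neg (by linarith)
    rw [hS, mul_zero]
    refine le_add_of_le_of_nonneg ?_ hmin
    have h4 := Real.abs_cos_sub_cos_le (u * W.velocity hbar n k) 0
    refine h4.trans ?_
    rw [sub_zero, abs_mul]
    calc |u| * |W.velocity hbar n k| ≤ |u| * (C₁ * hbar ^ 2) := by gcongr
      _ = (|u| * C₁) * hbar ^ 2 := by ring
      _ ≤ _ := by
        gcongr
        exact le_add_of_nonneg_right (by positivity)

/-- Dominated convergence with the constant `C + 2`. The pointwise limit is 0 everywhere, since
division by zero gives 0 at the zeros of the sine. -/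
theorem tendsto_lintegral_error {C : ℝ} (hC : 0 < C) (l : ℝ) :
    Tendsto (fun hbar => ∫⁻ k in Set.Ico 0 (2 * Real.pi / l),
      ENNReal.ofReal (C * hbar ^ 2 + min 2 (C * hbar / |Real.sin (k * l)|))) (𝓝[>] 0) (𝓝 0) := by
  have hmem : Set.Ioo (0 : ℝ) 1 ∈ 𝓝[>] (0 : ℝ) := Ioo_mem_nhdsGT one_pos
  have h := tendsto_lintegral_filter_of_dominated_convergence (l := 𝓝[>] (0 : ℝ))
    (μ := volume.restrict (Set.Ico 0 (2 * Real.pi / l)))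
    (F := fun hbar k => ENNReal.ofReal (C * hbar ^ 2 + min 2 (C * hbar / |Real.sin (k * l)|)))
    (f := fun _ => 0) (fun _ => ENNReal.ofReal (C + 2))
    (Eventually.of_forall fun hbar => by
      refine Measurable.ennreal_ofReal (measurable_const.add (measurable_const.min
        (measurable_const.div ?_)))
      exact (by fun_prop : Continuous fun k => |Real.sin (k * l)|).measurable) (by
      filter_upwards [hmem] with hbar hh
      refine Eventually.of_forall fun k => ENNReal.ofReal_le_ofReal ?_
      gcongr
      · exact mul_le_of_le_one_right hC.le (pow_le_one₀ hh.1.le hh.2.le)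
      · exact min_le_left _ _) (by
      rw [lintegral_const, Measure.restrict_apply_univ, Real.volume_Ico]
      exact (ENNReal.mul_lt_top ENNReal.ofReal_lt_top ENNReal.ofReal_lt_top).ne)
    (Eventually.of_forall fun k => by
      have h1 : Continuous fun hbar : ℝ =>
        C * hbar ^ 2 + min 2 (C * hbar / |Real.sin (k * l)|) := by fun_prop
      have h2 := (ENNReal.continuous_ofReal.comp h1).tendsto 0
      simp only [Function.comp_apply] at h2
      simp only [ne_eq, OfNat.ofNat_ne_zero, not_false_eq_true, zero_pow, mul_zero, zero_div,
        Nat.ofNat_nonneg, inf_of_le_right, add_zero, ENNReal.ofReal_zero] at h2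
      exact h2.mono_left nhdsWithin_le_nhds)
  simpa using h

/-- The error bound depends on `k` alone, uniformly over the bands. Summation of the energy weight
over the bands costs a resolvent trace of order `1/ħ`, which the factor `ħ` in the band measure
compensates. -/
theorem tendsto_integral_cutoff_error (m : ℕ) (u : ℝ) :
    Tendsto (fun hbar => ∫ x, Real.exp (-W.energy hbar x.1 x.2) *
      (cutoff W.maxValue m (W.energy hbar x.1 x.2) * |Real.cos (u * W.velocity hbar x.1 x.2) -
        Real.cos (u * W.meanSpeed (W.energy hbar x.1 x.2))|) ∂(bandMeasure l hbar))
      (𝓝[>] 0) (𝓝 0) := by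
  have hl := W.length_pos
  obtain ⟨C, hC, hb⟩ := W.exists_cutoff_mul_abs_cos_sub_le m u
  set A : ℝ → ℝ≥0∞ := fun hbar => ENNReal.ofReal ((W.bound + 1) ^ 2 * (l / (2 * Real.pi)) *
        ((2 + 2 * (hbar * (2 * Real.pi / l)) ^ 2) * Real.pi) * l) with hA
  set c := ENNReal.ofReal (2 * Real.exp (W.bound + 1)) with hc
  have hlim : Tendsto (fun hbar => A hbar * (c * ∫⁻ k in Set.Ico 0 (2 * Real.pi / l),
      ENNReal.ofReal (C * hbar ^ 2 + min 2 (C * hbar / |Real.sin (k * l)|))))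
      (𝓝[>] 0) (𝓝 0) := by
    have hAc : Continuous A := ENNReal.continuous_ofReal.comp (by fun_prop)
    have h1 := ENNReal.Tendsto.const_mul (a := c) (tendsto_lintegral_error hC l)
      (Or.inr ENNReal.ofReal_ne_top)
    rw [mul_zero] at h1
    have h2 := ENNReal.Tendsto.mul ((hAc.tendsto 0).mono_left nhdsWithin_le_nhds)
      (Or.inr ENNReal.zero_ne_top) h1 (Or.inr ENNReal.ofReal_ne_top)
    rwa [mul_zero] at h2
  have hlim' := (ENNReal.tendsto_toReal ENNReal.zero_ne_top).comp hlim
  rw [ENNReal.toReal_zero] at hlim'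
  refine squeeze_zero' (Eventually.of_forall fun hbar => integral_nonneg fun x => ?_) ?_ hlim'
  · exact mul_nonneg (Real.exp_pos _).le (mul_nonneg (cutoff_mem _ _ _).1 (abs_nonneg _))
  filter_upwards [self_mem_nhdsWithin, hlim.eventually_lt_const ENNReal.zero_lt_top] with hbar hh hfin
  have hh : 0 < hbar := hh
  have hmE := W.measurable_energy hh
  have hmeas : AEStronglyMeasurable (fun x : ℕ × ℝ => Real.exp (-W.energy hbar x.1 x.2) *
      (cutoff W.maxValue m (W.energy hbar x.1 x.2) * |Real.cos (u * W.velocity hbar x.1 x.2) -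
        Real.cos (u * W.meanSpeed (W.energy hbar x.1 x.2))|)) (bandMeasure l hbar) :=
    (hmE.neg.exp.mul (((continuous_cutoff _ m).measurable.comp hmE).mul
      (((W.measurable_velocity_prod.const_mul u).cos.sub
        ((W.measurable_meanSpeed.comp hmE).const_mul u).cos).abs))).aestronglyMeasurable
  rw [integral_eq_lintegral_of_nonneg_ae (Eventually.of_forall fun x =>
    mul_nonneg (Real.exp_pos _).le (mul_nonneg (cutoff_mem _ _ _).1 (abs_nonneg _))) hmeas]
  refine ENNReal.toReal_mono hfin.ne ?_
  beta_reduce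
  rw [← lintegral_const_mul' c _ ENNReal.ofReal_ne_top]
  refine le_trans (lintegral_mono_ae ?_) (W.lintegral_energy_le hh (b := fun k => c *
    ENNReal.ofReal (C * hbar ^ 2 + min 2 (C * hbar / |Real.sin (k * l)|))) ?_)
  · filter_upwards [ae_bandMeasure (hb hbar hh)] with x hx
    rw [hc, ← ENNReal.ofReal_mul (by positivity), ← ENNReal.ofReal_mul (by positivity)]
    refine ENNReal.ofReal_le_ofReal ?_
    have h1 := exp_neg_le (W.one_le_energy_add hh x.1 x.2)
    rw [mul_comm (2 * _)] at h1
    exact (mul_le_mul h1 (hx x.1) (mul_nonneg (cutoff_mem _ _ _).1 (abs_nonneg _))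
      (by positivity)).trans_eq (mul_assoc _ _ _)
  · refine (Measurable.ennreal_ofReal (measurable_const.add (measurable_const.min
        (measurable_const.div ?_)))).const_mul _
    exact (by fun_prop : Continuous fun k => |Real.sin (k * l)|).measurable

theorem tendsto_integral_one_sub_cutoff :
    Tendsto (fun m : ℕ => ∫ x, Real.exp (-W.classicalEnergy x) *
      (1 - cutoff W.maxValue m (W.classicalEnergy x)) ∂(phaseMeasure l)) atTop (𝓝 0) := by
  have hc := W.continuous_classicalEnergy
  have h := tendsto_integral_of_dominated_convergence (μ := phaseMeasure l)
    (F := fun m x => Real.exp (-W.classicalEnergy x) *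
      (1 - cutoff W.maxValue m (W.classicalEnergy x))) (f := fun _ => 0)
    (fun x => Real.exp (-W.classicalEnergy x))
    (fun m => ((hc.neg.rexp).mul (continuous_const.sub
      ((continuous_cutoff _ m).comp hc))).aestronglyMeasurable)
    W.integrable_exp_neg_classicalEnergy
    (fun m => Eventually.of_forall fun x => by
      have := cutoff_mem W.maxValue m (W.classicalEnergy x)
      rw [norm_mul, Real.norm_of_nonneg (Real.exp_pos _).le,
        Real.norm_of_nonneg (by linarith [this.2])]
      exact mul_le_of_le_one_right (Real.exp_pos _).le (by linarith [this.1])) (by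
      filter_upwards [W.ae_classicalEnergy_ne W.maxValue] with x hx
      have := ((tendsto_cutoff hx).const_sub 1).const_mul (Real.exp (-W.classicalEnergy x))
      rwa [sub_self, mul_zero] at this)
  simpa using h

/-- Joint limit of energy and absolute velocity. -/
theorem tendsto_integral_mul_cos {g : ℝ → ℝ} (hg : Continuous g) (hle : ∀ E, |g E| ≤ Real.exp (-E))
    (u : ℝ) : Tendsto (fun hbar => ∫ x, g (W.energy hbar x.1 x.2) *
      Real.cos (u * W.velocity hbar x.1 x.2) ∂(bandMeasure l hbar)) (𝓝[>] 0)
      (𝓝 (∫ x, g (W.classicalEnergy x) * Real.cos (u * W.meanSpeed (W.classicalEnergy x))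
        ∂(phaseMeasure l))) := by
  have hcut : ∀ m E, |g E * (cutoff W.maxValue m E * Real.cos (u * W.meanSpeed E))| ≤
      Real.exp (-E) := fun m E => by
    have h1 := cutoff_mem W.maxValue m E
    rw [abs_mul, abs_mul, abs_of_nonneg h1.1]
    calc |g E| * (cutoff W.maxValue m E * |Real.cos (u * W.meanSpeed E)|)
        ≤ Real.exp (-E) * (1 * 1) := by
          refine mul_le_mul (hle E) ?_ (mul_nonneg h1.1 (abs_nonneg _)) (Real.exp_pos _).le
          refine mul_le_mul h1.2 ?_ (abs_nonneg _) zero_le_one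
          · exact Real.abs_cos_le_one _
      _ = _ := by ring
  -- The main term `Fm m` uses the classical speed and the cutoff, hence is a continuous function of
  -- the energy to which the Weyl law applies. The error `A m` consists of the velocity comparison
  -- inside the cutoff, which vanishes with `ħ`, and the mass outside it, which tends to its
  -- classical value and then vanishes with `m`.
  refine tendsto_of_approximation
    (Fm := fun m hbar => ∫ x, g (W.energy hbar x.1 x.2) * (cutoff W.maxValue m
      (W.energy hbar x.1 x.2) * Real.cos (u * W.meanSpeed (W.energy hbar x.1 x.2)))
        ∂(bandMeasure l hbar))
    (am := fun m => ∫ x, g (W.classicalEnergy x) * (cutoff W.maxValue m (W.classicalEnergy x) *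
      Real.cos (u * W.meanSpeed (W.classicalEnergy x))) ∂(phaseMeasure l))
    (A := fun m hbar => (∫ x, Real.exp (-W.energy hbar x.1 x.2) *
      (cutoff W.maxValue m (W.energy hbar x.1 x.2) * |Real.cos (u * W.velocity hbar x.1 x.2) -
        Real.cos (u * W.meanSpeed (W.energy hbar x.1 x.2))|) ∂(bandMeasure l hbar)) +
      ∫ x, Real.exp (-W.energy hbar x.1 x.2) *
        (1 - cutoff W.maxValue m (W.energy hbar x.1 x.2)) ∂(bandMeasure l hbar))
    (fun m => W.tendsto_integral_energy (hg.mul (W.continuous_cutoff_mul m u))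
      (tendsto_sq_mul_of_abs_le_exp (hcut m) _)) (fun m => ?_) (fun m => ?_) (fun m => ?_)
    W.tendsto_integral_one_sub_cutoff
  · filter_upwards [self_mem_nhdsWithin] with hbar hh
    have hh : 0 < hbar := hh
    have hmE := W.measurable_energy hh
    have hmv := W.measurable_velocity_prod (hbar := hbar)
    have hmS := W.measurable_meanSpeed.comp hmE
    have hmc := (continuous_cutoff W.maxValue m).measurable.comp hmE
    have hint := W.integrable_exp_neg_energy hh
    have i1 : Integrable (fun x : ℕ × ℝ => g (W.energy hbar x.1 x.2) *
        Real.cos (u * W.velocity hbar x.1 x.2)) (bandMeasure l hbar) := by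
      refine hint.mono' ((hg.measurable.comp hmE).mul (hmv.const_mul u).cos).aestronglyMeasurable
        (Eventually.of_forall fun x => ?_)
      rw [norm_mul]
      exact (mul_le_of_le_one_right (norm_nonneg _) (Real.abs_cos_le_one _)).trans (hle _)
    have i2 : Integrable (fun x : ℕ × ℝ => g (W.energy hbar x.1 x.2) * (cutoff W.maxValue m
        (W.energy hbar x.1 x.2) * Real.cos (u * W.meanSpeed (W.energy hbar x.1 x.2))))
        (bandMeasure l hbar) :=
      hint.mono' ((hg.measurable.comp hmE).mul (hmc.mul
        (hmS.const_mul u).cos)).aestronglyMeasurable (Eventually.of_forall fun x => hcut m _)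
    have i3 : Integrable (fun x : ℕ × ℝ => Real.exp (-W.energy hbar x.1 x.2) *
        (cutoff W.maxValue m (W.energy hbar x.1 x.2) * |Real.cos (u * W.velocity hbar x.1 x.2) -
          Real.cos (u * W.meanSpeed (W.energy hbar x.1 x.2))|)) (bandMeasure l hbar) := by
      refine (hint.const_mul 2).mono' (hmE.neg.exp.mul (hmc.mul ((hmv.const_mul u).cos.sub
        (hmS.const_mul u).cos).abs)).aestronglyMeasurable (Eventually.of_forall fun x => ?_)
      have h1 := cutoff_mem W.maxValue m (W.energy hbar x.1 x.2)
      rw [norm_mul, norm_mul, Real.norm_of_nonneg (Real.exp_pos _).le, Real.norm_of_nonneg h1.1,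
        Real.norm_of_nonneg (abs_nonneg _), mul_comm (2 : ℝ)]
      gcongr
      refine (mul_le_of_le_one_left (abs_nonneg _) h1.2).trans (abs_cos_sub_cos_le_two _ _)
    have i4 : Integrable (fun x : ℕ × ℝ => Real.exp (-W.energy hbar x.1 x.2) *
        (1 - cutoff W.maxValue m (W.energy hbar x.1 x.2))) (bandMeasure l hbar) := by
      refine hint.mono' (hmE.neg.exp.mul (hmc.const_sub 1)).aestronglyMeasurable
        (Eventually.of_forall fun x => ?_)
      have h1 := cutoff_mem W.maxValue m (W.energy hbar x.1 x.2)
      rw [norm_mul, Real.norm_of_nonneg (Real.exp_pos _).le,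
        Real.norm_of_nonneg (by linarith [h1.2])]
      exact mul_le_of_le_one_right (Real.exp_pos _).le (by linarith [h1.1])
    rw [← integral_sub i1 i2, ← integral_add i3 i4]
    refine (abs_integral_le_integral_abs).trans (integral_mono_of_nonneg
      (Eventually.of_forall fun x => abs_nonneg _) (i3.add i4) (Eventually.of_forall fun x => ?_))
    simp only
    set E := W.energy hbar x.1 x.2
    set v := W.velocity hbar x.1 x.2
    have h1 := cutoff_mem W.maxValue m E
    have e1 : g E * Real.cos (u * v) - g E * (cutoff W.maxValue m E * Real.cos (u * W.meanSpeed E)) =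
        g E * (cutoff W.maxValue m E * (Real.cos (u * v) - Real.cos (u * W.meanSpeed E)) +
          (1 - cutoff W.maxValue m E) * Real.cos (u * v)) := by ring
    rw [e1, abs_mul, ← mul_add]
    refine mul_le_mul (hle E) ((abs_add_le _ _).trans ?_) (abs_nonneg _) (Real.exp_pos _).le
    rw [abs_mul, abs_mul, abs_of_nonneg h1.1, abs_of_nonneg (by linarith [h1.2] :
      0 ≤ 1 - cutoff W.maxValue m E)]
    gcongr
    exact mul_le_of_le_one_right (by linarith [h1.2]) (Real.abs_cos_le_one _)
  · have h1 := (W.tendsto_integral_cutoff_error m u).add (W.tendsto_integral_energy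
      (g := fun E => Real.exp (-E) * (1 - cutoff W.maxValue m E))
      ((by fun_prop : Continuous fun E : ℝ => Real.exp (-E)).mul
        (continuous_const.sub (continuous_cutoff _ m)))
      (tendsto_sq_mul_of_abs_le_exp (fun E => by
        have h1 := cutoff_mem W.maxValue m E
        rw [abs_mul, abs_of_pos (Real.exp_pos _), abs_of_nonneg (by linarith [h1.2])]
        exact mul_le_of_le_one_right (Real.exp_pos _).le (by linarith [h1.1])) _))
    rwa [zero_add] at h1
  · have hmE := W.continuous_classicalEnergy.measurable
    have hmS := W.measurable_meanSpeed.comp hmE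
    have hmc := (continuous_cutoff W.maxValue m).measurable.comp hmE
    have hint := W.integrable_exp_neg_classicalEnergy
    have i1 : Integrable (fun x => g (W.classicalEnergy x) *
        Real.cos (u * W.meanSpeed (W.classicalEnergy x))) (phaseMeasure l) := by
      refine hint.mono' ((hg.measurable.comp hmE).mul (hmS.const_mul u).cos).aestronglyMeasurable
        (Eventually.of_forall fun x => ?_)
      rw [norm_mul]
      exact (mul_le_of_le_one_right (norm_nonneg _) (Real.abs_cos_le_one _)).trans (hle _)
    have i2 : Integrable (fun x => g (W.classicalEnergy x) * (cutoff W.maxValue m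
        (W.classicalEnergy x) * Real.cos (u * W.meanSpeed (W.classicalEnergy x))))
        (phaseMeasure l) :=
      hint.mono' ((hg.measurable.comp hmE).mul (hmc.mul
        (hmS.const_mul u).cos)).aestronglyMeasurable (Eventually.of_forall fun x => hcut m _)
    have i4 : Integrable (fun x => Real.exp (-W.classicalEnergy x) *
        (1 - cutoff W.maxValue m (W.classicalEnergy x))) (phaseMeasure l) := by
      refine hint.mono' (hmE.neg.exp.mul (hmc.const_sub 1)).aestronglyMeasurable
        (Eventually.of_forall fun x => ?_)
      have h1 := cutoff_mem W.maxValue m (W.classicalEnergy x)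
      rw [norm_mul, Real.norm_of_nonneg (Real.exp_pos _).le,
        Real.norm_of_nonneg (by linarith [h1.2])]
      exact mul_le_of_le_one_right (Real.exp_pos _).le (by linarith [h1.1])
    rw [← integral_sub i1 i2]
    refine (abs_integral_le_integral_abs).trans (integral_mono_of_nonneg
      (Eventually.of_forall fun x => abs_nonneg _) i4 (Eventually.of_forall fun x => ?_))
    simp only
    set E := W.classicalEnergy x
    have h1 := cutoff_mem W.maxValue m E
    have e1 : g E * Real.cos (u * W.meanSpeed E) - g E * (cutoff W.maxValue m E *
        Real.cos (u * W.meanSpeed E)) =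
        g E * ((1 - cutoff W.maxValue m E) * Real.cos (u * W.meanSpeed E)) := by ring
    rw [e1, abs_mul, abs_mul, abs_of_nonneg (by linarith [h1.2] :
      0 ≤ 1 - cutoff W.maxValue m E)]
    refine mul_le_mul (hle E) ?_ (by have := h1.2; positivity) (Real.exp_pos _).le
    exact mul_le_of_le_one_right (by linarith [h1.2]) (Real.abs_cos_le_one _)

end CirclePotential

/-! ### Characteristic functions on a circle -/

theorem norm_cexp_weight (s u E v : ℝ) :
    ‖Complex.exp ((-1 + s * Complex.I) * E + u * v * Complex.I)‖ = Real.exp (-E) := by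
  rw [Complex.norm_exp]
  simp

/-- If a measure-preserving map reverses the sign of `v` and preserves `E`, only the even part in
`v` of the joint characteristic function remains. -/
theorem integral_cexp_eq_of_reflection {α : Type*} [MeasurableSpace α] {μ : Measure α} {T : α → α}
    {E v : α → ℝ} (hT : MeasurePreserving T μ μ) (hEm : Measurable E) (hvm : Measurable v)
    (hE : ∀ x, E (T x) = E x) (hv : ∀ x, v (T x) = -v x)
    (hint : Integrable (fun x => Real.exp (-E x)) μ) (s u : ℝ) :
    ∫ x, Complex.exp ((-1 + s * Complex.I) * E x + u * v x * Complex.I) ∂μ =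
      (∫ x, (Real.exp (-E x) * Real.cos (s * E x)) * Real.cos (u * v x) ∂μ : ℝ) +
      (∫ x, (Real.exp (-E x) * Real.sin (s * E x)) * Real.cos (u * v x) ∂μ : ℝ) * Complex.I := by
  set F : α → ℂ := fun x => Complex.exp ((-1 + s * Complex.I) * E x + u * v x * Complex.I) with hF
  have hFm : Measurable F := by fun_prop
  have hFi : Integrable F μ := hint.mono' hFm.aestronglyMeasurable
    (Eventually.of_forall fun x => (norm_cexp_weight s u (E x) (v x)).le)
  have hFT : ∫ x, F (T x) ∂μ = ∫ x, F x ∂μ := by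
    conv_rhs => rw [← hT.map_eq]
    exact (integral_map hT.measurable.aemeasurable hFm.aestronglyMeasurable).symm
  have hFTi : Integrable (fun x => F (T x)) μ :=
    (hT.integrable_comp hFm.aestronglyMeasurable).2 hFi
  have i1 : Integrable (fun x => (Real.exp (-E x) * Real.cos (s * E x)) * Real.cos (u * v x)) μ := by
    refine hint.mono' (by fun_prop) (Eventually.of_forall fun x => ?_)
    rw [norm_mul, norm_mul, Real.norm_of_nonneg (Real.exp_pos _).le, mul_assoc]
    exact mul_le_of_le_one_right (Real.exp_pos _).le
      (mul_le_one₀ (Real.abs_cos_le_one _) (norm_nonneg _) (Real.abs_cos_le_one _))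
  have i2 : Integrable (fun x => (Real.exp (-E x) * Real.sin (s * E x)) * Real.cos (u * v x)) μ := by
    refine hint.mono' (by fun_prop) (Eventually.of_forall fun x => ?_)
    rw [norm_mul, norm_mul, Real.norm_of_nonneg (Real.exp_pos _).le, mul_assoc]
    exact mul_le_of_le_one_right (Real.exp_pos _).le
      (mul_le_one₀ (Real.abs_sin_le_one _) (norm_nonneg _) (Real.abs_cos_le_one _))
  -- The integral equals the average over a point and its reflection, in which the factors
  -- `exp(±iuv)` combine to `cos(uv)`.
  have h : ∀ x, F x + F (T x) =
      2 * (((Real.exp (-E x) * Real.cos (s * E x)) * Real.cos (u * v x) : ℝ) +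
        ((Real.exp (-E x) * Real.sin (s * E x)) * Real.cos (u * v x) : ℝ) * Complex.I) := fun x => by
    simp only [hF, hE, hv]
    have e1 : ∀ w : ℝ, Complex.exp ((-1 + s * Complex.I) * E x + u * w * Complex.I) =
        Complex.exp (-E x) * (Complex.exp ((s * E x : ℂ) * Complex.I) *
          Complex.exp ((u * w : ℂ) * Complex.I)) := fun w => by
      rw [← Complex.exp_add, ← Complex.exp_add]
      congr 1
      ring
    rw [e1, e1]
    push_cast
    rw [Complex.exp_mul_I, Complex.exp_mul_I, Complex.exp_mul_I, mul_neg, Complex.cos_neg,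
      Complex.sin_neg]
    ring
  have h2 : (2 : ℂ) * ∫ x, F x ∂μ = 2 * ((∫ x, (Real.exp (-E x) * Real.cos (s * E x)) *
      Real.cos (u * v x) ∂μ : ℝ) + (∫ x, (Real.exp (-E x) * Real.sin (s * E x)) *
        Real.cos (u * v x) ∂μ : ℝ) * Complex.I) := by
    rw [two_mul]
    nth_rewrite 2 [← hFT]
    rw [← integral_add hFi hFTi, integral_congr_ae (Eventually.of_forall h), integral_const_mul,
      integral_add i1.ofReal (i2.ofReal.mul_const _), integral_mul_const,
      integral_complex_ofReal, integral_complex_ofReal]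
  exact mul_left_cancel₀ two_ne_zero h2

namespace CirclePotential

variable {l : ℝ} (W : CirclePotential l) {hbar : ℝ}

/-- The asymptotic velocity of the classical motion off the separatrix. -/
def classicalVelocity (x : ℝ × ℝ) : ℝ :=
  if 0 ≤ x.1 then W.meanSpeed (W.classicalEnergy x) else -W.meanSpeed (W.classicalEnergy x)

theorem measurable_classicalVelocity : Measurable W.classicalVelocity := by
  have h := W.measurable_meanSpeed.comp W.continuous_classicalEnergy.measurable
  exact Measurable.ite (measurableSet_le measurable_const measurable_fst) h h.neg

theorem cos_classicalVelocity (u : ℝ) (x : ℝ × ℝ) :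
    Real.cos (u * W.classicalVelocity x) = Real.cos (u * W.meanSpeed (W.classicalEnergy x)) := by
  rw [classicalVelocity]
  split_ifs
  · rfl
  · rw [mul_neg, Real.cos_neg]

/-- The convention at momentum zero does no harm: the energy is then a value of the potential, at
most its maximum, so the mean speed is 0. -/
theorem classicalVelocity_neg (x : ℝ × ℝ) :
    W.classicalVelocity (-x.1, x.2) = -W.classicalVelocity x := by
  have hE : W.classicalEnergy (-x.1, x.2) = W.classicalEnergy x := by simp [classicalEnergy]
  rw [classicalVelocity, classicalVelocity, hE]
  simp only [Left.nonneg_neg_iff]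
  rcases lt_trichotomy x.1 0 with h | h | h
  · rw [if_pos h.le, if_neg (not_le.2 h), neg_neg]
  · rw [if_pos h.le, if_pos h.ge, meanSpeed, if_neg, neg_zero]
    rw [classicalEnergy, h, not_lt]
    simpa using W.le_maxValue x.2
  · rw [if_neg (not_le.2 h), if_pos h.le]

/-- Limit of the weighted joint characteristic functions of energy and velocity. -/
theorem tendsto_integral_cexp (s u : ℝ) :
    Tendsto (fun hbar => ∫ x, Complex.exp ((-1 + s * Complex.I) * W.energy hbar x.1 x.2 +
      u * W.velocity hbar x.1 x.2 * Complex.I) ∂(bandMeasure l hbar)) (𝓝[>] 0)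
      (𝓝 (∫ x, Complex.exp ((-1 + s * Complex.I) * W.classicalEnergy x +
        u * W.classicalVelocity x * Complex.I) ∂(phaseMeasure l))) := by
  have hT : MeasurePreserving (fun x : ℝ × ℝ => (-x.1, x.2)) (phaseMeasure l) (phaseMeasure l) :=
    (Measure.measurePreserving_neg (volume : Measure ℝ)).prod (MeasurePreserving.id (circleMeasure l))
  rw [integral_cexp_eq_of_reflection hT W.continuous_classicalEnergy.measurable
    W.measurable_classicalVelocity (fun x => by simp [classicalEnergy]) W.classicalVelocity_neg
    W.integrable_exp_neg_classicalEnergy]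
  simp only [W.cos_classicalVelocity]
  have hc := W.tendsto_integral_mul_cos (g := fun E => Real.exp (-E) * Real.cos (s * E))
    (by fun_prop) (fun E => by
      rw [abs_mul, abs_of_pos (Real.exp_pos _)]
      exact mul_le_of_le_one_right (Real.exp_pos _).le (Real.abs_cos_le_one _)) u
  have hs := W.tendsto_integral_mul_cos (g := fun E => Real.exp (-E) * Real.sin (s * E))
    (by fun_prop) (fun E => by
      rw [abs_mul, abs_of_pos (Real.exp_pos _)]
      exact mul_le_of_le_one_right (Real.exp_pos _).le (Real.abs_sin_le_one _)) u
  refine (((Complex.continuous_ofReal.tendsto _).comp hc).add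
    (((Complex.continuous_ofReal.tendsto _).comp hs).mul_const Complex.I)).congr' ?_
  filter_upwards [self_mem_nhdsWithin] with hbar hh
  have hh : 0 < hbar := hh
  exact (integral_cexp_eq_of_reflection (measurePreserving_reflect hbar) (W.measurable_energy hh)
    W.measurable_velocity_prod (fun x => W.energy_reflect hh x.1 x.2)
    (fun x => W.velocity_reflect hh x.1 x.2) (W.integrable_exp_neg_energy hh) s u).symm

end CirclePotential

/-! ### Classical motion in one dimension -/

open scoped NNReal Manifold

/-- Global solvability of autonomous equations with a globally Lipschitz field of class `C¹`. -/
theorem exists_hasDerivAt_of_lipschitzWith {E : Type*} [NormedAddCommGroup E] [NormedSpace ℝ E]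
    [CompleteSpace E] {f : E → E} (hf : ContDiff ℝ 1 f) {K : ℝ≥0} (hK : LipschitzWith K f) (x : E) :
    ∃ γ : ℝ → E, γ 0 = x ∧ ∀ t, HasDerivAt γ (f (γ t)) t := by
  -- On the ball of radius `a = ‖f x‖ + 1` the field is bounded by `(K + 1) a`, so solutions remain
  -- in it for time `1/(K + 1)`. This existence time does not depend on `x`, which allows
  -- continuation to the whole line.
  set ε : ℝ := (2 * (K + 1))⁻¹ with hε
  have hε0 : 0 < ε := by positivity
  have hloc : ∀ x : E, ∃ γ : ℝ → E, γ 0 = x ∧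
      IsMIntegralCurveOn (I := 𝓘(ℝ, E)) γ f (Set.Ioo (-ε) ε) := fun x => by
    set a : ℝ≥0 := ‖f x‖₊ + 1 with ha
    have hpl : IsPicardLindelof (fun _ => f) (tmin := -ε) (tmax := ε) ⟨0, by simp [hε0.le]⟩ x a 0
        (K * a + a) K := by
      refine IsPicardLindelof.of_time_independent (fun y hy => ?_) hK.lipschitzOnWith ?_
      · have h1 : ‖f y‖ ≤ ‖f y - f x‖ + ‖f x‖ := by
          simpa using norm_add_le (f y - f x) (f x)
        have h2 : ‖f y - f x‖ ≤ K * a := by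
          rw [← dist_eq_norm]
          exact (hK.dist_le_mul y x).trans (by gcongr; exact hy)
        have h3 : (a : ℝ) = ‖f x‖ + 1 := by simp [ha]
        push_cast
        linarith
      · have h1 : (ε : ℝ) * (2 * (K + 1)) = 1 := inv_mul_cancel₀ (by positivity)
        have h2 : (0 : ℝ) ≤ a := a.2
        simp only [sub_zero, zero_sub, neg_neg, max_self, NNReal.coe_zero, NNReal.coe_add,
          NNReal.coe_mul]
        nlinarith
    obtain ⟨γ, h0, h⟩ := hpl.exists_eq_forall_mem_Icc_hasDerivWithinAt₀
    refine ⟨γ, h0, fun t ht => ?_⟩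
    exact hasMFDerivWithinAt_iff_hasFDerivWithinAt.2
      ((h t (Set.Ioo_subset_Icc_self ht)).mono Set.Ioo_subset_Icc_self).hasFDerivWithinAt
  obtain ⟨γ, h0, h⟩ := exists_isMIntegralCurve_of_isMIntegralCurveOn (I := 𝓘(ℝ, E))
    (contMDiff_vectorSpace_iff_contDiff.2 hf) hε0 hloc x
  refine ⟨γ, h0, fun t => ?_⟩
  have h1 : HasFDerivAt γ ((1 : ℝ →L[ℝ] ℝ).smulRight (f (γ t))) t :=
    hasMFDerivAt_iff_hasFDerivAt.1 (h t)
  simpa using h1.hasDerivAt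

theorem tendsto_inv_mul_of_abs_sub_le {F : Filter ℝ} (hF : Tendsto (fun t : ℝ => |t|) F atTop)
    {f : ℝ → ℝ} {c C : ℝ} (h : ∀ t, |f t - c * t| ≤ C) :
    Tendsto (fun t => t⁻¹ * f t) F (𝓝 c) := by
  rw [tendsto_iff_norm_sub_tendsto_zero]
  refine squeeze_zero' (Eventually.of_forall fun t => norm_nonneg _) ?_
    (hF.inv_tendsto_atTop.const_mul C |>.congr' EventuallyEq.rfl |>.trans_eq (by rw [mul_zero]))
  filter_upwards [hF.eventually_gt_atTop 0] with t ht
  have h0 : t ≠ 0 := abs_pos.1 ht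
  rw [show t⁻¹ * f t - c = (f t - c * t) * t⁻¹ by field_simp, norm_mul, norm_inv]
  exact mul_le_mul_of_nonneg_right (h t) (by positivity)

namespace CirclePotential

variable {l : ℝ} (W : CirclePotential l)

/-- One-dimensional Hamiltonian motion. -/
structure IsMotion (p q : ℝ → ℝ) : Prop where
  momentum : ∀ t, HasDerivAt p (-deriv W.toFun (q t)) t
  position : ∀ t, HasDerivAt q (p t) t

theorem exists_isMotion (x : ℝ × ℝ) : ∃ p q, W.IsMotion p q ∧ p 0 = x.1 ∧ q 0 = x.2 := by
  obtain ⟨C, hC, -, h2⟩ := W.exists_abs_deriv_le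
  have hl : LipschitzWith C.toNNReal (deriv W.toFun) := by
    refine lipschitzWith_of_nnnorm_deriv_le W.contDiff.differentiable_deriv_two fun q => ?_
    rw [← NNReal.coe_le_coe, coe_nnnorm, Real.coe_toNNReal _ hC]
    exact h2 q
  have hc : ContDiff ℝ 1 (deriv W.toFun) := ContDiff.deriv' (n := 1) W.contDiff
  obtain ⟨γ, h0, h⟩ := exists_hasDerivAt_of_lipschitzWith
    (f := fun y : ℝ × ℝ => (-deriv W.toFun y.2, y.1))
    ((hc.comp contDiff_snd).neg.prodMk contDiff_fst)
    ((hl.comp LipschitzWith.prod_snd).neg.prodMk LipschitzWith.prod_fst) x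
  exact ⟨fun t => (γ t).1, fun t => (γ t).2, ⟨fun t => (h t).fst, fun t => (h t).snd⟩,
    congrArg Prod.fst h0, congrArg Prod.snd h0⟩

variable {W} {p q : ℝ → ℝ}

theorem IsMotion.energy_eq (h : W.IsMotion p q) (t : ℝ) :
    W.classicalEnergy (p t, q t) = W.classicalEnergy (p 0, q 0) := by
  have hd : ∀ t, HasDerivAt (fun t => p t ^ 2 / 2 + W.toFun (q t)) 0 t := fun t => by
    refine ((((h.momentum t).fun_pow 2).div_const 2).add
      ((W.hasDerivAt (q t)).comp t (h.position t))).congr_deriv ?_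
    push_cast
    ring
  exact is_const_of_deriv_eq_zero (fun t => (hd t).differentiableAt) (fun t => (hd t).deriv) t 0

/-- By periodicity the potential attains its maximum in each closed-open period on either side of
the starting point. By continuity a longer excursion would pass such a point, against energy
conservation. -/
theorem IsMotion.abs_position_sub_le (h : W.IsMotion p q)
    (hE : W.classicalEnergy (p 0, q 0) < W.maxValue) (t : ℝ) : |q t - q 0| ≤ l := by
  have hl := W.length_pos
  have hqc : Continuous q := continuous_iff_continuousAt.2 fun t => (h.position t).continuousAt
  obtain ⟨r, -, hr⟩ := W.exists_eq_maxValue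
  have hne : ∀ s, W.toFun (q s) ≠ W.maxValue := fun s hs => by
    have h1 := h.energy_eq s
    rw [classicalEnergy] at h1
    simp only at h1
    nlinarith [sq_nonneg (p s)]
  rw [_root_.abs_le]
  constructor
  · by_contra hlt
    obtain ⟨y, hy, hWy⟩ := W.periodic.exists_mem_Ico hl r (q 0 - l)
    obtain ⟨s, hs⟩ : y ∈ Set.range q := mem_range_of_exists_le_of_exists_ge hqc ⟨t, by linarith [hy.1]⟩
      ⟨0, by linarith [hy.2]⟩
    exact hne s (by rw [hs, ← hWy, hr])
  · by_contra hlt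
    obtain ⟨y, hy, hWy⟩ := W.periodic.exists_mem_Ico hl r (q 0)
    obtain ⟨s, hs⟩ : y ∈ Set.range q := mem_range_of_exists_le_of_exists_ge hqc ⟨0, hy.1⟩
      ⟨t, by linarith [hy.2]⟩
    exact hne s (by rw [hs, ← hWy, hr])

/-- The momentum never vanishes, so it has a constant sign `σ`, and the time of flight `τ`, a
primitive of the inverse speed, satisfies `τ (q t) = τ (q 0) + σ t`. This turns the position into a
periodic perturbation of a linear function of time. -/
theorem IsMotion.exists_abs_sub_le_of_gt (h : W.IsMotion p q)
    (hE : W.maxValue < W.classicalEnergy (p 0, q 0)) :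
    ∃ C, ∀ t, |q t - q 0 - W.classicalVelocity (p 0, q 0) * t| ≤ C := by
  have hl := W.length_pos
  set E := W.classicalEnergy (p 0, q 0) with hEdef
  have hpc : Continuous p := continuous_iff_continuousAt.2 fun t => (h.momentum t).continuousAt
  have hw := W.continuous_inv_sqrt hE
  have hT := W.travelTime_pos hE
  have hp2 : ∀ t, p t ^ 2 = 2 * (E - W.toFun (q t)) := fun t => by
    have := h.energy_eq t
    rw [← hEdef, classicalEnergy] at this
    simp only at this
    linarith
  have hp0 : ∀ t, p t ≠ 0 := fun t ht => by
    have := hp2 t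
    rw [ht] at this
    nlinarith [W.le_maxValue (q t)]
  obtain ⟨σ, hσ, hσ0, hv⟩ : ∃ σ : ℝ, σ ^ 2 = 1 ∧ 0 < σ * p 0 ∧
      W.classicalVelocity (p 0, q 0) = σ * (l / W.travelTime E) := by
    rcases lt_or_gt_of_ne (hp0 0) with h0 | h0
    · refine ⟨-1, by norm_num, by linarith, ?_⟩
      rw [classicalVelocity, if_neg (not_le.2 h0), ← hEdef, meanSpeed, if_pos hE]
      ring
    · refine ⟨1, by norm_num, by linarith, ?_⟩
      rw [classicalVelocity, if_pos h0.le, ← hEdef, meanSpeed, if_pos hE]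
      ring
  have hσne : σ ≠ 0 := fun h => by simp [h] at hσ
  have hpos : ∀ t, 0 < σ * p t := fun t => by
    by_contra hlt
    obtain ⟨s, hs⟩ := mem_range_of_exists_le_of_exists_ge
      (by fun_prop : Continuous fun t => σ * p t) ⟨t, not_lt.1 hlt⟩ ⟨0, hσ0.le⟩
    exact mul_ne_zero hσne (hp0 s) hs
  have hps : ∀ t, σ * p t = √(2 * (E - W.toFun (q t))) := fun t => by
    rw [← hp2, ← Real.sqrt_sq (hpos t).le, mul_pow, hσ, one_mul]
  set τ : ℝ → ℝ := fun y => ∫ s in (0 : ℝ)..y, (√(2 * (E - W.toFun s)))⁻¹ with hτ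
  have hτd : ∀ y, HasDerivAt τ (√(2 * (E - W.toFun y)))⁻¹ y := fun y =>
    intervalIntegral.integral_hasDerivAt_right (hw.intervalIntegrable _ _)
      (hw.stronglyMeasurableAtFilter _ _) hw.continuousAt
  have hτq : ∀ t, τ (q t) = τ (q 0) + σ * t := fun t => by
    have hd : ∀ t, HasDerivAt (fun t => τ (q t) - σ * t) 0 t := fun t => by
      refine (((hτd (q t)).comp t (h.position t)).sub ((hasDerivAt_id t).const_mul σ)).congr_deriv ?_
      have h1 : p t = σ * (σ * p t) := by rw [← mul_assoc, ← sq, hσ, one_mul]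
      rw [h1, hps, mul_left_comm, inv_mul_cancel₀ (by rw [← hps]; exact (hpos t).ne')]
      ring
    have := is_const_of_deriv_eq_zero (fun t => (hd t).differentiableAt) (fun t => (hd t).deriv) t 0
    simp only [mul_zero, sub_zero] at this
    linarith
  set T := W.travelTime E with hTdef
  -- `τ` grows by `T` over each period. The periodic difference is bounded, and so is the deviation
  -- of `q t` from uniform motion with velocity `σ l / T`.
  have hper : Function.Periodic (fun y => y - l / T * τ y) l := fun y => by
    have h1 : Function.Periodic (fun s => (√(2 * (E - W.toFun s)))⁻¹) l := fun s => by
      simp only [W.periodic s]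
    have h2 : τ (y + l) = τ y + T := by
      have := h1.intervalIntegral_add_eq y 0
      rw [zero_add] at this
      rw [hτ, hTdef, travelTime]
      simp only
      rw [← this, intervalIntegral.integral_add_adjacent_intervals (hw.intervalIntegrable _ _)
        (hw.intervalIntegrable _ _)]
    simp only [h2]
    field_simp
    ring
  obtain ⟨M, hM⟩ := Periodic.exists_abs_le hl (continuous_id.sub (continuous_const.mul
    (continuous_iff_continuousAt.2 fun y => (hτd y).continuousAt))) hper
  refine ⟨M + M, fun t => ?_⟩
  have e : q t - q 0 - W.classicalVelocity (p 0, q 0) * t =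
      (q t - l / T * τ (q t)) - (q 0 - l / T * τ (q 0)) := by
    rw [hv, hτq t]
    ring
  rw [e]
  exact (abs_sub _ _).trans (add_le_add (hM _) (hM _))

theorem IsMotion.tendsto_mean (h : W.IsMotion p q)
    (hE : W.classicalEnergy (p 0, q 0) ≠ W.maxValue) {F : Filter ℝ}
    (hF : Tendsto (fun t : ℝ => |t|) F atTop) :
    Tendsto (fun t => t⁻¹ * (q t - q 0)) F (𝓝 (W.classicalVelocity (p 0, q 0))) := by
  rcases lt_or_gt_of_ne hE with h1 | h1
  · have h2 : W.classicalVelocity (p 0, q 0) = 0 := by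
      rw [classicalVelocity, meanSpeed, if_neg (not_lt.2 h1.le)]
      simp
    refine tendsto_inv_mul_of_abs_sub_le hF (C := l) fun t => ?_
    rw [h2, zero_mul, sub_zero]
    exact h.abs_position_sub_le h1 t
  · obtain ⟨C, hC⟩ := h.exists_abs_sub_le_of_gt h1
    exact tendsto_inv_mul_of_abs_sub_le hF hC

end CirclePotential

/-! ### Asymptotic velocity of the separable motion -/

section Motion

variable {L : Fin d → ℝ} {V : Space d → ℝ} {W : ∀ j, CirclePotential (L j)}

theorem hasDerivAt_space_iff {γ : ℝ → Space d} {v : Space d} {t : ℝ} :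
    HasDerivAt γ v t ↔ ∀ j, HasDerivAt (fun t => γ t j) (v j) t := by
  rw [hasDerivAt_iff_hasFDerivAt, ← hasFDerivWithinAt_univ, hasFDerivWithinAt_euclidean]
  simp only [hasFDerivWithinAt_univ]
  refine forall_congr' fun j => ?_
  rw [hasDerivAt_iff_hasFDerivAt]
  refine iff_of_eq (congrArg (fun A => HasFDerivAt _ A t) ?_)
  ext
  simp

theorem hasGradientAt_separable (hsep : ∀ q : Space d, V q = ∑ j, (W j).toFun (q j))
    (q : Space d) :
    HasGradientAt V (WithLp.toLp 2 fun j => deriv (W j).toFun (q j)) q := by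
  rw [hasGradientAt_iff_hasFDerivAt, show V = fun q => ∑ j, (W j).toFun (q j) from funext hsep]
  have h : ∀ j, HasFDerivAt (fun q : Space d => (W j).toFun (q j))
      (deriv (W j).toFun (q j) • (EuclideanSpace.proj (𝕜 := ℝ) j : Space d →L[ℝ] ℝ)) q := fun j =>
    ((W j).hasDerivAt (q j)).comp_hasFDerivAt q
      (EuclideanSpace.proj (𝕜 := ℝ) j : Space d →L[ℝ] ℝ).hasFDerivAt
  refine (HasFDerivAt.fun_sum fun j _ => h j).congr_fderiv ?_
  ext v
  simp [InnerProductSpace.toDual_apply_apply, PiLp.inner_apply, mul_comm]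

theorem isTrajectory_iff (hsep : ∀ q : Space d, V q = ∑ j, (W j).toFun (q j))
    {x : Space d × Space d} {γ : ℝ → Space d × Space d} :
    IsTrajectory V x γ ↔ γ 0 = x ∧
      ∀ j, (W j).IsMotion (fun t => (γ t).1 j) (fun t => (γ t).2 j) := by
  refine and_congr_right fun _ => ⟨fun h j => ⟨fun t => ?_, fun t => ?_⟩, fun h t => ?_⟩
  · have h1 := hasDerivAt_space_iff.1 (h t).fst j
    rw [(hasGradientAt_separable hsep (γ t).2).gradient] at h1
    exact h1
  · exact hasDerivAt_space_iff.1 (h t).snd j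
  · refine HasDerivAt.prodMk (f₁ := fun t => (γ t).1) (f₂ := fun t => (γ t).2)
      (hasDerivAt_space_iff.2 fun j => ?_) (hasDerivAt_space_iff.2 fun j => ?_)
    · rw [(hasGradientAt_separable hsep (γ t).2).gradient]
      exact (h j).momentum t
    · exact (h j).position t

theorem exists_isTrajectory (hsep : ∀ q : Space d, V q = ∑ j, (W j).toFun (q j))
    (x : Space d × Space d) : ∃ γ, IsTrajectory V x γ := by
  choose p q h hp hq using fun j => (W j).exists_isMotion (x.1 j, x.2 j)
  refine ⟨fun t => (WithLp.toLp 2 fun j => p j t, WithLp.toLp 2 fun j => q j t),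
    (isTrajectory_iff hsep).2 ⟨?_, fun j => h j⟩⟩
  refine Prod.ext ?_ ?_
  · ext j
    exact hp j
  · ext j
    exact hq j

/-- The mean velocity is displacement over time, and the one-dimensional limits apply to whichever
trajectory the definition of `flow` selects. -/
theorem asymptoticVelocity_eq (hsep : ∀ q : Space d, V q = ∑ j, (W j).toFun (q j))
    {x : Space d × Space d} (hx : ∀ j, (W j).classicalEnergy (x.1 j, x.2 j) ≠ (W j).maxValue) :
    asymptoticVelocity V x =
      WithLp.toLp 2 fun j => (W j).classicalVelocity (x.1 j, x.2 j) := by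
  have hex := exists_isTrajectory hsep x
  set γ := hex.choose with hγ
  have hflow : ∀ t, flow V t x = γ t := fun t => by rw [flow, dif_pos hex]
  have htraj : IsTrajectory V x γ := hex.choose_spec
  obtain ⟨h0, hm⟩ := (isTrajectory_iff hsep).1 htraj
  have hcont : Continuous fun t => (γ t).1 :=
    continuous_iff_continuousAt.2 fun t => (htraj.2 t).continuousAt.fst
  have hmean : ∀ T, meanVelocity V x T = T⁻¹ • ((γ T).2 - (γ 0).2) := fun T => by
    rw [meanVelocity]
    simp only [hflow]
    rw [intervalIntegral.integral_eq_sub_of_hasDerivAt (f := fun t => (γ t).2)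
      (fun t _ => (htraj.2 t).snd) (hcont.intervalIntegrable _ _)]
  have hlim : ∀ F : Filter ℝ, Tendsto (fun t : ℝ => |t|) F atTop →
      Tendsto (meanVelocity V x) F
        (𝓝 (WithLp.toLp 2 fun j => (W j).classicalVelocity (x.1 j, x.2 j))) := fun F hF => by
    have h1 : Tendsto (fun T j => T⁻¹ * ((γ T).2 j - (γ 0).2 j)) F
        (𝓝 fun j => (W j).classicalVelocity (x.1 j, x.2 j)) := by
      refine tendsto_pi_nhds.2 fun j => ?_
      have h2 := (hm j).tendsto_mean (by rw [h0]; exact hx j) hF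
      rw [h0] at h2 ⊢
      exact h2
    refine (((PiLp.continuous_toLp 2 _).tendsto _).comp h1).congr fun T => ?_
    rw [hmean]
    rfl
  have hex2 : ∃ v, Tendsto (meanVelocity V x) atTop (𝓝 v) ∧
      Tendsto (meanVelocity V x) atBot (𝓝 v) :=
    ⟨_, hlim _ tendsto_abs_atTop_atTop, hlim _ tendsto_abs_atBot_atTop⟩
  rw [asymptoticVelocity, dif_pos hex2]
  exact tendsto_nhds_unique hex2.choose_spec.1 (hlim _ tendsto_abs_atTop_atTop)

theorem hamiltonian_eq (hsep : ∀ q : Space d, V q = ∑ j, (W j).toFun (q j))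
    (x : Space d × Space d) :
    hamiltonian V x = ∑ j, (W j).classicalEnergy (x.1 j, x.2 j) := by
  rw [hamiltonian, hsep, EuclideanSpace.norm_sq_eq, Finset.sum_div, ← Finset.sum_add_distrib]
  refine Finset.sum_congr rfl fun j _ => ?_
  rw [CirclePotential.classicalEnergy, Real.norm_eq_abs, sq_abs]

end Motion

/-! ### Gibbs weights and Lévy's continuity theorem -/

section Levy

open scoped ENNReal
open InnerProductSpace

variable {Ω Ω' : Type*} [MeasurableSpace Ω] [MeasurableSpace Ω']

/-- The Gibbs-weighted joint law of `E` and `v`. -/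
def gibbsLaw (m : Measure Ω) (E : Ω → ℝ) (v : Ω → Space d) : Measure (WithLp 2 (ℝ × Space d)) :=
  (m.tilted fun x => -E x).map fun x => WithLp.toLp 2 (E x, v x)

variable {m : Measure Ω} {E : Ω → ℝ} {v : Ω → Space d}

theorem isProbabilityMeasure_gibbsLaw (hm : m ≠ 0) (hE : Measurable E) (hv : Measurable v)
    (hint : Integrable (fun x => Real.exp (-E x)) m) : IsProbabilityMeasure (gibbsLaw m E v) := by
  have : NeZero m := ⟨hm⟩
  have := isProbabilityMeasure_tilted hint
  exact Measure.isProbabilityMeasure_map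
    ((WithLp.measurable_toLp 2 _).comp (hE.prodMk hv)).aemeasurable

theorem integral_gibbsLaw (hE : Measurable E) (hv : Measurable v) {F : Type*}
    [NormedAddCommGroup F] [NormedSpace ℝ F] {g : WithLp 2 (ℝ × Space d) → F}
    (hg : StronglyMeasurable g) :
    ∫ y, g y ∂(gibbsLaw m E v) = (∫ x, Real.exp (-E x) ∂m)⁻¹ •
      ∫ x, Real.exp (-E x) • g (WithLp.toLp 2 (E x, v x)) ∂m := by
  have hX : Measurable fun x => WithLp.toLp 2 (E x, v x) :=
    (WithLp.measurable_toLp 2 _).comp (hE.prodMk hv)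
  rw [gibbsLaw, integral_map hX.aemeasurable hg.aestronglyMeasurable, integral_tilted, ← integral_smul]
  refine integral_congr_ae (Eventually.of_forall fun x => ?_)
  simp only
  rw [smul_smul, div_eq_inv_mul]

theorem charFun_gibbsLaw (hE : Measurable E) (hv : Measurable v)
    (t : WithLp 2 (ℝ × Space d)) :
    charFun (gibbsLaw m E v) t = (∫ x, Real.exp (-E x) ∂m)⁻¹ •
      ∫ x, Complex.exp ((-1 + (t.fst : ℂ) * Complex.I) * E x +
        (⟪v x, t.snd⟫_ℝ : ℝ) * Complex.I) ∂m := by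
  rw [charFun_apply, integral_gibbsLaw hE hv (Continuous.stronglyMeasurable (by fun_prop))]
  congr 1
  refine integral_congr_ae (Eventually.of_forall fun x => ?_)
  simp only
  have h : ⟪WithLp.toLp 2 (E x, v x), t⟫_ℝ = t.fst * E x + ⟪v x, t.snd⟫_ℝ := by
    rw [WithLp.prod_inner_apply, RCLike.inner_apply, conj_trivial]
    rfl
  rw [h, Complex.real_smul, Complex.ofReal_exp, ← Complex.exp_add]
  congr 1
  push_cast
  ring

theorem re_integral_cexp_zero (m : Measure Ω) (E : Ω → ℝ) (v : Ω → Space d) :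
    (∫ x, Complex.exp ((-1 + ((0 : ℝ) : ℂ) * Complex.I) * E x +
      (⟪v x, (0 : Space d)⟫_ℝ : ℝ) * Complex.I) ∂m).re = ∫ x, Real.exp (-E x) ∂m := by
  rw [← Complex.ofReal_re (∫ x, Real.exp (-E x) ∂m), ← integral_complex_ofReal]
  simp

theorem integral_exp_mul_integral_gibbsLaw (hm : m ≠ 0) (hE : Measurable E) (hv : Measurable v)
    (hint : Integrable (fun x => Real.exp (-E x)) m) {f : ℝ × Space d → ℝ} (hf : Continuous f) :
    (∫ x, Real.exp (-E x) ∂m) * ∫ y, Real.exp y.fst * f (y.fst, y.snd) ∂(gibbsLaw m E v) =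
      ∫ x, f (E x, v x) ∂m := by
  have : NeZero m := ⟨hm⟩
  rw [integral_gibbsLaw hE hv (Continuous.stronglyMeasurable (by fun_prop)), smul_eq_mul,
    mul_inv_cancel_left₀ (integral_exp_pos hint).ne']
  refine integral_congr_ae (Eventually.of_forall fun x => ?_)
  change Real.exp (-E x) * (Real.exp (E x) * f (E x, v x)) = f (E x, v x)
  rw [← mul_assoc, ← Real.exp_add, neg_add_cancel, Real.exp_zero, one_mul]

/-- The case `s = 0`, `u = 0` of the hypothesis is convergence of the partition functions. Dividing
by them gives convergence of the characteristic functions of probability measures, hence weak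
convergence. The weight is undone by the test function `exp(E) f`, bounded because `f` has compact
support. -/
theorem tendsto_integral_of_tendsto_cexp_seq {m : ℕ → Measure Ω} {E : ℕ → Ω → ℝ}
    {v : ℕ → Ω → Space d} (hm : ∀ n, m n ≠ 0) (hE : ∀ n, Measurable (E n))
    (hv : ∀ n, Measurable (v n)) (hint : ∀ n, Integrable (fun x => Real.exp (-E n x)) (m n))
    {m' : Measure Ω'} {E' : Ω' → ℝ} {v' : Ω' → Space d} (hm' : m' ≠ 0) (hE' : Measurable E')
    (hv' : Measurable v') (hint' : Integrable (fun x => Real.exp (-E' x)) m')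
    (h : ∀ (s : ℝ) (u : Space d), Tendsto (fun n => ∫ x, Complex.exp
      ((-1 + (s : ℂ) * Complex.I) * E n x + (⟪v n x, u⟫_ℝ : ℝ) * Complex.I) ∂(m n)) atTop
      (𝓝 (∫ x, Complex.exp ((-1 + (s : ℂ) * Complex.I) * E' x +
        (⟪v' x, u⟫_ℝ : ℝ) * Complex.I) ∂m')))
    {f : ℝ × Space d → ℝ} (hf : Continuous f) (hfc : HasCompactSupport f) :
    Tendsto (fun n => ∫ x, f (E n x, v n x) ∂(m n)) atTop (𝓝 (∫ x, f (E' x, v' x) ∂m')) := by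
  have hZ : Tendsto (fun n => ∫ x, Real.exp (-E n x) ∂(m n)) atTop
      (𝓝 (∫ x, Real.exp (-E' x) ∂m')) := by
    have h0 := (Complex.continuous_re.tendsto _).comp (h 0 0)
    simpa only [Function.comp_def, re_integral_cexp_zero] using h0
  have hne : NeZero m' := ⟨hm'⟩
  have hZ0 : 0 < ∫ x, Real.exp (-E' x) ∂m' := integral_exp_pos hint'
  set P : ℕ → ProbabilityMeasure (WithLp 2 (ℝ × Space d)) := fun n =>
    ⟨gibbsLaw (m n) (E n) (v n), isProbabilityMeasure_gibbsLaw (hm n) (hE n) (hv n) (hint n)⟩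
  set P' : ProbabilityMeasure (WithLp 2 (ℝ × Space d)) :=
    ⟨gibbsLaw m' E' v', isProbabilityMeasure_gibbsLaw hm' hE' hv' hint'⟩
  have hP : Tendsto P atTop (𝓝 P') := by
    refine ProbabilityMeasure.tendsto_of_tendsto_charFun fun t => ?_
    simp only [P, P', ProbabilityMeasure.coe_mk]
    rw [charFun_gibbsLaw hE' hv']
    refine ((hZ.inv₀ hZ0.ne').smul (h t.fst t.snd)).congr fun n => ?_
    rw [charFun_gibbsLaw (hE n) (hv n)]
  set g : WithLp 2 (ℝ × Space d) → ℝ := fun y => Real.exp y.fst * f (y.fst, y.snd) with hg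
  have hgc : Continuous g := by fun_prop
  obtain ⟨C, hC⟩ : ∃ C, ∀ y : ℝ × Space d, ‖Real.exp y.1 * f y‖ ≤ C := by
    refine HasCompactSupport.exists_bound_of_continuous ?_ (by fun_prop)
    exact hfc.mul_left (f := fun y : ℝ × Space d => Real.exp y.1)
  have hlim := ProbabilityMeasure.tendsto_iff_forall_integral_tendsto.1 hP
    (BoundedContinuousFunction.ofNormedAddCommGroup g hgc C fun y => hC (y.fst, y.snd))
  simp only [BoundedContinuousFunction.coe_ofNormedAddCommGroup, P, P', ProbabilityMeasure.coe_mk]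
    at hlim
  have h2 := hZ.mul hlim
  rw [integral_exp_mul_integral_gibbsLaw hm' hE' hv' hint' hf] at h2
  exact h2.congr fun n => integral_exp_mul_integral_gibbsLaw (hm n) (hE n) (hv n) (hint n) hf

/-- Vague convergence of joint laws from convergence of Gibbs-weighted characteristic functions. -/
theorem tendsto_integral_of_tendsto_cexp {ι : Type*} {F : Filter ι} [F.IsCountablyGenerated]
    {m : ι → Measure Ω} {E : ι → Ω → ℝ} {v : ι → Ω → Space d}
    (hgood : ∀ᶠ i in F, m i ≠ 0 ∧ Measurable (E i) ∧ Measurable (v i) ∧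
      Integrable (fun x => Real.exp (-E i x)) (m i))
    {m' : Measure Ω'} {E' : Ω' → ℝ} {v' : Ω' → Space d} (hm' : m' ≠ 0) (hE' : Measurable E')
    (hv' : Measurable v') (hint' : Integrable (fun x => Real.exp (-E' x)) m')
    (h : ∀ (s : ℝ) (u : Space d), Tendsto (fun i => ∫ x, Complex.exp
      ((-1 + (s : ℂ) * Complex.I) * E i x + (⟪v i x, u⟫_ℝ : ℝ) * Complex.I) ∂(m i)) F
      (𝓝 (∫ x, Complex.exp ((-1 + (s : ℂ) * Complex.I) * E' x +
        (⟪v' x, u⟫_ℝ : ℝ) * Complex.I) ∂m')))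
    {f : ℝ × Space d → ℝ} (hf : Continuous f) (hfc : HasCompactSupport f) :
    Tendsto (fun i => ∫ x, f (E i x, v i x) ∂(m i)) F (𝓝 (∫ x, f (E' x, v' x) ∂m')) := by
  -- Lévy's theorem is used along sequences; an initial segment is discarded so that the measures
  -- are weighted probability laws for every index.
  refine tendsto_of_seq_tendsto fun i hi => ?_
  obtain ⟨N, hN⟩ := eventually_atTop.1 (hi.eventually hgood)
  have hg : ∀ n, _ := fun n => hN (n + N) (Nat.le_add_left N n)
  refine (tendsto_add_atTop_iff_nat N).1 ?_
  exact tendsto_integral_of_tendsto_cexp_seq (m := fun n => m (i (n + N)))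
    (E := fun n => E (i (n + N))) (v := fun n => v (i (n + N))) (fun n => (hg n).1)
    (fun n => (hg n).2.1) (fun n => (hg n).2.2.1) (fun n => (hg n).2.2.2) hm' hE' hv' hint'
    (fun s u => ((tendsto_add_atTop_iff_nat N).2 ((h s u).comp hi))) hf hfc

/-- On a compact set the energy is bounded by some `R`, so the integrable weight is at least
`exp(-R)`; Markov's inequality bounds the measure. -/
theorem isFiniteMeasureOnCompacts_map (hE : Measurable E) (hv : Measurable v)
    (hint : Integrable (fun x => Real.exp (-E x)) m) :
    IsFiniteMeasureOnCompacts (m.map fun x => (E x, v x)) := by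
  refine ⟨fun K hK => ?_⟩
  obtain ⟨R, hR⟩ := (hK.image continuous_fst).bddAbove
  rw [Measure.map_apply (hE.prodMk hv) hK.measurableSet]
  refine (measure_mono fun x hx => ?_).trans_lt (hint.measure_ge_lt_top (Real.exp_pos (-R)))
  exact Real.exp_le_exp.2 (neg_le_neg (hR ⟨_, hx, rfl⟩))

end Levy

/-! ### Factorization over coordinates -/

section Product

open InnerProductSpace

variable {α : Type*} [MeasurableSpace α] {μ : Fin d → Measure α} [∀ j, SigmaFinite (μ j)]
  {E v : Fin d → α → ℝ}

theorem integrable_exp_neg_sum (hint : ∀ j, Integrable (fun x => Real.exp (-E j x)) (μ j)) :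
    Integrable (fun y : Fin d → α => Real.exp (-∑ j, E j (y j))) (Measure.pi μ) := by
  refine (Integrable.fintype_prod hint).congr (Eventually.of_forall fun y => ?_)
  simp only
  rw [← Finset.sum_neg_distrib, Real.exp_sum]

/-- Both the energy and `⟪v, u⟫` are sums of functions of single coordinates, so the exponential is
a product and Fubini applies. -/
theorem integral_cexp_sum (s : ℝ) (u : Space d) :
    ∫ y, Complex.exp ((-1 + (s : ℂ) * Complex.I) * (∑ j, E j (y j) : ℝ) +
      (⟪(WithLp.toLp 2 fun j => v j (y j) : Space d), u⟫_ℝ : ℝ) * Complex.I) ∂(Measure.pi μ) =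
    ∏ j, ∫ x, Complex.exp ((-1 + (s : ℂ) * Complex.I) * E j x + u j * v j x * Complex.I) ∂(μ j) := by
  rw [← integral_fintype_prod_eq_prod (𝕜 := ℂ)]
  refine integral_congr_ae (Eventually.of_forall fun y => ?_)
  simp only
  rw [← Complex.exp_sum]
  congr 1
  simp only [PiLp.inner_apply, RCLike.inner_apply, conj_trivial]
  push_cast
  rw [Finset.mul_sum, Finset.sum_mul, ← Finset.sum_add_distrib]

end Product

open scoped ENNReal NNReal

/-! ### Product measures and their normalization -/

namespace CirclePotential

instance (l : ℝ) : SigmaFinite (phaseMeasure l) :=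
  inferInstanceAs (SigmaFinite ((volume : Measure ℝ).prod (volume.restrict (Set.Ico 0 l))))

instance (l hbar : ℝ) : SigmaFinite (bandMeasure l hbar) :=
  inferInstanceAs (SigmaFinite ((hbar * l).toNNReal •
    (Measure.count : Measure ℕ).prod (volume.restrict (Set.Ico 0 (2 * Real.pi / l)))))

theorem phaseMeasure_ne_zero {l : ℝ} (hl : 0 < l) : phaseMeasure l ≠ 0 := by
  rw [← Measure.measure_univ_ne_zero, phaseMeasure, circleMeasure,
    ← Set.univ_prod_univ, Measure.prod_prod, Measure.restrict_apply_univ, Real.volume_Ico]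
  simpa using hl

theorem bandMeasure_ne_zero {l hbar : ℝ} (hl : 0 < l) (hh : 0 < hbar) : bandMeasure l hbar ≠ 0 := by
  rw [← Measure.measure_univ_ne_zero, bandMeasure, Measure.smul_apply,
    ← Set.univ_prod_univ, Measure.prod_prod, Measure.restrict_apply_univ, Real.volume_Ico, smul_eq_mul]
  have h1 : 0 < 2 * Real.pi / l := by positivity
  have h2 : 0 < hbar * l := by positivity
  simp [h1, h2]

end CirclePotential

theorem pi_ne_zero {α : Type*} [MeasurableSpace α] {μ : Fin d → Measure α} [∀ j, SigmaFinite (μ j)]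
    (h : ∀ j, μ j ≠ 0) : Measure.pi μ ≠ 0 := by
  rw [← Measure.measure_univ_ne_zero, Measure.pi_univ]
  exact Finset.prod_ne_zero_iff.2 fun j _ => Measure.measure_univ_ne_zero.2 (h j)

theorem measurePreserving_liouville (L : Fin d → ℝ) :
    MeasurePreserving (fun y : Fin d → ℝ × ℝ =>
      ((WithLp.toLp 2 fun j => (y j).1 : Space d), (WithLp.toLp 2 fun j => (y j).2 : Space d)))
      (Measure.pi fun j => CirclePotential.phaseMeasure (L j)) (liouville L) := by
  have h1 := measurePreserving_arrowProdEquivProdArrow ℝ ℝ (Fin d) (fun _ => volume)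
    (fun j => volume.restrict (Set.Ico 0 (L j)))
  have h2 := (PiLp.volume_preserving_toLp (Fin d)).prod (measurePreserving_toLp_cell L)
  have h3 : liouville L = (volume : Measure (Space d)).prod (volume.restrict (cell L)) := by
    rw [liouville, Measure.volume_eq_prod, ← Measure.prod_restrict, Measure.restrict_univ]
  rw [h3]
  exact h2.comp h1

theorem pi_smul_count (c : Fin d → ℝ) :
    (Measure.pi fun j => ((c j).toNNReal • (Measure.count : Measure ℕ))) =
      (∏ j, ENNReal.ofReal (c j)) • (Measure.count : Measure (Fin d → ℕ)) := by
  refine Measure.ext_of_singleton fun m => ?_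
  rw [Measure.pi_singleton, Measure.smul_apply, Measure.count_singleton, smul_eq_mul, mul_one]
  refine Finset.prod_congr rfl fun j _ => ?_
  rw [Measure.smul_apply, Measure.count_singleton]
  simp [ENNReal.ofReal, ENNReal.smul_def]

theorem measurePreserving_bands (L : Fin d → ℝ) (hbar : ℝ) :
    MeasurePreserving (fun y : Fin d → ℕ × ℝ =>
      ((fun j => (y j).1), (WithLp.toLp 2 fun j => (y j).2 : Space d)))
      (Measure.pi fun j => CirclePotential.bandMeasure (L j) hbar)
      ((∏ j, ENNReal.ofReal (hbar * L j)) •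
        (Measure.count : Measure (Fin d → ℕ)).prod (volume.restrict (dualCell L))) := by
  have h1 := measurePreserving_arrowProdEquivProdArrow ℕ ℝ (Fin d)
    (fun j => (hbar * L j).toNNReal • (Measure.count : Measure ℕ))
    (fun j => volume.restrict (Set.Ico 0 (2 * Real.pi / L j)))
  rw [pi_smul_count] at h1
  have h2 := (MeasurePreserving.id ((∏ j, ENNReal.ofReal (hbar * L j)) •
    (Measure.count : Measure (Fin d → ℕ)))).prod (measurePreserving_toLp_cell fun j => 2 * Real.pi / L j)
  have h3 : (fun j => CirclePotential.bandMeasure (L j) hbar) = fun j =>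
      ((hbar * L j).toNNReal • (Measure.count : Measure ℕ)).prod
        (volume.restrict (Set.Ico 0 (2 * Real.pi / L j))) := funext fun j => by
    rw [Measure.prod_smul_left]
    rfl
  rw [h3, ← Measure.prod_smul_left]
  exact h2.comp h1

theorem volume_cell (L : Fin d → ℝ) : volume (cell L) = ∏ j, ENNReal.ofReal (L j) := by
  have h := (measurePreserving_toLp_cell L).measure_preimage (s := Set.univ)
    MeasurableSet.univ.nullMeasurableSet
  rw [Set.preimage_univ, Measure.pi_univ, Measure.restrict_apply_univ] at h
  rw [← h]
  refine Finset.prod_congr rfl fun j _ => ?_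
  rw [circleMeasure, Measure.restrict_apply_univ, Real.volume_Ico, sub_zero]

/-- The Brillouin zone has volume `∏ 2π / L j`, so each direction retains `2πħ · L j / (2π) = ħ L
j`, the prefactor of the band measure on a circle. -/
theorem semiclassical_prefactor {L : Fin d → ℝ} (hL : ∀ j, 0 < L j) {hbar : ℝ} (hh : 0 < hbar) :
    ENNReal.ofReal ((2 * Real.pi * hbar) ^ d) * (volume (dualCell L))⁻¹ =
      ∏ j, ENNReal.ofReal (hbar * L j) := by
  have h1 : ∀ j, 0 < 2 * Real.pi / L j := fun j => by
    have := hL j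
    positivity
  rw [dualCell, volume_cell, ← ENNReal.ofReal_prod_of_nonneg fun j _ => (h1 j).le,
    ← ENNReal.ofReal_prod_of_nonneg fun j _ => (mul_pos hh (hL j)).le,
    ← ENNReal.ofReal_inv_of_pos (Finset.prod_pos fun j _ => h1 j),
    ← ENNReal.ofReal_mul (by positivity)]
  congr 1
  have h2 : (2 * Real.pi * hbar) ^ d = ∏ _j : Fin d, (2 * Real.pi * hbar) := by simp
  rw [h2, ← Finset.prod_inv_distrib, ← Finset.prod_mul_distrib]
  refine Finset.prod_congr rfl fun j _ => ?_
  have := (hL j).ne'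
  have := Real.pi_ne_zero
  field_simp

/-! ### Both distributions as images of product measures -/

section Identification

variable {L : Fin d → ℝ} {V : Space d → ℝ} {W : ∀ j, CirclePotential (L j)}

variable (W) in
/-- Energy and asymptotic velocity of the product motion. -/
def classicalMap (y : Fin d → ℝ × ℝ) : ℝ × Space d :=
  (∑ j, (W j).classicalEnergy (y j), WithLp.toLp 2 fun j => (W j).classicalVelocity (y j))

variable (W) in
/-- Energy and group velocity of the product bands. -/
def bandMap (hbar : ℝ) (y : Fin d → ℕ × ℝ) : ℝ × Space d :=
  (∑ j, (W j).energy hbar (y j).1 (y j).2,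
    WithLp.toLp 2 fun j => (W j).velocity hbar (y j).1 (y j).2)

variable (W) in
theorem measurable_classicalMap : Measurable (classicalMap W) := by
  have h1 := fun j => (W j).continuous_classicalEnergy.measurable
  have h2 := fun j => (W j).measurable_classicalVelocity
  exact (Finset.measurable_sum _ fun j _ => (h1 j).comp (measurable_pi_apply j)).prodMk
    ((WithLp.measurable_toLp 2 _).comp (measurable_pi_lambda _ fun j =>
      (h2 j).comp (measurable_pi_apply j)))

variable (W) in
theorem measurable_bandMap {hbar : ℝ} (hh : 0 < hbar) : Measurable (bandMap W hbar) := by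
  have h1 := fun j => (W j).measurable_energy hh
  have h2 := fun j => (W j).measurable_velocity_prod (hbar := hbar)
  exact (Finset.measurable_sum _ fun j _ => (h1 j).comp (measurable_pi_apply j)).prodMk
    ((WithLp.measurable_toLp 2 _).comp (measurable_pi_lambda _ fun j =>
      (h2 j).comp (measurable_pi_apply j)))

/-- The exceptional set consists of the phase points with some coordinate at its critical energy, a
finite union of null sets. -/
theorem ae_energyVelocity_eq (hsep : ∀ q : Space d, V q = ∑ j, (W j).toFun (q j)) :
    energyVelocity V =ᵐ[liouville L] fun x => classicalMap W fun j => (x.1 j, x.2 j) := by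
  have h : ∀ᵐ x ∂(liouville L), ∀ j, (W j).classicalEnergy (x.1 j, x.2 j) ≠ (W j).maxValue := by
    refine ae_all_iff.2 fun j => ?_
    rw [← (measurePreserving_liouville L).map_eq, ae_map_iff
      (measurePreserving_liouville L).measurable.aemeasurable]
    · exact (Measure.quasiMeasurePreserving_eval (μ := fun j => CirclePotential.phaseMeasure (L j))
        j).ae ((W j).ae_classicalEnergy_ne (W j).maxValue)
    · have hc := (W j).continuous_classicalEnergy
      have h1 : Continuous fun x : Space d × Space d => (W j).classicalEnergy (x.1 j, x.2 j) :=
        hc.comp (by fun_prop)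
      exact (isOpen_ne_fun h1 continuous_const).measurableSet
  filter_upwards [h] with x hx
  rw [energyVelocity, hamiltonian_eq hsep, asymptoticVelocity_eq hsep hx, classicalMap]

theorem measurable_classicalMap_coord :
    Measurable fun x : Space d × Space d => classicalMap W fun j => (x.1 j, x.2 j) :=
  (measurable_classicalMap W).comp (measurable_pi_lambda _ fun j => by fun_prop)

theorem classicalMeasure_eq (hsep : ∀ q : Space d, V q = ∑ j, (W j).toFun (q j)) :
    classicalMeasure L V =
      (Measure.pi fun j => CirclePotential.phaseMeasure (L j)).map (classicalMap W) := by
  rw [classicalMeasure, Measure.map_congr (ae_energyVelocity_eq hsep),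
    ← (measurePreserving_liouville L).map_eq,
    Measure.map_map measurable_classicalMap_coord (measurePreserving_liouville L).measurable]
  rfl

variable (W) in
/-- Energy and group velocity of the product bands, with separated indices. -/
def bandMapProd (hbar : ℝ) (x : (Fin d → ℕ) × Space d) : ℝ × Space d :=
  bandMap W hbar fun j => (x.1 j, x.2 j)

variable (W) in
theorem measurable_bandMapProd {hbar : ℝ} (hh : 0 < hbar) : Measurable (bandMapProd W hbar) := by
  refine (measurable_bandMap W hh).comp (measurable_pi_lambda _ fun j => ?_)
  exact ((measurable_pi_apply j).comp measurable_fst).prodMk (by fun_prop)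

theorem lintegral_bandMap {hbar : ℝ} (hh : 0 < hbar) {G : ℝ × Space d → ℝ≥0∞} (hG : Measurable G) :
    ∫⁻ y, G (bandMap W hbar y) ∂(Measure.pi fun j => CirclePotential.bandMeasure (L j) hbar) =
      (∏ j, ENNReal.ofReal (hbar * L j)) *
        ∫⁻ k in dualCell L, ∑' m, G (bandMapProd W hbar (m, k)) := by
  have hm : Measurable fun x => G (bandMapProd W hbar x) := hG.comp (measurable_bandMapProd W hh)
  have h1 := (measurePreserving_bands L hbar).lintegral_comp hm
  rw [lintegral_smul_measure, lintegral_prod_symm _ hm.aemeasurable, smul_eq_mul] at h1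
  simp only [lintegral_count] at h1
  exact h1

theorem lintegral_semiclassicalLiouville (hL : ∀ j, 0 < L j) {hbar : ℝ} (hh : 0 < hbar)
    {G : ℕ × Space d → ℝ≥0∞} (hG : Measurable G) :
    ∫⁻ x, G x ∂(semiclassicalLiouville L hbar) =
      (∏ j, ENNReal.ofReal (hbar * L j)) * ∫⁻ k in dualCell L, ∑' n, G (n, k) := by
  rw [semiclassicalLiouville, lintegral_smul_measure, brillouinMeasure,
    lintegral_prod_symm _ hG.aemeasurable, lintegral_smul_measure, smul_eq_mul, smul_eq_mul,
    ← mul_assoc, semiclassical_prefactor hL hh]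
  simp only [lintegral_count]

/-- Tested on nonnegative functions, the measure is an integral over `k` of a sum over all bands.
For almost every `k` the renumbering from sorted bands to multi-indices leaves this sum unchanged,
whatever its dependence on `k`. -/
theorem semiclassicalMeasure_eq (hd : 0 < d) (hL : ∀ j, 0 < L j)
    (hsep : ∀ q : Space d, V q = ∑ j, (W j).toFun (q j)) {hbar : ℝ} (hh : 0 < hbar) :
    semiclassicalMeasure L V hbar =
      (Measure.pi fun j => CirclePotential.bandMeasure (L j) hbar).map (bandMap W hbar) := by
  refine Measure.ext_of_lintegral _ fun G hG => ?_
  have hB := measurable_bandEnergyVelocity hd hL hsep hh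
  rw [lintegral_map hG (measurable_bandMap W hh), lintegral_bandMap hh hG, semiclassicalMeasure,
    lintegral_map hG hB, lintegral_semiclassicalLiouville hL hh (G := fun x => G (bandEnergyVelocity L V hbar x))
      (hG.comp hB)]
  congr 1
  refine lintegral_congr_ae (ae_restrict_of_ae ?_)
  filter_upwards [ae_bandEnergyVelocity_eq hd hL hsep hh] with k hk
  obtain ⟨σ, hσ⟩ := hk
  rw [← σ.tsum_eq]
  exact tsum_congr fun n => congrArg G (hσ n)

theorem integrable_exp_neg_classicalMap :
    Integrable (fun y => Real.exp (-(classicalMap W y).1))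
      (Measure.pi fun j => CirclePotential.phaseMeasure (L j)) :=
  integrable_exp_neg_sum fun j => (W j).integrable_exp_neg_classicalEnergy

theorem integrable_exp_neg_bandMap {hbar : ℝ} (hh : 0 < hbar) :
    Integrable (fun y => Real.exp (-(bandMap W hbar y).1))
      (Measure.pi fun j => CirclePotential.bandMeasure (L j) hbar) := by
  simp only [bandMap]
  exact integrable_exp_neg_sum (μ := fun j => CirclePotential.bandMeasure (L j) hbar) (E := fun j x => (W j).energy hbar x.1 x.2)
    fun j => (W j).integrable_exp_neg_energy hh

/-- Vague convergence of the product laws. -/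
theorem tendsto_integral_bandMap (hL : ∀ j, 0 < L j) {f : ℝ × Space d → ℝ} (hf : Continuous f)
    (hfc : HasCompactSupport f) :
    Tendsto (fun hbar => ∫ y, f (bandMap W hbar y)
      ∂(Measure.pi fun j => CirclePotential.bandMeasure (L j) hbar)) (𝓝[>] 0)
      (𝓝 (∫ y, f (classicalMap W y)
        ∂(Measure.pi fun j => CirclePotential.phaseMeasure (L j)))) := by
  have hA := measurable_classicalMap W
  refine tendsto_integral_of_tendsto_cexp (m := fun hbar =>
    Measure.pi fun j => CirclePotential.bandMeasure (L j) hbar)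
    (E := fun hbar y => (bandMap W hbar y).1) (v := fun hbar y => (bandMap W hbar y).2)
    (E' := fun y => (classicalMap W y).1) (v' := fun y => (classicalMap W y).2) ?_
    (pi_ne_zero fun j => CirclePotential.phaseMeasure_ne_zero (hL j)) hA.fst hA.snd
    integrable_exp_neg_classicalMap (fun s u => ?_) hf hfc
  · filter_upwards [self_mem_nhdsWithin] with hbar hh
    have hB := measurable_bandMap W hh
    exact ⟨pi_ne_zero fun j => CirclePotential.bandMeasure_ne_zero (hL j) hh, hB.fst, hB.snd,
      integrable_exp_neg_bandMap hh⟩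
  · simp only [bandMap, classicalMap]
    rw [integral_cexp_sum (E := fun j => (W j).classicalEnergy)
      (v := fun j => (W j).classicalVelocity)]
    have h := fun hbar => integral_cexp_sum (μ := fun j => CirclePotential.bandMeasure (L j) hbar)
      (E := fun j x => (W j).energy hbar x.1 x.2) (v := fun j x => (W j).velocity hbar x.1 x.2) s u
    exact Tendsto.congr (fun hbar => (h hbar).symm)
      (tendsto_finsetProd _ fun j _ => (W j).tendsto_integral_cexp s (u j))

end Identification

end PeriodicMotion

end

theorem mainTheorem9 (d : ℕ) (hd : 0 < d) (L : Fin d → ℝ) (hL : ∀ j, 0 < L j)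
    (V : PeriodicMotion.Space d → ℝ) (hV : ContDiff ℝ 2 V)
    (hper : PeriodicMotion.IsLatticePeriodic L V)
    (hsep : ∃ W : Fin d → ℝ → ℝ, ∀ q : PeriodicMotion.Space d, V q = ∑ j, W j (q j)) :
    -- the image measures are well defined and finite on compact sets
    AEMeasurable (PeriodicMotion.energyVelocity V) (PeriodicMotion.liouville L) ∧
    IsFiniteMeasureOnCompacts (PeriodicMotion.classicalMeasure L V) ∧
    (∀ hbar : ℝ, 0 < hbar →
      AEMeasurable (PeriodicMotion.bandEnergyVelocity L V hbar)
        (PeriodicMotion.semiclassicalLiouville L hbar) ∧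
      IsFiniteMeasureOnCompacts (PeriodicMotion.semiclassicalMeasure L V hbar)) ∧
    -- weak-* convergence
    ∀ f : ℝ × PeriodicMotion.Space d → ℝ, Continuous f → HasCompactSupport f →
      Tendsto (fun hbar : ℝ => ∫ y, f y ∂(PeriodicMotion.semiclassicalMeasure L V hbar))
        (𝓝[>] 0) (𝓝 (∫ y, f y ∂(PeriodicMotion.classicalMeasure L V))) := by
  obtain ⟨W, hW⟩ := PeriodicMotion.exists_circlePotential hd hL hV hper hsep
  have hc := PeriodicMotion.measurable_classicalMap W
  refine ⟨⟨_, PeriodicMotion.measurable_classicalMap_coord, PeriodicMotion.ae_energyVelocity_eq hW⟩,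
    ?_, fun hbar hh => ⟨(PeriodicMotion.measurable_bandEnergyVelocity hd hL hW hh).aemeasurable, ?_⟩,
    fun f hf hfc => ?_⟩
  · rw [PeriodicMotion.classicalMeasure_eq hW]
    exact PeriodicMotion.isFiniteMeasureOnCompacts_map hc.fst hc.snd
      PeriodicMotion.integrable_exp_neg_classicalMap
  · have hb := PeriodicMotion.measurable_bandMap W hh
    rw [PeriodicMotion.semiclassicalMeasure_eq hd hL hW hh]
    exact PeriodicMotion.isFiniteMeasureOnCompacts_map hb.fst hb.snd
      (PeriodicMotion.integrable_exp_neg_bandMap hh)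
  · rw [PeriodicMotion.classicalMeasure_eq hW,
      integral_map hc.aemeasurable hf.aestronglyMeasurable]
    refine (PeriodicMotion.tendsto_integral_bandMap hL hf hfc).congr' ?_
    filter_upwards [self_mem_nhdsWithin] with hbar hh
    rw [PeriodicMotion.semiclassicalMeasure_eq hd hL hW hh, integral_map
      (PeriodicMotion.measurable_bandMap W hh).aemeasurable hf.aestronglyMeasurable]
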